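/- Let $n\ge 2$ and let $\tilde M$ be $\mathbb R^n$ (polar coordinates $x=t\theta$, $t=|x|$, $\theta\in N:=\mathbb S^{n-1}$) with a smooth complete rotationally symmetric Riemannian metric $$f(t)\,dt^2+g(t)\,d\theta^2,$$ where $d\theta^2$ is the standard metric of $N$, $f,g$ are smooth and positive on $(0,+\infty)$, $f(t)=1$ and $g(t)=t^2$ for all sufficiently small $t>0$, and $\int_0^{+\infty}\sqrt{f(t)}\,dt=+\infty$ (completeness). Let $d$ and $\delta$ be the exterior derivative and the codifferential on $\tilde M$, and let $\Delta^q$ be the closure, in the Hilbert space $L^2_q(\tilde M)$ of square integrable real $q$-forms, of the operator $d\delta+\delta d$ on smooth compactly supported $q$-forms. On square integrable forms, $d$ and $\delta$ are understood in the sense of distributions. Write a $q$-form as $\omega=\omega_1+\omega_2\wedge dt$, with $\omega_1(t)$ a $q$-form and $\omega_2(t)$ a $(q-1)$-form on $N$ depending on $t$. Define subspaces of $L^2_q(\tilde M)$ by conditions for almost every $t>0$: - $\mathcal L_1$: $\omega_2=0$, and $\omega_1(t)$ is in the closure in $L^2(N)$ of the smooth coclosed $q$-forms on $N$; - $\mathcal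 L_2$ (for $q\ge1$): $\omega_1=0$, and $\omega_2(t)$ is in the closure in $L^2(N)$ of the smooth closed $(q-1)$-forms on $N$; - $\mathcal L_3$ (for $q\ge1$): $\omega_1(t)$ is in the closure of $d\,C^\infty(\Lambda^{q-1}(N))$ and $\omega_2(t)$ is in the closure of $\delta\,C^\infty(\Lambda^{q}(N))$. Let $\Delta^q_i$ be the restriction of $\Delta^q$ to $\mathcal L_i$; an eigenform of $\Delta^q_i$ is a nonzero element of $\mathcal L_i$ that lies in the domain of $\Delta^q$ and is an eigenvector of it. **Proposition 6.3.** Let $p\ge1$ and let $\Phi$ be a $p$-eigenform of $\Delta^p_3$ with eigenvalue $\mu>0$. Then $d\Phi$ and $\delta\Phi$ are square integrable. If $d\Phi\ne0$, then $d\Phi$ is a $(p+1)$-eigenform of $\Delta^{p+1}_2$ with eigenvalue $\mu$. If $\delta\Phi\ne0$, then $\delta\Phi$ is a $(p-1)$-eigenform of $\Delta^{p-1}_1$ with eigenvalue $\mu$. -/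

import Mathlib

open MeasureTheory Set Filter Topology
open scoped ENNReal InnerProductSpace

noncomputable section

namespace HodgeWarped

/-- The Euclidean space carrying the (single, global) chart of the manifold. -/
abbrev E (n : ℕ) : Type := EuclideanSpace ℝ (Fin n)

/-- Differential `p`-forms on `ℝⁿ` (no regularity imposed). -/
abbrev Form (n p : ℕ) : Type := E n → E n [⋀^Fin p]→L[ℝ] ℝ

/-- A Riemannian metric on `ℝⁿ`, given by the field `G` of its matrices:
the scalar product of `u` and `v` at `x` is `⟪G x u, v⟫`. -/
abbrev MetricField (n : ℕ) : Type := E n → E n →L[ℝ] E n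

section General

variable {n : ℕ} (G : MetricField n)

/-- The Riemannian volume density `√det G` with respect to the Lebesgue measure. -/
def volDensity (x : E n) : ℝ := √(LinearMap.det (G x : E n →ₗ[ℝ] E n))

/-- The inverse metric (raising of indices). -/
def coMetric (x : E n) : E n →L[ℝ] E n := (G x).inverse

/-- The scalar product on `p`-covectors at `x`,
`(1 / p!) g^{i₁j₁} ⋯ g^{iₚjₚ} α_{j₁…jₚ} β_{i₁…iₚ}`; it is the one with `α ∧ *β = ⟨α, β⟩ dV`. -/
def formInner {p : ℕ} (x : E n) (α β : E n [⋀^Fin p]→L[ℝ] ℝ) : ℝ :=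
  (p.factorial : ℝ)⁻¹ * ∑ i : Fin p → Fin n,
    α (fun k => coMetric G x (EuclideanSpace.basisFun (Fin n) ℝ (i k))) *
      β (fun k => EuclideanSpace.basisFun (Fin n) ℝ (i k))

/-- The squared `L²` norm `∫ |ω|² dV` of a `p`-form, as an extended nonnegative number. -/
def normSq {p : ℕ} (ω : Form n p) : ℝ≥0∞ :=
  ∫⁻ x, ENNReal.ofReal (formInner G x (ω x) (ω x) * volDensity G x)

/-- The `L²` scalar product `∫ ω ∧ *η = ∫ ⟨ω, η⟩ dV`. -/
def l2Inner {p : ℕ} (ω η : Form n p) : ℝ :=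
  ∫ x, formInner G x (ω x) (η x) * volDensity G x

/-- Square integrable `p`-forms. They represent the elements of the Hilbert space of `L²` forms;
two of them represent the same element when they agree almost everywhere. -/
def MemL2 {p : ℕ} (ω : Form n p) : Prop :=
  AEStronglyMeasurable ω ∧ normSq G ω < ∞

/-- The codifferential of a `(p+1)`-form,
`(δω)_{i₁…iₚ} = - ∇^j ω_{j i₁…iₚ}`: one raises all indices of `ω`, takes the divergence
`(det G)^{-1/2} ∂_j ((det G)^{1/2} ω^{j i₁…iₚ})` in the first index, lowers the remaining
indices, and changes the sign. -/
def codiff {p : ℕ} (ω : Form n (p + 1)) : Form n p := fun x =>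
  -((volDensity G x)⁻¹ •
    (∑ j : Fin n,
      (fderiv ℝ (fun y => volDensity G y • (ω y).compContinuousLinearMap (coMetric G y)) x
        (EuclideanSpace.basisFun (Fin n) ℝ j)).curryLeft
          (EuclideanSpace.basisFun (Fin n) ℝ j)).compContinuousLinearMap (G x))

/-- The Laplace-Beltrami (Hodge) operator `Δ = dδ + δd` on `p`-forms (`Δ = δd` for `p = 0`). -/
def laplacian : {p : ℕ} → Form n p → Form n p
  | 0, ω => codiff G (extDeriv ω)
  | _ + 1, ω => extDeriv (codiff G ω) + codiff G (extDeriv ω)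

/-- Smooth, compactly supported forms. -/
def IsTestForm {p : ℕ} (ω : Form n p) : Prop :=
  ContDiff ℝ (⊤ : ℕ∞) ω ∧ HasCompactSupport ω

/-- The graph of the closed operator `Δ` in the Hilbert space of `L²` forms: the closure of the
graph of the Laplace-Beltrami operator on smooth compactly supported forms.
`LaplacianGraph G ω η` says that `ω` is in the domain of the closure and that `Δω = η`. -/
def LaplacianGraph {p : ℕ} (ω η : Form n p) : Prop :=
  MemL2 G ω ∧ MemL2 G η ∧ ∃ φ : ℕ → Form n p, (∀ k, IsTestForm (φ k)) ∧
    Tendsto (fun k => normSq G (φ k - ω)) atTop (𝓝 0) ∧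
    Tendsto (fun k => normSq G (laplacian G (φ k) - η)) atTop (𝓝 0)

/-- `Φ` is a `p`-eigenform: a nonzero eigenvector, with eigenvalue `μ`, of the closed operator. -/
def IsEigenform {p : ℕ} (μ : ℝ) (Φ : Form n p) : Prop :=
  ¬ Φ =ᵐ[volume] 0 ∧ LaplacianGraph G Φ (μ • Φ)

/-- The square integrable form `η` is the exterior derivative `dω` of the square integrable
form `ω` (in the sense of distributions). -/
def HasExtDeriv {p : ℕ} (ω : Form n p) (η : Form n (p + 1)) : Prop :=
  ∀ ψ : Form n (p + 1), IsTestForm ψ → l2Inner G η ψ = l2Inner G ω (codiff G ψ)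

/-- The square integrable form `η` is the codifferential `δω` of the square integrable
form `ω` (in the sense of distributions). -/
def HasCodiff {p : ℕ} (ω : Form n (p + 1)) (η : Form n p) : Prop :=
  ∀ ψ : Form n p, IsTestForm ψ → l2Inner G η ψ = l2Inner G ω (extDeriv ψ)

end General

/-! ### Rotationally symmetric metrics -/

/-- The Euclidean orthogonal projection on the line `ℝ x` (zero if `x = 0`). -/
def radialProj {n : ℕ} (x : E n) : E n →L[ℝ] E n :=
  (‖x‖ ^ 2)⁻¹ • (innerSL ℝ x).smulRight x

/-- The Euclidean orthogonal projection on the orthogonal complement of `x`. -/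
def tangProj {n : ℕ} (x : E n) : E n →L[ℝ] E n :=
  ContinuousLinearMap.id ℝ (E n) - radialProj x

/-- The metric `f(t) dt² + g(t) dθ²` in polar coordinates `x = t θ`, `t = ‖x‖`, `θ ∈ Sⁿ⁻¹`, with
`dθ²` the standard metric of the unit sphere (so that the Euclidean metric is `dt² + t² dθ²`).
At the origin it is the Euclidean metric. -/
def warpedMetric (n : ℕ) (f g : ℝ → ℝ) : MetricField n := fun x =>
  if x = 0 then ContinuousLinearMap.id ℝ (E n)
  else f ‖x‖ • radialProj x + (g ‖x‖ / ‖x‖ ^ 2) • tangProj x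

/-- The conditions on `f` and `g`: smooth, positive, Euclidean near the origin, and such that
`f(t) dt² + g(t) dθ²` is complete, that is, the rays from the origin have infinite length. -/
structure IsWarpingPair (f g : ℝ → ℝ) : Prop where
  smooth_f : ContDiffOn ℝ (⊤ : ℕ∞) f (Ioi 0)
  smooth_g : ContDiffOn ℝ (⊤ : ℕ∞) g (Ioi 0)
  pos_f : ∀ t, 0 < t → 0 < f t
  pos_g : ∀ t, 0 < t → 0 < g t
  euclidean : ∃ ε > 0, ∀ t ∈ Ioo 0 ε, f t = 1 ∧ g t = t ^ 2
  complete : Tendsto (fun T => ∫ t in (0 : ℝ)..T, √(f t)) atTop atTop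

/-! ### Forms on the unit sphere -/

/-- The cylindrical metric `dt² + dθ²` on `ℝⁿ \ {0} ≃ (0, ∞) × Sⁿ⁻¹`. -/
def cylMetric (n : ℕ) : MetricField n := warpedMetric n 1 1

/-- Smooth `p`-forms on the unit sphere `N = Sⁿ⁻¹`. Such a form is represented by its pullback
under `x ↦ x / ‖x‖`, `ℝⁿ \ {0} → N`. These pullbacks are the smooth forms on `ℝⁿ \ {0}`
which vanish on the radial direction and are invariant under all dilations. The pullback commutes
with `d`, and it carries the codifferential of `N` to that of the product metric `dt² + dθ²`. -/
structure IsSphereForm {n p : ℕ} (τ : Form n p) : Prop where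
  smooth : ContDiffOn ℝ (⊤ : ℕ∞) τ {0}ᶜ
  horizontal : ∀ x, x ≠ 0 → ∀ v : Fin p → E n, (∃ i, v i = x) → τ x v = 0
  invariant : ∀ x, x ≠ 0 → ∀ c : ℝ, 0 < c → c ^ p • τ (c • x) = τ x

/-- `δ_N τ = 0` (an empty condition for functions). -/
def IsSphereCoclosed {n : ℕ} : {p : ℕ} → Form n p → Prop
  | 0, _ => True
  | _ + 1, τ => ∀ x, x ≠ 0 → codiff (cylMetric n) τ x = 0

/-- `d_N τ = 0`. -/
def IsSphereClosed {n p : ℕ} (τ : Form n p) : Prop := ∀ x, x ≠ 0 → extDeriv τ x = 0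

/-- The squared norm of a form in `L²(N)`; only the values at the points of the unit sphere enter,
and there `cylMetric` is the Euclidean scalar product. -/
def sphereNormSq {n p : ℕ} (τ : Form n p) : ℝ≥0∞ :=
  ∫⁻ θ : Metric.sphere (0 : E n) 1,
    ENNReal.ofReal (formInner (cylMetric n) (θ : E n) (τ θ) (τ θ))
      ∂((volume : Measure (E n)).toSphere)

/-- `α` is in the closure of the set `S` in `L²(N)`. -/
def InSphereClosure {n p : ℕ} (S : Set (Form n p)) (α : Form n p) : Prop :=
  ∀ ε : ℝ≥0∞, 0 < ε → ∃ τ ∈ S, sphereNormSq (α - τ) < ε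

/-! ### The decomposition `ω = ω₁ + ω₂ ∧ dt` and the three types -/

/-- The form `ω₁(t)` on `N` (at the points `θ` of the unit sphere), where `ω = ω₁ + ω₂ ∧ dt`. -/
def slice₁ {n p : ℕ} (ω : Form n p) (t : ℝ) : Form n p := fun θ =>
  (ω (t • θ)).compContinuousLinearMap (t • tangProj θ)

/-- The form `ω₂(t)` on `N` (at the points `θ` of the unit sphere), where `ω = ω₁ + ω₂ ∧ dt`.
The sign comes from `ι_{∂/∂t} (ω₂ ∧ dt) = (-1)^p ω₂` for a `p`-form `ω₂`. -/
def slice₂ {n p : ℕ} (ω : Form n (p + 1)) (t : ℝ) : Form n p := fun θ =>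
  (-1 : ℝ) ^ p • ((ω (t • θ)).curryLeft θ).compContinuousLinearMap (t • tangProj θ)

/-- The subspace `𝓛₁`: `ω = ω₁` with `ω₁(t)` coclosed on `N` for almost every `t`.
The condition `ω₂ = 0` is expressed by: `ω` vanishes on the radial direction. -/
def InL1 {n p : ℕ} (ω : Form n p) : Prop :=
  (∀ᵐ x : E n, ∀ v : Fin p → E n, (∃ i, v i = x) → ω x v = 0) ∧
  ∀ᵐ t ∂(volume.restrict (Ioi (0 : ℝ))),
    InSphereClosure {τ | IsSphereForm τ ∧ IsSphereCoclosed τ} (slice₁ ω t)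

/-- The subspace `𝓛₂`: `ω = ω₂ ∧ dt` with `ω₂(t)` closed on `N` for almost every `t`.
The condition `ω₁ = 0` is expressed by: the restriction of `ω` to spheres vanishes. -/
def InL2 {n p : ℕ} (ω : Form n (p + 1)) : Prop :=
  (∀ᵐ x : E n, (ω x).compContinuousLinearMap (tangProj x) = 0) ∧
  ∀ᵐ t ∂(volume.restrict (Ioi (0 : ℝ))),
    InSphereClosure {τ | IsSphereForm τ ∧ IsSphereClosed τ} (slice₂ ω t)

/-- The subspace `𝓛₃`, the orthogonal complement of `𝓛₁ ⊕ 𝓛₂`: `ω = ω₁ + ω₂ ∧ dt` where, for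
almost every `t`, `ω₁(t)` is in the closure of `d C^∞(Λᵖ(N))` and `ω₂(t)` is in the closure of
`δ C^∞(Λᵖ⁺¹(N))`; here `ω` is of degree `p + 1` (in degree `0`, `𝓛₃` is zero). -/
def InL3 {n p : ℕ} (ω : Form n (p + 1)) : Prop :=
  ∀ᵐ t ∂(volume.restrict (Ioi (0 : ℝ))),
    InSphereClosure {τ | ∃ σ : Form n p, IsSphereForm σ ∧ τ = extDeriv σ} (slice₁ ω t) ∧
    InSphereClosure {τ | ∃ σ : Form n (p + 1), IsSphereForm σ ∧ τ = codiff (cylMetric n) σ}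
      (slice₂ ω t)

end HodgeWarped

end

/-!
The exterior derivative and the codifferential of an eigenform on a complete manifold are again
in the domain of the closed Laplacian, with the same eigenvalue, and on a rotationally symmetric
manifold they inherit their type from the decomposition of `Φ` over the spheres. The two halves
of the proof are independent.

*Analysis.* Let `φₖ` be test forms with `φₖ → Φ` and `Δφₖ → μΦ` in `L²`. By the energy identity
`‖dφ‖² + ‖δφ‖² = ⟨Δφ, φ⟩`, the forms `dφₖ` and `δφₖ` are Cauchy sequences, so they converge to
square integrable forms `η` and `ζ`, which are `dΦ` and `δΦ` in the sense of distributions. Since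
`Δ` commutes with `d` and `δ` on test forms, `η` and `ζ` are weak eigenforms of `Δ`. A weak
eigenform is in the domain of the closure (`MetricRoot.laplacianGraph_of_weak`) because `Δ + 1`
is essentially self-adjoint on test forms (`ScalarOp.ae_eq_zero_of_orthogonal`). To see this, the
square root of the metric and coordinates of covectors turn `Δ + 1` into a symmetric operator with
scalar principal part on vector-valued functions. A function `v` orthogonal to the range is
mollified to a test function `u`, and the equation is tested against `χ² u`, where `χ` is a cutoff
function with small gradient. Mollification costs a commutator, which is small in the weak sense by
Friedrichs' lemma (`ScalarOp.friedrichs`) and symmetry, and is absorbed using Gårding's inequality.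
The cutoff functions come from the distance to the origin, which is proper by completeness
(`IsWarpingPair.hasCutoffs`). The outcome is `MetricRoot.exists_derivatives`.

*Types.* In polar coordinates write `Φ = Φ₁ + Φ₂ ∧ dt`, with `Φ₁(t)` exact and `Φ₂(t)` coexact on
the sphere. Formally, with `d_N` and `δ_N` the operators of the sphere,

* the spherical component of `dΦ` is `d_N Φ₁ = 0`,
* the radial one is `±∂Φ₁/∂t + d_N Φ₂`, which is closed,
* the radial component of `δΦ` is a multiple of `δ_N Φ₂ = 0`,
* the spherical one is a multiple of `δ_N Φ₁` plus a multiple of a `t`-derivative of a multiple of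
  `Φ₂`, hence coclosed.

As nothing is known about the regularity of the slices of `Φ`, these identities are proved for the
smooth `φₖ` in weak form, paired with `a(t) w` for a weight `a` with compact support in `(0, ∞)`
and a square integrable function `w` on the sphere, and passed to the limit (`pairing_angRad_extDeriv`,
`pairing_extDeriv`, `pairing_codiff`). Since all weights are allowed, the vanishing of the pairings for
all `w` in a set gives the orthogonality of almost every slice to that set
(`ae_orthogonal_of_pairing`), and a slice orthogonal to the orthogonal complement of a space of
smooth forms lies in the closure of that space (`inSphereClosure_of_orthogonal`). Smooth forms on
the sphere are not shown to be dense; functions `w` orthogonal to all of them are dealt with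
separately (`clm_eq_zero_of_sphereForms`), using that the slices of a smooth form are smooth.
-/

noncomputable section

set_option linter.unusedSectionVars false

namespace HodgeWarped

/-! ### Square integrable vector-valued functions -/

section L2

variable {n : ℕ} {V W : Type*} [NormedAddCommGroup V] [InnerProductSpace ℝ V]
  [NormedAddCommGroup W] [NormedSpace ℝ W]

/-- Smooth compactly supported functions with values in a normed space. -/
def IsTestFun (h : E n → W) : Prop := ContDiff ℝ (⊤ : ℕ∞) h ∧ HasCompactSupport h

/-- The `L²` norm for the Lebesgue measure, as a real number (it is `0` if the norm is infinite). -/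
def l2n (h : E n → W) : ℝ := (eLpNorm h 2 volume).toReal

theorem l2n_nonneg (h : E n → W) : 0 ≤ l2n h := ENNReal.toReal_nonneg

theorem IsTestFun.memLp {h : E n → W} (hh : IsTestFun h) : MemLp h 2 volume :=
  hh.1.continuous.memLp_of_hasCompactSupport hh.2

theorem l2n_add_le {f g : E n → W} (hf : MemLp f 2 volume) (hg : MemLp g 2 volume) :
    l2n (f + g) ≤ l2n f + l2n g := by
  unfold l2n
  rw [← ENNReal.toReal_add hf.2.ne hg.2.ne]
  exact ENNReal.toReal_mono (ENNReal.add_ne_top.2 ⟨hf.2.ne, hg.2.ne⟩)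
    (eLpNorm_add_le hf.1 hg.1 (by norm_num))

theorem l2n_sub_le {f g : E n → W} (hf : MemLp f 2 volume) (hg : MemLp g 2 volume) :
    l2n (f - g) ≤ l2n f + l2n g := by
  unfold l2n
  rw [← ENNReal.toReal_add hf.2.ne hg.2.ne]
  exact ENNReal.toReal_mono (ENNReal.add_ne_top.2 ⟨hf.2.ne, hg.2.ne⟩)
    (eLpNorm_sub_le hf.1 hg.1 (by norm_num))

theorem l2n_sub_comm (f g : E n → W) : l2n (f - g) = l2n (g - f) := by
  unfold l2n; rw [eLpNorm_sub_comm]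

theorem l2n_le_of_norm_le {W' : Type*} [NormedAddCommGroup W'] [NormedSpace ℝ W']
    {f : E n → W} {g : E n → W'} {C : ℝ} (hC : 0 ≤ C)
    (hg : MemLp g 2 volume) (h : ∀ x, ‖f x‖ ≤ C * ‖g x‖) : l2n f ≤ C * l2n g := by
  have h1 := eLpNorm_le_mul_eLpNorm_of_ae_le_mul (p := 2) (μ := volume)
    (Eventually.of_forall h)
  unfold l2n
  have h2 := ENNReal.toReal_mono (ENNReal.mul_ne_top ENNReal.ofReal_ne_top hg.2.ne) h1
  rwa [ENNReal.toReal_mul, ENNReal.toReal_ofReal hC] at h2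

theorem l2n_sum_le {ι : Type*} (s : Finset ι) {f : ι → E n → W}
    (hf : ∀ i ∈ s, MemLp (f i) 2 volume) : l2n (∑ i ∈ s, f i) ≤ ∑ i ∈ s, l2n (f i) := by
  classical
  induction s using Finset.induction_on with
  | empty => simp [l2n]
  | insert a s ha ih =>
    rw [Finset.sum_insert ha, Finset.sum_insert ha]
    have h1 : MemLp (∑ i ∈ s, f i) 2 volume :=
      memLp_finsetSum' s fun i hi => hf i (Finset.mem_insert_of_mem hi)
    refine (l2n_add_le (hf a (Finset.mem_insert_self _ _)) h1).trans ?_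
    gcongr
    exact ih fun i hi => hf i (Finset.mem_insert_of_mem hi)

theorem l2n_sq {f : E n → W} (hf : MemLp f 2 volume) : l2n f ^ 2 = ∫ x, ‖f x‖ ^ 2 := by
  have h := hf.eLpNorm_eq_integral_rpow_norm (by norm_num) (by norm_num)
  have h0 : 0 ≤ ∫ x, ‖f x‖ ^ 2 := integral_nonneg fun x => by positivity
  unfold l2n
  rw [h, ENNReal.toReal_ofReal (by positivity)]
  simp only [ENNReal.toReal_ofNat, Real.rpow_ofNat]
  rw [← Real.rpow_natCast, ← Real.rpow_mul h0]
  norm_num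

theorem integrable_inner_of_memLp {f g : E n → V} (hf : MemLp f 2 volume)
    (hg : MemLp g 2 volume) : Integrable (fun x => ⟪f x, g x⟫_ℝ) volume := by
  have h := MeasureTheory.L2.integrable_inner (𝕜 := ℝ) (hf.toLp f) (hg.toLp g)
  refine h.congr ?_
  filter_upwards [hf.coeFn_toLp, hg.coeFn_toLp] with x h1 h2
  rw [h1, h2]

theorem abs_integral_inner_le {f g : E n → V} (hf : MemLp f 2 volume) (hg : MemLp g 2 volume) :
    |∫ x, ⟪f x, g x⟫_ℝ| ≤ l2n f * l2n g := by
  have h := abs_real_inner_le_norm (hf.toLp f) (hg.toLp g)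
  rw [MeasureTheory.L2.inner_def, Lp.norm_toLp, Lp.norm_toLp] at h
  refine le_trans (le_of_eq ?_) h
  congr 1
  refine integral_congr_ae ?_
  filter_upwards [hf.coeFn_toLp, hg.coeFn_toLp] with x h1 h2
  rw [h1, h2]

/-- Young's inequality `‖k ⋆ h‖₂ ≤ ‖k‖₁ ‖h‖₂`, for a function dominated by a convolution. -/
theorem eLpNorm_le_of_convolution_bound {W' : Type*} [NormedAddCommGroup W']
    {k : E n → ℝ≥0∞} (hk : Measurable k) (hk' : ∫⁻ z, k z ≠ ∞)
    {h : E n → W} (hh : AEStronglyMeasurable h volume) {F : E n → W'}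
    (hF : ∀ x, ‖F x‖ₑ ≤ ∫⁻ y, k (x - y) * ‖h y‖ₑ) :
    eLpNorm F 2 volume ≤ (∫⁻ z, k z) * eLpNorm h 2 volume := by
  have hm : AEMeasurable (fun y => ‖h y‖ₑ) volume := hh.enorm
  have e1 : ∀ x, ∫⁻ y, k (x - y) = ∫⁻ z, k z := fun x =>
    lintegral_sub_left_eq_self k x
  have hkx : ∀ x, AEMeasurable (fun y => k (x - y)) volume := fun x =>
    (hk.comp (measurable_const.sub measurable_id)).aemeasurable
  have key : ∀ x, ‖F x‖ₑ ^ (2 : ℝ) ≤ (∫⁻ z, k z) * ∫⁻ y, k (x - y) * ‖h y‖ₑ ^ (2 : ℝ) := by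
    intro x
    have hcs := ENNReal.lintegral_mul_le_Lp_mul_Lq volume
      (Real.HolderConjugate.two_two) (f := fun y => k (x - y) ^ (1 / 2 : ℝ))
      (g := fun y => k (x - y) ^ (1 / 2 : ℝ) * ‖h y‖ₑ)
      ((hkx x).pow_const _) (((hkx x).pow_const _).mul hm)
    have e2 : ∀ y, (k (x - y) ^ (1 / 2 : ℝ)) ^ (2 : ℝ) = k (x - y) := fun y => by
      rw [← ENNReal.rpow_mul]; norm_num
    have e3 : ∀ y, k (x - y) ^ (1 / 2 : ℝ) * (k (x - y) ^ (1 / 2 : ℝ) * ‖h y‖ₑ)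
        = k (x - y) * ‖h y‖ₑ := fun y => by
      rw [← mul_assoc, ← ENNReal.rpow_add_of_nonneg _ _ (by norm_num) (by norm_num)]; norm_num
    simp only [Pi.mul_apply, e3, e2, ENNReal.mul_rpow_of_nonneg _ _ (zero_le_two (α := ℝ)), e1]
      at hcs
    calc ‖F x‖ₑ ^ (2 : ℝ) ≤ (∫⁻ y, k (x - y) * ‖h y‖ₑ) ^ (2 : ℝ) := by gcongr; exact hF x
      _ ≤ ((∫⁻ z, k z) ^ (1 / 2 : ℝ) * (∫⁻ y, k (x - y) * ‖h y‖ₑ ^ (2 : ℝ)) ^ (1 / 2 : ℝ))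
          ^ (2 : ℝ) := by gcongr
      _ = _ := by
        rw [ENNReal.mul_rpow_of_nonneg _ _ zero_le_two, ← ENNReal.rpow_mul, ← ENNReal.rpow_mul]
        norm_num
  have htot : ∫⁻ x, ‖F x‖ₑ ^ (2 : ℝ) ≤ (∫⁻ z, k z) ^ (2 : ℝ) * ∫⁻ y, ‖h y‖ₑ ^ (2 : ℝ) := by
    have hm2 : AEMeasurable (fun p : E n × E n => k (p.1 - p.2) * ‖h p.2‖ₑ ^ (2 : ℝ))
        (volume.prod volume) := by
      refine ((hk.comp (measurable_fst.sub measurable_snd)).aemeasurable).mul ?_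
      exact ((hm.pow_const 2).comp_quasiMeasurePreserving
        Measure.quasiMeasurePreserving_snd)
    calc ∫⁻ x, ‖F x‖ₑ ^ (2 : ℝ)
        ≤ ∫⁻ x, (∫⁻ z, k z) * ∫⁻ y, k (x - y) * ‖h y‖ₑ ^ (2 : ℝ) := lintegral_mono key
      _ = (∫⁻ z, k z) * ∫⁻ x, ∫⁻ y, k (x - y) * ‖h y‖ₑ ^ (2 : ℝ) := lintegral_const_mul' _ _ hk'
      _ = (∫⁻ z, k z) * ∫⁻ y, ∫⁻ x, k (x - y) * ‖h y‖ₑ ^ (2 : ℝ) := by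
          rw [lintegral_lintegral_swap hm2]
      _ = (∫⁻ z, k z) * ∫⁻ y, (∫⁻ z, k z) * ‖h y‖ₑ ^ (2 : ℝ) := by
          congr 1
          refine lintegral_congr fun y => ?_
          rw [lintegral_mul_const _ (by fun_prop), lintegral_sub_right_eq_self k y]
      _ = _ := by
          rw [lintegral_const_mul' _ _ hk', ← mul_assoc, ENNReal.rpow_two, sq]
  rw [eLpNorm_eq_lintegral_rpow_enorm_toReal (by norm_num) (by norm_num),
    eLpNorm_eq_lintegral_rpow_enorm_toReal (by norm_num) (by norm_num)]
  simp only [ENNReal.toReal_ofNat]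
  calc (∫⁻ x, ‖F x‖ₑ ^ (2 : ℝ)) ^ (1 / 2 : ℝ)
      ≤ ((∫⁻ z, k z) ^ (2 : ℝ) * ∫⁻ y, ‖h y‖ₑ ^ (2 : ℝ)) ^ (1 / 2 : ℝ) := by gcongr
    _ = _ := by
      rw [ENNReal.mul_rpow_of_nonneg _ _ (by norm_num), ← ENNReal.rpow_mul]; norm_num

end L2

/-! ### Mollification -/

section Mollifier

variable {n : ℕ} {V W : Type*} [NormedAddCommGroup V] [InnerProductSpace ℝ V]
  [NormedAddCommGroup W] [NormedSpace ℝ W]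

/-- An even smooth probability density supported in the unit ball. -/
def bumpDensity (n : ℕ) : E n → ℝ :=
  (⟨1 / 2, 1, by norm_num, by norm_num⟩ : ContDiffBump (0 : E n)).normed volume

/-- The rescaled density `ε⁻ⁿ ρ(x / ε)`. -/
def mollifier (n : ℕ) (ε : ℝ) (x : E n) : ℝ := (ε ^ n)⁻¹ * bumpDensity n (ε⁻¹ • x)

/-- The mollification `J_ε h` of a function. -/
def mollify (ε : ℝ) (h : E n → W) : E n → W :=
  convolution (mollifier n ε) h (ContinuousLinearMap.lsmul ℝ ℝ) volume

theorem bumpDensity_contDiff : ContDiff ℝ (⊤ : ℕ∞) (bumpDensity n) :=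
  ContDiffBump.contDiff_normed _

theorem bumpDensity_support : Function.support (bumpDensity n) = Metric.ball 0 1 :=
  ContDiffBump.support_normed_eq _

theorem bumpDensity_hasCompactSupport : HasCompactSupport (bumpDensity n) :=
  ContDiffBump.hasCompactSupport_normed _

theorem mollifier_contDiff (ε : ℝ) : ContDiff ℝ (⊤ : ℕ∞) (mollifier n ε) := by
  unfold mollifier
  exact contDiff_const.mul (bumpDensity_contDiff.comp (contDiff_const_smul _))

theorem mollifier_support {ε : ℝ} (hε : 0 < ε) :
    Function.support (mollifier n ε) ⊆ Metric.ball 0 ε := by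
  intro x hx
  have h1 : bumpDensity n (ε⁻¹ • x) ≠ 0 := fun h => hx (by simp [mollifier, h])
  have h2 : ε⁻¹ • x ∈ Metric.ball (0 : E n) 1 := by
    rw [← bumpDensity_support]; exact h1
  rw [mem_ball_zero_iff, norm_smul, norm_inv, Real.norm_of_nonneg hε.le] at h2
  rw [mem_ball_zero_iff]
  field_simp at h2
  exact h2

theorem mollifier_hasCompactSupport {ε : ℝ} (hε : 0 < ε) :
    HasCompactSupport (mollifier n ε) :=
  HasCompactSupport.of_support_subset_isCompact (isCompact_closedBall (0 : E n) ε)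
    ((mollifier_support hε).trans Metric.ball_subset_closedBall)

theorem mollifier_nonneg {ε : ℝ} (hε : 0 < ε) (x : E n) : 0 ≤ mollifier n ε x :=
  mul_nonneg (by positivity) (ContDiffBump.nonneg_normed _ _)

theorem mollifier_neg (ε : ℝ) (x : E n) : mollifier n ε (-x) = mollifier n ε x := by
  unfold mollifier bumpDensity
  rw [smul_neg, ContDiffBump.normed_neg]

theorem integral_rescale {ε : ℝ} (hε : 0 < ε) (κ : E n → ℝ) :
    ∫ x, (ε ^ n)⁻¹ * κ (ε⁻¹ • x) = ∫ x, κ x := by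
  rw [integral_const_mul, Measure.integral_comp_inv_smul, finrank_euclideanSpace_fin,
    abs_of_pos (by positivity), smul_eq_mul, ← mul_assoc, inv_mul_cancel₀ (by positivity), one_mul]

theorem integral_mollifier {ε : ℝ} (hε : 0 < ε) : ∫ x, mollifier n ε x = 1 := by
  unfold mollifier
  rw [integral_rescale hε]
  exact ContDiffBump.integral_normed _

theorem mollify_apply (ε : ℝ) (h : E n → W) (x : E n) :
    mollify ε h x = ∫ y, mollifier n ε (x - y) • h y := by
  unfold mollify
  rw [convolution_eq_swap]; rfl

theorem mollify_contDiff {ε : ℝ} (hε : 0 < ε) {h : E n → W} (hh : LocallyIntegrable h volume) :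
    ContDiff ℝ (⊤ : ℕ∞) (mollify ε h) :=
  (mollifier_hasCompactSupport hε).contDiff_convolution_left _ (mollifier_contDiff ε) hh

theorem integrable_mollifier_smul {ε : ℝ} (hε : 0 < ε) {h : E n → W}
    (hh : LocallyIntegrable h volume) (x : E n) :
    Integrable (fun y => mollifier n ε (x - y) • h y) volume :=
  ((mollifier_hasCompactSupport hε).convolutionExists_left
    (ContinuousLinearMap.lsmul ℝ ℝ) (mollifier_contDiff ε).continuous hh x).integrable_swap

theorem mollify_fderiv_apply {ε : ℝ} (hε : 0 < ε) {h : E n → W}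
    (hh : LocallyIntegrable h volume) (x v : E n) :
    fderiv ℝ (mollify ε h) x v = ∫ y, fderiv ℝ (mollifier n ε) (x - y) v • h y := by
  have h1 := (mollifier_hasCompactSupport (n := n) hε).hasFDerivAt_convolution_left
    (ContinuousLinearMap.lsmul ℝ ℝ (E := W)) ((mollifier_contDiff ε).of_le (by simp)) hh x
  unfold mollify
  rw [h1.fderiv, convolution_eq_swap, ContinuousLinearMap.integral_apply]
  · rfl
  · exact (((mollifier_hasCompactSupport hε).fderiv ℝ).convolutionExists_left _
      ((mollifier_contDiff ε).continuous_fderiv (by simp)) hh x).integrable_swap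

theorem mollify_fderiv {ε : ℝ} {h : E n → W} (hh : IsTestFun h) :
    fderiv ℝ (mollify ε h) = mollify ε (fderiv ℝ h) := by
  funext x
  have h1 := hh.2.hasFDerivAt_convolution_right (μ := volume)
    (ContinuousLinearMap.lsmul ℝ ℝ (E := W))
    (mollifier_contDiff (n := n) ε).continuous.locallyIntegrable (hh.1.of_le (by simp)) x
  unfold mollify
  rw [h1.fderiv]
  rfl

theorem mollify_eq_zero {ε R : ℝ} (hε : 0 < ε) {h : E n → W}
    (hR : ∀ y, R < ‖y‖ → h y = 0) {x : E n} (hx : R + ε < ‖x‖) : mollify ε h x = 0 := by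
  rw [mollify_apply]
  refine integral_eq_zero_of_ae (Eventually.of_forall fun y => ?_)
  by_cases hy : R < ‖y‖
  · simp [hR y hy]
  · have : x - y ∉ Metric.ball (0 : E n) ε := by
      rw [mem_ball_zero_iff, not_lt]
      have := norm_sub_norm_le x y
      linarith
    have h0 : mollifier n ε (x - y) = 0 := by
      by_contra h0
      exact this (mollifier_support hε h0)
    simp [h0]

theorem exists_radius {h : E n → W} (hh : HasCompactSupport h) :
    ∃ R, 0 < R ∧ ∀ y, R < ‖y‖ → h y = 0 := by
  obtain ⟨R, hR⟩ := hh.isCompact.isBounded.subset_closedBall (0 : E n)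
  refine ⟨max R 1, by positivity, fun y hy => ?_⟩
  by_contra h0
  have := hR (subset_tsupport _ h0)
  rw [mem_closedBall_zero_iff] at this
  exact absurd (lt_of_le_of_lt (le_max_left _ _) hy) (not_lt.2 this)

theorem hasCompactSupport_of_radius {h : E n → W} {R : ℝ} (hR : ∀ y, R < ‖y‖ → h y = 0) :
    HasCompactSupport h :=
  HasCompactSupport.of_support_subset_isCompact (isCompact_closedBall (0 : E n) R) fun y hy => by
    rw [mem_closedBall_zero_iff]
    by_contra h0
    exact hy (hR y (not_le.1 h0))

theorem mollify_isTestFun {ε R : ℝ} (hε : 0 < ε) {h : E n → W}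
    (hh : LocallyIntegrable h volume) (hR : ∀ y, R < ‖y‖ → h y = 0) :
    IsTestFun (mollify ε h) :=
  ⟨mollify_contDiff hε hh, hasCompactSupport_of_radius fun _ hy => mollify_eq_zero hε hR hy⟩

theorem eLpNorm_mollify_le {ε : ℝ} (hε : 0 < ε) {h : E n → W} (hh : MemLp h 2 volume) :
    eLpNorm (mollify ε h) 2 volume ≤ eLpNorm h 2 volume := by
  have hint : ∫⁻ z, ENNReal.ofReal (mollifier n ε z) = 1 := by
    rw [← ofReal_integral_eq_lintegral_ofReal, integral_mollifier hε, ENNReal.ofReal_one]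
    · exact (mollifier_contDiff ε).continuous.integrable_of_hasCompactSupport
        (mollifier_hasCompactSupport hε)
    · exact Eventually.of_forall (mollifier_nonneg hε)
  have := eLpNorm_le_of_convolution_bound (k := fun z => ENNReal.ofReal (mollifier n ε z))
    (by have := (mollifier_contDiff (n := n) ε).continuous; fun_prop) (by rw [hint]; simp) hh.1
    (F := mollify ε h) (fun x => by
      rw [mollify_apply]
      refine (enorm_integral_le_lintegral_enorm _).trans (le_of_eq ?_)
      refine lintegral_congr fun y => ?_
      rw [enorm_smul, Real.enorm_eq_ofReal (mollifier_nonneg hε _)])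
  rwa [hint, one_mul] at this

theorem memLp_mollify {ε : ℝ} (hε : 0 < ε) {h : E n → W} (hh : MemLp h 2 volume) :
    MemLp (mollify ε h) 2 volume :=
  ⟨(mollify_contDiff hε (hh.locallyIntegrable (by norm_num))).continuous.aestronglyMeasurable,
    (eLpNorm_mollify_le hε hh).trans_lt hh.2⟩

theorem l2n_mollify_le {ε : ℝ} (hε : 0 < ε) {h : E n → W} (hh : MemLp h 2 volume) :
    l2n (mollify ε h) ≤ l2n h :=
  ENNReal.toReal_mono hh.2.ne (eLpNorm_mollify_le hε hh)

theorem mollify_sub {ε : ℝ} (hε : 0 < ε) {f g : E n → W} (hf : LocallyIntegrable f volume)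
    (hg : LocallyIntegrable g volume) : mollify ε (f - g) = mollify ε f - mollify ε g := by
  funext x
  simp only [Pi.sub_apply, mollify_apply, smul_sub]
  exact integral_sub (integrable_mollifier_smul hε hf x) (integrable_mollifier_smul hε hg x)

/-- Mollification is symmetric, the density being even. -/
theorem integral_inner_mollify [CompleteSpace V] {ε : ℝ} (hε : 0 < ε) {f g : E n → V}
    (hf : Integrable f volume) (hg : Continuous g)
    (hg' : HasCompactSupport g) :
    ∫ x, ⟪mollify ε f x, g x⟫_ℝ = ∫ x, ⟪f x, mollify ε g x⟫_ℝ := by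
  have hgi : LocallyIntegrable g volume := hg.locallyIntegrable
  have e1 : ∀ x, ⟪mollify ε f x, g x⟫_ℝ = ∫ y, mollifier n ε (x - y) * ⟪f y, g x⟫_ℝ := by
    intro x
    rw [mollify_apply, real_inner_comm,
      ← integral_inner (integrable_mollifier_smul hε hf.locallyIntegrable x)]
    refine integral_congr_ae (Eventually.of_forall fun y => ?_)
    simp only [inner_smul_right, real_inner_comm]
  have e2 : ∀ y, ⟪f y, mollify ε g y⟫_ℝ = ∫ x, mollifier n ε (x - y) * ⟪f y, g x⟫_ℝ := by
    intro y
    rw [mollify_apply, ← integral_inner (integrable_mollifier_smul hε hgi y)]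
    refine integral_congr_ae (Eventually.of_forall fun x => ?_)
    simp only [inner_smul_right]
    rw [← mollifier_neg, neg_sub]
  simp only [e1, e2]
  refine integral_integral_swap ?_
  have hm : Continuous (mollifier n ε) := (mollifier_contDiff ε).continuous
  obtain ⟨C, hC⟩ := (mollifier_hasCompactSupport hε).exists_bound_of_continuous hm
  have hp : Integrable (fun p : E n × E n => ‖g p.1‖ * ‖f p.2‖) (volume.prod volume) :=
    ((hg.integrable_of_hasCompactSupport hg').norm).mul_prod hf.norm
  refine (hp.const_mul C).mono' ?_ (Eventually.of_forall fun p => ?_)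
  · refine AEStronglyMeasurable.mul
      ((hm.comp (continuous_fst.sub continuous_snd)).aestronglyMeasurable) ?_
    exact (hf.1.comp_quasiMeasurePreserving Measure.quasiMeasurePreserving_snd).inner
      (hg.comp continuous_fst).aestronglyMeasurable
  · simp only [Function.uncurry, norm_mul]
    gcongr
    · exact (norm_nonneg _).trans (hC (p.1 - p.2))
    · exact hC _
    · rw [mul_comm]; exact norm_inner_le_norm _ _

theorem exists_l2n_mollify_sub_le_of_continuous [CompleteSpace W] {h : E n → W} (hh : Continuous h)
    (hc : HasCompactSupport h) {s : ℝ} (hs : 0 < s) :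
    ∃ ε₀, 0 < ε₀ ∧ ∀ ε, 0 < ε → ε ≤ ε₀ → l2n (mollify ε h - h) ≤ s := by
  obtain ⟨R, hR0, hR⟩ := exists_radius hc
  set K : Set (E n) := Metric.closedBall 0 (R + 1)
  set M : ℝ := (volume K ^ (1 / (2 : ℝ≥0∞).toReal)).toReal
  have hM : volume K ^ (1 / (2 : ℝ≥0∞).toReal) ≠ ∞ := by
    refine ENNReal.rpow_ne_top_of_nonneg (by positivity) ?_
    exact (isCompact_closedBall _ _).measure_lt_top.ne
  have hM0 : 0 ≤ M := ENNReal.toReal_nonneg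
  set s' : ℝ := s / (M + 1)
  have hs' : 0 < s' := by positivity
  have huc : UniformContinuous h := hc.uniformContinuous_of_continuous hh
  obtain ⟨δ, hδ, hδ'⟩ := Metric.uniformContinuous_iff.1 huc s' hs'
  refine ⟨min δ 1, by positivity, fun ε hε hε' => ?_⟩
  have hd : ∀ x, dist (mollify ε h x) (h x) ≤ s' := by
    intro x
    refine dist_convolution_le hs'.le (mollifier_support hε) (mollifier_nonneg hε)
      (integral_mollifier hε) hh.aestronglyMeasurable fun y hy => ?_
    exact (hδ' (lt_of_lt_of_le hy (hε'.trans (min_le_left _ _)))).le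
  have h1 := eLpNorm_sub_le_of_dist_bdd (p := 2) volume (by norm_num)
    (isCompact_closedBall (0 : E n) (R + 1)).measurableSet hs'.le (f := mollify ε h) (g := h)
    hd (fun x hx => by
      rw [mem_closedBall_zero_iff]
      by_contra h0
      refine hx (mollify_eq_zero hε hR ?_)
      have := hε'.trans (min_le_right _ _)
      linarith [not_le.1 h0]) (fun x hx => by
      rw [mem_closedBall_zero_iff]
      by_contra h0
      refine hx (hR _ ?_)
      linarith [not_le.1 h0])
  unfold l2n
  have h2 := ENNReal.toReal_mono (ENNReal.mul_ne_top ENNReal.ofReal_ne_top hM) h1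
  rw [ENNReal.toReal_mul, ENNReal.toReal_ofReal hs'.le] at h2
  refine h2.trans ?_
  change s / (M + 1) * M ≤ s
  rw [div_mul_eq_mul_div, div_le_iff₀ (by positivity)]
  nlinarith

theorem exists_test_approx {h : E n → W} (hh : MemLp h 2 volume) {s : ℝ}
    (hs : 0 < s) : ∃ g : E n → W, IsTestFun g ∧ l2n (h - g) ≤ s := by
  obtain ⟨g, h1, h2, h3⟩ := hh.exist_eLpNorm_sub_le (by norm_num) (by norm_num) hs
  refine ⟨g, ⟨h2, h1⟩, ?_⟩
  have := ENNReal.toReal_mono ENNReal.ofReal_ne_top h3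
  rwa [ENNReal.toReal_ofReal hs.le] at this

theorem exists_l2n_mollify_sub_le [CompleteSpace W] {h : E n → W} (hh : MemLp h 2 volume) {s : ℝ} (hs : 0 < s) :
    ∃ ε₀, 0 < ε₀ ∧ ∀ ε, 0 < ε → ε ≤ ε₀ → l2n (mollify ε h - h) ≤ s := by
  obtain ⟨g, hg, hgs⟩ := exists_test_approx hh (s := s / 3) (by positivity)
  obtain ⟨ε₀, h0, h1⟩ := exists_l2n_mollify_sub_le_of_continuous hg.1.continuous hg.2
    (s := s / 3) (by positivity)
  refine ⟨ε₀, h0, fun ε hε hε' => ?_⟩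
  have hgm := hg.memLp
  have e : mollify ε h - h = (mollify ε (h - g) + (mollify ε g - g)) - (h - g) := by
    rw [mollify_sub hε (hh.locallyIntegrable (by norm_num)) hg.1.continuous.locallyIntegrable]
    abel
  have m1 := memLp_mollify hε (hh.sub hgm)
  have m2 := (memLp_mollify hε hgm).sub hgm
  rw [e]
  have i1 := l2n_sub_le (m1.add m2) (hh.sub hgm)
  have i2 := l2n_add_le m1 m2
  have i3 := l2n_mollify_le hε (hh.sub hgm)
  have i4 := h1 ε hε hε'
  linarith

end Mollifier

/-! ### Second order operators with scalar principal part -/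

/-- The standard basis vectors. -/
abbrev stdVec {n : ℕ} (i : Fin n) : E n := EuclideanSpace.basisFun (Fin n) ℝ i

/-- A second order operator `-∑ ∂ᵢ (aᵢⱼ ∂ⱼ u) + b (Du) + c u` on vector-valued functions whose
principal part `a` is scalar, symmetric and positive definite. -/
structure ScalarOp (n : ℕ) (V : Type*) [NormedAddCommGroup V] [InnerProductSpace ℝ V] where
  /-- the principal part -/
  a : E n → E n →L[ℝ] E n
  /-- the first order coefficients -/
  b : E n → (E n →L[ℝ] V) →L[ℝ] V
  /-- the zeroth order coefficient -/
  c : E n → V →L[ℝ] V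
  smooth_a : ContDiff ℝ (⊤ : ℕ∞) a
  continuous_b : Continuous b
  continuous_c : Continuous c
  symm_a : ∀ x u v, ⟪a x u, v⟫_ℝ = ⟪u, a x v⟫_ℝ
  pos_a : ∀ x v, v ≠ 0 → 0 < ⟪a x v, v⟫_ℝ

namespace ScalarOp

variable {n : ℕ} {V : Type*} [NormedAddCommGroup V] [InnerProductSpace ℝ V]
  [FiniteDimensional ℝ V] (P : ScalarOp n V)

/-- The flux `∑ⱼ aᵢⱼ ∂ⱼ u`. -/
def flux (u : E n → V) (i : Fin n) : E n → V := fun x => fderiv ℝ u x (P.a x (stdVec i))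

/-- The lower order terms of the operator. -/
def low (u : E n → V) : E n → V := fun x => P.b x (fderiv ℝ u x) + P.c x (u x)

/-- The action of the operator on functions. -/
def op (u : E n → V) : E n → V := fun x =>
  -(∑ i, fderiv ℝ (P.flux u i) x (stdVec i)) + P.low u x

/-- The integrand of the quadratic form of the operator. -/
def formDensity (u h : E n → V) (x : E n) : ℝ :=
  ∑ i, ⟪P.flux u i x, fderiv ℝ h x (stdVec i)⟫_ℝ + ⟪P.low u x, h x⟫_ℝ

/-- The squared length `∑ aᵢⱼ ∂ᵢχ ∂ⱼχ` of the differential of a function. -/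
def gradSq (χ : E n → ℝ) (x : E n) : ℝ :=
  ∑ i, fderiv ℝ χ x (P.a x (stdVec i)) * fderiv ℝ χ x (stdVec i)

variable {P}

theorem _root_.HodgeWarped.memLp_of_continuous {W : Type*} [NormedAddCommGroup W]
    {h : E n → W} (hh : Continuous h) {R : ℝ}
    (hR : ∀ y, R < ‖y‖ → h y = 0) : MemLp h 2 volume :=
  hh.memLp_of_hasCompactSupport
    (HasCompactSupport.of_support_subset_isCompact (isCompact_closedBall (0 : E n) R) fun y hy => by
      rw [mem_closedBall_zero_iff]
      by_contra h0
      exact hy (hR y (not_le.1 h0)))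

theorem _root_.HodgeWarped.fderiv_eq_zero_of_radius {W : Type*} [NormedAddCommGroup W]
    [NormedSpace ℝ W] {h : E n → W} {R : ℝ} (hR : ∀ y, R < ‖y‖ → h y = 0) {x : E n}
    (hx : R < ‖x‖) : fderiv ℝ h x = 0 := by
  have : h =ᶠ[𝓝 x] fun _ => 0 := by
    filter_upwards [(isOpen_lt continuous_const continuous_norm).mem_nhds hx] with y hy
    exact hR y hy
  rw [this.fderiv_eq]
  exact fderiv_const_apply 0

theorem _root_.HodgeWarped.exists_bound_of_continuous {W : Type*} [NormedAddCommGroup W]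
    {h : E n → W} (hh : Continuous h) (R : ℝ) : ∃ C, 0 ≤ C ∧ ∀ x, ‖x‖ ≤ R → ‖h x‖ ≤ C := by
  obtain ⟨C, hC⟩ := (isCompact_closedBall (0 : E n) R).exists_bound_of_continuousOn
    hh.continuousOn
  exact ⟨max C 0, le_max_right _ _, fun x hx =>
    (hC x (mem_closedBall_zero_iff.2 hx)).trans (le_max_left _ _)⟩

theorem flux_contDiff {u : E n → V} (hu : ContDiff ℝ (⊤ : ℕ∞) u) (i : Fin n) :
    ContDiff ℝ (⊤ : ℕ∞) (P.flux u i) :=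
  (hu.fderiv_right (m := (⊤ : ℕ∞)) (by simp)).clm_apply
    (P.smooth_a.clm_apply contDiff_const)

theorem flux_radius {u : E n → V} {R : ℝ} (hR : ∀ y, R < ‖y‖ → u y = 0) (i : Fin n) :
    ∀ y, R < ‖y‖ → P.flux u i y = 0 := fun y hy => by
  simp [flux, fderiv_eq_zero_of_radius hR hy]

theorem low_continuous {u : E n → V} (hu : ContDiff ℝ (⊤ : ℕ∞) u) : Continuous (P.low u) :=
  (P.continuous_b.clm_apply (hu.continuous_fderiv (by simp))).add
    (P.continuous_c.clm_apply hu.continuous)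

theorem low_radius {u : E n → V} {R : ℝ} (hR : ∀ y, R < ‖y‖ → u y = 0) :
    ∀ y, R < ‖y‖ → P.low u y = 0 := fun y hy => by
  simp [low, fderiv_eq_zero_of_radius hR hy, hR y hy]

theorem op_continuous {u : E n → V} (hu : ContDiff ℝ (⊤ : ℕ∞) u) : Continuous (P.op u) := by
  refine Continuous.add (Continuous.neg (continuous_finsetSum _ fun i _ => ?_))
    (low_continuous hu)
  exact ((flux_contDiff hu i).continuous_fderiv (by simp)).clm_apply continuous_const

theorem op_radius {u : E n → V} {R : ℝ} (hR : ∀ y, R < ‖y‖ → u y = 0) :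
    ∀ y, R < ‖y‖ → P.op u y = 0 := fun y hy => by
  simp [op, low_radius hR y hy, fderiv_eq_zero_of_radius (flux_radius hR _) hy]

/-- Integration by parts: the quadratic form of the operator. -/
theorem integral_op_inner {u h : E n → V} (hu : IsTestFun u) (hh : IsTestFun h) :
    ∫ x, ⟪P.op u x, h x⟫_ℝ = ∫ x, P.formDensity u h x := by
  obtain ⟨R, -, hR⟩ := exists_radius hu.2
  have hfl : ∀ i, MemLp (P.flux u i) 2 volume := fun i =>
    memLp_of_continuous (flux_contDiff hu.1 i).continuous (flux_radius hR i)
  have hDfl : ∀ i, MemLp (fun x => fderiv ℝ (P.flux u i) x (stdVec i)) 2 volume := fun i =>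
    memLp_of_continuous (R := R)
      (((flux_contDiff hu.1 i).continuous_fderiv (by simp)).clm_apply continuous_const)
      (fun y hy => by simp [fderiv_eq_zero_of_radius (flux_radius hR i) hy])
  have hlow : MemLp (P.low u) 2 volume :=
    memLp_of_continuous (low_continuous hu.1) (low_radius hR)
  have hDh : ∀ i, MemLp (fun x => fderiv ℝ h x (stdVec i)) 2 volume := fun i => by
    obtain ⟨R', -, hR'⟩ := exists_radius hh.2
    exact memLp_of_continuous (R := R') ((hh.1.continuous_fderiv (by simp)).clm_apply
      continuous_const) (fun y hy => by simp [fderiv_eq_zero_of_radius hR' hy])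
  have key : ∀ i, ∫ x, ⟪P.flux u i x, fderiv ℝ h x (stdVec i)⟫_ℝ
      = -∫ x, ⟪fderiv ℝ (P.flux u i) x (stdVec i), h x⟫_ℝ := fun i =>
    integral_bilinear_fderiv_right_eq_neg_left_of_integrable (B := innerSL ℝ)
      (integrable_inner_of_memLp (hDfl i) hh.memLp)
      (integrable_inner_of_memLp (hfl i) (hDh i))
      (integrable_inner_of_memLp (hfl i) hh.memLp)
      (fun x _ => ((flux_contDiff hu.1 i).differentiable (by simp)) x)
      (fun x _ => (hh.1.differentiable (by simp)) x)
  simp only [op, formDensity, inner_add_left, inner_neg_left, sum_inner]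
  rw [integral_add, integral_add, integral_neg, integral_finsetSum, integral_finsetSum,
    ← Finset.sum_neg_distrib]
  · simp only [key]
  · exact fun i _ => integrable_inner_of_memLp (hfl i) (hDh i)
  · exact fun i _ => integrable_inner_of_memLp (hDfl i) hh.memLp
  · exact integrable_finsetSum _ fun i _ => integrable_inner_of_memLp (hfl i) (hDh i)
  · exact integrable_inner_of_memLp hlow hh.memLp
  · exact (integrable_finsetSum _ fun i _ => integrable_inner_of_memLp (hDfl i) hh.memLp).neg
  · exact integrable_inner_of_memLp hlow hh.memLp

theorem norm_stdVec (i : Fin n) : ‖(stdVec i : E n)‖ = 1 :=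
  (EuclideanSpace.basisFun (Fin n) ℝ).orthonormal.1 i

theorem sq_opNorm_le_sum (L : E n →L[ℝ] V) : ‖L‖ ^ 2 ≤ ∑ i, ‖L (stdVec i)‖ ^ 2 := by
  have h : ‖L‖ ≤ √(∑ i, ‖L (stdVec i)‖ ^ 2) := by
    refine L.opNorm_le_bound (Real.sqrt_nonneg _) fun v => ?_
    have hv : L v = ∑ i, ⟪stdVec i, v⟫_ℝ • L (stdVec i) := by
      conv_lhs => rw [← (EuclideanSpace.basisFun (Fin n) ℝ).sum_repr' v]
      simp
    have hn : ‖v‖ = √(∑ i, ⟪stdVec i, v⟫_ℝ ^ 2) := by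
      rw [EuclideanSpace.norm_eq]
      congr 1
      refine Finset.sum_congr rfl fun i _ => ?_
      simp [stdVec, EuclideanSpace.basisFun_apply, EuclideanSpace.inner_single_left]
    rw [hv, hn]
    refine (norm_sum_le _ _).trans ?_
    simp only [norm_smul]
    have := Real.sum_mul_le_sqrt_mul_sqrt Finset.univ (fun i => ‖⟪(stdVec i : E n), v⟫_ℝ‖)
      (fun i => ‖L (stdVec i)‖)
    simp only [Real.norm_eq_abs, sq_abs] at this ⊢
    rw [mul_comm]
    exact this
  calc ‖L‖ ^ 2 ≤ (√(∑ i, ‖L (stdVec i)‖ ^ 2)) ^ 2 := by gcongr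
    _ = _ := Real.sq_sqrt (Finset.sum_nonneg fun i _ => by positivity)

/-- On a ball the principal part is uniformly positive. -/
theorem exists_lower_bound (R : ℝ) : ∃ l, 0 < l ∧ ∀ x, ‖x‖ ≤ R → ∀ v,
    l * ‖v‖ ^ 2 ≤ ⟪P.a x v, v⟫_ℝ := by
  by_cases hne : ((Metric.closedBall (0 : E n) R) ×ˢ (Metric.sphere (0 : E n) 1)).Nonempty
  · have hc : IsCompact ((Metric.closedBall (0 : E n) R) ×ˢ (Metric.sphere (0 : E n) 1)) :=
      (isCompact_closedBall _ _).prod (isCompact_sphere _ _)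
    have hcont : Continuous fun p : E n × E n => ⟪P.a p.1 p.2, p.2⟫_ℝ :=
      ((P.smooth_a.continuous.comp continuous_fst).clm_apply continuous_snd).inner continuous_snd
    obtain ⟨p, hp, hmin⟩ := hc.exists_isMinOn hne hcont.continuousOn
    have hp2 : ‖p.2‖ = 1 := mem_sphere_zero_iff_norm.1 hp.2
    refine ⟨⟪P.a p.1 p.2, p.2⟫_ℝ, P.pos_a _ _ (fun h => by simp [h] at hp2), fun x hx v => ?_⟩
    rcases eq_or_ne v 0 with rfl | hv
    · simp
    · have hv' : ‖v‖ ≠ 0 := norm_ne_zero_iff.2 hv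
      have h1 : ((x, ‖v‖⁻¹ • v) : E n × E n) ∈
          (Metric.closedBall (0 : E n) R) ×ˢ (Metric.sphere (0 : E n) 1) := by
        refine ⟨mem_closedBall_zero_iff.2 hx, mem_sphere_zero_iff_norm.2 ?_⟩
        simp [norm_smul, hv']
      have h2 := hmin h1
      simp only [mem_ofPred_eq, map_smul, inner_smul_left, inner_smul_right,
        RCLike.conj_to_real] at h2
      have h3 : 0 < ‖v‖ := by positivity
      calc _ ≤ (‖v‖⁻¹ * (‖v‖⁻¹ * ⟪P.a x v, v⟫_ℝ)) * ‖v‖ ^ 2 := by gcongr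
        _ = _ := by field_simp
  · refine ⟨1, one_pos, fun x hx v => ?_⟩
    rcases eq_or_ne v 0 with rfl | hv
    · simp
    · exact absurd ⟨(x, ‖v‖⁻¹ • v), mem_closedBall_zero_iff.2 hx, mem_sphere_zero_iff_norm.2
        (by simp [norm_smul, norm_ne_zero_iff.2 hv])⟩ hne

theorem exists_form_lower_bound (R : ℝ) : ∃ l, 0 < l ∧ ∀ x, ‖x‖ ≤ R → ∀ L : E n →L[ℝ] V,
    l * ‖L‖ ^ 2 ≤ ∑ i, ⟪L (P.a x (stdVec i)), L (stdVec i)⟫_ℝ := by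
  obtain ⟨l, hl, h⟩ := P.exists_lower_bound R
  refine ⟨l, hl, fun x hx L => ?_⟩
  set f := stdOrthonormalBasis ℝ V
  set z := fun k => L.adjoint (f k)
  have hz : ∀ v k, ⟪L v, f k⟫_ℝ = ⟪v, z k⟫_ℝ := fun v k =>
    (ContinuousLinearMap.adjoint_inner_right L v (f k)).symm
  have e1 : ∑ i, ⟪L (P.a x (stdVec i)), L (stdVec i)⟫_ℝ = ∑ k, ⟪P.a x (z k), z k⟫_ℝ := by
    have : ∀ i, ⟪L (P.a x (stdVec i)), L (stdVec i)⟫_ℝ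
        = ∑ k, ⟪stdVec i, P.a x (z k)⟫_ℝ * ⟪(stdVec i : E n), z k⟫_ℝ := fun i => by
      rw [← f.sum_inner_mul_inner]
      refine Finset.sum_congr rfl fun k _ => ?_
      rw [hz, P.symm_a, real_inner_comm _ (f k), hz]
    simp only [this]
    rw [Finset.sum_comm]
    refine Finset.sum_congr rfl fun k _ => ?_
    rw [← (EuclideanSpace.basisFun (Fin n) ℝ).sum_inner_mul_inner]
    refine Finset.sum_congr rfl fun i _ => ?_
    rw [real_inner_comm]
  have e2 : ∑ i, ‖L (stdVec i)‖ ^ 2 = ∑ k, ‖z k‖ ^ 2 := by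
    have : ∀ i, ‖L (stdVec i)‖ ^ 2 = ∑ k, ⟪(stdVec i : E n), z k⟫_ℝ ^ 2 := fun i => by
      rw [← real_inner_self_eq_norm_sq, ← f.sum_inner_mul_inner]
      refine Finset.sum_congr rfl fun k _ => ?_
      rw [real_inner_comm _ (f k), hz, sq]
    simp only [this]
    rw [Finset.sum_comm]
    refine Finset.sum_congr rfl fun k _ => ?_
    rw [← real_inner_self_eq_norm_sq, ← (EuclideanSpace.basisFun (Fin n) ℝ).sum_inner_mul_inner]
    refine Finset.sum_congr rfl fun i _ => ?_
    rw [real_inner_comm, sq]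
  calc l * ‖L‖ ^ 2 ≤ l * ∑ i, ‖L (stdVec i)‖ ^ 2 := by gcongr; exact sq_opNorm_le_sum L
    _ = ∑ k, l * ‖z k‖ ^ 2 := by rw [e2, Finset.mul_sum]
    _ ≤ ∑ k, ⟪P.a x (z k), z k⟫_ℝ := Finset.sum_le_sum fun k _ => h x hx _
    _ = _ := e1.symm

theorem exists_low_bound (R : ℝ) : ∃ C, 0 ≤ C ∧ ∀ (u : E n → V) x, ‖x‖ ≤ R →
    ‖P.low u x‖ ≤ C * (‖fderiv ℝ u x‖ + ‖u x‖) := by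
  obtain ⟨Cb, hb0, hb⟩ := exists_bound_of_continuous (W := (E n →L[ℝ] V) →L[ℝ] V) P.continuous_b R
  obtain ⟨Cc, hc0, hc⟩ := exists_bound_of_continuous (W := V →L[ℝ] V) P.continuous_c R
  refine ⟨max Cb Cc, le_max_of_le_left hb0, fun u x hx => ?_⟩
  calc ‖P.low u x‖ ≤ ‖P.b x‖ * ‖fderiv ℝ u x‖ + ‖P.c x‖ * ‖u x‖ :=
        (norm_add_le _ _).trans (add_le_add (ContinuousLinearMap.le_opNorm _ _)
          (ContinuousLinearMap.le_opNorm _ _))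
    _ ≤ max Cb Cc * ‖fderiv ℝ u x‖ + max Cb Cc * ‖u x‖ := by
        gcongr
        · exact (hb x hx).trans (le_max_left _ _)
        · exact (hc x hx).trans (le_max_right _ _)
    _ = _ := by ring

theorem _root_.HodgeWarped.IsTestFun.fderiv_memLp {W : Type*} [NormedAddCommGroup W]
    [NormedSpace ℝ W] {u : E n → W} (hu : IsTestFun u) :
    MemLp (fderiv ℝ u) 2 volume :=
  (hu.1.continuous_fderiv (by simp)).memLp_of_hasCompactSupport (hu.2.fderiv ℝ)

/-- The first order Sobolev norm. -/
def _root_.HodgeWarped.h1n {W : Type*} [NormedAddCommGroup W] [NormedSpace ℝ W]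
    (u : E n → W) : ℝ := l2n (fderiv ℝ u) + l2n u

theorem l2n_low_le (R : ℝ) : ∃ C, 0 ≤ C ∧ ∀ (u : E n → V), IsTestFun u →
    (∀ y, R < ‖y‖ → u y = 0) → l2n (P.low u) ≤ C * h1n u := by
  obtain ⟨C, hC0, hC⟩ := P.exists_low_bound R
  refine ⟨C, hC0, fun u hu hR => ?_⟩
  set F : E n → ℝ := fun x => ‖fderiv ℝ u x‖
  set G : E n → ℝ := fun x => ‖u x‖
  have hF : MemLp F 2 volume := hu.fderiv_memLp.norm
  have hG : MemLp G 2 volume := hu.memLp.norm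
  have h1 : l2n (P.low u) ≤ C * l2n (F + G) := by
    refine l2n_le_of_norm_le hC0 (hF.add hG) fun x => ?_
    rcases le_or_gt ‖x‖ R with hx | hx
    · refine (hC u x hx).trans ?_
      rw [Pi.add_apply, Real.norm_of_nonneg (by positivity)]
    · rw [low_radius hR x hx, norm_zero]; positivity
  have h2 : l2n (F + G) ≤ l2n F + l2n G := l2n_add_le hF hG
  have h3 : l2n F = l2n (fderiv ℝ u) := by unfold l2n; rw [eLpNorm_norm]
  have h4 : l2n G = l2n u := by unfold l2n; rw [eLpNorm_norm]
  rw [h3, h4] at h2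
  exact h1.trans (mul_le_mul_of_nonneg_left h2 hC0)

theorem _root_.HodgeWarped.h1n_nonneg {W : Type*} [NormedAddCommGroup W] [NormedSpace ℝ W]
    (u : E n → W) : 0 ≤ h1n u := add_nonneg (l2n_nonneg _) (l2n_nonneg _)

theorem l2n_flux_le (R : ℝ) : ∃ C, 0 ≤ C ∧ ∀ (u : E n → V) i, IsTestFun u →
    (∀ y, R < ‖y‖ → u y = 0) → l2n (P.flux u i) ≤ C * l2n (fderiv ℝ u) := by
  obtain ⟨C, hC0, hC⟩ := exists_bound_of_continuous P.smooth_a.continuous R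
  refine ⟨C, hC0, fun u i hu hR => l2n_le_of_norm_le hC0 hu.fderiv_memLp fun x => ?_⟩
  rcases le_or_gt ‖x‖ R with hx | hx
  · calc ‖fderiv ℝ u x (P.a x (stdVec i))‖ ≤ ‖fderiv ℝ u x‖ * (‖P.a x‖ * ‖(stdVec i : E n)‖) :=
        (ContinuousLinearMap.le_opNorm _ _).trans (by gcongr; exact ContinuousLinearMap.le_opNorm _ _)
      _ ≤ ‖fderiv ℝ u x‖ * (C * 1) := by gcongr; exacts [hC x hx, (norm_stdVec i).le]
      _ = _ := by ring
  · rw [flux_radius hR i x hx, norm_zero]; positivity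

/-- The quadratic form of the operator is bounded for the first order Sobolev norm, locally. -/
theorem exists_form_bound (R : ℝ) : ∃ C, 0 ≤ C ∧ ∀ u h : E n → V, IsTestFun u → IsTestFun h →
    (∀ y, R < ‖y‖ → u y = 0) → |∫ x, ⟪P.op u x, h x⟫_ℝ| ≤ C * h1n u * h1n h := by
  obtain ⟨C1, h10, hC1⟩ := P.l2n_low_le R
  obtain ⟨C2, h20, hC2⟩ := P.l2n_flux_le R
  refine ⟨n * C2 + C1, by positivity, fun u h hu hh hR => ?_⟩
  have hfl : ∀ i, MemLp (P.flux u i) 2 volume := fun i =>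
    memLp_of_continuous (flux_contDiff hu.1 i).continuous (flux_radius hR i)
  have hlow : MemLp (P.low u) 2 volume :=
    memLp_of_continuous (low_continuous hu.1) (low_radius hR)
  have hDh : ∀ i, MemLp (fun x => fderiv ℝ h x (stdVec i)) 2 volume := fun i => by
    obtain ⟨R', -, hR'⟩ := exists_radius hh.2
    exact memLp_of_continuous (R := R') ((hh.1.continuous_fderiv (by simp)).clm_apply
      continuous_const) (fun y hy => by simp [fderiv_eq_zero_of_radius hR' hy])
  have hDh' : ∀ i, l2n (fun x => fderiv ℝ h x (stdVec i)) ≤ l2n (fderiv ℝ h) := fun i => by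
    have := l2n_le_of_norm_le (C := 1) zero_le_one hh.fderiv_memLp
      (f := fun x => fderiv ℝ h x (stdVec i)) fun x => by
        have := (fderiv ℝ h x).le_opNorm (stdVec i)
        rw [norm_stdVec] at this
        linarith
    linarith
  rw [integral_op_inner hu hh]
  simp only [formDensity]
  rw [integral_add (integrable_finsetSum _ fun i _ => integrable_inner_of_memLp (hfl i) (hDh i))
    (integrable_inner_of_memLp hlow hh.memLp),
    integral_finsetSum _ fun i _ => integrable_inner_of_memLp (hfl i) (hDh i)]
  have i0 := h1n_nonneg u
  have i1 := h1n_nonneg h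
  have j0 : l2n (fderiv ℝ u) ≤ h1n u := by unfold h1n; linarith [l2n_nonneg u]
  have j1 : l2n (fderiv ℝ h) ≤ h1n h := by unfold h1n; linarith [l2n_nonneg h]
  have j2 : l2n h ≤ h1n h := by unfold h1n; linarith [l2n_nonneg (fderiv ℝ h)]
  calc _ ≤ ∑ i : Fin n, |∫ x, ⟪P.flux u i x, fderiv ℝ h x (stdVec i)⟫_ℝ|
        + |∫ x, ⟪P.low u x, h x⟫_ℝ| :=
        (abs_add_le _ _).trans (add_le_add_left (Finset.abs_sum_le_sum_abs _ _) _)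
    _ ≤ ∑ i : Fin n, (C2 * h1n u) * h1n h + (C1 * h1n u) * h1n h := by
        gcongr with i
        · refine (abs_integral_inner_le (hfl i) (hDh i)).trans ?_
          gcongr
          · exact l2n_nonneg _
          · exact (hC2 u i hu hR).trans (by gcongr)
          · exact (hDh' i).trans j1
        · refine (abs_integral_inner_le hlow hh.memLp).trans ?_
          gcongr
          · exact l2n_nonneg _
          · exact hC1 u hu hR
    _ = _ := by simp; ring

/-- **Gårding's inequality** on a ball. -/
theorem garding (R : ℝ) : ∃ C, 0 ≤ C ∧ ∀ u : E n → V, IsTestFun u →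
    (∀ y, R < ‖y‖ → u y = 0) → 0 ≤ ∫ x, ⟪P.op u x, u x⟫_ℝ →
    l2n (fderiv ℝ u) ^ 2 ≤ C * ((∫ x, ⟪P.op u x, u x⟫_ℝ) + l2n u ^ 2) := by
  obtain ⟨C1, h10, hC1⟩ := P.l2n_low_le R
  obtain ⟨l, hl, hlb⟩ := P.exists_form_lower_bound R
  refine ⟨2 / l * (1 + C1 + C1 ^ 2 / (2 * l)), by positivity, fun u hu hR hQ => ?_⟩
  have hfl : ∀ i, MemLp (P.flux u i) 2 volume := fun i =>
    memLp_of_continuous (flux_contDiff hu.1 i).continuous (flux_radius hR i)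
  have hlow : MemLp (P.low u) 2 volume :=
    memLp_of_continuous (low_continuous hu.1) (low_radius hR)
  have hDu : ∀ i, MemLp (fun x => fderiv ℝ u x (stdVec i)) 2 volume := fun i =>
    memLp_of_continuous (R := R) ((hu.1.continuous_fderiv (by simp)).clm_apply
      continuous_const) (fun y hy => by simp [fderiv_eq_zero_of_radius hR hy])
  set D := l2n (fderiv ℝ u)
  set A := l2n u
  have hD : 0 ≤ D := l2n_nonneg _
  have hA : 0 ≤ A := l2n_nonneg _
  have e1 : ∫ x, ⟪P.op u x, u x⟫_ℝ
      = (∫ x, ∑ i, ⟪P.flux u i x, fderiv ℝ u x (stdVec i)⟫_ℝ) + ∫ x, ⟪P.low u x, u x⟫_ℝ := by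
    rw [integral_op_inner hu hu]
    simp only [formDensity]
    exact integral_add (integrable_finsetSum _ fun i _ => integrable_inner_of_memLp (hfl i) (hDu i))
      (integrable_inner_of_memLp hlow hu.memLp)
  have e2 : l * D ^ 2 ≤ ∫ x, ∑ i, ⟪P.flux u i x, fderiv ℝ u x (stdVec i)⟫_ℝ := by
    rw [l2n_sq hu.fderiv_memLp, ← integral_const_mul]
    refine integral_mono ?_ (integrable_finsetSum _ fun i _ =>
      integrable_inner_of_memLp (hfl i) (hDu i)) fun x => ?_
    · have := hu.fderiv_memLp.integrable_norm_pow (p := 2) (by norm_num)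
      exact this.const_mul _
    · rcases le_or_gt ‖x‖ R with hx | hx
      · exact hlb x hx _
      · simp [fderiv_eq_zero_of_radius hR hx]
  have e3 := abs_integral_inner_le hlow hu.memLp
  have e4 : |∫ x, ⟪P.low u x, u x⟫_ℝ| ≤ C1 * (D + A) * A :=
    e3.trans (mul_le_mul_of_nonneg_right (hC1 u hu hR) hA)
  have e5 := (abs_le.1 e4).1
  set Q := ∫ x, ⟪P.op u x, u x⟫_ℝ
  -- Absorb `C₁ D A` into `l D² / 2`.
  have e6 : C1 * D * A ≤ l / 2 * D ^ 2 + C1 ^ 2 / (2 * l) * A ^ 2 := by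
    have : 0 ≤ (l * D - C1 * A) ^ 2 / (2 * l) := by positivity
    have e : (l * D - C1 * A) ^ 2 / (2 * l)
        = l / 2 * D ^ 2 + C1 ^ 2 / (2 * l) * A ^ 2 - C1 * D * A := by field_simp; ring
    linarith
  have e7 : l / 2 * D ^ 2 ≤ Q + (C1 + C1 ^ 2 / (2 * l)) * A ^ 2 := by nlinarith
  have e8 : Q + (C1 + C1 ^ 2 / (2 * l)) * A ^ 2
      ≤ (1 + C1 + C1 ^ 2 / (2 * l)) * (Q + A ^ 2) := by
    set k := C1 + C1 ^ 2 / (2 * l)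
    have hk : 0 ≤ k := by positivity
    rw [add_assoc]
    nlinarith [mul_nonneg hk hQ, sq_nonneg A]
  calc D ^ 2 = 2 / l * (l / 2 * D ^ 2) := by field_simp
    _ ≤ 2 / l * ((1 + C1 + C1 ^ 2 / (2 * l)) * (Q + A ^ 2)) :=
        mul_le_mul_of_nonneg_left (e7.trans e8) (by positivity)
    _ = _ := by ring

end ScalarOp

/-! ### Commutators with mollification -/

theorem fderiv_mollifier {n : ℕ} (ε : ℝ) (z : E n) : fderiv ℝ (mollifier n ε) z
    = ((ε ^ n)⁻¹ * ε⁻¹) • fderiv ℝ (bumpDensity n) (ε⁻¹ • z) := by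
  have h1 : HasFDerivAt (bumpDensity n) (fderiv ℝ (bumpDensity n) (ε⁻¹ • z)) (ε⁻¹ • z) :=
    ((bumpDensity_contDiff.differentiable (by simp)) _).hasFDerivAt
  have h2 : HasFDerivAt (fun x : E n => ε⁻¹ • x) (ε⁻¹ • ContinuousLinearMap.id ℝ (E n)) z :=
    (ε⁻¹ • ContinuousLinearMap.id ℝ (E n)).hasFDerivAt
  have h3 := (h1.comp z h2).const_mul ((ε ^ n)⁻¹)
  have : mollifier n ε = fun x => (ε ^ n)⁻¹ * (bumpDensity n ∘ fun x : E n => ε⁻¹ • x) x := rfl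
  rw [this, h3.fderiv, mul_smul]
  congr 1
  ext v
  simp

namespace ScalarOp

variable {n : ℕ} {V : Type*} [NormedAddCommGroup V] [InnerProductSpace ℝ V]
  [FiniteDimensional ℝ V] {P : ScalarOp n V}

/-- **Friedrichs' commutator lemma**: the commutator of a first order operator with mollification
is bounded in `L²`, uniformly in the mollification parameter. -/
theorem friedrichs (P : ScalarOp n V) (R : ℝ) : ∃ C, 0 ≤ C ∧ ∀ ε, 0 < ε → ε ≤ 1 →
    ∀ φ : E n → (E n →L[ℝ] V), Continuous φ → (∀ y, R < ‖y‖ → φ y = 0) → ∀ i,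
    l2n (fun x => fderiv ℝ (mollify ε (fun y => φ y (P.a y (stdVec i)))) x (stdVec i)
      - fderiv ℝ (mollify ε φ) x (stdVec i) (P.a x (stdVec i))) ≤ C * l2n φ := by
  obtain ⟨L, hL0, hL⟩ := exists_bound_of_continuous (W := E n →L[ℝ] E n →L[ℝ] E n)
    (P.smooth_a.continuous_fderiv (by simp)) (R + 1)
  have hLip : ∀ x y, ‖x‖ ≤ R + 1 → ‖y‖ ≤ R + 1 → ‖P.a y - P.a x‖ ≤ L * ‖y - x‖ := by
    intro x y hx hy
    exact (convex_closedBall (0 : E n) (R + 1)).norm_image_sub_le_of_norm_fderiv_le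
      (fun z _ => (P.smooth_a.differentiable (by simp)) z)
      (fun z hz => hL z (mem_closedBall_zero_iff.1 hz))
      (mem_closedBall_zero_iff.2 hx) (mem_closedBall_zero_iff.2 hy)
  -- The commutator has the kernel `∂ᵢρ_ε(x - y) (a(y) - a(x))`. Since `|a(y) - a(x)| ≤ L |x - y|`,
  -- it is dominated by the rescaling `k` of the integrable function `κ`, and the `L¹` norm of `k`
  -- does not depend on `ε`: Young's inequality applies.
  set κ : E n → ℝ := fun z => L * (‖fderiv ℝ (bumpDensity n) z‖ * ‖z‖)
  have hκ : Continuous κ := continuous_const.mul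
    ((bumpDensity_contDiff.continuous_fderiv (by simp)).norm.mul continuous_norm)
  have hκ0 : ∀ z, 0 ≤ κ z := fun z => by positivity
  have hκi : Integrable κ volume := by
    refine hκ.integrable_of_hasCompactSupport ?_
    exact ((bumpDensity_hasCompactSupport.fderiv ℝ).norm.mul_right).mul_left
  refine ⟨∫ z, κ z, integral_nonneg hκ0, fun ε hε hε1 φ hφ hR i => ?_⟩
  have hφ2 : MemLp φ 2 volume := memLp_of_continuous hφ hR
  set k : E n → ℝ := fun z => (ε ^ n)⁻¹ * κ (ε⁻¹ • z)
  have hk : Continuous k := continuous_const.mul (hκ.comp (continuous_const_smul _))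
  have hk0 : ∀ z, 0 ≤ k z := fun z => mul_nonneg (by positivity) (hκ0 _)
  have hki : Integrable k volume := by
    refine Integrable.const_mul ?_ _
    exact hκi.comp_smul (inv_ne_zero hε.ne')
  have hkint : ∫⁻ z, ENNReal.ofReal (k z) = ENNReal.ofReal (∫ z, κ z) := by
    rw [← integral_rescale hε κ, ofReal_integral_eq_lintegral_ofReal hki (Eventually.of_forall hk0)]
  have hkeq : ∀ z, k z = L * (‖fderiv ℝ (mollifier n ε) z‖ * ‖z‖) := by
    intro z
    simp only [k, κ]
    rw [fderiv_mollifier, norm_smul, norm_smul, norm_mul, norm_inv, norm_inv, norm_pow,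
      Real.norm_of_nonneg hε.le]
    ring
  have hψ : Continuous fun y => φ y (P.a y (stdVec i)) :=
    hφ.clm_apply (P.smooth_a.continuous.clm_apply continuous_const)
  have hrep : ∀ x, fderiv ℝ (mollify ε (fun y => φ y (P.a y (stdVec i)))) x (stdVec i)
      - fderiv ℝ (mollify ε φ) x (stdVec i) (P.a x (stdVec i))
      = ∫ y, fderiv ℝ (mollifier n ε) (x - y) (stdVec i) •
          φ y ((P.a y - P.a x) (stdVec i)) := by
    intro x
    have hi : Integrable (fun y => fderiv ℝ (mollifier n ε) (x - y) (stdVec i) • φ y) volume := by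
      refine Continuous.integrable_of_hasCompactSupport ?_ ?_
      · exact ((((mollifier_contDiff ε).continuous_fderiv (by simp)).comp
          (continuous_const.sub continuous_id)).clm_apply continuous_const).smul hφ
      · exact hasCompactSupport_of_radius (R := R) fun y hy => by simp [hR y hy]
    have hi2 : Integrable (fun y => fderiv ℝ (mollifier n ε) (x - y) (stdVec i) •
        φ y (P.a y (stdVec i))) volume := by
      refine Continuous.integrable_of_hasCompactSupport ?_ ?_
      · exact ((((mollifier_contDiff ε).continuous_fderiv (by simp)).comp
          (continuous_const.sub continuous_id)).clm_apply continuous_const).smul hψ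
      · exact hasCompactSupport_of_radius (R := R) fun y hy => by simp [hR y hy]
    rw [mollify_fderiv_apply hε hψ.locallyIntegrable, mollify_fderiv_apply hε hφ.locallyIntegrable,
      ContinuousLinearMap.integral_apply hi, ← integral_sub hi2 (hi.apply_continuousLinearMap _)]
    refine integral_congr_ae (Eventually.of_forall fun y => ?_)
    simp [smul_sub]
  have hb := eLpNorm_le_of_convolution_bound (k := fun z => ENNReal.ofReal (k z))
    (by fun_prop) (by rw [hkint]; simp) hφ2.1
    (F := fun x => fderiv ℝ (mollify ε (fun y => φ y (P.a y (stdVec i)))) x (stdVec i)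
      - fderiv ℝ (mollify ε φ) x (stdVec i) (P.a x (stdVec i))) (fun x => by
      rw [hrep]
      refine (enorm_integral_le_lintegral_enorm _).trans (lintegral_mono fun y => ?_)
      rw [← ofReal_norm, ← ofReal_norm, ← ENNReal.ofReal_mul (hk0 _)]
      refine ENNReal.ofReal_le_ofReal ?_
      rw [hkeq, norm_smul]
      by_cases hy : R < ‖y‖
      · simp [hR y hy]
      by_cases hxy : ε < ‖x - y‖
      · have : fderiv ℝ (mollifier n ε) (x - y) = 0 := by
          refine fderiv_eq_zero_of_radius (R := ε) (fun z hz => ?_) hxy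
          by_contra h0
          have := mollifier_support hε h0
          rw [mem_ball_zero_iff] at this
          linarith
        simp [this]
      · rw [not_lt] at hy hxy
        have hx : ‖x‖ ≤ R + 1 := by
          have := norm_le_norm_add_norm_sub' x y
          linarith
        have h1 : ‖fderiv ℝ (mollifier n ε) (x - y) (stdVec i)‖
            ≤ ‖fderiv ℝ (mollifier n ε) (x - y)‖ := by
          have := (fderiv ℝ (mollifier n ε) (x - y)).le_opNorm (stdVec i)
          rwa [norm_stdVec, mul_one] at this
        have h2 : ‖φ y ((P.a y - P.a x) (stdVec i))‖ ≤ ‖φ y‖ * (L * ‖x - y‖) := by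
          refine ((φ y).le_opNorm _).trans ?_
          gcongr
          have := (P.a y - P.a x).le_opNorm (stdVec i)
          rw [norm_stdVec, mul_one] at this
          refine this.trans ?_
          rw [norm_sub_rev x y]
          exact hLip x y hx (by linarith)
        calc _ ≤ ‖fderiv ℝ (mollifier n ε) (x - y)‖ * (‖φ y‖ * (L * ‖x - y‖)) := by gcongr
          _ = _ := by ring)
  rw [hkint] at hb
  have := ENNReal.toReal_mono (ENNReal.mul_ne_top ENNReal.ofReal_ne_top hφ2.2.ne) hb
  rwa [ENNReal.toReal_mul, ENNReal.toReal_ofReal (integral_nonneg hκ0)] at this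

theorem _root_.HodgeWarped.mollify_radius {W : Type*} [NormedAddCommGroup W] [NormedSpace ℝ W]
    {ε R : ℝ} (hε : 0 < ε) (hε1 : ε ≤ 1) {h : E n → W}
    (hR : ∀ y, R < ‖y‖ → h y = 0) : ∀ x, R + 1 < ‖x‖ → mollify ε h x = 0 := fun x hx =>
  mollify_eq_zero hε hR (by linarith)

/-- The commutator of the operator with mollification is bounded from `H¹` to `L²`, uniformly in
the mollification parameter. -/
theorem exists_commutator_bound (P : ScalarOp n V) (R : ℝ) : ∃ C, 0 ≤ C ∧ ∀ ε, 0 < ε → ε ≤ 1 →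
    ∀ u : E n → V, IsTestFun u → (∀ y, R < ‖y‖ → u y = 0) →
    l2n (mollify ε (P.op u) - P.op (mollify ε u)) ≤ C * h1n u := by
  obtain ⟨C1, h10, hC1⟩ := P.friedrichs R
  obtain ⟨C2, h20, hC2⟩ := P.l2n_low_le (R + 1)
  obtain ⟨C3, h30, hC3⟩ := exists_bound_of_continuous (W := E n →L[ℝ] E n →L[ℝ] E n)
    (P.smooth_a.continuous_fderiv (by simp)) (R + 1)
  refine ⟨n * (C1 + C3) + 2 * C2, by positivity, fun ε hε hε1 u hu hR => ?_⟩
  have hli : LocallyIntegrable u volume := hu.1.continuous.locallyIntegrable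
  have hDu : IsTestFun (fderiv ℝ u) :=
    ⟨hu.1.fderiv_right (m := (⊤ : ℕ∞)) (by simp), hu.2.fderiv ℝ⟩
  have hJ : IsTestFun (mollify ε u) := mollify_isTestFun hε hli hR
  have hJR := mollify_radius hε hε1 hR
  have hDR : ∀ y, R < ‖y‖ → fderiv ℝ u y = 0 := fun y hy => fderiv_eq_zero_of_radius hR hy
  have hJD := mollify_fderiv (ε := ε) hu
  have hflT : ∀ i, IsTestFun (P.flux u i) := fun i =>
    ⟨flux_contDiff hu.1 i, hasCompactSupport_of_radius (flux_radius hR i)⟩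
  have hflD : ∀ i, Continuous fun y => fderiv ℝ (P.flux u i) y (stdVec i) := fun i =>
    ((hflT i).1.continuous_fderiv (by simp)).clm_apply continuous_const
  -- The two kinds of terms coming from the principal part.
  set K : Fin n → E n → V := fun i x =>
    fderiv ℝ (mollify ε (P.flux u i)) x (stdVec i)
      - fderiv ℝ (mollify ε (fderiv ℝ u)) x (stdVec i) (P.a x (stdVec i))
  set N : Fin n → E n → V := fun i x =>
    mollify ε (fderiv ℝ u) x (fderiv ℝ P.a x (stdVec i) (stdVec i))
  have hJDu : ContDiff ℝ (⊤ : ℕ∞) (mollify ε (fderiv ℝ u)) :=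
    mollify_contDiff hε hDu.1.continuous.locallyIntegrable
  have hKc : ∀ i, Continuous (K i) := fun i => by
    refine Continuous.sub ?_ ?_
    · exact ((mollify_contDiff hε (hflT i).1.continuous.locallyIntegrable).continuous_fderiv
        (by simp)).clm_apply continuous_const
    · exact ((hJDu.continuous_fderiv (by simp)).clm_apply continuous_const).clm_apply
        (P.smooth_a.continuous.clm_apply continuous_const)
  have hNc : ∀ i, Continuous (N i) := fun i =>
    hJDu.continuous.clm_apply (((P.smooth_a.continuous_fderiv (by simp)).clm_apply
      continuous_const).clm_apply continuous_const)
  have hKm : ∀ i, MemLp (K i) 2 volume := fun i => memLp_of_continuous (R := R + 1) (hKc i)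
    fun y hy => by
      simp only [K]
      rw [fderiv_eq_zero_of_radius (mollify_radius hε hε1 (flux_radius hR i)) hy,
        fderiv_eq_zero_of_radius (mollify_radius hε hε1 hDR) hy]
      simp
  have hNm : ∀ i, MemLp (N i) 2 volume := fun i => memLp_of_continuous (R := R + 1) (hNc i)
    fun y hy => by
      simp only [N]
      rw [mollify_radius hε hε1 hDR y hy]; simp
  have hlowm : MemLp (P.low u) 2 volume :=
    memLp_of_continuous (low_continuous hu.1) (low_radius hR)
  have hJlow : MemLp (mollify ε (P.low u)) 2 volume := memLp_mollify hε hlowm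
  have hlowJ : MemLp (P.low (mollify ε u)) 2 volume :=
    memLp_of_continuous (low_continuous hJ.1) (low_radius hJR)
  have hK : ∀ i, l2n (K i) ≤ C1 * l2n (fderiv ℝ u) := fun i =>
    hC1 ε hε hε1 (fderiv ℝ u) hDu.1.continuous hDR i
  have hN : ∀ i, l2n (N i) ≤ C3 * l2n (fderiv ℝ u) := fun i => by
    refine (l2n_le_of_norm_le (C := C3) h30 (memLp_mollify hε hDu.memLp) fun x => ?_).trans
      (mul_le_mul_of_nonneg_left (l2n_mollify_le hε hDu.memLp) h30)
    rcases le_or_gt ‖x‖ (R + 1) with hx | hx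
    · refine ((mollify ε (fderiv ℝ u) x).le_opNorm _).trans ?_
      rw [mul_comm]
      gcongr
      refine (ContinuousLinearMap.le_opNorm _ _).trans ?_
      rw [norm_stdVec, mul_one]
      refine (ContinuousLinearMap.le_opNorm _ _).trans ?_
      rw [norm_stdVec, mul_one]
      exact hC3 x hx
    · simp only [N]
      rw [mollify_radius hε hε1 hDR x hx]; simp
  -- The commutator is a sum of terms estimated separately: those of Friedrichs' lemma, those in
  -- which the coefficients are differentiated, and the lower order terms.
  have hrep : mollify ε (P.op u) - P.op (mollify ε u)
      = (∑ i, (N i - K i)) + (mollify ε (P.low u) - P.low (mollify ε u)) := by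
    funext x
    have e1 : mollify ε (P.op u) x = -(∑ i, fderiv ℝ (mollify ε (P.flux u i)) x (stdVec i))
        + mollify ε (P.low u) x := by
      rw [mollify_apply, mollify_apply]
      have : ∀ y, mollifier n ε (x - y) • P.op u y =
          -(∑ i, mollifier n ε (x - y) • fderiv ℝ (P.flux u i) y (stdVec i))
          + mollifier n ε (x - y) • P.low u y := fun y => by
        simp [op, smul_add, Finset.smul_sum]
      simp only [this]
      have hI : ∀ i, Integrable (fun y => mollifier n ε (x - y) •
          fderiv ℝ (P.flux u i) y (stdVec i)) volume := fun i =>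
        integrable_mollifier_smul hε (hflD i).locallyIntegrable x
      have hIs : Integrable (fun y => -∑ i, mollifier n ε (x - y) •
          fderiv ℝ (P.flux u i) y (stdVec i)) volume :=
        (integrable_finsetSum _ fun i _ => hI i).neg
      rw [integral_add hIs
        (integrable_mollifier_smul hε (low_continuous hu.1).locallyIntegrable x), integral_neg,
        integral_finsetSum _ fun i _ => hI i]
      congr 3
      funext i
      rw [mollify_fderiv (hflT i), mollify_apply, ContinuousLinearMap.integral_apply
        (integrable_mollifier_smul hε
          ((hflT i).1.continuous_fderiv (by simp)).locallyIntegrable x)]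
      rfl
    have e2 : ∀ i, fderiv ℝ (P.flux (mollify ε u) i) x (stdVec i)
        = fderiv ℝ (mollify ε (fderiv ℝ u)) x (stdVec i) (P.a x (stdVec i)) + N i x := by
      intro i
      have : P.flux (mollify ε u) i = fun y => mollify ε (fderiv ℝ u) y (P.a y (stdVec i)) := by
        funext y; simp only [flux, hJD]
      rw [this]
      have d1 : DifferentiableAt ℝ (mollify ε (fderiv ℝ u)) x :=
        (hJDu.differentiable (by simp)) x
      have d2 : DifferentiableAt ℝ P.a x := (P.smooth_a.differentiable (by simp)) x
      rw [fderiv_clm_apply d1 (d2.clm_apply (differentiableAt_const _)),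
        fderiv_clm_apply d2 (differentiableAt_const _)]
      simp [N, add_comm]
    simp only [Pi.sub_apply, Pi.add_apply, Finset.sum_apply, e1]
    simp only [op, e2, K, Finset.sum_sub_distrib, Finset.sum_add_distrib]
    abel
  rw [hrep]
  have i1 : l2n (P.low u) ≤ C2 * h1n u := hC2 u hu fun y hy => hR y (by linarith)
  have i2 : l2n (P.low (mollify ε u)) ≤ C2 * h1n (mollify ε u) := hC2 _ hJ hJR
  have i3 : h1n (mollify ε u) ≤ h1n u := by
    unfold h1n
    rw [hJD]
    exact add_le_add (l2n_mollify_le hε hDu.memLp) (l2n_mollify_le hε hu.memLp)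
  have i4 := l2n_mollify_le hε hlowm
  have i5 : l2n (fderiv ℝ u) ≤ h1n u := by unfold h1n; linarith [l2n_nonneg u]
  have m1 : MemLp (∑ i, (N i - K i)) 2 volume := memLp_finsetSum' _ fun i _ => (hNm i).sub (hKm i)
  have i6 : l2n (∑ i, (N i - K i)) ≤ ∑ _i : Fin n, (C1 + C3) * h1n u := by
    refine (l2n_sum_le _ fun i _ => (hNm i).sub (hKm i)).trans (Finset.sum_le_sum fun i _ => ?_)
    have := l2n_sub_le (hNm i) (hKm i)
    have := hK i
    have := hN i
    nlinarith
  have i7 := l2n_add_le m1 (hJlow.sub hlowJ)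
  have i8 := l2n_sub_le hJlow hlowJ
  simp only [Finset.sum_const, Finset.card_univ, Fintype.card_fin, nsmul_eq_mul] at i6
  have i9 := mul_le_mul_of_nonneg_left i3 h20
  linarith

end ScalarOp

/-! ### Weak commutator estimates and localization -/

theorem IsTestFun.sub {n : ℕ} {W : Type*} [NormedAddCommGroup W] [NormedSpace ℝ W]
    {f g : E n → W} (hf : IsTestFun f) (hg : IsTestFun g) : IsTestFun (f - g) :=
  ⟨hf.1.sub hg.1, hf.2.sub hg.2⟩

theorem IsTestFun.integrable {n : ℕ} {W : Type*} [NormedAddCommGroup W] [NormedSpace ℝ W]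
    {f : E n → W} (hf : IsTestFun f) : Integrable f volume :=
  hf.1.continuous.integrable_of_hasCompactSupport hf.2

theorem IsTestFun.smul {n : ℕ} {W : Type*} [NormedAddCommGroup W] [NormedSpace ℝ W]
    {χ : E n → ℝ} {f : E n → W} (hχ : ContDiff ℝ (⊤ : ℕ∞) χ) (hf : IsTestFun f) :
    IsTestFun (fun x => χ x • f x) :=
  ⟨hχ.smul hf.1, hf.2.smul_left⟩

namespace ScalarOp

variable {n : ℕ} {V : Type*} [NormedAddCommGroup V] [InnerProductSpace ℝ V]
  [FiniteDimensional ℝ V] {P : ScalarOp n V}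

theorem op_memLp {u : E n → V} (hu : IsTestFun u) : MemLp (P.op u) 2 volume := by
  obtain ⟨R, -, hR⟩ := exists_radius hu.2
  exact memLp_of_continuous (op_continuous hu.1) (op_radius hR)

theorem op_hasCompactSupport {u : E n → V} (hu : IsTestFun u) : HasCompactSupport (P.op u) := by
  obtain ⟨R, -, hR⟩ := exists_radius hu.2
  exact hasCompactSupport_of_radius (op_radius hR)

/-- For a symmetric operator, the commutator with mollification tends to `0` weakly, with a rate
controlled by the `H¹` norm of the test function. -/
theorem exists_commutator_small
    (hsymm : ∀ u h : E n → V, IsTestFun u → IsTestFun h →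
      ∫ x, ⟪P.op u x, h x⟫_ℝ = ∫ x, ⟪u x, P.op h x⟫_ℝ)
    {v : E n → V} (hv : MemLp v 2 volume) (R : ℝ) {s : ℝ} (hs : 0 < s) :
    ∃ ε₀, 0 < ε₀ ∧ ε₀ ≤ 1 ∧ ∀ ε, 0 < ε → ε ≤ ε₀ → ∀ u : E n → V, IsTestFun u →
      (∀ y, R < ‖y‖ → u y = 0) →
      |∫ x, ⟪v x, (mollify ε (P.op u) - P.op (mollify ε u)) x⟫_ℝ| ≤ s * h1n u := by
  obtain ⟨C, hC0, hC⟩ := P.exists_commutator_bound R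
  obtain ⟨D, hD0, hD⟩ := P.exists_form_bound R
  -- The commutators are uniformly bounded, so `v` may be replaced by a test function `w`; for `w`,
  -- symmetry moves the commutator to `w`, where it is small.
  obtain ⟨w, hw, hwv⟩ := exists_test_approx hv (s := s / (3 * (C + 1))) (by positivity)
  have hDw : IsTestFun (fderiv ℝ w) :=
    ⟨hw.1.fderiv_right (m := (⊤ : ℕ∞)) (by simp), hw.2.fderiv ℝ⟩
  set r := s / (3 * (2 * D + 1)) with hr
  have hr0 : 0 < r := by positivity
  obtain ⟨e1, he1, h1⟩ := exists_l2n_mollify_sub_le hw.memLp hr0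
  obtain ⟨e2, he2, h2⟩ := exists_l2n_mollify_sub_le hDw.memLp hr0
  obtain ⟨e3, he3, h3⟩ := exists_l2n_mollify_sub_le (P.op_memLp hw) (s := s / 3) (by positivity)
  refine ⟨min (min e1 e2) (min e3 1), by positivity,
    (min_le_right _ _).trans (min_le_right _ _), fun ε hε hε' u hu hR => ?_⟩
  have hε1 : ε ≤ 1 := hε'.trans ((min_le_right _ _).trans (min_le_right _ _))
  have k1 := h1 ε hε (hε'.trans ((min_le_left _ _).trans (min_le_left _ _)))
  have k2 := h2 ε hε (hε'.trans ((min_le_left _ _).trans (min_le_right _ _)))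
  have k3 := h3 ε hε (hε'.trans ((min_le_right _ _).trans (min_le_left _ _)))
  obtain ⟨Rw, -, hRw⟩ := exists_radius hw.2
  have hJu : IsTestFun (mollify ε u) := mollify_isTestFun hε hu.1.continuous.locallyIntegrable hR
  have hJw : IsTestFun (mollify ε w) := mollify_isTestFun hε hw.1.continuous.locallyIntegrable hRw
  set c := mollify ε (P.op u) - P.op (mollify ε u)
  have mJP : MemLp (mollify ε (P.op u)) 2 volume := memLp_mollify hε (op_memLp hu)
  have mPJ : MemLp (P.op (mollify ε u)) 2 volume := op_memLp hJu
  have hc : MemLp c 2 volume := mJP.sub mPJ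
  have split : ∫ x, ⟪v x, c x⟫_ℝ = (∫ x, ⟪(v - w) x, c x⟫_ℝ) + ∫ x, ⟪w x, c x⟫_ℝ := by
    rw [← integral_add (integrable_inner_of_memLp (hv.sub hw.memLp) hc)
      (integrable_inner_of_memLp hw.memLp hc)]
    refine integral_congr_ae (Eventually.of_forall fun x => ?_)
    simp [inner_sub_left]
  have b1 : |∫ x, ⟪(v - w) x, c x⟫_ℝ| ≤ s / (3 * (C + 1)) * (C * h1n u) :=
    (abs_integral_inner_le (hv.sub hw.memLp) hc).trans
      (mul_le_mul hwv (hC ε hε hε1 u hu hR) (l2n_nonneg _) (by positivity))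
  have eqw : ∫ x, ⟪w x, c x⟫_ℝ = (∫ x, ⟪P.op u x, (mollify ε w - w) x⟫_ℝ)
      - ∫ x, ⟪(mollify ε (P.op w) - P.op w) x, u x⟫_ℝ := by
    have a1 : ∫ x, ⟪w x, c x⟫_ℝ
        = (∫ x, ⟪w x, mollify ε (P.op u) x⟫_ℝ) - ∫ x, ⟪w x, P.op (mollify ε u) x⟫_ℝ := by
      rw [← integral_sub (integrable_inner_of_memLp hw.memLp mJP)
        (integrable_inner_of_memLp hw.memLp mPJ)]
      simp [c, inner_sub_right]
    have a2 : ∫ x, ⟪P.op u x, (mollify ε w - w) x⟫_ℝ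
        = (∫ x, ⟪P.op u x, mollify ε w x⟫_ℝ) - ∫ x, ⟪P.op u x, w x⟫_ℝ := by
      rw [← integral_sub (integrable_inner_of_memLp (op_memLp hu) hJw.memLp)
        (integrable_inner_of_memLp (op_memLp hu) hw.memLp)]
      simp [inner_sub_right]
    have a3 : ∫ x, ⟪(mollify ε (P.op w) - P.op w) x, u x⟫_ℝ
        = (∫ x, ⟪mollify ε (P.op w) x, u x⟫_ℝ) - ∫ x, ⟪P.op w x, u x⟫_ℝ := by
      rw [← integral_sub (integrable_inner_of_memLp (memLp_mollify hε (op_memLp hw)) hu.memLp)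
        (integrable_inner_of_memLp (op_memLp hw) hu.memLp)]
      simp [inner_sub_left]
    have a4 : ∫ x, ⟪mollify ε w x, P.op u x⟫_ℝ = ∫ x, ⟪w x, mollify ε (P.op u) x⟫_ℝ :=
      integral_inner_mollify hε hw.integrable (op_continuous hu.1) (op_hasCompactSupport hu)
    have a5 : ∫ x, ⟪mollify ε (P.op w) x, u x⟫_ℝ = ∫ x, ⟪P.op w x, mollify ε u x⟫_ℝ :=
      integral_inner_mollify hε
        ((op_continuous hw.1).integrable_of_hasCompactSupport (op_hasCompactSupport hw))
        hu.1.continuous hu.2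
    have a6 := hsymm w (mollify ε u) hw hJu
    have a7 := hsymm w u hw hu
    have a8 : ∫ x, ⟪P.op u x, mollify ε w x⟫_ℝ = ∫ x, ⟪mollify ε w x, P.op u x⟫_ℝ := by
      simp only [real_inner_comm]
    have a9 : ∫ x, ⟪P.op u x, w x⟫_ℝ = ∫ x, ⟪w x, P.op u x⟫_ℝ := by
      simp only [real_inner_comm]
    rw [a1, a2, a3, a8, a4, a5, a6, a9, a7]
    ring
  have b2 : |∫ x, ⟪P.op u x, (mollify ε w - w) x⟫_ℝ| ≤ D * h1n u * (2 * r) := by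
    refine (hD u _ hu (hJw.sub hw) hR).trans ?_
    have : h1n (mollify ε w - w) ≤ 2 * r := by
      unfold h1n
      have : fderiv ℝ (mollify ε w - w) = mollify ε (fderiv ℝ w) - fderiv ℝ w := by
        funext x
        rw [fderiv_sub ((hJw.1.differentiable (by simp)) x) ((hw.1.differentiable (by simp)) x),
          mollify_fderiv hw]
        rfl
      rw [this]
      linarith
    exact mul_le_mul_of_nonneg_left this (mul_nonneg hD0 (h1n_nonneg u))
  have hu1 : l2n u ≤ h1n u := by unfold h1n; linarith [l2n_nonneg (fderiv ℝ u)]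
  have b3 : |∫ x, ⟪(mollify ε (P.op w) - P.op w) x, u x⟫_ℝ| ≤ s / 3 * h1n u :=
    (abs_integral_inner_le ((memLp_mollify hε (op_memLp hw)).sub (op_memLp hw)) hu.memLp).trans
      (mul_le_mul k3 hu1 (l2n_nonneg _) (by positivity))
  have b4 := abs_add_le (∫ x, ⟪(v - w) x, c x⟫_ℝ) (∫ x, ⟪w x, c x⟫_ℝ)
  have b5 := abs_sub (∫ x, ⟪P.op u x, (mollify ε w - w) x⟫_ℝ)
    (∫ x, ⟪(mollify ε (P.op w) - P.op w) x, u x⟫_ℝ)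
  rw [← eqw] at b5
  rw [split]
  have hh := h1n_nonneg u
  have c1 : s / (3 * (C + 1)) * (C * h1n u) ≤ s / 3 * h1n u := by
    have : s / (3 * (C + 1)) * C ≤ s / 3 := by
      rw [div_mul_eq_mul_div, div_le_div_iff₀ (by positivity) (by positivity)]
      nlinarith
    nlinarith
  have c2 : D * h1n u * (2 * r) ≤ s / 3 * h1n u := by
    have : D * (2 * r) ≤ s / 3 := by
      rw [hr, ← mul_assoc, ← mul_div_assoc, div_le_div_iff₀ (by positivity) (by positivity)]
      nlinarith
    nlinarith
  linarith

/-- The localization identity `2 χ P (χ u) = P (χ² u) + χ² P u + 2 |dχ|² u`, in integrated form. -/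
theorem integral_op_cutoff
    (hsymm : ∀ u h : E n → V, IsTestFun u → IsTestFun h →
      ∫ x, ⟪P.op u x, h x⟫_ℝ = ∫ x, ⟪u x, P.op h x⟫_ℝ)
    {χ : E n → ℝ} (hχ : IsTestFun χ) {u : E n → V} (hu : IsTestFun u) :
    ∫ x, ⟪P.op (fun y => χ y • u y) x, χ x • u x⟫_ℝ
      = (∫ x, ⟪u x, P.op (fun y => χ y ^ 2 • u y) x⟫_ℝ) + ∫ x, P.gradSq χ x * ‖u x‖ ^ 2 := by
  have h1 : IsTestFun (fun y => χ y • u y) := hu.smul hχ.1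
  have h2 : IsTestFun (fun y => χ y ^ 2 • u y) := hu.smul (hχ.1.pow 2)
  have i1 := integral_op_inner (P := P) h1 h1
  have i2 := integral_op_inner (P := P) hu h2
  have i3 := integral_op_inner (P := P) h2 hu
  have i4 := hsymm u _ hu h2
  have i5 : ∫ x, ⟪P.op (fun y => χ y ^ 2 • u y) x, u x⟫_ℝ
      = ∫ x, ⟪u x, P.op (fun y => χ y ^ 2 • u y) x⟫_ℝ := by simp only [real_inner_comm]
  have cont : ∀ {f h : E n → V}, IsTestFun f → IsTestFun h →
      Integrable (P.formDensity f h) volume := by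
    intro f h hf hh
    refine Continuous.integrable_of_hasCompactSupport ?_ ?_
    · refine Continuous.add (continuous_finsetSum _ fun i _ => ?_) ?_
      · exact (flux_contDiff hf.1 i).continuous.inner
          ((hh.1.continuous_fderiv (by simp)).clm_apply continuous_const)
      · exact (low_continuous hf.1).inner hh.1.continuous
    · obtain ⟨R, -, hR⟩ := exists_radius hf.2
      exact hasCompactSupport_of_radius (R := R) fun y hy => by
        simp [formDensity, flux_radius hR _ y hy, low_radius hR y hy]
  -- The identity holds pointwise for the densities of the quadratic form, symmetrized in the two
  -- arguments.
  have hpt : ∀ x, P.formDensity (fun y => χ y • u y) (fun y => χ y • u y) x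
      = 2⁻¹ * P.formDensity u (fun y => χ y ^ 2 • u y) x
        + 2⁻¹ * P.formDensity (fun y => χ y ^ 2 • u y) u x + P.gradSq χ x * ‖u x‖ ^ 2 := by
    intro x
    have dχ : DifferentiableAt ℝ χ x := (hχ.1.differentiable (by simp)) x
    have du : DifferentiableAt ℝ u x := (hu.1.differentiable (by simp)) x
    have f1 : ∀ v, fderiv ℝ (fun y => χ y • u y) x v
        = χ x • fderiv ℝ u x v + fderiv ℝ χ x v • u x := fun v => by
      rw [fderiv_fun_smul dχ du]; simp
    have f2 : ∀ v, fderiv ℝ (fun y => χ y ^ 2 • u y) x v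
        = χ x ^ 2 • fderiv ℝ u x v + (2 * χ x * fderiv ℝ χ x v) • u x := fun v => by
      rw [fderiv_fun_smul (c := fun y => χ y ^ 2) (dχ.pow 2) du, fderiv_fun_pow _ dχ]; simp
    have g1 : fderiv ℝ (fun y => χ y • u y) x
        = χ x • fderiv ℝ u x + (fderiv ℝ χ x).smulRight (u x) := by
      ext v; rw [f1]; simp
    have g2 : fderiv ℝ (fun y => χ y ^ 2 • u y) x
        = χ x ^ 2 • fderiv ℝ u x + (2 * χ x) • (fderiv ℝ χ x).smulRight (u x) := by
      ext v; rw [f2]; simp [mul_smul]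
    have hi : ∀ i, ⟪fderiv ℝ (fun y => χ y • u y) x (P.a x (stdVec i)),
        fderiv ℝ (fun y => χ y • u y) x (stdVec i)⟫_ℝ
        = 2⁻¹ * ⟪fderiv ℝ u x (P.a x (stdVec i)),
            fderiv ℝ (fun y => χ y ^ 2 • u y) x (stdVec i)⟫_ℝ
          + 2⁻¹ * ⟪fderiv ℝ (fun y => χ y ^ 2 • u y) x (P.a x (stdVec i)),
            fderiv ℝ u x (stdVec i)⟫_ℝ
          + fderiv ℝ χ x (P.a x (stdVec i)) * fderiv ℝ χ x (stdVec i) * ‖u x‖ ^ 2 := fun i => by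
      rw [f1, f1, f2, f2]
      simp only [inner_add_left, inner_add_right, inner_smul_left,
        inner_smul_right, real_inner_self_eq_norm_sq, RCLike.conj_to_real]
      ring
    have hl : ⟪P.low (fun y => χ y • u y) x, χ x • u x⟫_ℝ
        = 2⁻¹ * ⟪P.low u x, χ x ^ 2 • u x⟫_ℝ
          + 2⁻¹ * ⟪P.low (fun y => χ y ^ 2 • u y) x, u x⟫_ℝ := by
      simp only [low]
      rw [g1, g2]
      simp only [map_add, map_smul, inner_add_left, inner_smul_left,
        inner_smul_right, RCLike.conj_to_real]
      ring
    simp only [formDensity, flux, gradSq, hi, hl, Finset.sum_add_distrib, ← Finset.mul_sum,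
      ← Finset.sum_mul]
    ring
  have ig : Integrable (fun x => P.gradSq χ x * ‖u x‖ ^ 2) volume := by
    refine Continuous.integrable_of_hasCompactSupport ?_ ?_
    · have c1 : Continuous (P.gradSq χ) := continuous_finsetSum _ fun i _ =>
        ((hχ.1.continuous_fderiv (by simp)).clm_apply
          (P.smooth_a.continuous.clm_apply continuous_const)).mul
        ((hχ.1.continuous_fderiv (by simp)).clm_apply continuous_const)
      exact c1.mul (hu.1.continuous.norm.pow 2)
    · obtain ⟨R, -, hR⟩ := exists_radius hu.2
      exact hasCompactSupport_of_radius (R := R) fun y hy => by simp [hR y hy]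
  rw [i1]
  simp only [hpt]
  have ia : Integrable (fun x => 2⁻¹ * P.formDensity u (fun y => χ y ^ 2 • u y) x
      + 2⁻¹ * P.formDensity (fun y => χ y ^ 2 • u y) u x) volume :=
    ((cont hu h2).const_mul _).add ((cont h2 hu).const_mul _)
  rw [integral_add ia ig, integral_add ((cont hu h2).const_mul _) ((cont h2 hu).const_mul _),
    integral_const_mul, integral_const_mul, ← i2, ← i3, i4, i5]
  ring

end ScalarOp

/-! ### Essential self-adjointness of operators with scalar principal part -/

theorem exists_h1n_smul_le {n : ℕ} {W : Type*} [NormedAddCommGroup W] [NormedSpace ℝ W]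
    {χ : E n → ℝ} (hχ : IsTestFun χ) : ∃ M, 0 ≤ M ∧ ∀ w : E n → W, IsTestFun w →
      h1n (fun x => χ x • w x) ≤ M * h1n w := by
  obtain ⟨C, hC⟩ := hχ.2.exists_bound_of_continuous hχ.1.continuous
  obtain ⟨D, hD⟩ := (hχ.2.fderiv ℝ).exists_bound_of_continuous
    (hχ.1.continuous_fderiv (by simp))
  have hC0 : 0 ≤ C := (norm_nonneg _).trans (hC 0)
  have hD0 : 0 ≤ D := (norm_nonneg _).trans (hD 0)
  refine ⟨C + D, by positivity, fun w hw => ?_⟩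
  set F : E n → (E n →L[ℝ] W) := fun x => χ x • fderiv ℝ w x
  set G : E n → (E n →L[ℝ] W) := fun x => (fderiv ℝ χ x).smulRight (w x)
  have hF : MemLp F 2 volume := hw.fderiv_memLp.of_le_mul
    (hχ.1.continuous.smul (hw.1.continuous_fderiv (by simp))).aestronglyMeasurable
    (Eventually.of_forall fun x => by
      rw [norm_smul]; exact mul_le_mul_of_nonneg_right (hC x) (norm_nonneg _))
  have hGb : ∀ x, ‖G x‖ ≤ D * ‖w x‖ := fun x => by
    rw [ContinuousLinearMap.norm_smulRight_apply]
    exact mul_le_mul_of_nonneg_right (hD x) (norm_nonneg _)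
  have hGc : Continuous G :=
    ((ContinuousLinearMap.smulRightL ℝ (E n) W).continuous.comp
      (hχ.1.continuous_fderiv (by simp))).clm_apply hw.1.continuous
  have hG : MemLp G 2 volume := hw.memLp.of_le_mul hGc.aestronglyMeasurable
    (Eventually.of_forall hGb)
  have e : fderiv ℝ (fun x => χ x • w x) = F + G := by
    funext x
    rw [fderiv_fun_smul ((hχ.1.differentiable (by simp)) x) ((hw.1.differentiable (by simp)) x)]
    rfl
  have i1 : l2n F ≤ C * l2n (fderiv ℝ w) := l2n_le_of_norm_le hC0 hw.fderiv_memLp fun x => by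
    rw [norm_smul]; exact mul_le_mul_of_nonneg_right (hC x) (norm_nonneg _)
  have i2 : l2n G ≤ D * l2n w := l2n_le_of_norm_le hD0 hw.memLp hGb
  have i3 : l2n (fun x => χ x • w x) ≤ C * l2n w := l2n_le_of_norm_le hC0 hw.memLp fun x => by
    rw [norm_smul]; exact mul_le_mul_of_nonneg_right (hC x) (norm_nonneg _)
  have i4 := l2n_add_le hF hG
  unfold h1n
  rw [e]
  nlinarith [l2n_nonneg (fderiv ℝ w), l2n_nonneg w]

namespace ScalarOp

variable {n : ℕ} {V : Type*} [NormedAddCommGroup V] [InnerProductSpace ℝ V]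
  [FiniteDimensional ℝ V] {P : ScalarOp n V}

/-- The localized estimate behind essential self-adjointness: a square integrable function
orthogonal to the range is small on every ball. -/
theorem l2n_indicator_le
    (hsymm : ∀ u h : E n → V, IsTestFun u → IsTestFun h →
      ∫ x, ⟪P.op u x, h x⟫_ℝ = ∫ x, ⟪u x, P.op h x⟫_ℝ)
    (hcoer : ∀ u : E n → V, IsTestFun u → ∫ x, ‖u x‖ ^ 2 ≤ ∫ x, ⟪P.op u x, u x⟫_ℝ)
    (hcut : ∀ R δ : ℝ, 0 < δ → ∃ χ : E n → ℝ, IsTestFun χ ∧ (∀ x, ‖x‖ ≤ R → χ x = 1) ∧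
      ∀ x, P.gradSq χ x ≤ δ)
    {v : E n → V} (hv : MemLp v 2 volume)
    (horth : ∀ u : E n → V, IsTestFun u → ∫ x, ⟪v x, P.op u x⟫_ℝ = 0) (R₀ : ℝ)
    {τ : ℝ} (hτ : 0 < τ) :
    l2n ((Metric.closedBall 0 R₀).indicator v) ≤ √(τ + 2 * τ * l2n v ^ 2) + τ := by
  obtain ⟨χ, hχ, hχ1, hχg⟩ := hcut R₀ τ hτ
  obtain ⟨R', -, hR'⟩ := exists_radius hχ.2
  set R := max R' R₀
  have hR : ∀ y, R < ‖y‖ → χ y = 0 := fun y hy => hR' y (lt_of_le_of_lt (le_max_left _ _) hy)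
  obtain ⟨M, hM0, hM⟩ := exists_h1n_smul_le (W := V) hχ
  obtain ⟨C, hC0, hC⟩ := P.garding R
  obtain ⟨B, hB⟩ := hχ.2.exists_bound_of_continuous hχ.1.continuous
  have hB0 : 0 ≤ B := (norm_nonneg _).trans (hB 0)
  -- The commutator of `P` with mollification, tested against `χ² u`, will be at most
  -- `s * h1n (χ² u)`. This is half of the energy `Q` of `χ u` plus `τ / 2` for this choice of `s`.
  set s := min (1 / (2 * (M + 1) * (C + 1))) (τ / (2 * (M + 1)))
  have hs : 0 < s := by positivity
  set v₁ := (Metric.closedBall (0 : E n) (R + 1)).indicator v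
  have hv1 : MemLp v₁ 2 volume := hv.indicator Metric.isClosed_closedBall.measurableSet
  have hv1R : ∀ y, R + 1 < ‖y‖ → v₁ y = 0 := fun y hy => by
    refine Set.indicator_of_notMem ?_ _
    rw [mem_closedBall_zero_iff]; linarith
  have hv1i : Integrable v₁ volume := by
    have : IntegrableOn v (Metric.closedBall (0 : E n) (R + 1)) volume :=
      (hv.locallyIntegrable (by norm_num)).integrableOn_isCompact (isCompact_closedBall _ _)
    exact this.integrable_indicator Metric.isClosed_closedBall.measurableSet
  obtain ⟨e1, he1, he11, h1⟩ := exists_commutator_small hsymm hv R hs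
  obtain ⟨e2, he2, h2⟩ := exists_l2n_mollify_sub_le hv1 (s := τ / (B + 1)) (by positivity)
  set ε := min e1 e2
  have hε : 0 < ε := by positivity
  have hε1 : ε ≤ 1 := (min_le_left _ _).trans he11
  set u := mollify ε v₁
  have hu : IsTestFun u := mollify_isTestFun hε hv1i.locallyIntegrable hv1R
  set ψ : E n → V := fun x => χ x ^ 2 • u x
  have hψ : IsTestFun ψ := hu.smul (hχ.1.pow 2)
  have hψR : ∀ y, R < ‖y‖ → ψ y = 0 := fun y hy => by simp [ψ, hR y hy]
  set w : E n → V := fun x => χ x • u x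
  have hw : IsTestFun w := hu.smul hχ.1
  have hwR : ∀ y, R < ‖y‖ → w y = 0 := fun y hy => by simp [w, hR y hy]
  -- The equation for `v`, mollified and tested against `χ² u`.
  have a1 : ∫ x, ⟪u x, P.op ψ x⟫_ℝ
      = ∫ x, ⟪v x, (mollify ε (P.op ψ) - P.op (mollify ε ψ)) x⟫_ℝ := by
    have b1 : ∫ x, ⟪u x, P.op ψ x⟫_ℝ = ∫ x, ⟪v₁ x, mollify ε (P.op ψ) x⟫_ℝ :=
      integral_inner_mollify hε hv1i (op_continuous hψ.1) (op_hasCompactSupport hψ)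
    have b2 : ∫ x, ⟪v₁ x, mollify ε (P.op ψ) x⟫_ℝ = ∫ x, ⟪v x, mollify ε (P.op ψ) x⟫_ℝ := by
      refine integral_congr_ae (Eventually.of_forall fun x => ?_)
      by_cases hx : x ∈ Metric.closedBall (0 : E n) (R + 1)
      · simp [v₁, Set.indicator_of_mem hx]
      · have : mollify ε (P.op ψ) x = 0 := mollify_radius hε hε1 (op_radius hψR) x (by
          rw [mem_closedBall_zero_iff, not_le] at hx; exact hx)
        simp [this]
    have hJψ : IsTestFun (mollify ε ψ) :=
      mollify_isTestFun hε hψ.1.continuous.locallyIntegrable hψR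
    have b3 : ∫ x, ⟪v x, (mollify ε (P.op ψ) - P.op (mollify ε ψ)) x⟫_ℝ
        = (∫ x, ⟪v x, mollify ε (P.op ψ) x⟫_ℝ) - ∫ x, ⟪v x, P.op (mollify ε ψ) x⟫_ℝ := by
      rw [← integral_sub (integrable_inner_of_memLp hv (memLp_mollify hε (op_memLp hψ)))
        (integrable_inner_of_memLp hv (op_memLp hJψ))]
      simp [inner_sub_right]
    rw [b3, horth _ hJψ, sub_zero, b1, b2]
  have a2 := h1 ε hε (min_le_left _ _) ψ hψ hψR
  rw [← a1] at a2
  have a3 := integral_op_cutoff hsymm hχ hu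
  set Q := ∫ x, ⟪P.op w x, χ x • u x⟫_ℝ with hQ
  have a4 : l2n w ^ 2 ≤ Q := by
    rw [l2n_sq hw.memLp]; exact hcoer w hw
  have a5 : ∫ x, P.gradSq χ x * ‖u x‖ ^ 2 ≤ τ * l2n u ^ 2 := by
    rw [l2n_sq hu.memLp, ← integral_const_mul]
    refine integral_mono_of_nonneg (Eventually.of_forall fun x => ?_)
      ((hu.memLp.integrable_norm_pow (by norm_num)).const_mul τ) (Eventually.of_forall fun x => ?_)
    · have : 0 ≤ P.gradSq χ x := by
        obtain ⟨l, hl, h⟩ := exists_form_lower_bound (V := ℝ) (P := ⟨P.a, 0, 0, P.smooth_a,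
          continuous_const, continuous_const, P.symm_a, P.pos_a⟩) ‖x‖
        have := h x le_rfl (fderiv ℝ χ x)
        simp only [RCLike.inner_apply, conj_trivial] at this
        refine le_trans (by positivity) (this.trans (le_of_eq ?_))
        exact Finset.sum_congr rfl fun i _ => mul_comm _ _
      positivity
    · exact mul_le_mul_of_nonneg_right (hχg x) (by positivity)
  have a6 : l2n u ≤ l2n v := (l2n_mollify_le hε hv1).trans (by
    have := l2n_le_of_norm_le (C := 1) zero_le_one hv (f := v₁) fun x => by
      rw [one_mul]; exact norm_indicator_le_norm_self _ _
    linarith)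
  have a7 : h1n ψ ≤ M * h1n w := by
    have := hM w hw
    have e : (fun x => χ x • w x) = ψ := by
      funext x; simp [w, ψ, smul_smul, sq]
    rwa [e] at this
  have hQ0 : 0 ≤ Q := le_trans (sq_nonneg _) a4
  have a8 : l2n (fderiv ℝ w) ^ 2 ≤ C * (Q + l2n w ^ 2) := hC w hw hwR hQ0
  -- Absorb the commutator into the energy `Q`.
  have a9 : h1n w ≤ (C + 1) * Q + 1 := by
    unfold h1n
    have := mul_le_mul_of_nonneg_left a4 hC0
    nlinarith [sq_nonneg (l2n (fderiv ℝ w) - 1), sq_nonneg (l2n w - 1)]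
  have a10 : s * h1n ψ ≤ Q / 2 + τ / 2 := by
    have s1 : s * (2 * (M + 1) * (C + 1)) ≤ 1 := by
      have := min_le_left (1 / (2 * (M + 1) * (C + 1))) (τ / (2 * (M + 1)))
      rwa [← le_div_iff₀ (by positivity)]
    have s2 : s * (2 * (M + 1)) ≤ τ := by
      have := min_le_right (1 / (2 * (M + 1) * (C + 1))) (τ / (2 * (M + 1)))
      rwa [← le_div_iff₀ (by positivity)]
    calc s * h1n ψ ≤ s * ((M + 1) * ((C + 1) * Q + 1)) := by
          refine mul_le_mul_of_nonneg_left (a7.trans ?_) hs.le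
          have := h1n_nonneg w
          exact mul_le_mul (by linarith) a9 this (by positivity)
      _ = (s * (2 * (M + 1) * (C + 1))) * (Q / 2) + s * (2 * (M + 1)) / 2 := by ring
      _ ≤ 1 * (Q / 2) + τ / 2 := by gcongr
      _ = _ := by ring
  have a11 : Q ≤ τ + 2 * τ * l2n v ^ 2 := by
    have b1 := (abs_le.1 a2).2
    have b2 : l2n u ^ 2 ≤ l2n v ^ 2 := pow_le_pow_left₀ (l2n_nonneg _) a6 2
    have b3 := mul_le_mul_of_nonneg_left b2 hτ.le
    rw [a3] at hQ
    linarith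
  have a12 : l2n w ≤ √(τ + 2 * τ * l2n v ^ 2) := Real.le_sqrt_of_sq_le (a4.trans a11)
  -- Compare with `v` on the ball, where `χ = 1`.
  set d : E n → V := fun x => χ x • (v₁ - u) x
  have hd : MemLp d 2 volume := (hv1.sub hu.memLp).of_le_mul
    (hχ.1.continuous.aestronglyMeasurable.smul (hv1.sub hu.memLp).1)
    (Eventually.of_forall fun x => by
      rw [norm_smul]; exact mul_le_mul_of_nonneg_right (hB x) (norm_nonneg _))
  have a13 : l2n d ≤ τ := by
    have b1 : l2n d ≤ B * l2n (v₁ - u) := l2n_le_of_norm_le hB0 (hv1.sub hu.memLp) fun x => by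
      rw [norm_smul]; exact mul_le_mul_of_nonneg_right (hB x) (norm_nonneg _)
    have b2 : l2n (v₁ - u) ≤ τ / (B + 1) := by
      rw [l2n_sub_comm]; exact h2 ε hε (min_le_right _ _)
    calc l2n d ≤ B * (τ / (B + 1)) := b1.trans (mul_le_mul_of_nonneg_left b2 hB0)
      _ ≤ τ := by
        rw [← mul_div_assoc, div_le_iff₀ (by positivity)]; nlinarith
  have a14 : l2n ((Metric.closedBall 0 R₀).indicator v) ≤ 1 * l2n (w + d) := by
    refine l2n_le_of_norm_le zero_le_one (hw.memLp.add hd) fun x => ?_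
    by_cases hx : x ∈ Metric.closedBall (0 : E n) R₀
    · have hx' := mem_closedBall_zero_iff.1 hx
      have hx2 : x ∈ Metric.closedBall (0 : E n) (R + 1) := by
        rw [mem_closedBall_zero_iff]
        have := le_max_right R' R₀
        linarith
      rw [Set.indicator_of_mem hx]
      simp [w, d, hχ1 x hx', v₁, Set.indicator_of_mem hx2]
    · rw [Set.indicator_of_notMem hx]; simp
  have := l2n_add_le hw.memLp hd
  linarith

/-- **Essential self-adjointness**, in the form: the range of a symmetric operator with scalar
principal part and bounded below by `1`, on a space which is complete (there are cutoff functions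
with small gradient), is dense in `L²`. -/
theorem ae_eq_zero_of_orthogonal
    (hsymm : ∀ u h : E n → V, IsTestFun u → IsTestFun h →
      ∫ x, ⟪P.op u x, h x⟫_ℝ = ∫ x, ⟪u x, P.op h x⟫_ℝ)
    (hcoer : ∀ u : E n → V, IsTestFun u → ∫ x, ‖u x‖ ^ 2 ≤ ∫ x, ⟪P.op u x, u x⟫_ℝ)
    (hcut : ∀ R δ : ℝ, 0 < δ → ∃ χ : E n → ℝ, IsTestFun χ ∧ (∀ x, ‖x‖ ≤ R → χ x = 1) ∧
      ∀ x, P.gradSq χ x ≤ δ)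
    {v : E n → V} (hv : MemLp v 2 volume)
    (horth : ∀ u : E n → V, IsTestFun u → ∫ x, ⟪v x, P.op u x⟫_ℝ = 0) : v =ᵐ[volume] 0 := by
  have h0 : ∀ k : ℕ, (Metric.closedBall (0 : E n) k).indicator v =ᵐ[volume] 0 := by
    intro k
    have hm : MemLp ((Metric.closedBall (0 : E n) k).indicator v) 2 volume :=
      hv.indicator Metric.isClosed_closedBall.measurableSet
    have h1 : l2n ((Metric.closedBall (0 : E n) k).indicator v) ≤ 0 := by
      -- Let the gradients of the cutoff functions tend to `0`.
      have hlim : Tendsto (fun τ : ℝ => √(τ + 2 * τ * l2n v ^ 2) + τ) (𝓝[>] 0) (𝓝 0) := by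
        have : Continuous (fun τ : ℝ => √(τ + 2 * τ * l2n v ^ 2) + τ) := by fun_prop
        have h := this.tendsto 0
        simp only [mul_zero, zero_mul, add_zero, Real.sqrt_zero] at h
        exact h.mono_left nhdsWithin_le_nhds
      refine ge_of_tendsto hlim ?_
      filter_upwards [self_mem_nhdsWithin] with τ hτ
      exact l2n_indicator_le hsymm hcoer hcut hv horth k hτ
    have h2 : eLpNorm ((Metric.closedBall (0 : E n) k).indicator v) 2 volume = 0 := by
      have h3 := le_antisymm h1 (l2n_nonneg _)
      exact (ENNReal.toReal_eq_zero_iff _).1 h3 |>.resolve_right hm.2.ne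
    exact (eLpNorm_eq_zero_iff hm.1 (by norm_num)).1 h2
  filter_upwards [ae_all_iff.2 h0] with x hx
  obtain ⟨k, hk⟩ := exists_nat_ge ‖x‖
  have := hx k
  rwa [Set.indicator_of_mem (mem_closedBall_zero_iff.2 hk)] at this

end ScalarOp

/-! ### The Euclidean scalar product of covectors -/

/-- The space of `p`-covectors. -/
abbrev Cov (n p : ℕ) : Type := E n [⋀^Fin p]→L[ℝ] ℝ

section Covectors

variable {n p : ℕ}

theorem Cov.ext_basis {α β : Cov n p}
    (h : ∀ I : Fin p → Fin n, α (fun k => stdVec (I k)) = β (fun k => stdVec (I k))) : α = β := by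
  have : α.toMultilinearMap = β.toMultilinearMap :=
    Module.Basis.ext_multilinear (fun _ => (EuclideanSpace.basisFun (Fin n) ℝ).toBasis) (by
      intro v; simpa using h v)
  ext v
  exact congrArg (fun f => f v) this

/-- The normalized coordinates of covectors, as a linear map. -/
def coordLin (n p : ℕ) : Cov n p →ₗ[ℝ] EuclideanSpace ℝ (Fin p → Fin n) where
  toFun α := WithLp.toLp 2 fun I => (√(p.factorial : ℝ))⁻¹ * α (fun k => stdVec (I k))
  map_add' α β := by ext I; simp [mul_add]
  map_smul' c α := by ext I; simp [mul_left_comm]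

theorem coordLin_apply (α : Cov n p) (I : Fin p → Fin n) :
    coordLin n p α I = (√(p.factorial : ℝ))⁻¹ * α (fun k => stdVec (I k)) := rfl

theorem coordLin_injective : Function.Injective (coordLin n p) := by
  intro α β h
  refine Cov.ext_basis fun I => ?_
  have := congrArg (fun w : EuclideanSpace ℝ (Fin p → Fin n) => w I) h
  simp only [coordLin_apply] at this
  exact mul_left_cancel₀ (inv_ne_zero (Real.sqrt_ne_zero'.2 (by positivity))) this

instance : FiniteDimensional ℝ (Cov n p) := Module.Finite.of_injective _ coordLin_injective

/-- The space of normalized coordinates of covectors, with its Euclidean scalar product. -/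
def CoordSpace (n p : ℕ) : Type := LinearMap.range (coordLin n p)

instance : NormedAddCommGroup (CoordSpace n p) :=
  inferInstanceAs (NormedAddCommGroup (LinearMap.range (coordLin n p)))

instance : InnerProductSpace ℝ (CoordSpace n p) :=
  inferInstanceAs (InnerProductSpace ℝ (LinearMap.range (coordLin n p)))

instance : FiniteDimensional ℝ (CoordSpace n p) :=
  inferInstanceAs (FiniteDimensional ℝ (LinearMap.range (coordLin n p)))

/-- The normalized coordinates of covectors, as an isomorphism onto a Euclidean space. -/
def coord (n p : ℕ) : Cov n p ≃L[ℝ] CoordSpace n p :=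
  LinearEquiv.toContinuousLinearEquiv (F := CoordSpace n p)
    (LinearEquiv.ofInjective (coordLin n p) coordLin_injective)

/-- The Euclidean scalar product of covectors, as a continuous bilinear map. -/
def flatInner (n p : ℕ) : Cov n p →L[ℝ] Cov n p →L[ℝ] ℝ :=
  (innerSL ℝ).bilinearComp (coord n p : Cov n p →L[ℝ] CoordSpace n p)
    (coord n p : Cov n p →L[ℝ] CoordSpace n p)

theorem flatInner_eq_inner (α β : Cov n p) :
    flatInner n p α β = ⟪coord n p α, coord n p β⟫_ℝ := rfl

theorem flatInner_apply (α β : Cov n p) :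
    flatInner n p α β = (p.factorial : ℝ)⁻¹ * ∑ I : Fin p → Fin n,
      α (fun k => stdVec (I k)) * β (fun k => stdVec (I k)) := by
  have : flatInner n p α β = ⟪coordLin n p α, coordLin n p β⟫_ℝ := rfl
  rw [this, PiLp.inner_apply, Finset.mul_sum]
  refine Finset.sum_congr rfl fun I _ => ?_
  simp only [coordLin_apply, RCLike.inner_apply, conj_trivial]
  have h : (√(p.factorial : ℝ))⁻¹ * (√(p.factorial : ℝ))⁻¹ = (p.factorial : ℝ)⁻¹ := by
    rw [← mul_inv, Real.mul_self_sqrt (by positivity)]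
  rw [← h]; ring

theorem flatInner_comm (α β : Cov n p) : flatInner n p α β = flatInner n p β α := by
  rw [flatInner_eq_inner, flatInner_eq_inner, real_inner_comm]

theorem flatInner_self (α : Cov n p) : flatInner n p α α = ‖coord n p α‖ ^ 2 := by
  rw [flatInner_eq_inner, real_inner_self_eq_norm_sq]

/-- A left inverse of the coordinates, used to test regularity on coordinates. -/
theorem exists_coord_leftInverse :
    ∃ L : EuclideanSpace ℝ (Fin p → Fin n) →L[ℝ] Cov n p, ∀ α, L (coordLin n p α) = α := by
  obtain ⟨g, hg⟩ := (coordLin n p).exists_leftInverse_of_injective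
    (LinearMap.ker_eq_bot.2 coordLin_injective)
  exact ⟨LinearMap.toContinuousLinearMap g, fun α => by
    simpa using congrArg (fun f => f α) hg⟩

/-- Regularity of a field of covectors can be tested on the coordinates. -/
theorem contDiffOn_cov {W : Type*} [NormedAddCommGroup W] [NormedSpace ℝ W] {k : ℕ∞}
    {s : Set W} {F : W → Cov n p}
    (h : ∀ I : Fin p → Fin n, ContDiffOn ℝ k (fun x => F x (fun k => stdVec (I k))) s) :
    ContDiffOn ℝ k F s := by
  obtain ⟨L, hL⟩ := exists_coord_leftInverse (n := n) (p := p)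
  have : F = fun x => L (coordLin n p (F x)) := funext fun x => (hL _).symm
  rw [this]
  refine L.contDiff.comp_contDiffOn (contDiffOn_euclidean.2 fun I => ?_)
  exact contDiffOn_const.mul (h I)

/-- Pullback of covectors, as a continuous linear map. -/
abbrev pull (p : ℕ) (T : E n →L[ℝ] E n) : Cov n p →L[ℝ] Cov n p :=
  ContinuousAlternatingMap.compContinuousLinearMapCLM T

theorem pull_apply (T : E n →L[ℝ] E n) (α : Cov n p) (v : Fin p → E n) :
    pull p T α v = α (fun k => T (v k)) := rfl

theorem pull_pull (S T : E n →L[ℝ] E n) (α : Cov n p) :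
    pull p S (pull p T α) = pull p (T ∘L S) α := rfl

theorem pull_id (α : Cov n p) : pull p (ContinuousLinearMap.id ℝ (E n)) α = α := rfl

theorem contDiffOn_pull {W : Type*} [NormedAddCommGroup W] [NormedSpace ℝ W] {k : ℕ∞}
    {s : Set W} {T : W → E n →L[ℝ] E n} (hT : ContDiffOn ℝ k T s) :
    ContDiffOn ℝ k (fun x => pull p (T x)) s := by
  refine contDiffOn_clm_apply.2 fun α => contDiffOn_cov fun I => ?_
  have h : ContDiffOn ℝ k (fun x => fun i : Fin p => T x (stdVec (I i))) s :=
    contDiffOn_pi.2 fun i => hT.clm_apply contDiffOn_const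
  exact (α.toContinuousMultilinearMap.contDiff.of_le le_top).comp_contDiffOn h

theorem Cov.apply_eq_sum (α : Cov n p) (v : Fin p → E n) :
    α v = ∑ J : Fin p → Fin n, (∏ k, v k (J k)) * α (fun k => stdVec (J k)) := by
  have hv : v = fun k => ∑ j : Fin n, v k j • (stdVec j : E n) := by
    funext k
    conv_lhs => rw [← (EuclideanSpace.basisFun (Fin n) ℝ).sum_repr (v k)]
    rfl
  have := α.toMultilinearMap.map_sum (fun k j => v k j • (stdVec j : E n))
  conv_lhs => rw [hv]
  refine this.trans (Finset.sum_congr rfl fun J _ => ?_)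
  exact (α.toMultilinearMap.map_smul_univ (fun k => v k (J k)) fun k => stdVec (J k))

theorem apply_coord_eq_inner (v : E n) (j : Fin n) : v j = ⟪(stdVec j : E n), v⟫_ℝ := by
  simp [stdVec, EuclideanSpace.basisFun_apply, EuclideanSpace.inner_single_left]

/-- The adjoint of a pullback is the pullback by the adjoint. -/
theorem flatInner_pull_left {S S' : E n →L[ℝ] E n} (hS : ∀ u v, ⟪S u, v⟫_ℝ = ⟪u, S' v⟫_ℝ)
    (α β : Cov n p) : flatInner n p (pull p S α) β = flatInner n p α (pull p S' β) := by
  rw [flatInner_apply, flatInner_apply]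
  congr 1
  simp only [pull_apply]
  have h1 : ∀ I : Fin p → Fin n, α (fun k => S (stdVec (I k))) * β (fun k => stdVec (I k)) =
      ∑ J : Fin p → Fin n, (∏ k, ⟪(stdVec (J k) : E n), S (stdVec (I k))⟫_ℝ) *
        α (fun k => stdVec (J k)) * β (fun k => stdVec (I k)) := fun I => by
    rw [Cov.apply_eq_sum α, Finset.sum_mul]
    simp only [apply_coord_eq_inner]
  have h2 : ∀ J : Fin p → Fin n, α (fun k => stdVec (J k)) * β (fun k => S' (stdVec (J k))) =
      ∑ I : Fin p → Fin n, (∏ k, ⟪(stdVec (J k) : E n), S (stdVec (I k))⟫_ℝ) *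
        α (fun k => stdVec (J k)) * β (fun k => stdVec (I k)) := fun J => by
    rw [Cov.apply_eq_sum β, Finset.mul_sum]
    refine Finset.sum_congr rfl fun I _ => ?_
    have : ∀ k, S' (stdVec (J k)) (I k) = ⟪(stdVec (J k) : E n), S (stdVec (I k))⟫_ℝ := fun k => by
      rw [apply_coord_eq_inner, ← hS, real_inner_comm]
    simp only [this]; ring
  rw [Finset.sum_congr rfl fun I _ => h1 I, Finset.sum_congr rfl fun J _ => h2 J,
    Finset.sum_comm]

/-- The adjoint of the alternation is the interior product. -/
theorem flatInner_alternatize (L : E n →L[ℝ] Cov n p) (B : Cov n (p + 1)) :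
    flatInner n (p + 1) (ContinuousAlternatingMap.alternatizeUncurryFin L) B =
      ∑ j, flatInner n p (L (stdVec j)) (B.curryLeft (stdVec j)) := by
  have key : ∀ i : Fin (p + 1),
      ∑ I : Fin (p + 1) → Fin n, ((-1 : ℝ) ^ (i : ℕ) * L (stdVec (I i))
        (fun k => stdVec (i.removeNth I k))) * B (fun k => stdVec (I k)) =
      ∑ j, ∑ J : Fin p → Fin n, L (stdVec j) (fun k => stdVec (J k)) *
        B.curryLeft (stdVec j) (fun k => stdVec (J k)) := by
    intro i
    rw [← Finset.sum_product', ← (Fin.insertNthEquiv (fun _ => Fin n) i).sum_comp]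
    refine Finset.sum_congr rfl fun x _ => ?_
    obtain ⟨j, J⟩ := x
    have e1 : (Fin.insertNthEquiv (fun _ => Fin n) i) (j, J) = i.insertNth j J := rfl
    have e2 : (fun k => (stdVec ((i.insertNth j J : Fin (p + 1) → Fin n) k) : E n)) =
        i.insertNth (stdVec j) (fun k => stdVec (J k)) := by
      funext k
      refine Fin.succAboveCases i ?_ (fun k => ?_) k <;> simp
    rw [e1, e2, ContinuousAlternatingMap.map_insertNth]
    simp only [Fin.insertNth_apply_same, Fin.removeNth_insertNth,
      ContinuousAlternatingMap.curryLeft_apply_apply]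
    rcases neg_one_pow_eq_or ℝ (i : ℕ) with h | h <;>
    rcases neg_one_pow_eq_or ℤ (i : ℕ) with h' | h' <;> simp_all
    all_goals
      rcases Nat.even_or_odd (i : ℕ) with h2 | h2 <;>
      simp [h2.neg_one_pow] at h h'
      try norm_num at h
  rw [flatInner_apply]
  have h1 : ∀ I : Fin (p + 1) → Fin n,
      ContinuousAlternatingMap.alternatizeUncurryFin L (fun k => stdVec (I k)) *
        B (fun k => stdVec (I k)) =
      ∑ i : Fin (p + 1), ((-1 : ℝ) ^ (i : ℕ) * L (stdVec (I i))
        (fun k => stdVec (i.removeNth I k))) * B (fun k => stdVec (I k)) := fun I => by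
    rw [ContinuousAlternatingMap.alternatizeUncurryFin_apply, Finset.sum_mul]
    refine Finset.sum_congr rfl fun i _ => ?_
    rw [zsmul_eq_mul]
    push_cast
    rfl
  rw [Finset.sum_congr rfl fun I _ => h1 I, Finset.sum_comm, Finset.sum_congr rfl fun i _ => key i]
  simp only [Finset.sum_const, Finset.card_univ, Fintype.card_fin, nsmul_eq_mul, flatInner_apply,
    ← Finset.mul_sum]
  rw [Nat.factorial_succ]
  push_cast
  field_simp

/-- The interior product of an alternation. -/
theorem curryLeft_alternatize (L : E n →L[ℝ] Cov n (p + 1)) (v : E n) :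
    (ContinuousAlternatingMap.alternatizeUncurryFin L).curryLeft v =
      L v - ContinuousAlternatingMap.alternatizeUncurryFin
        (((ContinuousAlternatingMap.curryLeftLI (𝕜 := ℝ) (E := E n) (F := ℝ) (n := p)).toContinuousLinearMap.flip v) ∘L L) := by
  ext w
  have h : ∀ k : Fin (p + 1), k.succ.removeNth (Matrix.vecCons v w) =
      Matrix.vecCons v (k.removeNth w) := fun k => by
    funext i
    refine Fin.cases ?_ (fun i => ?_) i <;> simp [Fin.removeNth]
  simp only [ContinuousAlternatingMap.curryLeft_apply_apply,
    ContinuousAlternatingMap.alternatizeUncurryFin_apply, ContinuousAlternatingMap.sub_apply]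
  rw [Fin.sum_univ_succ, sub_eq_add_neg, ← Finset.sum_neg_distrib]
  congr 1
  · simp
  · refine Finset.sum_congr rfl fun k _ => ?_
    rw [h]
    simp [pow_succ]

theorem curryLeft_alternatize_zero (L : E n →L[ℝ] Cov n 0) (v : E n) :
    (ContinuousAlternatingMap.alternatizeUncurryFin L).curryLeft v = L v := by
  ext w
  simp [ContinuousAlternatingMap.alternatizeUncurryFin_apply]

end Covectors

/-! ### Green's formula -/

/-- A smooth metric on the open set `U`, with the positive square root `S` of its matrix and the
inverse `T` of that root. Pulling back by `T` turns the metric into the Euclidean one. -/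
structure MetricRoot {n : ℕ} (G : MetricField n) (U : Set (E n)) where
  /-- the inverse square root of the metric -/
  T : E n → E n →L[ℝ] E n
  /-- the square root of the metric -/
  S : E n → E n →L[ℝ] E n
  isOpen : IsOpen U
  smooth_T : ContDiffOn ℝ (⊤ : ℕ∞) T U
  smooth_S : ContDiffOn ℝ (⊤ : ℕ∞) S U
  smooth_vol : ContDiffOn ℝ (⊤ : ℕ∞) (volDensity G) U
  vol_pos : ∀ x ∈ U, 0 < volDensity G x
  symm_T : ∀ x ∈ U, ∀ u v, ⟪T x u, v⟫_ℝ = ⟪u, T x v⟫_ℝ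
  symm_S : ∀ x ∈ U, ∀ u v, ⟪S x u, v⟫_ℝ = ⟪u, S x v⟫_ℝ
  T_comp_S : ∀ x ∈ U, T x ∘L S x = ContinuousLinearMap.id ℝ (E n)
  S_comp_T : ∀ x ∈ U, S x ∘L T x = ContinuousLinearMap.id ℝ (E n)
  sq_S : ∀ x ∈ U, G x = S x ∘L S x

@[simp]
theorem zero_compContinuousLinearMap {n p : ℕ} (T : E n →L[ℝ] E n) :
    (0 : Cov n p).compContinuousLinearMap T = 0 := rfl

theorem alternatize_zero {n p : ℕ} :
    ContinuousAlternatingMap.alternatizeUncurryFin (0 : E n →L[ℝ] Cov n p) = 0 :=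
  map_zero (ContinuousAlternatingMap.alternatizeUncurryFinCLM ℝ (E n) ℝ)

/-- The interior product with a vector. -/
def contr {n : ℕ} (p : ℕ) : E n →L[ℝ] Cov n (p + 1) →L[ℝ] Cov n p :=
  (ContinuousAlternatingMap.curryLeftLI (𝕜 := ℝ) (E := E n) (F := ℝ)
    (n := p)).toContinuousLinearMap.flip

theorem contr_apply {n p : ℕ} (v : E n) (α : Cov n (p + 1)) : contr p v α = α.curryLeft v := rfl

section Products

variable {n : ℕ} {X Y Z : Type*} [NormedAddCommGroup X] [NormedSpace ℝ X] [NormedAddCommGroup Y]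
  [NormedSpace ℝ Y] [NormedAddCommGroup Z] [NormedSpace ℝ Z] (b : X →L[ℝ] Y →L[ℝ] Z)
  {U : Set (E n)} {u : E n → X} {w : E n → Y}

theorem hasCompactSupport_bilin (hu : HasCompactSupport u) :
    HasCompactSupport fun x => b (u x) (w x) :=
  hu.mono fun x hx => by
    contrapose! hx
    simp only [Function.mem_support, not_not] at hx ⊢
    simp [hx]

theorem eventually_eq_zero_bilin {x : E n} (hx : x ∉ tsupport u) :
    (fun x => b (u x) (w x)) =ᶠ[𝓝 x] fun _ => 0 := by
  filter_upwards [notMem_tsupport_iff_eventuallyEq.1 hx] with y hy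
  simp [hy]

theorem continuous_bilin (hU : IsOpen U) (hu : Continuous u) (hs : tsupport u ⊆ U)
    (hw : ContinuousOn w U) : Continuous fun x => b (u x) (w x) := by
  refine continuous_iff_continuousAt.2 fun x => ?_
  by_cases hx : x ∈ U
  · exact (b.continuous.continuousAt.comp hu.continuousAt).clm_apply
      (hw.continuousAt (hU.mem_nhds hx))
  · exact (eventually_eq_zero_bilin b fun h => hx (hs h)).continuousAt

theorem contDiff_bilin (hU : IsOpen U) {k : ℕ∞} (hu : ContDiff ℝ k u) (hs : tsupport u ⊆ U)
    (hw : ContDiffOn ℝ k w U) : ContDiff ℝ k fun x => b (u x) (w x) := by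
  refine contDiff_iff_contDiffAt.2 fun x => ?_
  by_cases hx : x ∈ U
  · exact (b.contDiff.contDiffAt.comp x hu.contDiffAt).clm_apply
      (hw.contDiffAt (hU.mem_nhds hx))
  · exact contDiffAt_const.congr_of_eventuallyEq (eventually_eq_zero_bilin b fun h => hx (hs h))

end Products

theorem integral_fderiv_eq_zero {n : ℕ} {h : E n → ℝ} (hh : ContDiff ℝ (⊤ : ℕ∞) h)
    (hc : HasCompactSupport h) (v : E n) : ∫ x, fderiv ℝ h x v = 0 := by
  have hD : Integrable fun x => fderiv ℝ h x v :=
    ((hh.continuous_fderiv (by simp)).clm_apply continuous_const).integrable_of_hasCompactSupport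
      (hc.fderiv_apply (𝕜 := ℝ) v)
  have := integral_bilinear_fderiv_right_eq_neg_left_of_integrable (μ := (volume : Measure (E n)))
    (B := ContinuousLinearMap.mul ℝ ℝ) (f := fun _ : E n => (1 : ℝ)) (g := h) (v := v)
    (by simp) (by simpa using hD)
    (by simpa using hh.continuous.integrable_of_hasCompactSupport hc)
    (fun _ _ => differentiableAt_const _) (fun x _ => hh.differentiable (by simp) x)
  simpa using this

theorem contDiffOn_extDeriv {n p : ℕ} {U : Set (E n)} (hU : IsOpen U) {ω : Form n p}
    (hω : ContDiffOn ℝ (⊤ : ℕ∞) ω U) : ContDiffOn ℝ (⊤ : ℕ∞) (extDeriv ω) U :=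
  (ContinuousAlternatingMap.alternatizeUncurryFinCLM ℝ (E n) ℝ).contDiff.comp_contDiffOn
    (hω.fderiv_of_isOpen hU (by simp))

theorem tsupport_extDeriv {n p : ℕ} (ω : Form n p) : tsupport (extDeriv ω) ⊆ tsupport ω :=
  closure_minimal (fun x hx => by
    by_contra h
    refine hx ?_
    have h1 := notMem_tsupport_iff_eventuallyEq.1 h
    rw [h1.extDeriv_eq]
    simp [extDeriv, alternatize_zero]) (isClosed_tsupport _)

theorem IsTestForm.extDeriv {n p : ℕ} {ω : Form n p} (h : IsTestForm ω) :
    IsTestForm (extDeriv ω) :=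
  ⟨contDiffOn_univ.1 (contDiffOn_extDeriv isOpen_univ h.1.contDiffOn),
    h.2.of_isClosed_subset (isClosed_tsupport _) (tsupport_extDeriv ω)⟩

namespace MetricRoot

variable {n p : ℕ} {G : MetricField n} {U : Set (E n)} (M : MetricRoot G U)
include M

theorem coMetric_eq {x : E n} (hx : x ∈ U) : coMetric G x = M.T x ∘L M.T x := by
  have h1 := M.T_comp_S x hx
  have h2 := M.S_comp_T x hx
  have e1 : ∀ v, M.T x (M.S x v) = v := fun v => congrArg (fun f => f v) h1
  have e2 : ∀ v, M.S x (M.T x v) = v := fun v => congrArg (fun f => f v) h2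
  rw [coMetric, M.sq_S x hx]
  refine ContinuousLinearMap.inverse_eq ?_ ?_ <;> ext v : 1 <;> simp [e1, e2]

theorem coMetric_comp {x : E n} (hx : x ∈ U) :
    coMetric G x ∘L G x = ContinuousLinearMap.id ℝ (E n) := by
  have e2 : ∀ v, M.T x (M.S x v) = v := fun v => congrArg (fun f => f v) (M.T_comp_S x hx)
  rw [M.coMetric_eq hx, M.sq_S x hx]
  ext v : 1
  simp [e2]

theorem symm_G {x : E n} (hx : x ∈ U) (u v : E n) : ⟪G x u, v⟫_ℝ = ⟪u, G x v⟫_ℝ := by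
  rw [M.sq_S x hx]; simp [M.symm_S x hx]

theorem symm_coMetric {x : E n} (hx : x ∈ U) (u v : E n) :
    ⟪coMetric G x u, v⟫_ℝ = ⟪u, coMetric G x v⟫_ℝ := by
  rw [M.coMetric_eq hx]; simp [M.symm_T x hx]

theorem smooth_coMetric : ContDiffOn ℝ (⊤ : ℕ∞) (coMetric G) U :=
  (M.smooth_T.clm_comp M.smooth_T).congr fun _ hx => M.coMetric_eq hx

theorem smooth_G : ContDiffOn ℝ (⊤ : ℕ∞) G U :=
  (M.smooth_S.clm_comp M.smooth_S).congr fun _ hx => M.sq_S _ hx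

omit M in
theorem _root_.HodgeWarped.formInner_eq (x : E n) (α β : Cov n p) :
    formInner G x α β = flatInner n p (pull p (coMetric G x) α) β := by
  rw [flatInner_apply]; rfl

theorem formInner_eq_root {x : E n} (hx : x ∈ U) (α β : Cov n p) :
    formInner G x α β = flatInner n p (pull p (M.T x) α) (pull p (M.T x) β) := by
  rw [formInner_eq, ← flatInner_pull_left (M.symm_T x hx), pull_pull, M.coMetric_eq hx]

/-- The form whose Euclidean divergence gives the codifferential. -/
def raised {n p : ℕ} (G : MetricField n) (ω : Form n p) : Form n p := fun y =>
  volDensity G y • pull p (coMetric G y) (ω y)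

/-- The Euclidean divergence of a form. -/
def diverg {n p : ℕ} (F : Form n (p + 1)) : Form n p := fun x =>
  ∑ j : Fin n, contr p (stdVec j) (fderiv ℝ F x (stdVec j))

omit M in
theorem _root_.HodgeWarped.codiff_eq (ω : Form n (p + 1)) (x : E n) :
    codiff G ω x = -((volDensity G x)⁻¹ • pull p (G x) (diverg (raised G ω) x)) := rfl

theorem smooth_raised {ω : Form n p} (hω : ContDiffOn ℝ (⊤ : ℕ∞) ω U) :
    ContDiffOn ℝ (⊤ : ℕ∞) (raised G ω) U :=
  M.smooth_vol.smul ((contDiffOn_pull M.smooth_coMetric).clm_apply hω)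

omit M in
theorem smooth_diverg {F : Form n (p + 1)} (hU : IsOpen U) (hF : ContDiffOn ℝ (⊤ : ℕ∞) F U) :
    ContDiffOn ℝ (⊤ : ℕ∞) (diverg F) U :=
  ContDiffOn.sum fun j _ => (contr p (stdVec j)).contDiff.comp_contDiffOn
    ((hF.fderiv_of_isOpen hU (by simp)).clm_apply contDiffOn_const)

theorem smooth_codiff {ω : Form n (p + 1)} (hω : ContDiffOn ℝ (⊤ : ℕ∞) ω U) :
    ContDiffOn ℝ (⊤ : ℕ∞) (codiff G ω) U :=
  ((M.smooth_vol.inv fun x hx => (M.vol_pos x hx).ne').smul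
    ((contDiffOn_pull M.smooth_G).clm_apply
      (smooth_diverg M.isOpen (M.smooth_raised hω)))).neg

omit M in
theorem _root_.HodgeWarped.tsupport_codiff (ω : Form n (p + 1)) :
    tsupport (codiff G ω) ⊆ tsupport ω :=
  closure_minimal (fun x hx => by
    by_contra h
    refine hx ?_
    have h1 := notMem_tsupport_iff_eventuallyEq.1 h
    have h2 : raised G ω =ᶠ[𝓝 x] fun _ => 0 := by
      filter_upwards [h1] with y hy
      simp [raised, hy]
    rw [codiff_eq, diverg]
    simp [h2.fderiv_eq]) (isClosed_tsupport _)

/-- **Green's formula**: the codifferential is the formal adjoint of the exterior derivative. -/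
theorem green {φ : Form n p} (hφ : IsTestForm φ) (hs : tsupport φ ⊆ U) {ψ : Form n (p + 1)}
    (hψ : ContDiffOn ℝ (⊤ : ℕ∞) ψ U) :
    l2Inner G (extDeriv φ) ψ = l2Inner G φ (codiff G ψ) := by
  set F := raised G ψ with hF
  have hFs : ContDiffOn ℝ (⊤ : ℕ∞) F U := M.smooth_raised hψ
  have z1 : ∀ x ∉ U, φ x = 0 := fun x hx => image_eq_zero_of_notMem_tsupport fun h => hx (hs h)
  have z2 : ∀ x ∉ U, extDeriv φ x = 0 := fun x hx =>
    image_eq_zero_of_notMem_tsupport fun h => hx (hs (tsupport_extDeriv φ h))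
  have e1 : l2Inner G (extDeriv φ) ψ = ∫ x, flatInner n (p + 1) (extDeriv φ x) (F x) := by
    refine integral_congr_ae (Eventually.of_forall fun x => ?_)
    by_cases hx : x ∈ U
    · simp only [formInner_eq, flatInner_pull_left (M.symm_coMetric hx), hF, raised, map_smul,
        smul_eq_mul]
      ring
    · simp [formInner_eq, z2 x hx]
  have e2 : l2Inner G φ (codiff G ψ) = ∫ x, -flatInner n p (φ x) (diverg F x) := by
    refine integral_congr_ae (Eventually.of_forall fun x => ?_)
    by_cases hx : x ∈ U
    · have hv := (M.vol_pos x hx).ne'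
      simp only [formInner_eq, codiff_eq, map_neg, map_smul, ← hF,
        ← flatInner_pull_left (M.symm_G hx), pull_pull, M.coMetric_comp hx, pull_id, smul_eq_mul]
      field_simp
    · simp [formInner_eq, z1 x hx]
  have i1 : Integrable fun x => flatInner n (p + 1) (extDeriv φ x) (F x) :=
    (continuous_bilin _ M.isOpen hφ.extDeriv.1.continuous ((tsupport_extDeriv φ).trans hs)
      hFs.continuousOn).integrable_of_hasCompactSupport
        (hasCompactSupport_bilin _ hφ.extDeriv.2)
  have i2 : Integrable fun x => -flatInner n p (φ x) (diverg F x) :=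
    ((continuous_bilin _ M.isOpen hφ.1.continuous hs
      (smooth_diverg M.isOpen hFs).continuousOn).integrable_of_hasCompactSupport
        (hasCompactSupport_bilin _ hφ.2)).neg
  rw [e1, e2, ← sub_eq_zero, ← integral_sub i1 i2]
  let h : Fin n → E n → ℝ := fun j x => flatInner n p (φ x) (contr p (stdVec j) (F x))
  have hh : ∀ j, ContDiff ℝ (⊤ : ℕ∞) (h j) := fun j =>
    contDiff_bilin _ M.isOpen hφ.1 hs ((contr p (stdVec j)).contDiff.comp_contDiffOn hFs)
  have hhc : ∀ j, HasCompactSupport (h j) := fun j => hasCompactSupport_bilin _ hφ.2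
  -- After raising the indices of `ψ`, the difference of the two integrands is the Euclidean
  -- divergence of the vector field `h`.
  have key : ∀ x, flatInner n (p + 1) (extDeriv φ x) (F x) - -flatInner n p (φ x) (diverg F x) =
      ∑ j, fderiv ℝ (h j) x (stdVec j) := by
    intro x
    by_cases hx : x ∈ U
    · have d1 : DifferentiableAt ℝ φ x := hφ.1.contDiffAt.differentiableAt (by simp)
      have d2 : DifferentiableAt ℝ F x :=
        (hFs.contDiffAt (M.isOpen.mem_nhds hx)).differentiableAt (by simp)
      have e : ∀ j, fderiv ℝ (h j) x (stdVec j) =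
          flatInner n p (fderiv ℝ φ x (stdVec j)) (contr p (stdVec j) (F x)) +
          flatInner n p (φ x) (contr p (stdVec j) (fderiv ℝ F x (stdVec j))) := fun j => by
        have : HasFDerivAt (h j) _ x := (flatInner n p).hasFDerivAt_of_bilinear d1.hasFDerivAt
          ((contr p (stdVec j)).hasFDerivAt.comp x d2.hasFDerivAt)
        rw [this.fderiv]
        simp [add_comm]
      simp only [e, Finset.sum_add_distrib, diverg, map_sum, sub_neg_eq_add]
      congr 1
      exact flatInner_alternatize _ _
    · have : ∀ j, h j =ᶠ[𝓝 x] fun _ => 0 := fun j =>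
        eventually_eq_zero_bilin _ fun h => hx (hs h)
      simp [z1 x hx, z2 x hx, (this _).fderiv_eq]
  simp only [key]
  rw [integral_finsetSum _ fun j _ => ?_]
  · exact Finset.sum_eq_zero fun j _ => integral_fderiv_eq_zero (hh j) (hhc j) _
  · exact (((hh j).continuous_fderiv (by simp)).clm_apply
      continuous_const).integrable_of_hasCompactSupport ((hhc j).fderiv_apply (𝕜 := ℝ) _)

end MetricRoot

/-! ### Rotationally symmetric metrics -/

section Projections

variable {n : ℕ}

theorem radialProj_apply (x v : E n) : radialProj x v = ((‖x‖ ^ 2)⁻¹ * ⟪x, v⟫_ℝ) • x := by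
  simp [radialProj, smul_smul]

theorem tangProj_apply (x v : E n) : tangProj x v = v - radialProj x v := rfl

theorem radialProj_self {x : E n} (hx : x ≠ 0) : radialProj x x = x := by
  have : ‖x‖ ^ 2 ≠ 0 := by positivity
  rw [radialProj_apply, real_inner_self_eq_norm_sq, inv_mul_cancel₀ this, one_smul]

theorem tangProj_self {x : E n} (hx : x ≠ 0) : tangProj x x = 0 := by
  rw [tangProj_apply, radialProj_self hx, sub_self]

theorem radialProj_radialProj {x : E n} (hx : x ≠ 0) (v : E n) :
    radialProj x (radialProj x v) = radialProj x v := by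
  rw [radialProj_apply x v, map_smul, radialProj_self hx]

theorem tangProj_radialProj {x : E n} (hx : x ≠ 0) (v : E n) :
    tangProj x (radialProj x v) = 0 := by
  rw [tangProj_apply, radialProj_radialProj hx, sub_self]

theorem radialProj_tangProj {x : E n} (hx : x ≠ 0) (v : E n) :
    radialProj x (tangProj x v) = 0 := by
  rw [tangProj_apply, map_sub, radialProj_radialProj hx, sub_self]

theorem tangProj_tangProj {x : E n} (hx : x ≠ 0) (v : E n) :
    tangProj x (tangProj x v) = tangProj x v := by
  rw [tangProj_apply x (tangProj x v), radialProj_tangProj hx, sub_zero]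

theorem radialProj_symm (x u v : E n) : ⟪radialProj x u, v⟫_ℝ = ⟪u, radialProj x v⟫_ℝ := by
  simp only [radialProj_apply, real_inner_smul_left, real_inner_smul_right]
  rw [real_inner_comm x u]; ring

theorem tangProj_symm (x u v : E n) : ⟪tangProj x u, v⟫_ℝ = ⟪u, tangProj x v⟫_ℝ := by
  simp only [tangProj_apply, inner_sub_left, inner_sub_right, radialProj_symm]

theorem inner_tangProj {x : E n} (hx : x ≠ 0) (v : E n) : ⟪x, tangProj x v⟫_ℝ = 0 := by
  rw [← tangProj_symm, tangProj_self hx, inner_zero_left]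

theorem radialProj_smul {c : ℝ} (hc : c ≠ 0) (x : E n) : radialProj (c • x) = radialProj x := by
  ext1 v
  simp only [radialProj_apply, norm_smul, real_inner_smul_left, smul_smul, Real.norm_eq_abs,
    mul_pow, sq_abs, mul_inv]
  congr 1
  field_simp

theorem tangProj_smul {c : ℝ} (hc : c ≠ 0) (x : E n) : tangProj (c • x) = tangProj x := by
  rw [tangProj, radialProj_smul hc, tangProj]

theorem contDiffOn_radialProj :
    ContDiffOn ℝ (⊤ : ℕ∞) (radialProj (n := n)) ({0}ᶜ : Set (E n)) := by
  refine contDiffOn_clm_apply.2 fun v => ?_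
  simp only [radialProj_apply]
  have h1 : ContDiffOn ℝ (⊤ : ℕ∞) (fun x : E n => (‖x‖ ^ 2)⁻¹) {0}ᶜ :=
    (contDiff_norm_sq ℝ).contDiffOn.inv fun x hx => pow_ne_zero 2 (norm_ne_zero_iff.2 hx)
  exact (h1.mul (contDiff_id.inner ℝ contDiff_const).contDiffOn).smul contDiffOn_id

theorem contDiffOn_tangProj : ContDiffOn ℝ (⊤ : ℕ∞) (tangProj (n := n)) {0}ᶜ :=
  contDiffOn_const.sub contDiffOn_radialProj

/-- The field of matrices with the eigenvalue `F ‖x‖` in the radial direction and `K ‖x‖` in the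
directions tangent to the spheres; the identity at the origin. -/
def radialField (n : ℕ) (F K : ℝ → ℝ) (x : E n) : E n →L[ℝ] E n :=
  if x = 0 then ContinuousLinearMap.id ℝ (E n) else F ‖x‖ • radialProj x + K ‖x‖ • tangProj x

theorem radialField_apply (F K : ℝ → ℝ) {x : E n} (hx : x ≠ 0) (v : E n) :
    radialField n F K x v = F ‖x‖ • radialProj x v + K ‖x‖ • tangProj x v := by
  simp [radialField, hx]

theorem warpedMetric_eq (f g : ℝ → ℝ) :
    warpedMetric n f g = radialField n f fun t => g t / t ^ 2 := rfl

theorem radialField_symm (F K : ℝ → ℝ) (x u v : E n) :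
    ⟪radialField n F K x u, v⟫_ℝ = ⟪u, radialField n F K x v⟫_ℝ := by
  by_cases hx : x = 0
  · simp [radialField, hx]
  · simp only [radialField_apply F K hx, inner_add_left, inner_add_right, real_inner_smul_left,
      real_inner_smul_right, radialProj_symm, tangProj_symm]

theorem radialField_comp (F K F' K' : ℝ → ℝ) (x : E n) :
    radialField n F K x ∘L radialField n F' K' x =
      radialField n (fun t => F t * F' t) (fun t => K t * K' t) x := by
  by_cases hx : x = 0
  · simp [radialField, hx]
  · ext1 v
    simp only [ContinuousLinearMap.comp_apply, radialField_apply _ _ hx, map_add, map_smul,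
      radialProj_radialProj hx, tangProj_radialProj hx, radialProj_tangProj hx,
      tangProj_tangProj hx, smul_zero, add_zero, zero_add, smul_smul]

theorem radialField_congr {F K F' K' : ℝ → ℝ} {x : E n}
    (h : x ≠ 0 → F ‖x‖ = F' ‖x‖ ∧ K ‖x‖ = K' ‖x‖) :
    radialField n F K x = radialField n F' K' x := by
  by_cases hx : x = 0
  · simp [radialField, hx]
  · simp [radialField, hx, (h hx).1, (h hx).2]

theorem radialField_one (x : E n) :
    radialField n (fun _ => 1) (fun _ => 1) x = ContinuousLinearMap.id ℝ (E n) := by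
  by_cases hx : x = 0
  · simp [radialField, hx]
  · ext1 v
    simp [radialField_apply _ _ hx, tangProj_apply]

theorem contDiffOn_comp_norm {W : Type*} [NormedAddCommGroup W] [NormedSpace ℝ W] {F : ℝ → W}
    (hF : ContDiffOn ℝ (⊤ : ℕ∞) F (Ioi 0)) :
    ContDiffOn ℝ (⊤ : ℕ∞) (fun x : E n => F ‖x‖) {0}ᶜ :=
  hF.comp (fun _ hx => (contDiffAt_norm ℝ hx).contDiffWithinAt) fun _ hx => norm_pos_iff.2 hx

theorem contDiffOn_radialField {F K : ℝ → ℝ} (hF : ContDiffOn ℝ (⊤ : ℕ∞) F (Ioi 0))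
    (hK : ContDiffOn ℝ (⊤ : ℕ∞) K (Ioi 0)) :
    ContDiffOn ℝ (⊤ : ℕ∞) (radialField n F K) {0}ᶜ := by
  have : ContDiffOn ℝ (⊤ : ℕ∞) (fun x : E n => F ‖x‖ • radialProj x + K ‖x‖ • tangProj x) {0}ᶜ :=
    ((contDiffOn_comp_norm hF).smul contDiffOn_radialProj).add
      ((contDiffOn_comp_norm hK).smul contDiffOn_tangProj)
  refine this.congr fun x hx => ?_
  have hx' : x ≠ 0 := hx
  simp [radialField, hx']

theorem contDiff_of_eventually_const {W : Type*} [NormedAddCommGroup W] [NormedSpace ℝ W]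
    {H : E n → W} (hH : ContDiffOn ℝ (⊤ : ℕ∞) H {0}ᶜ) {c : W} (hc : H =ᶠ[𝓝 0] fun _ => c) :
    ContDiff ℝ (⊤ : ℕ∞) H := by
  refine contDiff_iff_contDiffAt.2 fun x => ?_
  by_cases hx : x = 0
  · subst hx
    exact contDiffAt_const.congr_of_eventuallyEq hc
  · exact hH.contDiffAt (isOpen_compl_singleton.mem_nhds hx)

theorem eventually_norm_mem {P : ℝ → Prop} {ε : ℝ} (hε : 0 < ε) (h : ∀ t ∈ Ioo 0 ε, P t) :
    ∀ᶠ x : E n in 𝓝 0, x ≠ 0 → P ‖x‖ := by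
  filter_upwards [Metric.ball_mem_nhds (0 : E n) hε] with x hx hx0
  exact h _ ⟨norm_pos_iff.2 hx0, by simpa using hx⟩

theorem det_radialField {F K : ℝ → ℝ} {x : E n} (hx : x ≠ 0) (hK : K ‖x‖ ≠ 0) :
    LinearMap.det (radialField n F K x : E n →ₗ[ℝ] E n) = F ‖x‖ * K ‖x‖ ^ (n - 1) := by
  have h0 : ‖x‖ ^ 2 ≠ 0 := by positivity
  have hn : n ≠ 0 := by
    rintro rfl
    exact hx (Subsingleton.elim _ _)
  have e : (radialField n F K x : E n →ₗ[ℝ] E n) = K ‖x‖ • LinearMap.transvection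
      (((‖x‖ ^ 2)⁻¹ * (F ‖x‖ / K ‖x‖ - 1)) • (innerSL ℝ x : E n →ₗ[ℝ] ℝ)) x := by
    ext1 v
    simp only [ContinuousLinearMap.coe_coe, radialField_apply F K hx, LinearMap.smul_apply,
      LinearMap.transvection.apply, tangProj_apply, radialProj_apply, innerSL_apply_apply,
      smul_eq_mul, smul_add, smul_sub, smul_smul]
    rw [add_comm, sub_add_eq_add_sub, add_sub_assoc, ← sub_smul]
    congr 2
    field_simp
  rw [e, LinearMap.det_smul, LinearMap.transvection.det]
  simp only [LinearMap.smul_apply, ContinuousLinearMap.coe_coe, innerSL_apply_apply,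
    real_inner_self_eq_norm_sq, smul_eq_mul, finrank_euclideanSpace, Fintype.card_fin]
  obtain ⟨m, rfl⟩ := Nat.exists_eq_succ_of_ne_zero hn
  simp only [Nat.succ_eq_add_one, Nat.add_sub_cancel, pow_succ]
  field_simp
  ring

end Projections

section WarpedMetric

variable {n : ℕ} {f g : ℝ → ℝ}

/-- The volume density of a rotationally symmetric metric, as a function of `‖x‖`. -/
def warpedVol (n : ℕ) (f g : ℝ → ℝ) (t : ℝ) : ℝ := √(f t * (g t / t ^ 2) ^ (n - 1))

theorem warpedVol_pos (hf0 : ∀ t, 0 < t → 0 < f t) (hg0 : ∀ t, 0 < t → 0 < g t) {t : ℝ}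
    (ht : 0 < t) : 0 < warpedVol n f g t := by
  have := hf0 t ht
  have := hg0 t ht
  unfold warpedVol
  positivity

theorem contDiffOn_warpedVol (hf : ContDiffOn ℝ (⊤ : ℕ∞) f (Ioi 0))
    (hg : ContDiffOn ℝ (⊤ : ℕ∞) g (Ioi 0)) (hf0 : ∀ t, 0 < t → 0 < f t)
    (hg0 : ∀ t, 0 < t → 0 < g t) : ContDiffOn ℝ (⊤ : ℕ∞) (warpedVol n f g) (Ioi 0) := by
  refine ContDiffOn.sqrt (hf.mul ((hg.div (contDiffOn_id.pow 2) fun t ht => ?_).pow _))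
    fun t ht => ?_
  · have : (0 : ℝ) < t := ht
    exact pow_ne_zero 2 this.ne'
  · have h0 : (0 : ℝ) < t := ht
    have := hf0 t ht
    have := hg0 t ht
    exact ne_of_gt (mul_pos (hf0 t ht) (pow_pos (div_pos this (pow_pos h0 2)) _))

theorem volDensity_warpedMetric (hg0 : ∀ t, 0 < t → 0 < g t) {x : E n} (hx : x ≠ 0) :
    volDensity (warpedMetric n f g) x = warpedVol n f g ‖x‖ := by
  have := hg0 _ (norm_pos_iff.2 hx)
  have h0 : 0 < ‖x‖ := norm_pos_iff.2 hx
  rw [volDensity, warpedMetric_eq, det_radialField hx (by positivity), warpedVol]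

/-- The inverse square root of a rotationally symmetric metric. -/
def warpedT (n : ℕ) (f g : ℝ → ℝ) : E n → E n →L[ℝ] E n :=
  radialField n (fun t => (√(f t))⁻¹) fun t => t / √(g t)

/-- The square root of a rotationally symmetric metric. -/
def warpedS (n : ℕ) (f g : ℝ → ℝ) : E n → E n →L[ℝ] E n :=
  radialField n (fun t => √(f t)) fun t => √(g t) / t

theorem warpedT_comp_warpedS (hf0 : ∀ t, 0 < t → 0 < f t) (hg0 : ∀ t, 0 < t → 0 < g t) (x : E n) :
    warpedT n f g x ∘L warpedS n f g x = ContinuousLinearMap.id ℝ (E n) := by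
  rw [warpedT, warpedS, radialField_comp, ← radialField_one x]
  refine radialField_congr fun hx => ?_
  have h := norm_pos_iff.2 hx
  have h1 := Real.sqrt_pos.2 (hf0 _ h)
  have h2 := Real.sqrt_pos.2 (hg0 _ h)
  constructor <;> field_simp

theorem warpedS_comp_warpedT (hf0 : ∀ t, 0 < t → 0 < f t) (hg0 : ∀ t, 0 < t → 0 < g t) (x : E n) :
    warpedS n f g x ∘L warpedT n f g x = ContinuousLinearMap.id ℝ (E n) := by
  rw [warpedT, warpedS, radialField_comp, ← radialField_one x]
  refine radialField_congr fun hx => ?_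
  have h := norm_pos_iff.2 hx
  have h1 := Real.sqrt_pos.2 (hf0 _ h)
  have h2 := Real.sqrt_pos.2 (hg0 _ h)
  constructor <;> field_simp

theorem warpedMetric_eq_sq (hf0 : ∀ t, 0 < t → 0 < f t) (hg0 : ∀ t, 0 < t → 0 < g t) (x : E n) :
    warpedMetric n f g x = warpedS n f g x ∘L warpedS n f g x := by
  rw [warpedS, radialField_comp, warpedMetric_eq]
  refine radialField_congr fun hx => ?_
  have h := norm_pos_iff.2 hx
  have h1 := Real.mul_self_sqrt (hf0 _ h).le
  have h2 := Real.mul_self_sqrt (hg0 _ h).le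
  constructor
  · exact h1.symm
  · rw [div_mul_div_comm, h2, sq]

theorem contDiffOn_sqrt_of_pos (hf : ContDiffOn ℝ (⊤ : ℕ∞) f (Ioi 0))
    (hf0 : ∀ t, 0 < t → 0 < f t) : ContDiffOn ℝ (⊤ : ℕ∞) (fun t => √(f t)) (Ioi 0) :=
  hf.sqrt fun t ht => (hf0 t ht).ne'

theorem contDiffOn_warpedT (hf : ContDiffOn ℝ (⊤ : ℕ∞) f (Ioi 0))
    (hg : ContDiffOn ℝ (⊤ : ℕ∞) g (Ioi 0)) (hf0 : ∀ t, 0 < t → 0 < f t)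
    (hg0 : ∀ t, 0 < t → 0 < g t) : ContDiffOn ℝ (⊤ : ℕ∞) (warpedT n f g) {0}ᶜ :=
  contDiffOn_radialField
    ((contDiffOn_sqrt_of_pos hf hf0).inv fun t ht => (Real.sqrt_pos.2 (hf0 t ht)).ne')
    (contDiffOn_id.div (contDiffOn_sqrt_of_pos hg hg0)
      fun t ht => (Real.sqrt_pos.2 (hg0 t ht)).ne')

theorem contDiffOn_warpedS (hf : ContDiffOn ℝ (⊤ : ℕ∞) f (Ioi 0))
    (hg : ContDiffOn ℝ (⊤ : ℕ∞) g (Ioi 0)) (hf0 : ∀ t, 0 < t → 0 < f t)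
    (hg0 : ∀ t, 0 < t → 0 < g t) : ContDiffOn ℝ (⊤ : ℕ∞) (warpedS n f g) {0}ᶜ :=
  contDiffOn_radialField (contDiffOn_sqrt_of_pos hf hf0)
    ((contDiffOn_sqrt_of_pos hg hg0).div contDiffOn_id fun t ht => (ne_of_gt ht : t ≠ 0))

/-- A rotationally symmetric metric is smooth away from the origin. -/
def rootCompl (hf : ContDiffOn ℝ (⊤ : ℕ∞) f (Ioi 0))
    (hg : ContDiffOn ℝ (⊤ : ℕ∞) g (Ioi 0)) (hf0 : ∀ t, 0 < t → 0 < f t)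
    (hg0 : ∀ t, 0 < t → 0 < g t) : MetricRoot (warpedMetric n f g) {0}ᶜ where
  T := warpedT n f g
  S := warpedS n f g
  isOpen := isOpen_compl_singleton
  smooth_T := contDiffOn_warpedT hf hg hf0 hg0
  smooth_S := contDiffOn_warpedS hf hg hf0 hg0
  smooth_vol := (contDiffOn_comp_norm (contDiffOn_warpedVol hf hg hf0 hg0)).congr
    fun x hx => volDensity_warpedMetric hg0 hx
  vol_pos x hx := by
    rw [volDensity_warpedMetric hg0 hx]
    exact warpedVol_pos hf0 hg0 (norm_pos_iff.2 hx)
  symm_T x _ := radialField_symm _ _ x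
  symm_S x _ := radialField_symm _ _ x
  T_comp_S x _ := warpedT_comp_warpedS hf0 hg0 x
  S_comp_T x _ := warpedS_comp_warpedT hf0 hg0 x
  sq_S x _ := warpedMetric_eq_sq hf0 hg0 x

theorem volDensity_warpedMetric_zero : volDensity (warpedMetric n f g) 0 = 1 := by
  simp [volDensity, warpedMetric]

/-- Under the standing assumptions the metric is smooth on the whole space. -/
def IsWarpingPair.root (n : ℕ) (h : IsWarpingPair f g) : MetricRoot (warpedMetric n f g) univ where
  T := warpedT n f g
  S := warpedS n f g
  isOpen := isOpen_univ
  smooth_T := by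
    obtain ⟨ε, hε, he⟩ := h.euclidean
    refine (contDiff_of_eventually_const (contDiffOn_warpedT h.smooth_f h.smooth_g h.pos_f h.pos_g)
      (c := ContinuousLinearMap.id ℝ (E n)) ?_).contDiffOn
    filter_upwards [eventually_norm_mem hε he] with x hx
    rw [← radialField_one x]
    refine radialField_congr fun h0 => ?_
    have := norm_pos_iff.2 h0
    simp [hx h0, this.ne']
  smooth_S := by
    obtain ⟨ε, hε, he⟩ := h.euclidean
    refine (contDiff_of_eventually_const (contDiffOn_warpedS h.smooth_f h.smooth_g h.pos_f h.pos_g)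
      (c := ContinuousLinearMap.id ℝ (E n)) ?_).contDiffOn
    filter_upwards [eventually_norm_mem hε he] with x hx
    rw [← radialField_one x]
    refine radialField_congr fun h0 => ?_
    have := norm_pos_iff.2 h0
    simp [hx h0, this.ne']
  smooth_vol := by
    obtain ⟨ε, hε, he⟩ := h.euclidean
    refine (contDiff_of_eventually_const
      (rootCompl h.smooth_f h.smooth_g h.pos_f h.pos_g).smooth_vol (c := 1) ?_).contDiffOn
    filter_upwards [eventually_norm_mem hε he] with x hx
    by_cases h0 : x = 0
    · rw [h0, volDensity_warpedMetric_zero]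
    · have := norm_pos_iff.2 h0
      rw [volDensity_warpedMetric h.pos_g h0, warpedVol]
      simp [hx h0, this.ne']
  vol_pos x _ := by
    by_cases h0 : x = 0
    · rw [h0, volDensity_warpedMetric_zero]; exact one_pos
    · exact (rootCompl h.smooth_f h.smooth_g h.pos_f h.pos_g).vol_pos x h0
  symm_T x _ := radialField_symm _ _ x
  symm_S x _ := radialField_symm _ _ x
  T_comp_S x _ := warpedT_comp_warpedS h.pos_f h.pos_g x
  S_comp_T x _ := warpedS_comp_warpedT h.pos_f h.pos_g x
  sq_S x _ := warpedMetric_eq_sq h.pos_f h.pos_g x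

/-- The cylindrical metric is smooth away from the origin. -/
def cylRoot (n : ℕ) : MetricRoot (cylMetric n) {0}ᶜ :=
  rootCompl contDiffOn_const contDiffOn_const (fun _ _ => one_pos) (fun _ _ => one_pos)

end WarpedMetric

/-! ### The closure of an operator with dense range -/

section Completeness

variable {n : ℕ} {V : Type*} [NormedAddCommGroup V] [InnerProductSpace ℝ V] [CompleteSpace V]

theorem norm_toLp_eq_l2n {f : E n → V} (hf : MemLp f 2 volume) : ‖hf.toLp f‖ = l2n f :=
  Lp.norm_toLp f hf

theorem inner_toLp {f g : E n → V} (hf : MemLp f 2 volume) (hg : MemLp g 2 volume) :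
    ⟪hf.toLp f, hg.toLp g⟫_ℝ = ∫ x, ⟪f x, g x⟫_ℝ := by
  rw [MeasureTheory.L2.inner_def]
  refine integral_congr_ae ?_
  filter_upwards [hf.coeFn_toLp, hg.coeFn_toLp] with x h1 h2
  rw [h1, h2]

/-- Completeness of `L²`, in terms of functions. -/
theorem exists_l2n_limit {f : ℕ → E n → V} (hf : ∀ k, MemLp (f k) 2 volume)
    (hc : ∀ ε : ℝ, 0 < ε → ∃ N, ∀ k ≥ N, ∀ l ≥ N, l2n (f k - f l) < ε) :
    ∃ v : E n → V, MemLp v 2 volume ∧ Tendsto (fun k => l2n (f k - v)) atTop (𝓝 0) := by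
  have hC : CauchySeq fun k => (hf k).toLp (f k) := by
    refine Metric.cauchySeq_iff.2 fun ε hε => ?_
    obtain ⟨N, hN⟩ := hc ε hε
    refine ⟨N, fun k hk l hl => ?_⟩
    rw [dist_eq_norm, ← MemLp.toLp_sub, norm_toLp_eq_l2n]
    exact hN k hk l hl
  obtain ⟨F, hF⟩ := cauchySeq_tendsto_of_complete hC
  refine ⟨F, Lp.memLp F, ?_⟩
  have h1 : (Lp.memLp F).toLp F = F := Lp.toLp_coeFn F _
  have := tendsto_iff_norm_sub_tendsto_zero.1 hF
  refine this.congr fun k => ?_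
  conv_lhs => rw [← h1]
  rw [← MemLp.toLp_sub, norm_toLp_eq_l2n]

theorem tendsto_integral_inner {f : ℕ → E n → V} {v h : E n → V}
    (hf : ∀ k, MemLp (f k) 2 volume) (hv : MemLp v 2 volume)
    (hlim : Tendsto (fun k => l2n (f k - v)) atTop (𝓝 0)) (hh : MemLp h 2 volume) :
    Tendsto (fun k => ∫ x, ⟪f k x, h x⟫_ℝ) atTop (𝓝 (∫ x, ⟪v x, h x⟫_ℝ)) := by
  rw [tendsto_iff_norm_sub_tendsto_zero]
  refine squeeze_zero (fun _ => norm_nonneg _) (fun k => ?_)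
    (by simpa using hlim.mul_const (l2n h))
  rw [← integral_sub (integrable_inner_of_memLp (hf k) hh) (integrable_inner_of_memLp hv hh)]
  simp only [← inner_sub_left]
  exact abs_integral_inner_le ((hf k).sub hv) hh

end Completeness

namespace ScalarOp

variable {n : ℕ} {V : Type*} [NormedAddCommGroup V] [InnerProductSpace ℝ V]
  [FiniteDimensional ℝ V] {P : ScalarOp n V}

theorem op_add {u w : E n → V} (hu : IsTestFun u) (hw : IsTestFun w) :
    P.op (u + w) = P.op u + P.op w := by
  have d : ∀ x, fderiv ℝ (u + w) x = fderiv ℝ u x + fderiv ℝ w x := fun x =>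
    fderiv_add (hu.1.differentiable (by simp) x) (hw.1.differentiable (by simp) x)
  have hf : ∀ i, P.flux (u + w) i = P.flux u i + P.flux w i := fun i => by
    funext x; simp [flux, d]
  have hd : ∀ i x, fderiv ℝ (P.flux (u + w) i) x =
      fderiv ℝ (P.flux u i) x + fderiv ℝ (P.flux w i) x := fun i x => by
    rw [hf]
    exact fderiv_add ((flux_contDiff hu.1 i).differentiable (by simp) x)
      ((flux_contDiff hw.1 i).differentiable (by simp) x)
  funext x
  simp only [op, low, hd, d, Pi.add_apply, add_apply, map_add,
    Finset.sum_add_distrib]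
  abel

theorem op_smul {u : E n → V} (hu : IsTestFun u) (c : ℝ) : P.op (c • u) = c • P.op u := by
  have d : ∀ x, fderiv ℝ (c • u) x = c • fderiv ℝ u x := fun x =>
    fderiv_const_smul (hu.1.differentiable (by simp) x) c
  have hf : ∀ i, P.flux (c • u) i = c • P.flux u i := fun i => by
    funext x; simp [flux, d]
  have hd : ∀ i x, fderiv ℝ (P.flux (c • u) i) x = c • fderiv ℝ (P.flux u i) x := fun i x => by
    rw [hf]
    exact fderiv_const_smul ((flux_contDiff hu.1 i).differentiable (by simp) x) c
  funext x
  simp only [op, low, hd, d, Pi.smul_apply, smul_apply, map_smul,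
    ← Finset.smul_sum, smul_add, smul_neg]

variable (hsymm : ∀ u h : E n → V, IsTestFun u → IsTestFun h →
      ∫ x, ⟪P.op u x, h x⟫_ℝ = ∫ x, ⟪u x, P.op h x⟫_ℝ)
    (hcoer : ∀ u : E n → V, IsTestFun u → ∫ x, ‖u x‖ ^ 2 ≤ ∫ x, ⟪P.op u x, u x⟫_ℝ)
    (hcut : ∀ R δ : ℝ, 0 < δ → ∃ χ : E n → ℝ, IsTestFun χ ∧ (∀ x, ‖x‖ ≤ R → χ x = 1) ∧
      ∀ x, P.gradSq χ x ≤ δ)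
include hsymm hcoer hcut

/-- The range of the operator on test functions is dense. -/
theorem exists_op_tendsto {w : E n → V} (hw : MemLp w 2 volume) :
    ∃ u : ℕ → E n → V, (∀ k, IsTestFun (u k)) ∧
      Tendsto (fun k => l2n (P.op (u k) - w)) atTop (𝓝 0) := by
  let K : Submodule ℝ (Lp V 2 (volume : Measure (E n))) :=
    { carrier := {F | ∃ (u : E n → V) (hu : IsTestFun u), F = (op_memLp (P := P) hu).toLp (P.op u)}
      add_mem' := by
        rintro _ _ ⟨u, hu, rfl⟩ ⟨w, hw, rfl⟩
        refine ⟨u + w, ⟨hu.1.add hw.1, hu.2.add hw.2⟩, ?_⟩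
        rw [← MemLp.toLp_add]
        exact MemLp.toLp_congr _ _ (by rw [op_add hu hw])
      zero_mem' := by
        refine ⟨0, ⟨contDiff_const, HasCompactSupport.zero⟩, ?_⟩
        have h0 : P.op (0 : E n → V) = 0 := by
          have := op_smul (P := P) (u := (0 : E n → V)) ⟨contDiff_const, HasCompactSupport.zero⟩ 0
          simpa using this
        rw [← MemLp.toLp_zero (MemLp.zero' (ε := V))]
        exact MemLp.toLp_congr _ _ (by rw [h0])
      smul_mem' := by
        rintro c _ ⟨u, hu, rfl⟩
        refine ⟨c • u, ⟨contDiff_const.smul hu.1, hu.2.smul_left⟩, ?_⟩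
        rw [← MemLp.toLp_const_smul]
        exact MemLp.toLp_congr _ _ (by rw [op_smul hu]) }
  have hK : K.topologicalClosure = ⊤ := by
    rw [Submodule.topologicalClosure_eq_top_iff, Submodule.eq_bot_iff]
    intro F hF
    have h1 : MemLp (F : E n → V) 2 volume := Lp.memLp F
    have h2 : (F : E n → V) =ᵐ[volume] 0 := by
      refine ae_eq_zero_of_orthogonal hsymm hcoer hcut h1 fun u hu => ?_
      have := (Submodule.mem_orthogonal' K F).1 hF _ ⟨u, hu, rfl⟩
      rwa [← Lp.toLp_coeFn F h1, inner_toLp] at this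
    exact Lp.eq_zero_iff_ae_eq_zero.2 h2
  have hmem : hw.toLp w ∈ closure (K : Set (Lp V 2 (volume : Measure (E n)))) := by
    rw [← Submodule.topologicalClosure_coe, hK]; trivial
  obtain ⟨F, hF, hlim⟩ := mem_closure_iff_seq_limit.1 hmem
  choose u hu hFu using hF
  refine ⟨u, hu, ?_⟩
  refine (tendsto_iff_norm_sub_tendsto_zero.1 hlim).congr fun k => ?_
  rw [hFu, ← MemLp.toLp_sub, norm_toLp_eq_l2n]

omit hsymm hcut in
theorem l2n_le_l2n_op {u : E n → V} (hu : IsTestFun u) : l2n u ≤ l2n (P.op u) := by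
  have h1 := hcoer u hu
  rw [← l2n_sq hu.memLp] at h1
  have h2 := (abs_le.1 (abs_integral_inner_le (op_memLp (P := P) hu) hu.memLp)).2
  by_contra h
  push Not at h
  have := l2n_nonneg (P.op u)
  nlinarith

/-- A weak eigenvector lies in the domain of the closure of the operator. -/
theorem exists_approx_of_weak_eigen {v : E n → V} (hv : MemLp v 2 volume) {c : ℝ}
    (hweak : ∀ u : E n → V, IsTestFun u → ∫ x, ⟪v x, P.op u x⟫_ℝ = c * ∫ x, ⟪v x, u x⟫_ℝ) :
    ∃ u : ℕ → E n → V, (∀ k, IsTestFun (u k)) ∧ Tendsto (fun k => l2n (u k - v)) atTop (𝓝 0) ∧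
      Tendsto (fun k => l2n (P.op (u k) - c • v)) atTop (𝓝 0) := by
  obtain ⟨u, hu, hlim⟩ := exists_op_tendsto hsymm hcoer hcut (hv.const_smul c)
  have hcv : MemLp (c • v) 2 volume := hv.const_smul c
  have hop : ∀ k, MemLp (P.op (u k)) 2 volume := fun k => op_memLp (hu k)
  -- By coercivity the `u k` converge. Their limit agrees with `v`, as the difference is orthogonal
  -- to the range of the operator.
  have hsub : ∀ k l, l2n (u k - u l) ≤ l2n (P.op (u k) - c • v) + l2n (P.op (u l) - c • v) := by
    intro k l
    have h1 : P.op (u k - u l) = P.op (u k) - P.op (u l) := by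
      have e : u k - u l = u k + (-1 : ℝ) • u l := by rw [neg_one_smul, sub_eq_add_neg]
      have hl : IsTestFun ((-1 : ℝ) • u l) := ⟨contDiff_const.smul (hu l).1, (hu l).2.smul_left⟩
      rw [e, op_add (hu k) hl, op_smul (hu l),
        neg_one_smul, sub_eq_add_neg]
    refine (l2n_le_l2n_op hcoer ((hu k).sub (hu l))).trans ?_
    have h2 := l2n_sub_le ((hop k).sub hcv) ((hop l).sub hcv)
    rw [h1]
    rwa [sub_sub_sub_cancel_right] at h2
  obtain ⟨v', hv', hlim'⟩ := exists_l2n_limit (fun k => (hu k).memLp) (by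
    intro ε hε
    obtain ⟨N, hN⟩ := (hlim.eventually_lt_const (half_pos hε)).exists_forall_of_atTop
    exact ⟨N, fun k hk l hl => by linarith [hsub k l, hN k hk, hN l hl]⟩)
  have heq : v' - v =ᵐ[volume] 0 := by
    refine ae_eq_zero_of_orthogonal hsymm hcoer hcut (hv'.sub hv) fun h hh => ?_
    have l1 := tendsto_integral_inner (fun k => (hu k).memLp) hv' hlim' (op_memLp (P := P) hh)
    have l2 := tendsto_integral_inner hop hcv hlim hh.memLp
    have l3 := tendsto_nhds_unique l1 (l2.congr fun k => hsymm _ _ (hu k) hh)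
    have e : ∫ x, ⟪(c • v) x, h x⟫_ℝ = c * ∫ x, ⟪v x, h x⟫_ℝ := by
      rw [← integral_const_mul]
      exact integral_congr_ae (Eventually.of_forall fun x => real_inner_smul_left _ _ _)
    rw [e, ← hweak h hh] at l3
    simp only [Pi.sub_apply, inner_sub_left]
    rw [integral_sub (integrable_inner_of_memLp hv' (op_memLp hh))
      (integrable_inner_of_memLp hv (op_memLp hh)), l3, sub_self]
  refine ⟨u, hu, hlim'.congr fun k => ?_, hlim⟩
  unfold l2n
  congr 1
  refine eLpNorm_congr_ae ?_
  filter_upwards [heq] with x hx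
  simp only [Pi.sub_apply, Pi.zero_apply, sub_eq_zero] at hx ⊢
  rw [hx]

end ScalarOp

/-! ### Square integrable forms as vector-valued functions -/

namespace MetricRoot

variable {n p : ℕ} {G : MetricField n} (M : MetricRoot G univ)

/-- The isometry of the covectors at `x` with the Euclidean space of coordinates, multiplied by
the root of the volume density. -/
def lift (p : ℕ) (x : E n) : Cov n p →L[ℝ] CoordSpace n p :=
  √(volDensity G x) • ((coord n p : Cov n p →L[ℝ] CoordSpace n p) ∘L pull p (M.T x))

/-- The inverse of `MetricRoot.lift`. -/
def unlift (p : ℕ) (x : E n) : CoordSpace n p →L[ℝ] Cov n p :=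
  (√(volDensity G x))⁻¹ • (pull p (M.S x) ∘L ((coord n p).symm : CoordSpace n p →L[ℝ] Cov n p))

/-- The representation of a form by a function with values in a Euclidean space, isometric for
the `L²` norms. -/
def up (ω : Form n p) : E n → CoordSpace n p := fun x => M.lift p x (ω x)

/-- The form represented by a function with values in the Euclidean space of coordinates. -/
def down (u : E n → CoordSpace n p) : Form n p := fun x => M.unlift p x (u x)

include M

theorem sqrt_vol_pos (x : E n) : 0 < √(volDensity G x) :=
  Real.sqrt_pos.2 (M.vol_pos x (mem_univ x))

theorem unlift_lift (x : E n) (α : Cov n p) : M.unlift p x (M.lift p x α) = α := by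
  have h := (M.sqrt_vol_pos x).ne'
  simp only [lift, unlift, smul_apply, ContinuousLinearMap.comp_apply, map_smul,
    ContinuousLinearEquiv.coe_coe, ContinuousLinearEquiv.symm_apply_apply, smul_smul, pull_pull,
    M.T_comp_S x (mem_univ x), pull_id, mul_inv_cancel₀ h, one_smul]

theorem lift_unlift (x : E n) (a : CoordSpace n p) : M.lift p x (M.unlift p x a) = a := by
  have h := (M.sqrt_vol_pos x).ne'
  simp only [lift, unlift, smul_apply, ContinuousLinearMap.comp_apply, map_smul,
    ContinuousLinearEquiv.coe_coe, smul_smul, pull_pull,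
    M.S_comp_T x (mem_univ x), pull_id, ContinuousLinearEquiv.apply_symm_apply,
    inv_mul_cancel₀ h, one_smul]

theorem down_up (ω : Form n p) : M.down (M.up ω) = ω := funext fun x => M.unlift_lift x _

theorem up_down (u : E n → CoordSpace n p) : M.up (M.down u) = u :=
  funext fun x => M.lift_unlift x _

theorem up_sub (ω η : Form n p) : M.up (ω - η) = M.up ω - M.up η := by
  funext x; simp [up]

theorem up_add (ω η : Form n p) : M.up (ω + η) = M.up ω + M.up η := by
  funext x; simp [up]

theorem up_smul (c : ℝ) (ω : Form n p) : M.up (c • ω) = c • M.up ω := by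
  funext x; simp [up]

theorem smooth_sqrt_vol : ContDiff ℝ (⊤ : ℕ∞) fun x => √(volDensity G x) :=
  contDiffOn_univ.1 (M.smooth_vol.sqrt fun x hx => (M.vol_pos x hx).ne')

theorem smooth_lift : ContDiff ℝ (⊤ : ℕ∞) (M.lift p) :=
  contDiff_clm_apply_iff.2 fun _ => M.smooth_sqrt_vol.smul ((coord n p).contDiff.comp
    ((contDiffOn_univ.1 (contDiffOn_pull M.smooth_T)).clm_apply contDiff_const))

theorem smooth_unlift : ContDiff ℝ (⊤ : ℕ∞) (M.unlift p) :=
  contDiff_clm_apply_iff.2 fun _ => (M.smooth_sqrt_vol.inv fun x => (M.sqrt_vol_pos x).ne').smul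
    ((contDiffOn_univ.1 (contDiffOn_pull M.smooth_S)).clm_apply contDiff_const)

theorem isTestFun_up {ω : Form n p} (h : IsTestForm ω) : IsTestFun (M.up ω) :=
  ⟨M.smooth_lift.clm_apply h.1, h.2.mono fun x hx => by
    contrapose! hx
    simp only [Function.mem_support, not_not] at hx ⊢
    simp [up, hx]⟩

theorem isTestForm_down {u : E n → CoordSpace n p} (h : IsTestFun u) : IsTestForm (M.down u) :=
  ⟨M.smooth_unlift.clm_apply h.1, h.2.mono fun x hx => by
    contrapose! hx
    simp only [Function.mem_support, not_not] at hx ⊢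
    simp [down, hx]⟩

theorem inner_up (x : E n) (α β : Cov n p) :
    ⟪M.lift p x α, M.lift p x β⟫_ℝ = formInner G x α β * volDensity G x := by
  have h := Real.mul_self_sqrt (M.vol_pos x (mem_univ x)).le
  rw [M.formInner_eq_root (mem_univ x), flatInner_eq_inner]
  simp only [lift, smul_apply, ContinuousLinearMap.comp_apply, real_inner_smul_left,
    real_inner_smul_right, ContinuousLinearEquiv.coe_coe]
  rw [← mul_assoc, h, mul_comm]

theorem l2Inner_eq (ω η : Form n p) : l2Inner G ω η = ∫ x, ⟪M.up ω x, M.up η x⟫_ℝ := by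
  simp only [up, M.inner_up]; rfl

theorem normSq_eq (ω : Form n p) : normSq G ω = eLpNorm (M.up ω) 2 volume ^ 2 := by
  have h : ∀ x, ENNReal.ofReal (formInner G x (ω x) (ω x) * volDensity G x) =
      ‖M.up ω x‖ₑ ^ (2 : ℝ) := fun x => by
    rw [← M.inner_up, real_inner_self_eq_norm_sq, ← ofReal_norm,
      ENNReal.ofReal_rpow_of_nonneg (norm_nonneg _) (by norm_num)]
    norm_num [up]
  rw [normSq, eLpNorm_eq_lintegral_rpow_enorm_toReal (by norm_num) (by norm_num)]
  simp only [h, ENNReal.toReal_ofNat]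
  rw [← ENNReal.rpow_natCast, ← ENNReal.rpow_mul]
  norm_num

theorem aestronglyMeasurable_up {ω : Form n p} (h : AEStronglyMeasurable ω) :
    AEStronglyMeasurable (M.up ω) :=
  have hc : Continuous fun q : E n × Cov n p => M.lift p q.1 q.2 :=
    (M.smooth_lift.continuous.comp continuous_fst).clm_apply continuous_snd
  hc.comp_aestronglyMeasurable (aestronglyMeasurable_id.prodMk h)

theorem aestronglyMeasurable_down {u : E n → CoordSpace n p} (h : AEStronglyMeasurable u) :
    AEStronglyMeasurable (M.down u) :=
  have hc : Continuous fun q : E n × CoordSpace n p => M.unlift p q.1 q.2 :=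
    (M.smooth_unlift.continuous.comp continuous_fst).clm_apply continuous_snd
  hc.comp_aestronglyMeasurable (aestronglyMeasurable_id.prodMk h)

theorem memL2_iff {ω : Form n p} : MemL2 G ω ↔ MemLp (M.up ω) 2 volume := by
  constructor
  · rintro ⟨h1, h2⟩
    rw [M.normSq_eq] at h2
    refine ⟨M.aestronglyMeasurable_up h1, ?_⟩
    by_contra h
    rw [not_lt_top_iff.1 h] at h2
    simp at h2
  · rintro ⟨h1, h2⟩
    refine ⟨M.down_up ω ▸ M.aestronglyMeasurable_down h1, ?_⟩
    rw [M.normSq_eq]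
    exact ENNReal.pow_lt_top h2

theorem tendsto_normSq_iff {φ : ℕ → Form n p} {ω : Form n p} (hφ : ∀ k, MemL2 G (φ k))
    (hω : MemL2 G ω) : Tendsto (fun k => normSq G (φ k - ω)) atTop (𝓝 0) ↔
      Tendsto (fun k => l2n (M.up (φ k) - M.up ω)) atTop (𝓝 0) := by
  have hm : ∀ k, MemLp (M.up (φ k) - M.up ω) 2 volume := fun k =>
    (M.memL2_iff.1 (hφ k)).sub (M.memL2_iff.1 hω)
  have e : ∀ k, normSq G (φ k - ω) = ENNReal.ofReal (l2n (M.up (φ k) - M.up ω) ^ 2) := fun k => by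
    rw [M.normSq_eq, M.up_sub, l2n, ← ENNReal.toReal_pow,
      ENNReal.ofReal_toReal (ENNReal.pow_lt_top (hm k).2).ne]
  constructor
  · intro h
    have h1 := (ENNReal.tendsto_toReal ENNReal.zero_ne_top).comp h
    have h2 : Tendsto (fun k => √(l2n (M.up (φ k) - M.up ω) ^ 2)) atTop (𝓝 (√0)) := by
      refine (Real.continuous_sqrt.tendsto 0).comp (h1.congr fun k => ?_)
      simp [e, ENNReal.toReal_ofReal (sq_nonneg _)]
    simpa [Real.sqrt_sq (l2n_nonneg _)] using h2
  · intro h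
    have h1 : Tendsto (fun k => ENNReal.ofReal (l2n (M.up (φ k) - M.up ω) ^ 2)) atTop (𝓝 0) := by
      have := (ENNReal.continuous_ofReal.tendsto _).comp (h.pow 2)
      simpa [Function.comp_def] using this
    exact h1.congr fun k => (e k).symm

theorem memL2 {ω : Form n p} (h : IsTestForm ω) : MemL2 G ω :=
  M.memL2_iff.2 (M.isTestFun_up h).memLp

theorem isTestForm_codiff {ω : Form n (p + 1)} (h : IsTestForm ω) : IsTestForm (codiff G ω) :=
  ⟨contDiffOn_univ.1 (M.smooth_codiff h.1.contDiffOn),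
    h.2.of_isClosed_subset (isClosed_tsupport _) (tsupport_codiff ω)⟩

theorem isTestForm_laplacian {ω : Form n p} (h : IsTestForm ω) : IsTestForm (laplacian G ω) := by
  cases p with
  | zero => exact M.isTestForm_codiff h.extDeriv
  | succ p =>
    have h1 := (M.isTestForm_codiff h).extDeriv
    have h2 := M.isTestForm_codiff h.extDeriv
    exact ⟨h1.1.add h2.1, h1.2.add h2.2⟩

theorem l2Inner_comm (ω η : Form n p) : l2Inner G ω η = l2Inner G η ω := by
  rw [M.l2Inner_eq, M.l2Inner_eq]
  simp only [real_inner_comm]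

theorem l2Inner_add_left {ω η ψ : Form n p} (h1 : MemL2 G ω) (h2 : MemL2 G η) (h3 : MemL2 G ψ) :
    l2Inner G (ω + η) ψ = l2Inner G ω ψ + l2Inner G η ψ := by
  simp only [M.l2Inner_eq, up_add, Pi.add_apply, inner_add_left]
  exact integral_add (integrable_inner_of_memLp (M.memL2_iff.1 h1) (M.memL2_iff.1 h3))
    (integrable_inner_of_memLp (M.memL2_iff.1 h2) (M.memL2_iff.1 h3))

theorem l2Inner_add_right {ω η ψ : Form n p} (h1 : MemL2 G ω) (h2 : MemL2 G η) (h3 : MemL2 G ψ) :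
    l2Inner G ψ (ω + η) = l2Inner G ψ ω + l2Inner G ψ η := by
  rw [M.l2Inner_comm, M.l2Inner_add_left h1 h2 h3, M.l2Inner_comm ψ, M.l2Inner_comm ψ]

theorem l2Inner_smul_left (c : ℝ) (ω η : Form n p) :
    l2Inner G (c • ω) η = c * l2Inner G ω η := by
  simp only [M.l2Inner_eq, up_smul, Pi.smul_apply, real_inner_smul_left]
  exact integral_const_mul _ _

theorem l2Inner_self_nonneg (ω : Form n p) : 0 ≤ l2Inner G ω ω := by
  rw [M.l2Inner_eq]
  exact integral_nonneg fun x => real_inner_self_nonneg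

theorem l2Inner_self {ω : Form n p} (h : MemL2 G ω) : l2Inner G ω ω = l2n (M.up ω) ^ 2 := by
  rw [M.l2Inner_eq, l2n_sq (M.memL2_iff.1 h)]
  simp only [real_inner_self_eq_norm_sq]

theorem abs_l2Inner_le {ω η : Form n p} (h1 : MemL2 G ω) (h2 : MemL2 G η) :
    |l2Inner G ω η| ≤ l2n (M.up ω) * l2n (M.up η) := by
  rw [M.l2Inner_eq]
  exact abs_integral_inner_le (M.memL2_iff.1 h1) (M.memL2_iff.1 h2)

theorem tendsto_l2Inner {φ : ℕ → Form n p} {ω ψ : Form n p} (hφ : ∀ k, MemL2 G (φ k))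
    (hω : MemL2 G ω) (hψ : MemL2 G ψ) (h : Tendsto (fun k => normSq G (φ k - ω)) atTop (𝓝 0)) :
    Tendsto (fun k => l2Inner G (φ k) ψ) atTop (𝓝 (l2Inner G ω ψ)) := by
  simp only [M.l2Inner_eq]
  exact tendsto_integral_inner (fun k => M.memL2_iff.1 (hφ k)) (M.memL2_iff.1 hω)
    ((M.tendsto_normSq_iff hφ hω).1 h) (M.memL2_iff.1 hψ)

/-- Green's formula on the whole space. -/
theorem green_univ {φ : Form n p} (hφ : IsTestForm φ) {ψ : Form n (p + 1)} (hψ : IsTestForm ψ) :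
    l2Inner G (extDeriv φ) ψ = l2Inner G φ (codiff G ψ) :=
  M.green hφ (subset_univ _) hψ.1.contDiffOn

/-- The quadratic form of the Laplacian. -/
theorem l2Inner_laplacian_zero {φ ψ : Form n 0} (hφ : IsTestForm φ) (hψ : IsTestForm ψ) :
    l2Inner G (laplacian G φ) ψ = l2Inner G (extDeriv φ) (extDeriv ψ) := by
  rw [M.l2Inner_comm (extDeriv φ), M.green_univ hψ hφ.extDeriv, M.l2Inner_comm]
  rfl

theorem l2Inner_laplacian_succ {φ ψ : Form n (p + 1)} (hφ : IsTestForm φ) (hψ : IsTestForm ψ) :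
    l2Inner G (laplacian G φ) ψ =
      l2Inner G (codiff G φ) (codiff G ψ) + l2Inner G (extDeriv φ) (extDeriv ψ) := by
  have h1 := M.isTestForm_codiff hφ
  have h2 := M.isTestForm_codiff hφ.extDeriv
  have e : laplacian G φ = extDeriv (codiff G φ) + codiff G (extDeriv φ) := rfl
  rw [e, M.l2Inner_add_left (M.memL2 h1.extDeriv) (M.memL2 h2) (M.memL2 hψ),
    M.green_univ h1 hψ, M.l2Inner_comm (extDeriv φ), M.green_univ hψ hφ.extDeriv,
    M.l2Inner_comm ψ]

theorem l2Inner_laplacian_comm {φ ψ : Form n p} (hφ : IsTestForm φ) (hψ : IsTestForm ψ) :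
    l2Inner G (laplacian G φ) ψ = l2Inner G φ (laplacian G ψ) := by
  rw [M.l2Inner_comm φ]
  cases p with
  | zero => rw [M.l2Inner_laplacian_zero hφ hψ, M.l2Inner_laplacian_zero hψ hφ, M.l2Inner_comm]
  | succ p =>
    rw [M.l2Inner_laplacian_succ hφ hψ, M.l2Inner_laplacian_succ hψ hφ, M.l2Inner_comm,
      M.l2Inner_comm (extDeriv φ)]

theorem l2Inner_laplacian_self_nonneg {φ : Form n p} (hφ : IsTestForm φ) :
    0 ≤ l2Inner G (laplacian G φ) φ := by
  cases p with
  | zero => rw [M.l2Inner_laplacian_zero hφ hφ]; exact M.l2Inner_self_nonneg _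
  | succ p =>
    rw [M.l2Inner_laplacian_succ hφ hφ]
    exact add_nonneg (M.l2Inner_self_nonneg _) (M.l2Inner_self_nonneg _)

end MetricRoot

/-! ### Symbols of differential operators -/

section Symbols

variable {D W X Y Z : Type*} [NormedAddCommGroup D] [NormedSpace ℝ D]
  [NormedAddCommGroup W] [NormedSpace ℝ W]
  [NormedAddCommGroup X] [NormedSpace ℝ X] [NormedAddCommGroup Y] [NormedSpace ℝ Y]
  [NormedAddCommGroup Z] [NormedSpace ℝ Z]

/-- The operator `Q` has order one, smooth coefficients and principal symbol `σ`. -/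
def IsFirstOrder (Q : (D → X) → D → Y) (σ : D → (D →L[ℝ] X) →L[ℝ] Y) : Prop :=
  ContDiff ℝ (⊤ : ℕ∞) σ ∧ ∃ c : D → X →L[ℝ] Y, ContDiff ℝ (⊤ : ℕ∞) c ∧
    ∀ u, ContDiff ℝ (⊤ : ℕ∞) u → ∀ x, Q u x = σ x (fderiv ℝ u x) + c x (u x)

/-- The operator `Q` has order two and principal symbol `τ`. -/
def IsSecondOrder (Q : (D → X) → D → Y) (τ : D → (D →L[ℝ] D →L[ℝ] X) → Y) : Prop :=
  ∃ (b : D → (D →L[ℝ] X) →L[ℝ] Y) (c : D → X →L[ℝ] Y), Continuous b ∧ Continuous c ∧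
    ∀ u, ContDiff ℝ (⊤ : ℕ∞) u → ∀ x,
      Q u x = τ x (fderiv ℝ (fderiv ℝ u) x) + (b x (fderiv ℝ u x) + c x (u x))

theorem isFirstOrder_const (σ : (D →L[ℝ] X) →L[ℝ] Y) :
    IsFirstOrder (fun (u : D → X) x => σ (fderiv ℝ u x)) fun _ => σ :=
  ⟨contDiff_const, 0, contDiff_const, fun u _ x => by simp⟩

theorem IsFirstOrder.postcomp {Q : (D → X) → D → Y} {σ : D → (D →L[ℝ] X) →L[ℝ] Y}
    (h : IsFirstOrder Q σ) {B : D → Y →L[ℝ] Z} (hB : ContDiff ℝ (⊤ : ℕ∞) B) :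
    IsFirstOrder (fun u x => B x (Q u x)) fun x => B x ∘L σ x := by
  obtain ⟨h1, c, hc, h2⟩ := h
  exact ⟨hB.clm_comp h1, fun x => B x ∘L c x, hB.clm_comp hc, fun u hu x => by simp [h2 u hu x]⟩

theorem IsFirstOrder.precomp [FiniteDimensional ℝ D] [FiniteDimensional ℝ W]
    {Q : (D → X) → D → Y} {σ : D → (D →L[ℝ] X) →L[ℝ] Y}
    (h : IsFirstOrder Q σ) {A : D → W →L[ℝ] X} (hA : ContDiff ℝ (⊤ : ℕ∞) A) :
    IsFirstOrder (fun u => Q fun x => A x (u x))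
      fun x => σ x ∘L ContinuousLinearMap.compL ℝ D W X (A x) := by
  obtain ⟨h1, c, hc, h2⟩ := h
  have hA' : ContDiff ℝ (⊤ : ℕ∞) fun x => ContinuousLinearMap.compL ℝ D W X (A x) :=
    contDiff_clm_apply_iff.2 fun L => hA.clm_comp contDiff_const
  refine ⟨h1.clm_comp hA',
    fun x => σ x ∘L (fderiv ℝ A x).flip + c x ∘L A x, ?_, fun u hu x => ?_⟩
  · have hf : ContDiff ℝ (⊤ : ℕ∞) fun x => (fderiv ℝ A x).flip :=
      contDiff_clm_apply_iff.2 fun w => contDiff_clm_apply_iff.2 fun v =>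
        ((hA.fderiv_right (m := (⊤ : ℕ∞)) (by simp)).clm_apply contDiff_const).clm_apply
          contDiff_const
    exact (h1.clm_comp hf).add (hc.clm_comp hA)
  · beta_reduce
    rw [h2 _ (hA.clm_apply hu)]
    have e : fderiv ℝ (fun x => A x (u x)) x =
        A x ∘L fderiv ℝ u x + (fderiv ℝ A x).flip (u x) := by
      rw [fderiv_clm_apply (hA.differentiable (by simp) x) (hu.differentiable (by simp) x)]
    rw [e]
    simp [add_assoc]

theorem IsFirstOrder.comp {Q₁ : (D → X) → D → Y} {σ₁ : D → (D →L[ℝ] X) →L[ℝ] Y}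
    {Q₂ : (D → Y) → D → Z} {σ₂ : D → (D →L[ℝ] Y) →L[ℝ] Z}
    (h₂ : IsFirstOrder Q₂ σ₂) (h₁ : IsFirstOrder Q₁ σ₁) :
    IsSecondOrder (fun u => Q₂ (Q₁ u)) fun x H => σ₂ x (σ₁ x ∘L H) := by
  obtain ⟨hσ₁, c₁, hc₁, e₁⟩ := h₁
  obtain ⟨hσ₂, c₂, hc₂, e₂⟩ := h₂
  refine ⟨fun x => σ₂ x ∘L ((fderiv ℝ σ₁ x).flip +
      ContinuousLinearMap.compL ℝ D X Y (c₁ x)) + c₂ x ∘L σ₁ x,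
    fun x => σ₂ x ∘L (fderiv ℝ c₁ x).flip + c₂ x ∘L c₁ x, ?_, ?_, fun u hu x => ?_⟩
  · exact (hσ₂.continuous.clm_comp
      (((ContinuousLinearMap.flipₗᵢ ℝ D (D →L[ℝ] X) Y).continuous.comp
        (hσ₁.continuous_fderiv (by simp))).add
        ((ContinuousLinearMap.compL ℝ D X Y).continuous.comp hc₁.continuous))).add
        (hc₂.continuous.clm_comp hσ₁.continuous)
  · exact (hσ₂.continuous.clm_comp
      ((ContinuousLinearMap.flipₗᵢ ℝ D X Y).continuous.comp
        (hc₁.continuous_fderiv (by simp)))).add (hc₂.continuous.clm_comp hc₁.continuous)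
  · have hDu : ContDiff ℝ (⊤ : ℕ∞) (fderiv ℝ u) := hu.fderiv_right (by simp)
    have e : Q₁ u = fun x => σ₁ x (fderiv ℝ u x) + c₁ x (u x) := funext fun x => e₁ u hu x
    have hs : ContDiff ℝ (⊤ : ℕ∞) (Q₁ u) := by
      rw [e]; exact (hσ₁.clm_apply hDu).add (hc₁.clm_apply hu)
    have hd : fderiv ℝ (Q₁ u) x = (σ₁ x ∘L fderiv ℝ (fderiv ℝ u) x +
        (fderiv ℝ σ₁ x).flip (fderiv ℝ u x)) + (c₁ x ∘L fderiv ℝ u x +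
        (fderiv ℝ c₁ x).flip (u x)) := by
      rw [e, fderiv_fun_add ((hσ₁.clm_apply hDu).differentiable (by simp) x)
        ((hc₁.clm_apply hu).differentiable (by simp) x),
        fderiv_clm_apply (hσ₁.differentiable (by simp) x) (hDu.differentiable (by simp) x),
        fderiv_clm_apply (hc₁.differentiable (by simp) x) (hu.differentiable (by simp) x)]
    beta_reduce
    rw [e₂ _ hs, hd, e₁ u hu]
    simp only [map_add, add_apply, ContinuousLinearMap.comp_apply,
      ContinuousLinearMap.compL_apply]
    abel

theorem IsSecondOrder.add {Q₁ Q₂ : (D → X) → D → Y}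
    {τ₁ τ₂ : D → (D →L[ℝ] D →L[ℝ] X) → Y}
    (h₁ : IsSecondOrder Q₁ τ₁) (h₂ : IsSecondOrder Q₂ τ₂) :
    IsSecondOrder (fun u x => Q₁ u x + Q₂ u x) fun x H => τ₁ x H + τ₂ x H := by
  obtain ⟨b₁, c₁, hb₁, hc₁, e₁⟩ := h₁
  obtain ⟨b₂, c₂, hb₂, hc₂, e₂⟩ := h₂
  refine ⟨fun x => b₁ x + b₂ x, fun x => c₁ x + c₂ x, hb₁.add hb₂, hc₁.add hc₂,
    fun u hu x => ?_⟩
  beta_reduce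
  rw [e₁ u hu, e₂ u hu]
  simp only [add_apply]
  abel

end Symbols

namespace MetricRoot

variable {n p : ℕ} {G : MetricField n} (M : MetricRoot G univ)

/-- The Euclidean divergence of a form, as a function of its derivative. -/
def divergSymbol (n p : ℕ) : (E n →L[ℝ] Cov n (p + 1)) →L[ℝ] Cov n p :=
  ∑ j : Fin n, contr p (stdVec j) ∘L ContinuousLinearMap.apply ℝ (Cov n (p + 1)) (stdVec j)

theorem divergSymbol_apply (L : E n →L[ℝ] Cov n (p + 1)) :
    divergSymbol n p L = ∑ j, contr p (stdVec j) (L (stdVec j)) := by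
  simp [divergSymbol]

include M in
theorem isFirstOrder_codiff : ∃ σ : E n → (E n →L[ℝ] Cov n (p + 1)) →L[ℝ] Cov n p,
    IsFirstOrder (codiff G) σ ∧
    ∀ x L, σ x L = -∑ j, contr p (coMetric G x (stdVec j)) (L (stdVec j)) := by
  have hA : ContDiff ℝ (⊤ : ℕ∞) fun y => volDensity G y • pull (p + 1) (coMetric G y) :=
    contDiff_clm_apply_iff.2 fun α => (contDiffOn_univ.1 M.smooth_vol).smul
      ((contDiffOn_univ.1 (contDiffOn_pull M.smooth_coMetric)).clm_apply contDiff_const)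
  have hB : ContDiff ℝ (⊤ : ℕ∞) fun y => -((volDensity G y)⁻¹ • pull p (G y)) :=
    contDiff_clm_apply_iff.2 fun α => (((contDiffOn_univ.1 M.smooth_vol).inv
      fun x => (M.vol_pos x (mem_univ x)).ne').smul
      ((contDiffOn_univ.1 (contDiffOn_pull M.smooth_G)).clm_apply contDiff_const)).neg
  have h := ((isFirstOrder_const (divergSymbol n p)).precomp hA).postcomp hB
  have e : (fun (u : E n → Cov n (p + 1)) x => (-((volDensity G x)⁻¹ • pull p (G x)))
      (divergSymbol n p (fderiv ℝ (fun x => (volDensity G x • pull (p + 1) (coMetric G x)) (u x))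
        x))) = codiff G := by
    funext u x
    rw [codiff_eq, divergSymbol_apply]
    rfl
  rw [e] at h
  refine ⟨_, h, fun x L => ?_⟩
  have hv := (M.vol_pos x (mem_univ x)).ne'
  have e1 : ∀ (v : E n) (α : Cov n (p + 1)), contr p v (pull (p + 1) (coMetric G x) α) =
      pull p (coMetric G x) (contr p (coMetric G x v) α) := fun v α =>
    ContinuousAlternatingMap.curryLeft_compContinuousLinearMap _ _ _
  have e2 : ∀ α : Cov n p, pull p (G x) (pull p (coMetric G x) α) = α := fun α => by
    rw [pull_pull, M.coMetric_comp (mem_univ x), pull_id]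
  simp only [ContinuousLinearMap.comp_apply, divergSymbol_apply, ContinuousLinearMap.compL_apply,
    neg_apply, smul_apply, map_smul, e1, map_sum, e2, Finset.smul_sum, smul_neg, smul_smul,
    mul_inv_cancel₀ hv, one_smul, Finset.sum_neg_distrib]

theorem isFirstOrder_extDeriv : IsFirstOrder (extDeriv : Form n p → Form n (p + 1))
    fun _ => ContinuousAlternatingMap.alternatizeUncurryFinCLM ℝ (E n) ℝ :=
  isFirstOrder_const _

/-- The composition of the codifferential with the exterior derivative. -/
theorem isSecondOrder_codiff_extDeriv :
    ∃ τ : E n → (E n →L[ℝ] E n →L[ℝ] CoordSpace n p) → CoordSpace n p,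
    IsSecondOrder (fun (u : E n → CoordSpace n p) => M.up (codiff G (extDeriv (M.down u)))) τ ∧
    ∀ x H, τ x H = M.lift p x (-∑ j, contr p (coMetric G x (stdVec j))
      (ContinuousAlternatingMap.alternatizeUncurryFin (M.unlift p x ∘L H (stdVec j)))) := by
  obtain ⟨σ, h1, h2⟩ := M.isFirstOrder_codiff (p := p)
  refine ⟨_, (h1.postcomp (M.smooth_lift (p := p))).comp
    ((isFirstOrder_extDeriv (p := p)).precomp (M.smooth_unlift (p := p))), fun x H => ?_⟩
  simp only [ContinuousLinearMap.comp_apply, h2]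
  rfl

/-- The composition of the exterior derivative with the codifferential. -/
theorem isSecondOrder_extDeriv_codiff :
    ∃ τ : E n → (E n →L[ℝ] E n →L[ℝ] CoordSpace n (p + 1)) → CoordSpace n (p + 1),
    IsSecondOrder (fun (u : E n → CoordSpace n (p + 1)) =>
      M.up (extDeriv (codiff G (M.down u)))) τ ∧
    ∀ x H, (∀ v w, H v w = H w v) → τ x H = M.lift (p + 1) x
      (-∑ j, ContinuousAlternatingMap.alternatizeUncurryFin
        (contr p (coMetric G x (stdVec j)) ∘L (M.unlift (p + 1) x ∘L H (stdVec j)))) := by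
  obtain ⟨σ, h1, h2⟩ := M.isFirstOrder_codiff (p := p)
  refine ⟨_, ((isFirstOrder_extDeriv (p := p)).postcomp (M.smooth_lift (p := p + 1))).comp
    (h1.precomp (M.smooth_unlift (p := p + 1))), fun x H hH => ?_⟩
  have e : (σ x ∘L ContinuousLinearMap.compL ℝ (E n) (CoordSpace n (p + 1)) (Cov n (p + 1))
      (M.unlift (p + 1) x)) ∘L H = -∑ j, contr p (coMetric G x (stdVec j)) ∘L
        (M.unlift (p + 1) x ∘L H (stdVec j)) := by
    ext1 v
    simp only [ContinuousLinearMap.comp_apply, h2, ContinuousLinearMap.compL_apply, neg_apply,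
      sum_apply]
    simp only [hH v]
  rw [ContinuousLinearMap.comp_apply, e, map_neg, map_sum]
  rfl

/-- The Laplace-Beltrami operator has the scalar principal part `coMetric G`. -/
theorem isSecondOrder_laplacian :
    ∃ τ : E n → (E n →L[ℝ] E n →L[ℝ] CoordSpace n p) → CoordSpace n p,
    IsSecondOrder (fun (u : E n → CoordSpace n p) => M.up (laplacian G (M.down u))) τ ∧
    ∀ x H, (∀ v w, H v w = H w v) → τ x H = -∑ j, H (stdVec j) (coMetric G x (stdVec j)) := by
  cases p with
  | zero =>
    obtain ⟨τ, h1, h2⟩ := M.isSecondOrder_codiff_extDeriv (p := 0)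
    refine ⟨τ, h1, fun x H _ => ?_⟩
    simp only [h2, contr_apply, curryLeft_alternatize_zero, ContinuousLinearMap.comp_apply,
      map_neg, map_sum, M.lift_unlift]
  | succ p =>
    obtain ⟨τ, h1, h2⟩ := M.isSecondOrder_codiff_extDeriv (p := p + 1)
    obtain ⟨τ', h1', h2'⟩ := M.isSecondOrder_extDeriv_codiff (p := p)
    refine ⟨fun x H => τ' x H + τ x H, ?_, ?_⟩
    · have := h1'.add h1
      convert this using 2 with u
      exact M.up_add _ _
    · intro x H hH
      -- The alternated terms of `dδ` and `δd` cancel.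
      have e : ∀ j, contr (p + 1) (coMetric G x (stdVec j))
          (ContinuousAlternatingMap.alternatizeUncurryFin (M.unlift (p + 1) x ∘L H (stdVec j))) =
          M.unlift (p + 1) x (H (stdVec j) (coMetric G x (stdVec j))) -
          ContinuousAlternatingMap.alternatizeUncurryFin
            (contr p (coMetric G x (stdVec j)) ∘L (M.unlift (p + 1) x ∘L H (stdVec j))) :=
        fun j => curryLeft_alternatize _ _
      simp only [h2, h2' x H hH, e, ← map_add, Finset.sum_sub_distrib]
      rw [neg_sub, neg_add_eq_sub, sub_sub_cancel_left, map_neg, map_sum]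
      simp only [M.lift_unlift]

end MetricRoot

/-! ### Limits of the derivatives of an approximating sequence -/

theorem IsFirstOrder.map_sub {D X Y : Type*} [NormedAddCommGroup D] [NormedSpace ℝ D]
    [NormedAddCommGroup X] [NormedSpace ℝ X] [NormedAddCommGroup Y] [NormedSpace ℝ Y]
    {Q : (D → X) → D → Y} {σ : D → (D →L[ℝ] X) →L[ℝ] Y} (h : IsFirstOrder Q σ) {u w : D → X}
    (hu : ContDiff ℝ (⊤ : ℕ∞) u) (hw : ContDiff ℝ (⊤ : ℕ∞) w) : Q (u - w) = Q u - Q w := by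
  obtain ⟨-, c, -, h2⟩ := h
  funext x
  have : fderiv ℝ (u - w) x = fderiv ℝ u x - fderiv ℝ w x :=
    fderiv_sub (hu.differentiable (by simp) x) (hw.differentiable (by simp) x)
  rw [h2 (u - w) (hu.sub hw), this]
  simp only [Pi.sub_apply, _root_.map_sub, h2 u hu, h2 w hw]
  abel

theorem two_le_minSmoothness : minSmoothness ℝ 2 ≤ ((⊤ : ℕ∞) : WithTop ℕ∞) := by
  rw [minSmoothness_of_isRCLikeNormedField]
  exact WithTop.coe_le_coe.2 (le_top : (2 : ℕ∞) ≤ ⊤)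

theorem IsTestForm.sub {n p : ℕ} {ω η : Form n p} (h1 : IsTestForm ω) (h2 : IsTestForm η) :
    IsTestForm (ω - η) := ⟨h1.1.sub h2.1, h1.2.sub h2.2⟩

namespace MetricRoot

variable {n p : ℕ} {G : MetricField n} (M : MetricRoot G univ)

include M

theorem exists_scalarOp : ∃ P : ScalarOp n (CoordSpace n p), P.a = coMetric G ∧
    ∀ u, ContDiff ℝ (⊤ : ℕ∞) u → P.op u = M.up (laplacian G (M.down u)) + u := by
  obtain ⟨τ, ⟨b, c, hb, hc, h1⟩, h2⟩ := M.isSecondOrder_laplacian (p := p)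
  have ha := contDiffOn_univ.1 M.smooth_coMetric
  have hDa : ∀ i, Continuous fun x => fderiv ℝ (coMetric G) x (stdVec i) (stdVec i) := fun i =>
    ((ha.continuous_fderiv (by simp)).clm_apply continuous_const).clm_apply continuous_const
  -- The difference between `∑ aᵢⱼ ∂ᵢ∂ⱼ u` and `∑ ∂ᵢ (aᵢⱼ ∂ⱼ u)` is absorbed by the first order terms.
  obtain ⟨b', hb', hbe⟩ : ∃ b' : E n → (E n →L[ℝ] CoordSpace n p) →L[ℝ] CoordSpace n p,
      Continuous b' ∧ ∀ x L, b' x L = b x L +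
        ∑ i, L (fderiv ℝ (coMetric G) x (stdVec i) (stdVec i)) := by
    refine ⟨fun x => b x + ∑ i, ContinuousLinearMap.apply ℝ (CoordSpace n p)
      (fderiv ℝ (coMetric G) x (stdVec i) (stdVec i)), ?_, fun x L => by simp⟩
    refine hb.add (continuous_finsetSum _ fun i _ => ?_)
    exact continuous_clm_apply.2 fun L => L.continuous.comp (hDa i)
  have hpos : ∀ x v, v ≠ 0 → 0 < ⟪coMetric G x v, v⟫_ℝ := fun x v hv => by
    have h0 : M.T x v ≠ 0 := fun h => hv <| by
      have : M.S x (M.T x v) = v := congrArg (fun f => f v) (M.S_comp_T x (mem_univ x))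
      rw [← this, h, map_zero]
    rw [M.coMetric_eq (mem_univ x), ContinuousLinearMap.comp_apply, M.symm_T x (mem_univ x)]
    exact real_inner_self_pos.2 h0
  refine ⟨⟨coMetric G, b', fun x => c x + ContinuousLinearMap.id ℝ _, ha, hb',
    hc.add continuous_const, fun x => M.symm_coMetric (mem_univ x), hpos⟩, rfl, fun u hu => ?_⟩
  · have hDu : ContDiff ℝ (⊤ : ℕ∞) (fderiv ℝ u) := hu.fderiv_right (by simp)
    funext x
    have hH : ∀ v w, fderiv ℝ (fderiv ℝ u) x v w = fderiv ℝ (fderiv ℝ u) x w v :=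
      fun v w => (hu.contDiffAt.isSymmSndFDerivAt two_le_minSmoothness) v w
    have hfl : ∀ i : Fin n, fderiv ℝ (fun x => fderiv ℝ u x (coMetric G x (stdVec i))) x
        (stdVec i) = fderiv ℝ (fderiv ℝ u) x (stdVec i) (coMetric G x (stdVec i)) +
          fderiv ℝ u x (fderiv ℝ (coMetric G) x (stdVec i) (stdVec i)) := fun i => by
      rw [fderiv_clm_apply (hDu.differentiable (by simp) x)
        ((ha.clm_apply contDiff_const).differentiable (by simp) x),
        fderiv_clm_apply (ha.differentiable (by simp) x) (differentiableAt_const _)]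
      simp [add_comm]
    have hL := h1 u hu x
    rw [h2 x _ hH] at hL
    change -(∑ i, fderiv ℝ (fun x => fderiv ℝ u x (coMetric G x (stdVec i))) x (stdVec i)) +
      (b' x (fderiv ℝ u x) + (c x + ContinuousLinearMap.id ℝ (CoordSpace n p)) (u x)) =
        M.up (laplacian G (M.down u)) x + u x
    rw [show M.up (laplacian G (M.down u)) x = _ from hL]
    simp only [hfl, Finset.sum_add_distrib, add_apply, hbe, ContinuousLinearMap.id_apply]
    abel

/-- The completeness of the metric, in the form used here: there are cutoff functions with small
gradient. -/
def HasCutoffs (G : MetricField n) : Prop :=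
  ∀ R δ : ℝ, 0 < δ → ∃ χ : E n → ℝ, IsTestFun χ ∧ (∀ x, ‖x‖ ≤ R → χ x = 1) ∧
    ∀ x, ∑ i, fderiv ℝ χ x (coMetric G x (stdVec i)) * fderiv ℝ χ x (stdVec i) ≤ δ

/-- On a complete manifold, a weak eigenform is in the domain of the closure of the Laplacian. -/
theorem laplacianGraph_of_weak (hcut : HasCutoffs G) {η : Form n p} (hη : MemL2 G η) {μ : ℝ}
    (hweak : ∀ ψ : Form n p, IsTestForm ψ → l2Inner G η (laplacian G ψ) = μ * l2Inner G η ψ) :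
    LaplacianGraph G η (μ • η) := by
  obtain ⟨P, hPa, hP⟩ := M.exists_scalarOp (p := p)
  have hop : ∀ u, IsTestFun u → ∀ w : Form n p, MemL2 G w →
      ∫ x, ⟪P.op u x, M.up w x⟫_ℝ = l2Inner G (laplacian G (M.down u)) w +
        l2Inner G (M.down u) w := fun u hu w hw => by
    rw [M.l2Inner_eq, M.l2Inner_eq, M.up_down, hP u hu.1]
    simp only [Pi.add_apply, inner_add_left]
    exact integral_add (integrable_inner_of_memLp
      (M.isTestFun_up (M.isTestForm_laplacian (M.isTestForm_down hu))).memLp (M.memL2_iff.1 hw))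
      (integrable_inner_of_memLp hu.memLp (M.memL2_iff.1 hw))
  have hsymm : ∀ u h, IsTestFun u → IsTestFun h →
      ∫ x, ⟪P.op u x, h x⟫_ℝ = ∫ x, ⟪u x, P.op h x⟫_ℝ := fun u h hu hh => by
    have e1 := hop u hu _ (M.memL2 (M.isTestForm_down hh))
    have e2 := hop h hh _ (M.memL2 (M.isTestForm_down hu))
    rw [M.up_down] at e1 e2
    have e3 : ∫ x, ⟪u x, P.op h x⟫_ℝ = ∫ x, ⟪P.op h x, u x⟫_ℝ := by simp only [real_inner_comm]
    rw [e1, e3, e2, M.l2Inner_laplacian_comm (M.isTestForm_down hu) (M.isTestForm_down hh),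
      M.l2Inner_comm (M.down u) (laplacian G _), M.l2Inner_comm (M.down u) (M.down h)]
  -- The operator `P` is `Δ + 1`, which is bounded below by `1`.
  have hcoer : ∀ u, IsTestFun u → ∫ x, ‖u x‖ ^ 2 ≤ ∫ x, ⟪P.op u x, u x⟫_ℝ := fun u hu => by
    have e1 := hop u hu _ (M.memL2 (M.isTestForm_down hu))
    rw [M.l2Inner_self (M.memL2 (M.isTestForm_down hu)), M.up_down, l2n_sq hu.memLp] at e1
    have := M.l2Inner_laplacian_self_nonneg (M.isTestForm_down hu)
    linarith
  have hcut' : ∀ R δ : ℝ, 0 < δ → ∃ χ : E n → ℝ, IsTestFun χ ∧ (∀ x, ‖x‖ ≤ R → χ x = 1) ∧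
      ∀ x, P.gradSq χ x ≤ δ := by
    simp only [ScalarOp.gradSq, hPa]
    exact hcut
  have hv := M.memL2_iff.1 hη
  have hμη : MemL2 G (μ • η) := M.memL2_iff.2 (by rw [up_smul]; exact hv.const_smul μ)
  obtain ⟨u, hu, l1, l2⟩ := ScalarOp.exists_approx_of_weak_eigen hsymm hcoer hcut' hv
    (c := μ + 1) fun u hu => by
      have e : ∫ x, ⟪M.up η x, P.op u x⟫_ℝ = ∫ x, ⟪P.op u x, M.up η x⟫_ℝ := by
        simp only [real_inner_comm]
      have e' : ∫ x, ⟪M.up η x, u x⟫_ℝ = l2Inner G η (M.down u) := by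
        rw [M.l2Inner_eq, M.up_down]
      rw [e, e', hop u hu η hη, M.l2Inner_comm, hweak _ (M.isTestForm_down hu),
        M.l2Inner_comm _ η]
      ring
  have hd : ∀ k, IsTestForm (M.down (u k)) := fun k => M.isTestForm_down (hu k)
  refine ⟨hη, hμη, fun k => M.down (u k), hd, ?_, ?_⟩
  · rw [M.tendsto_normSq_iff (fun k => M.memL2 (hd k)) hη]
    simpa only [M.up_down] using l1
  · rw [M.tendsto_normSq_iff (fun k => M.memL2 (M.isTestForm_laplacian (hd k))) hμη]
    refine squeeze_zero (fun _ => l2n_nonneg _) (fun k => ?_) (by simpa using l2.add l1)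
    have e : M.up (laplacian G (M.down (u k))) - M.up (μ • η) =
        (P.op (u k) - (μ + 1) • M.up η) - (u k - M.up η) := by
      rw [hP _ (hu k).1, up_smul, add_smul, one_smul]; abel
    rw [e]
    exact l2n_sub_le (((ScalarOp.op_memLp (hu k)).sub (hv.const_smul _)))
      ((hu k).memLp.sub hv)

theorem extDeriv_sub {φ ψ : Form n p} (hφ : IsTestForm φ) (hψ : IsTestForm ψ) :
    extDeriv (φ - ψ) = extDeriv φ - extDeriv ψ :=
  isFirstOrder_extDeriv.map_sub hφ.1 hψ.1

theorem codiff_sub {φ ψ : Form n (p + 1)} (hφ : IsTestForm φ) (hψ : IsTestForm ψ) :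
    codiff G (φ - ψ) = codiff G φ - codiff G ψ := by
  obtain ⟨σ, h, -⟩ := M.isFirstOrder_codiff (p := p)
  exact h.map_sub hφ.1 hψ.1

theorem laplacian_sub {φ ψ : Form n (p + 1)} (hφ : IsTestForm φ) (hψ : IsTestForm ψ) :
    laplacian G (φ - ψ) = laplacian G φ - laplacian G ψ := by
  simp only [laplacian]
  rw [M.extDeriv_sub hφ hψ, M.codiff_sub hφ hψ, M.codiff_sub hφ.extDeriv hψ.extDeriv,
    M.extDeriv_sub (M.isTestForm_codiff hφ) (M.isTestForm_codiff hψ)]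
  abel

/-- A sequence of test forms which is Cauchy for the graph norm of the Laplacian has convergent
exterior derivatives and codifferentials. -/
theorem exists_limits {φ : ℕ → Form n (p + 1)} (hφ : ∀ k, IsTestForm (φ k)) {Φ Ψ : Form n (p + 1)}
    (hΦ : MemL2 G Φ) (hΨ : MemL2 G Ψ) (h1 : Tendsto (fun k => normSq G (φ k - Φ)) atTop (𝓝 0))
    (h2 : Tendsto (fun k => normSq G (laplacian G (φ k) - Ψ)) atTop (𝓝 0)) :
    (∃ η, MemL2 G η ∧ Tendsto (fun k => normSq G (extDeriv (φ k) - η)) atTop (𝓝 0)) ∧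
    ∃ ζ, MemL2 G ζ ∧ Tendsto (fun k => normSq G (codiff G (φ k) - ζ)) atTop (𝓝 0) := by
  rw [M.tendsto_normSq_iff (fun k => M.memL2 (hφ k)) hΦ] at h1
  rw [M.tendsto_normSq_iff (fun k => M.memL2 (M.isTestForm_laplacian (hφ k))) hΨ] at h2
  set A := fun k => l2n (M.up (φ k) - M.up Φ) with hA
  set B := fun k => l2n (M.up (laplacian G (φ k)) - M.up Ψ) with hB
  have hAk : ∀ k l, l2n (M.up (φ k - φ l)) ≤ A k + A l := fun k l => by
    have := l2n_sub_le ((M.isTestFun_up (hφ k)).memLp.sub (M.memL2_iff.1 hΦ))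
      ((M.isTestFun_up (hφ l)).memLp.sub (M.memL2_iff.1 hΦ))
    rwa [sub_sub_sub_cancel_right, ← up_sub] at this
  have hBk : ∀ k l, l2n (M.up (laplacian G (φ k - φ l))) ≤ B k + B l := fun k l => by
    have := l2n_sub_le
      ((M.isTestFun_up (M.isTestForm_laplacian (hφ k))).memLp.sub (M.memL2_iff.1 hΨ))
      ((M.isTestFun_up (M.isTestForm_laplacian (hφ l))).memLp.sub (M.memL2_iff.1 hΨ))
    rwa [sub_sub_sub_cancel_right, ← up_sub, ← M.laplacian_sub (hφ k) (hφ l)] at this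
  -- The energy identity `‖δφ‖² + ‖dφ‖² = ⟨Δφ, φ⟩`, applied to differences.
  have hE : ∀ k l, l2n (M.up (codiff G (φ k - φ l))) ^ 2 + l2n (M.up (extDeriv (φ k - φ l))) ^ 2 ≤
      (B k + B l) * (A k + A l) := fun k l => by
    have ht := (hφ k).sub (hφ l)
    rw [← M.l2Inner_self (M.memL2 (M.isTestForm_codiff ht)),
      ← M.l2Inner_self (M.memL2 ht.extDeriv), ← M.l2Inner_laplacian_succ ht ht]
    refine ((abs_le.1 (M.abs_l2Inner_le (M.memL2 (M.isTestForm_laplacian ht))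
      (M.memL2 ht))).2).trans ?_
    exact mul_le_mul (hBk k l) (hAk k l) (l2n_nonneg _)
      (add_nonneg (l2n_nonneg _) (l2n_nonneg _))
  have hN : ∀ ε : ℝ, 0 < ε → ∃ N, ∀ k ≥ N, ∀ l ≥ N, (B k + B l) * (A k + A l) < ε ^ 2 := by
    intro ε hε
    obtain ⟨N, hN⟩ := ((h1.eventually_lt_const (half_pos hε)).and
      (h2.eventually_lt_const (half_pos hε))).exists_forall_of_atTop
    refine ⟨N, fun k hk l hl => ?_⟩
    have a1 := hN k hk
    have a2 := hN l hl
    have : 0 ≤ A k + A l := add_nonneg (l2n_nonneg _) (l2n_nonneg _)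
    have : 0 ≤ B k + B l := add_nonneg (l2n_nonneg _) (l2n_nonneg _)
    have b1 : A k + A l < ε := by linarith [a1.1, a2.1]
    have b2 : B k + B l < ε := by linarith [a1.2, a2.2]
    nlinarith
  constructor
  · obtain ⟨v, hv, hlim⟩ := exists_l2n_limit (f := fun k => M.up (extDeriv (φ k)))
      (fun k => (M.isTestFun_up (hφ k).extDeriv).memLp) (fun ε hε => by
        obtain ⟨N, hN⟩ := hN ε hε
        refine ⟨N, fun k hk l hl => lt_of_pow_lt_pow_left₀ 2 hε.le ?_⟩
        rw [← up_sub, ← M.extDeriv_sub (hφ k) (hφ l)]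
        have := hE k l
        have := hN k hk l hl
        nlinarith [sq_nonneg (l2n (M.up (codiff G (φ k - φ l))))])
    have hη : MemL2 G (M.down v) := M.memL2_iff.2 (by rwa [up_down])
    refine ⟨M.down v, hη, ?_⟩
    rw [M.tendsto_normSq_iff (fun k => M.memL2 (hφ k).extDeriv) hη, up_down]
    exact hlim
  · obtain ⟨v, hv, hlim⟩ := exists_l2n_limit (f := fun k => M.up (codiff G (φ k)))
      (fun k => (M.isTestFun_up (M.isTestForm_codiff (hφ k))).memLp) (fun ε hε => by
        obtain ⟨N, hN⟩ := hN ε hε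
        refine ⟨N, fun k hk l hl => lt_of_pow_lt_pow_left₀ 2 hε.le ?_⟩
        rw [← up_sub, ← M.codiff_sub (hφ k) (hφ l)]
        have := hE k l
        have := hN k hk l hl
        nlinarith [sq_nonneg (l2n (M.up (extDeriv (φ k - φ l))))])
    have hη : MemL2 G (M.down v) := M.memL2_iff.2 (by rwa [up_down])
    refine ⟨M.down v, hη, ?_⟩
    rw [M.tendsto_normSq_iff (fun k => M.memL2 (M.isTestForm_codiff (hφ k))) hη, up_down]
    exact hlim

theorem extDeriv_extDeriv_test {φ : Form n p} (hφ : IsTestForm φ) :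
    extDeriv (extDeriv φ) = 0 :=
  extDeriv_extDeriv hφ.1 two_le_minSmoothness

theorem l2Inner_zero_left (ψ : Form n p) : l2Inner G 0 ψ = 0 := by
  have := M.l2Inner_smul_left 0 0 ψ
  simpa using this

/-- The exterior derivatives and the codifferentials of test forms are orthogonal. -/
theorem l2Inner_extDeriv_codiff {φ : Form n p} (hφ : IsTestForm φ) {ψ : Form n (p + 2)}
    (hψ : IsTestForm ψ) : l2Inner G (extDeriv φ) (codiff G ψ) = 0 := by
  rw [← M.green_univ hφ.extDeriv hψ, M.extDeriv_extDeriv_test hφ, M.l2Inner_zero_left]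

/-- The Laplacian commutes with the exterior derivative, weakly. -/
theorem l2Inner_extDeriv_laplacian {φ : Form n (p + 1)} (hφ : IsTestForm φ)
    {ψ : Form n (p + 2)} (hψ : IsTestForm ψ) :
    l2Inner G (extDeriv φ) (laplacian G ψ) = l2Inner G (laplacian G φ) (codiff G ψ) := by
  have h1 := M.isTestForm_codiff hψ
  have h2 := M.isTestForm_codiff hφ
  have e : laplacian G ψ = extDeriv (codiff G ψ) + codiff G (extDeriv ψ) := rfl
  rw [e, M.l2Inner_add_right (M.memL2 h1.extDeriv) (M.memL2 (M.isTestForm_codiff hψ.extDeriv))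
    (M.memL2 hφ.extDeriv), M.l2Inner_extDeriv_codiff hφ hψ.extDeriv,
    M.l2Inner_laplacian_succ hφ h1, ← M.green_univ h2 h1, M.l2Inner_extDeriv_codiff h2 hψ]
  ring

/-- The Laplacian commutes with the codifferential, weakly. -/
theorem l2Inner_codiff_laplacian {φ : Form n (p + 1)} (hφ : IsTestForm φ)
    {ψ : Form n p} (hψ : IsTestForm ψ) :
    l2Inner G (codiff G φ) (laplacian G ψ) = l2Inner G (laplacian G φ) (extDeriv ψ) := by
  have h2 := M.isTestForm_codiff hφ
  have hz : l2Inner G (extDeriv φ) (extDeriv (extDeriv ψ)) = 0 := by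
    rw [M.extDeriv_extDeriv_test hψ, M.l2Inner_comm, M.l2Inner_zero_left]
  rw [M.l2Inner_laplacian_succ hφ hψ.extDeriv, hz, add_zero]
  cases p with
  | zero => rfl
  | succ p =>
    have h1 := M.isTestForm_codiff hψ
    have e : laplacian G ψ = extDeriv (codiff G ψ) + codiff G (extDeriv ψ) := rfl
    rw [e, M.l2Inner_add_right (M.memL2 h1.extDeriv) (M.memL2 (M.isTestForm_codiff hψ.extDeriv))
      (M.memL2 h2), M.l2Inner_comm (codiff G φ), M.l2Inner_extDeriv_codiff h1 hφ, zero_add]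

/-- On a complete manifold, the exterior derivative and the codifferential of an eigenform are
square integrable, and they are in the domain of the Laplacian with the same eigenvalue. -/
theorem exists_derivatives (hcut : HasCutoffs G) {μ : ℝ} {Φ : Form n (p + 1)}
    (h : LaplacianGraph G Φ (μ • Φ)) :
    ∃ φ : ℕ → Form n (p + 1), (∀ k, IsTestForm (φ k)) ∧
      Tendsto (fun k => normSq G (φ k - Φ)) atTop (𝓝 0) ∧
      (∃ η, MemL2 G η ∧ Tendsto (fun k => normSq G (extDeriv (φ k) - η)) atTop (𝓝 0) ∧
        HasExtDeriv G Φ η ∧ LaplacianGraph G η (μ • η)) ∧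
      ∃ ζ, MemL2 G ζ ∧ Tendsto (fun k => normSq G (codiff G (φ k) - ζ)) atTop (𝓝 0) ∧
        HasCodiff G Φ ζ ∧ LaplacianGraph G ζ (μ • ζ) := by
  obtain ⟨hΦ, hμΦ, φ, hφ, l1, l2⟩ := h
  obtain ⟨⟨η, hη, l3⟩, ζ, hζ, l4⟩ := M.exists_limits hφ hΦ hμΦ l1 l2
  have mφ : ∀ k, MemL2 G (φ k) := fun k => M.memL2 (hφ k)
  have mΔ : ∀ k, MemL2 G (laplacian G (φ k)) := fun k => M.memL2 (M.isTestForm_laplacian (hφ k))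
  have md : ∀ k, MemL2 G (extDeriv (φ k)) := fun k => M.memL2 (hφ k).extDeriv
  have mδ : ∀ k, MemL2 G (codiff G (φ k)) := fun k => M.memL2 (M.isTestForm_codiff (hφ k))
  have e1 : HasExtDeriv G Φ η := fun ψ hψ => by
    have a1 := M.tendsto_l2Inner md hη (M.memL2 hψ) l3
    have a2 := M.tendsto_l2Inner mφ hΦ (M.memL2 (M.isTestForm_codiff hψ)) l1
    exact tendsto_nhds_unique a1 (a2.congr fun k => (M.green_univ (hφ k) hψ).symm)
  have e2 : HasCodiff G Φ ζ := fun ψ hψ => by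
    have a1 := M.tendsto_l2Inner mδ hζ (M.memL2 hψ) l4
    have a2 := M.tendsto_l2Inner mφ hΦ (M.memL2 hψ.extDeriv) l1
    refine tendsto_nhds_unique a1 (a2.congr fun k => ?_)
    rw [M.l2Inner_comm, M.green_univ hψ (hφ k), M.l2Inner_comm]
  refine ⟨φ, hφ, l1, ⟨η, hη, l3, e1, M.laplacianGraph_of_weak hcut hη fun ψ hψ => ?_⟩,
    ζ, hζ, l4, e2, M.laplacianGraph_of_weak hcut hζ fun ψ hψ => ?_⟩
  · have a1 := M.tendsto_l2Inner md hη (M.memL2 (M.isTestForm_laplacian hψ)) l3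
    have a2 := M.tendsto_l2Inner mΔ hμΦ (M.memL2 (M.isTestForm_codiff hψ)) l2
    rw [M.l2Inner_smul_left, ← e1 ψ hψ] at a2
    exact tendsto_nhds_unique a1
      (a2.congr fun k => (M.l2Inner_extDeriv_laplacian (hφ k) hψ).symm)
  · have a1 := M.tendsto_l2Inner mδ hζ (M.memL2 (M.isTestForm_laplacian hψ)) l4
    have a2 := M.tendsto_l2Inner mΔ hμΦ (M.memL2 hψ.extDeriv) l2
    rw [M.l2Inner_smul_left, ← e2 ψ hψ] at a2
    exact tendsto_nhds_unique a1
      (a2.congr fun k => (M.l2Inner_codiff_laplacian (hφ k) hψ).symm)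

end MetricRoot

/-! ### Cutoff functions -/

/-- A smooth step from `1` on `(-∞, 1]` to `0` on `[2, ∞)`. -/
def smoothStep (t : ℝ) : ℝ := Real.smoothTransition (2 - t)

theorem smoothStep_contDiff : ContDiff ℝ (⊤ : ℕ∞) smoothStep :=
  Real.smoothTransition.contDiff.comp (contDiff_const.sub contDiff_id)

theorem smoothStep_of_le {t : ℝ} (ht : t ≤ 1) : smoothStep t = 1 :=
  Real.smoothTransition.one_of_one_le (by linarith)

theorem smoothStep_of_ge {t : ℝ} (ht : 2 ≤ t) : smoothStep t = 0 :=
  Real.smoothTransition.zero_of_nonpos (by linarith)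

theorem exists_deriv_smoothStep_bound : ∃ C, 0 < C ∧ ∀ t, |deriv smoothStep t| ≤ C := by
  obtain ⟨C, hC⟩ := (isCompact_Icc (a := (1 : ℝ)) (b := 2)).exists_bound_of_continuousOn
    (smoothStep_contDiff.continuous_deriv (by simp)).continuousOn
  refine ⟨max C 1, by positivity, fun t => ?_⟩
  by_cases h : t ∈ Icc (1 : ℝ) 2
  · exact (hC t h).trans (le_max_left _ _)
  · have h0 : deriv smoothStep t = 0 := by
      rcases lt_or_ge t 1 with h1 | h1
      · have : smoothStep =ᶠ[𝓝 t] fun _ => 1 := by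
          filter_upwards [Iio_mem_nhds h1] with s hs using smoothStep_of_le (le_of_lt hs)
        rw [this.deriv_eq, deriv_const]
      · have h2 : 2 < t := not_le.1 fun h2 => h ⟨h1, h2⟩
        have : smoothStep =ᶠ[𝓝 t] fun _ => 0 := by
          filter_upwards [Ioi_mem_nhds h2] with s hs using smoothStep_of_ge (le_of_lt hs)
        rw [this.deriv_eq, deriv_const]
    rw [h0, abs_zero]; positivity

section Radial

variable {n : ℕ} {f g : ℝ → ℝ}

theorem hasFDerivAt_comp_norm {h : ℝ → ℝ} {c : ℝ} {x : E n} (hx : x ≠ 0)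
    (hh : HasDerivAt h c ‖x‖) :
    HasFDerivAt (fun y : E n => h ‖y‖) ((c * ‖x‖⁻¹) • innerSL ℝ x) x := by
  have h1 : HasFDerivAt (fun y : E n => ‖y‖) (‖x‖⁻¹ • innerSL ℝ x) x := by
    have h0 : HasFDerivAt (fun y : E n => ‖y‖ ^ 2) (2 • innerSL ℝ x) x :=
      (hasStrictFDerivAt_norm_sq x).hasFDerivAt
    have h2 := h0.sqrt (by positivity)
    simp only [Real.sqrt_sq (norm_nonneg _)] at h2
    have e : ‖x‖⁻¹ • innerSL ℝ x = (1 / (2 * ‖x‖)) • 2 • innerSL ℝ x := by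
      have : ‖x‖ ≠ 0 := norm_ne_zero_iff.2 hx
      ext1 v
      simp only [smul_apply, smul_eq_mul, two_smul, add_apply]
      field_simp
      ring
    rw [e]
    exact h2
  have := hh.comp_hasFDerivAt x h1
  rwa [smul_smul] at this

/-- The square of the gradient of a radial function. -/
theorem sum_fderiv_radial (hf0 : ∀ t, 0 < t → 0 < f t) (hg0 : ∀ t, 0 < t → 0 < g t)
    (hf : ContDiffOn ℝ (⊤ : ℕ∞) f (Ioi 0)) (hg : ContDiffOn ℝ (⊤ : ℕ∞) g (Ioi 0))
    {h : ℝ → ℝ} {c : ℝ} {x : E n} (hx : x ≠ 0) (hh : HasDerivAt h c ‖x‖) :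
    ∑ i, fderiv ℝ (fun y : E n => h ‖y‖) x (coMetric (warpedMetric n f g) x (stdVec i)) *
      fderiv ℝ (fun y : E n => h ‖y‖) x (stdVec i) = c ^ 2 / f ‖x‖ := by
  set M : MetricRoot (warpedMetric n f g) {0}ᶜ := rootCompl hf hg hf0 hg0
  have hx' : x ∈ ({0}ᶜ : Set (E n)) := hx
  have ht : 0 < ‖x‖ := norm_pos_iff.2 hx
  have hft := hf0 _ ht
  rw [(hasFDerivAt_comp_norm hx hh).fderiv]
  simp only [smul_apply, innerSL_apply_apply, smul_eq_mul]
  have e1 : ∀ i : Fin n, c * ‖x‖⁻¹ * ⟪x, coMetric (warpedMetric n f g) x (stdVec i)⟫_ℝ *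
      (c * ‖x‖⁻¹ * ⟪x, (stdVec i : E n)⟫_ℝ) = (c * ‖x‖⁻¹) ^ 2 *
        (⟪coMetric (warpedMetric n f g) x x, (stdVec i : E n)⟫_ℝ * ⟪(stdVec i : E n), x⟫_ℝ) :=
    fun i => by
      rw [M.symm_coMetric hx', real_inner_comm x (stdVec i)]; ring
  have e2 : coMetric (warpedMetric n f g) x x = (f ‖x‖)⁻¹ • x := by
    have h1 : warpedMetric n f g x x = f ‖x‖ • x := by
      rw [warpedMetric_eq, radialField_apply _ _ hx, radialProj_self hx, tangProj_self hx,
        smul_zero, add_zero]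
    have h2 : coMetric (warpedMetric n f g) x (warpedMetric n f g x x) = x :=
      congrArg (fun A => A x) (M.coMetric_comp hx')
    rw [h1, map_smul] at h2
    rw [eq_inv_smul_iff₀ hft.ne', h2]
  rw [Finset.sum_congr rfl fun i _ => e1 i, ← Finset.mul_sum,
    (EuclideanSpace.basisFun (Fin n) ℝ).sum_inner_mul_inner, e2, real_inner_smul_left,
    real_inner_self_eq_norm_sq]
  field_simp

/-- Completeness: cutoff functions of the distance to the origin. -/
theorem IsWarpingPair.hasCutoffs (hfg : IsWarpingPair f g) :
    MetricRoot.HasCutoffs (warpedMetric n f g) := by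
  intro R δ hδ
  obtain ⟨ε, hε, he⟩ := hfg.euclidean
  -- `q` extends `√f` smoothly to the whole line, and `s` is the distance to the origin.
  set q : ℝ → ℝ := fun t => if t ≤ 0 then 1 else √(f t) with hq
  have hq1 : ∀ t < ε, q t = 1 := fun t ht => by
    by_cases h0 : t ≤ 0
    · simp [q, h0]
    · simp [q, h0, (he t ⟨not_le.1 h0, ht⟩).1]
  have hq2 : ∀ t, 0 < t → q t = √(f t) := fun t ht => by simp [q, not_le.2 ht]
  have hqs : ContDiff ℝ (⊤ : ℕ∞) q := by
    refine contDiff_iff_contDiffAt.2 fun t => ?_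
    rcases lt_or_ge t ε with h | h
    · refine contDiffAt_const (c := (1 : ℝ)) |>.congr_of_eventuallyEq ?_
      filter_upwards [Iio_mem_nhds h] with s hs using hq1 s hs
    · have h0 : 0 < t := hε.trans_le h
      refine ((contDiffOn_sqrt_of_pos hfg.smooth_f hfg.pos_f).contDiffAt
        (Ioi_mem_nhds h0)).congr_of_eventuallyEq ?_
      filter_upwards [Ioi_mem_nhds h0] with s hs using hq2 s hs
  have hqpos : ∀ t, 0 ≤ q t := fun t => by
    by_cases h0 : t ≤ 0 <;> simp [q, h0]
  set s : ℝ → ℝ := fun t => ∫ r in (0 : ℝ)..t, q r with hs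
  have hsd : ∀ t, HasDerivAt s (q t) t := fun t =>
    intervalIntegral.integral_hasDerivAt_right (hqs.continuous.intervalIntegrable _ _)
      (hqs.continuous.stronglyMeasurableAtFilter _ _) hqs.continuous.continuousAt
  have hss : ContDiff ℝ (⊤ : ℕ∞) s := by
    rw [contDiff_infty_iff_deriv]
    exact ⟨fun t => (hsd t).differentiableAt, by
      rw [show deriv s = q from funext fun t => (hsd t).deriv]; exact hqs⟩
  have hmono : Monotone s := monotone_of_deriv_nonneg (fun t => (hsd t).differentiableAt)
    fun t => by rw [(hsd t).deriv]; exact hqpos t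
  have hs0 : s 0 = 0 := by simp [s]
  have hlim : Tendsto s atTop atTop := by
    refine hfg.complete.congr' ?_
    filter_upwards [eventually_ge_atTop 0] with T hT
    refine intervalIntegral.integral_congr_ae (Eventually.of_forall fun t ht => ?_)
    rw [uIoc_of_le hT] at ht
    exact (hq2 t ht.1).symm
  obtain ⟨C, hC, hCb⟩ := exists_deriv_smoothStep_bound
  -- The width of the cutoff.
  set k : ℝ := max (s |R|) 1 + C / √δ with hk
  have hk0 : 0 < k := by positivity
  have hk1 : C ^ 2 / k ^ 2 ≤ δ := by
    have h1 : C / √δ ≤ k := le_add_of_nonneg_left (by positivity)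
    have h2 : C ≤ k * √δ := by rwa [div_le_iff₀ (by positivity)] at h1
    rw [div_le_iff₀ (by positivity)]
    calc C ^ 2 ≤ (k * √δ) ^ 2 := pow_le_pow_left₀ hC.le h2 2
      _ = δ * k ^ 2 := by rw [mul_pow, Real.sq_sqrt hδ.le]; ring
  obtain ⟨b, hb⟩ := (hlim.eventually_ge_atTop (2 * k)).exists
  have hbig : ∀ t, b ≤ t → 2 ≤ s t / k := fun t ht => by
    rw [le_div_iff₀ hk0]; exact hb.trans (hmono ht)
  have hsmall : ∀ t, t ≤ |R| → s t / k ≤ 1 := fun t ht => by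
    rw [div_le_one hk0]
    refine (hmono ht).trans ((le_max_left _ 1).trans (le_add_of_nonneg_right (by positivity)))
  -- The squared gradient of `H(|x|)` is at most `C² / k² ≤ δ`, since `|ds|` has length one.
  set H : ℝ → ℝ := fun t => smoothStep (s t / k) with hH
  have hHs : ContDiff ℝ (⊤ : ℕ∞) H := smoothStep_contDiff.comp (hss.div_const k)
  have hHd : ∀ t, HasDerivAt H (deriv smoothStep (s t / k) * (q t / k)) t := fun t =>
    HasDerivAt.comp (h₂ := smoothStep) (h := fun t => s t / k) t
      ((smoothStep_contDiff.differentiable (by simp) _).hasDerivAt) ((hsd t).div_const k)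
  have hH1 : ∀ t, t ≤ ε → t ≤ 1 → H t = 1 := fun t h1 h2 => by
    refine smoothStep_of_le ?_
    rw [div_le_one hk0]
    have h3 : s (min ε 1) = min ε 1 := by
      have : ∫ r in (0 : ℝ)..(min ε 1), q r = ∫ r in (0 : ℝ)..(min ε 1), (1 : ℝ) := by
        refine intervalIntegral.integral_congr_ae ?_
        have : ∀ᵐ r : ℝ, r ≠ ε := by simp [ae_iff, measure_singleton]
        filter_upwards [this] with r hr hr2
        rw [uIoc_of_le (by positivity)] at hr2
        exact hq1 r (lt_of_le_of_ne (hr2.2.trans (min_le_left _ _)) hr)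
      simpa [s] using this
    calc s t ≤ s (min ε 1) := hmono (le_min h1 h2)
      _ ≤ 1 := h3.le.trans (min_le_right _ _)
      _ ≤ k := (le_max_right _ _).trans (le_add_of_nonneg_right (by positivity))
  refine ⟨fun x => H ‖x‖, ⟨?_, ?_⟩, fun x hx => ?_, fun x => ?_⟩
  · refine contDiff_of_eventually_const (contDiffOn_comp_norm hHs.contDiffOn) (c := 1) ?_
    filter_upwards [Metric.ball_mem_nhds (0 : E n) (lt_min hε one_pos)] with x hx
    have hx' : ‖x‖ < min ε 1 := by simpa using hx
    exact hH1 _ (hx'.le.trans (min_le_left _ _)) (hx'.le.trans (min_le_right _ _))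
  · exact hasCompactSupport_of_radius (R := b) fun y hy => smoothStep_of_ge (hbig _ hy.le)
  · exact smoothStep_of_le (hsmall _ (hx.trans (le_abs_self R)))
  · by_cases hx : x = 0
    · have : (fun x : E n => H ‖x‖) =ᶠ[𝓝 x] fun _ => 1 := by
        rw [hx]
        filter_upwards [Metric.ball_mem_nhds (0 : E n) (lt_min hε one_pos)] with y hy
        have hy' : ‖y‖ < min ε 1 := by simpa using hy
        exact hH1 _ (hy'.le.trans (min_le_left _ _)) (hy'.le.trans (min_le_right _ _))
      simp [this.fderiv_eq, hδ.le]
    · have ht : 0 < ‖x‖ := norm_pos_iff.2 hx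
      have hft := hfg.pos_f _ ht
      rw [sum_fderiv_radial hfg.pos_f hfg.pos_g hfg.smooth_f hfg.smooth_g hx (hHd ‖x‖),
        hq2 _ ht, mul_pow, div_pow, Real.sq_sqrt hft.le]
      refine le_trans (le_of_eq_of_le ?_ (div_le_div_of_nonneg_right
        (sq_le_sq.2 ((hCb (s ‖x‖ / k)).trans (le_abs_self C))) (sq_nonneg k))) hk1
      field_simp

end Radial

/-! ### Polar coordinates -/

section Polar

variable {n : ℕ}

/-- The unit sphere of `ℝⁿ`. -/
abbrev Sph (n : ℕ) : Type := Metric.sphere (0 : E n) 1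

/-- The surface measure of the unit sphere. -/
abbrev surf (n : ℕ) : Measure (Sph n) := (volume : Measure (E n)).toSphere

/-- The map `(θ, t) ↦ t θ`. -/
def polar (q : Sph n × ℝ) : E n := q.2 • (q.1 : E n)

/-- The product measure `dθ dt` on the half-cylinder over the unit sphere. -/
def cylMeas (n : ℕ) : Measure (Sph n × ℝ) := (surf n).prod (volume.restrict (Ioi 0))

/-- The product measure `dθ dt` on a compact piece of the cylinder over the unit sphere. -/
def annMeas (n : ℕ) (r R : ℝ) : Measure (Sph n × ℝ) :=
  (surf n).prod (volume.restrict (Icc r R))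

instance (r R : ℝ) : IsFiniteMeasure (annMeas n r R) := by
  unfold annMeas; infer_instance

theorem norm_sph (θ : Sph n) : ‖(θ : E n)‖ = 1 := by simp

theorem sph_ne_zero (θ : Sph n) : (θ : E n) ≠ 0 := by
  rw [← norm_pos_iff, norm_sph]; norm_num

theorem continuous_polar : Continuous (polar : Sph n × ℝ → E n) :=
  continuous_snd.smul (continuous_subtype_val.comp continuous_fst)

theorem measurable_polar : Measurable (polar : Sph n × ℝ → E n) :=
  continuous_polar.measurable

theorem norm_polar {q : Sph n × ℝ} (hq : 0 < q.2) : ‖polar q‖ = q.2 := by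
  rw [polar, norm_smul, norm_sph, mul_one, Real.norm_of_nonneg hq.le]

theorem polar_ne_zero {q : Sph n × ℝ} (hq : 0 < q.2) : polar q ≠ 0 := by
  rw [← norm_pos_iff, norm_polar hq]; exact hq

theorem annMeas_eq (r R : ℝ) :
    annMeas n r R = ((surf n).prod volume).restrict (univ ×ˢ Icc r R) := by
  rw [annMeas, ← Measure.prod_restrict, Measure.restrict_univ]

theorem cylMeas_eq : cylMeas n = ((surf n).prod volume).restrict (univ ×ˢ Ioi 0) := by
  rw [cylMeas, ← Measure.prod_restrict, Measure.restrict_univ]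

theorem annMeas_eq_restrict {r : ℝ} (hr : 0 < r) (R : ℝ) :
    annMeas n r R = (cylMeas n).restrict (univ ×ˢ Icc r R) := by
  rw [cylMeas_eq, annMeas_eq, Measure.restrict_restrict (MeasurableSet.univ.prod measurableSet_Icc),
    inter_eq_left.2 (prod_mono_right fun t ht => mem_Ioi.2 (hr.trans_le ht.1))]

theorem ae_annMeas_mem (r R : ℝ) : ∀ᵐ q ∂annMeas n r R, q.2 ∈ Icc r R := by
  rw [annMeas_eq]
  filter_upwards [ae_restrict_mem (MeasurableSet.univ.prod measurableSet_Icc)] with q hq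
  exact hq.2

theorem ae_cylMeas_pos : ∀ᵐ q ∂cylMeas n, 0 < q.2 := by
  rw [cylMeas_eq]
  filter_upwards [ae_restrict_mem (MeasurableSet.univ.prod measurableSet_Ioi)] with q hq
  exact hq.2

theorem volume_eq_map_polar : (volume : Measure (E n)).restrict {0}ᶜ =
    Measure.map polar ((cylMeas n).withDensity fun q => ENNReal.ofReal (q.2 ^ (n - 1))) := by
  have hm := (volume : Measure (E n)).measurePreserving_homeomorphUnitSphereProd
  -- Mathlib has polar coordinates with values in the sphere times the subtype of positive numbers.
  have hd : Module.finrank ℝ (E n) = n := by simp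
  rw [hd] at hm
  have h1 : (volume : Measure (E n)).restrict {0}ᶜ = Measure.map polar (Measure.map
      (Prod.map id Subtype.val) ((surf n).prod (Measure.volumeIoiPow (n - 1)))) := by
    rw [← map_comap_subtype_coe (measurableSet_singleton _).compl, ← hm.map_eq,
      Measure.map_map measurable_polar (measurable_id.prodMap measurable_subtype_coe),
      Measure.map_map (measurable_polar.comp (measurable_id.prodMap measurable_subtype_coe))
        (Homeomorph.measurable _)]
    congr 1
    funext x
    have hx : (x : E n) ≠ 0 := x.2
    simp [polar, smul_smul, hx]
  have h2 : Measure.map Subtype.val (Measure.volumeIoiPow (n - 1)) =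
      (volume.restrict (Ioi (0 : ℝ))).withDensity fun t => ENNReal.ofReal (t ^ (n - 1)) := by
    ext s hs
    rw [Measure.map_apply measurable_subtype_coe hs, Measure.volumeIoiPow,
      withDensity_apply _ (measurable_subtype_coe hs), withDensity_apply _ hs,
      ← map_comap_subtype_coe measurableSet_Ioi,
      (MeasurableEmbedding.subtype_coe measurableSet_Ioi).restrict_map,
      (MeasurableEmbedding.subtype_coe measurableSet_Ioi).lintegral_map]
  rw [h1, ← Measure.map_prod_map _ _ measurable_id measurable_subtype_coe, Measure.map_id, h2,
    prod_withDensity_right (by fun_prop)]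
  rfl

theorem ae_eq_zero_of_polar [Nontrivial (E n)] {V : Type*} [NormedAddCommGroup V] {u : E n → V}
    (hu : AEStronglyMeasurable u) (h : ∀ᵐ q ∂cylMeas n, u (polar q) = 0) :
    u =ᵐ[volume] 0 := by
  rw [← restrict_compl_singleton (μ := (volume : Measure (E n))) 0, volume_eq_map_polar] at hu ⊢
  have h1 := (withDensity_absolutelyContinuous (cylMeas n)
    fun q => ENNReal.ofReal (q.2 ^ (n - 1))).ae_le h
  obtain ⟨v, hv, huv⟩ := hu
  have h2 := ae_of_ae_map measurable_polar.aemeasurable huv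
  refine huv.trans ((ae_map_iff measurable_polar.aemeasurable
    (hv.measurableSet_eq_fun stronglyMeasurable_const)).2 ?_)
  filter_upwards [h1, h2] with q h1 h2
  rw [← h2, h1]; rfl

theorem integral_polar [Nontrivial (E n)] (F : E n → ℝ) (hF : AEStronglyMeasurable F) :
    ∫ x, F x = ∫ q, q.2 ^ (n - 1) * F (polar q) ∂cylMeas n := by
  rw [← restrict_compl_singleton (μ := (volume : Measure (E n))) 0, volume_eq_map_polar] at hF ⊢
  rw [integral_map measurable_polar.aemeasurable hF]
  have := integral_withDensity_eq_integral_smul (μ := cylMeas n)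
    (f := fun q => (q.2 ^ (n - 1)).toNNReal) (by fun_prop) (fun q => F (polar q))
  refine this.trans (integral_congr_ae ?_)
  filter_upwards [ae_cylMeas_pos] with q hq
  rw [NNReal.smul_def, Real.coe_toNNReal _ (pow_nonneg hq.le _), smul_eq_mul]

theorem map_polar_annMeas_le [Nontrivial (E n)] {r : ℝ} (hr : 0 < r) (R : ℝ) :
    Measure.map polar (annMeas n r R) ≤ ENNReal.ofReal (r ^ (n - 1))⁻¹ • volume := by
  rw [← restrict_compl_singleton (μ := (volume : Measure (E n))) 0, volume_eq_map_polar,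
    ← Measure.map_smul]
  refine Measure.map_mono ?_ measurable_polar
  refine Measure.le_iff.2 fun s hs => ?_
  rw [Measure.smul_apply, withDensity_apply _ hs, smul_eq_mul, annMeas_eq_restrict hr,
    Measure.restrict_apply hs, ← lintegral_const_mul _ (by fun_prop)]
  have hm : MeasurableSet (s ∩ univ ×ˢ Icc r R) :=
    hs.inter (MeasurableSet.univ.prod measurableSet_Icc)
  calc cylMeas n (s ∩ univ ×ˢ Icc r R) = ∫⁻ _ in s ∩ univ ×ˢ Icc r R, 1 ∂cylMeas n := by simp
    _ ≤ ∫⁻ q in s ∩ univ ×ˢ Icc r R, ENNReal.ofReal (r ^ (n - 1))⁻¹ *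
        ENNReal.ofReal (q.2 ^ (n - 1)) ∂cylMeas n := by
      refine setLIntegral_mono (by fun_prop) fun q hq => ?_
      rw [← ENNReal.ofReal_mul (by positivity), ← ENNReal.ofReal_one]
      refine ENNReal.ofReal_le_ofReal ?_
      rw [inv_mul_eq_div, le_div_iff₀ (by positivity), one_mul]
      exact pow_le_pow_left₀ hr.le hq.2.2.1 _
    _ ≤ _ := lintegral_mono_set inter_subset_left

variable {V W : Type*} [NormedAddCommGroup V] [NormedSpace ℝ V] [NormedAddCommGroup W]
  [NormedSpace ℝ W]

/-- A field of linear maps that is continuous off the origin is bounded on compact pieces of the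
cylinder; hence it acts continuously from `L²` to `L²` of such pieces. -/
theorem exists_eLpNorm_polar_le [Nontrivial (E n)] {A : E n → V →L[ℝ] W}
    (hA : ContinuousOn A {0}ᶜ) {r : ℝ} (hr : 0 < r) (R : ℝ) :
    ∃ C : ℝ≥0∞, C ≠ ∞ ∧ ∀ u : E n → V, AEStronglyMeasurable u →
      AEStronglyMeasurable (fun q => A (polar q) (u (polar q))) (annMeas n r R) ∧
      eLpNorm (fun q => A (polar q) (u (polar q))) 2 (annMeas n r R) ≤ C * eLpNorm u 2 volume := by
  have hco : ContinuousOn (fun q : Sph n × ℝ => A (polar q)) (univ ×ˢ Icc r R) :=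
    hA.comp continuous_polar.continuousOn fun q hq => polar_ne_zero (hr.trans_le hq.2.1)
  obtain ⟨C, hC⟩ := (isCompact_univ.prod isCompact_Icc).exists_bound_of_continuousOn hco
  have hac : Measure.map polar (annMeas n r R) ≪ (volume : Measure (E n)) :=
    (Measure.absolutelyContinuous_of_le (map_polar_annMeas_le hr R)).trans
      Measure.smul_absolutelyContinuous
  refine ⟨ENNReal.ofReal C * ENNReal.ofReal (r ^ (n - 1))⁻¹ ^ (1 / (2 : ℝ≥0∞)).toReal,
    ENNReal.mul_ne_top ENNReal.ofReal_ne_top (by simp),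
    fun u hu => ?_⟩
  have h1 : AEStronglyMeasurable (fun q => A (polar q)) (annMeas n r R) := by
    rw [annMeas_eq]
    exact hco.aestronglyMeasurable (MeasurableSet.univ.prod measurableSet_Icc)
  have h2 : AEStronglyMeasurable (fun q => u (polar q)) (annMeas n r R) :=
    (hu.mono_ac hac).comp_measurable measurable_polar
  refine ⟨(ContinuousLinearMap.id ℝ (V →L[ℝ] W)).aestronglyMeasurable_comp₂ h1 h2, ?_⟩
  have h3 : eLpNorm (fun q => A (polar q) (u (polar q))) 2 (annMeas n r R) ≤
      ENNReal.ofReal C * eLpNorm (fun q => u (polar q)) 2 (annMeas n r R) := by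
    refine eLpNorm_le_mul_eLpNorm_of_ae_le_mul ?_ _
    filter_upwards [ae_annMeas_mem r R] with q hq
    exact (ContinuousLinearMap.le_opNorm _ _).trans
      (mul_le_mul_of_nonneg_right (hC q ⟨mem_univ _, hq⟩) (norm_nonneg _))
  refine h3.trans ?_
  rw [mul_assoc]
  gcongr
  have h4 := eLpNorm_map_measure (p := 2) (hu.mono_ac hac)
    (measurable_polar.aemeasurable (μ := annMeas n r R))
  have h5 := eLpNorm_mono_measure u (p := 2) (map_polar_annMeas_le (n := n) hr R)
  rw [h4] at h5
  refine h5.trans ?_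
  rw [eLpNorm_smul_measure_of_ne_top (by simp), smul_eq_mul]

end Polar

/-! ### Pairings of functions on the cylinder with functions on the sphere -/

section Inner

variable {X V : Type*} [MeasurableSpace X] {m : Measure X} [NormedAddCommGroup V]
  [InnerProductSpace ℝ V]

theorem MemLp.integrable_inner_real {f g : X → V} (hf : MemLp f 2 m) (hg : MemLp g 2 m) :
    Integrable (fun x => ⟪f x, g x⟫_ℝ) m := by
  refine (MeasureTheory.L2.integrable_inner (𝕜 := ℝ) (hf.toLp f) (hg.toLp g)).congr ?_
  filter_upwards [hf.coeFn_toLp, hg.coeFn_toLp] with x h1 h2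
  rw [h1, h2]

theorem MemLp.inner_toLp_real {f g : X → V} (hf : MemLp f 2 m) (hg : MemLp g 2 m) :
    ⟪hf.toLp f, hg.toLp g⟫_ℝ = ∫ x, ⟪f x, g x⟫_ℝ ∂m := by
  rw [MeasureTheory.L2.inner_def]
  refine integral_congr_ae ?_
  filter_upwards [hf.coeFn_toLp, hg.coeFn_toLp] with x h1 h2
  rw [h1, h2]

theorem MemLp.abs_integral_inner_real_le {f g : X → V} (hf : MemLp f 2 m) (hg : MemLp g 2 m) :
    |∫ x, ⟪f x, g x⟫_ℝ ∂m| ≤ (eLpNorm f 2 m).toReal * (eLpNorm g 2 m).toReal := by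
  rw [← MemLp.inner_toLp_real hf hg, ← Lp.norm_toLp f hf, ← Lp.norm_toLp g hg]
  exact abs_real_inner_le_norm _ _

end Inner

/-- Continuous functions with compact support in the open half-line. -/
structure IsWeight (b : ℝ → ℝ) : Prop where
  continuous : Continuous b
  compact : HasCompactSupport b
  support : tsupport b ⊆ Ioi 0

theorem IsWeight.exists_bounds {b : ℝ → ℝ} (hb : IsWeight b) :
    ∃ r R C : ℝ, 0 < r ∧ (∀ t, t ∉ Icc r R → b t = 0) ∧ ∀ t, |b t| ≤ C := by
  obtain ⟨C, hC⟩ := hb.continuous.bounded_above_of_compact_support hb.compact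
  rcases (tsupport b).eq_empty_or_nonempty with h | h
  · refine ⟨1, 1, C, one_pos, fun t _ => image_eq_zero_of_notMem_tsupport (by simp [h]), hC⟩
  · obtain ⟨r, hr, hrl⟩ := hb.compact.isCompact.exists_isLeast h
    obtain ⟨R, -, hRl⟩ := hb.compact.isCompact.exists_isGreatest h
    refine ⟨r, R, C, hb.support hr, fun t ht => image_eq_zero_of_notMem_tsupport fun h' =>
      ht ⟨hrl h', hRl h'⟩, hC⟩

theorem IsWeight.mul {a K : ℝ → ℝ} (ha : IsWeight a) (hK : ContinuousOn K (Ioi 0)) :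
    IsWeight fun t => a t * K t where
  continuous := by
    rw [continuous_iff_continuousAt]
    intro t
    by_cases ht : t ∈ tsupport a
    · exact ha.continuous.continuousAt.mul (hK.continuousAt (isOpen_Ioi.mem_nhds (ha.support ht)))
    · refine (continuousAt_const (y := (0 : ℝ))).congr ?_
      filter_upwards [(isClosed_tsupport a).isOpen_compl.mem_nhds ht] with s hs
      simp [image_eq_zero_of_notMem_tsupport hs]
  compact := ha.compact.mul_right
  support := (tsupport_mul_subset_left).trans ha.support

section Pairing

variable {n : ℕ} {V : Type*} [NormedAddCommGroup V] [InnerProductSpace ℝ V]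

/-- Functions on the half-cylinder that are square integrable on its compact pieces. -/
def LocL2 (L : Sph n × ℝ → V) : Prop := ∀ r R, 0 < r → MemLp L 2 (annMeas n r R)

/-- Convergence in `L²` of the compact pieces of the half-cylinder. -/
def LocTendsto (L : ℕ → Sph n × ℝ → V) (L' : Sph n × ℝ → V) : Prop :=
  ∀ r R, 0 < r → Tendsto (fun k => eLpNorm (L k - L') 2 (annMeas n r R)) atTop (𝓝 0)

/-- The pairing `∫ b(t) ∫ ⟨L(θ, t), w(θ)⟩ dθ dt`. -/
def pairing (b : ℝ → ℝ) (L : Sph n × ℝ → V) (w : Sph n → V) : ℝ :=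
  ∫ q, ⟪L q, b q.2 • w q.1⟫_ℝ ∂cylMeas n

theorem pairing_eq {b : ℝ → ℝ} {r R : ℝ} (hr : 0 < r) (h : ∀ t, t ∉ Icc r R → b t = 0)
    (L : Sph n × ℝ → V) (w : Sph n → V) :
    pairing b L w = ∫ q, ⟪L q, b q.2 • w q.1⟫_ℝ ∂annMeas n r R := by
  rw [annMeas_eq_restrict hr, setIntegral_eq_integral_of_forall_compl_eq_zero]
  · rfl
  · intro q hq
    rw [h q.2 fun h' => hq ⟨mem_univ _, h'⟩, zero_smul, inner_zero_right]

theorem memLp_weight_smul {b : ℝ → ℝ} (hb : IsWeight b) {w : Sph n → V} (hw : MemLp w 2 (surf n))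
    (r R : ℝ) : MemLp (fun q : Sph n × ℝ => b q.2 • w q.1) 2 (annMeas n r R) := by
  obtain ⟨-, -, C, -, -, hC⟩ := hb.exists_bounds
  have h1 : MemLp (fun q : Sph n × ℝ => w q.1) 2 (annMeas n r R) := hw.comp_fst _
  refine h1.of_le_mul (c := C) ((hb.continuous.comp continuous_snd).aestronglyMeasurable.smul h1.1)
    (ae_of_all _ fun q => ?_)
  rw [norm_smul]
  exact mul_le_mul_of_nonneg_right (hC _) (norm_nonneg _)

theorem pairing_sub_left {b : ℝ → ℝ} (hb : IsWeight b) {L L' : Sph n × ℝ → V} (hL : LocL2 L)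
    (hL' : LocL2 L') {w : Sph n → V} (hw : MemLp w 2 (surf n)) :
    pairing b (L - L') w = pairing b L w - pairing b L' w := by
  obtain ⟨r, R, C, hr, h0, -⟩ := hb.exists_bounds
  have h1 := memLp_weight_smul hb hw r R
  rw [pairing_eq hr h0, pairing_eq hr h0, pairing_eq hr h0, ← integral_sub
    (MemLp.integrable_inner_real (hL r R hr) h1) (MemLp.integrable_inner_real (hL' r R hr) h1)]
  simp only [Pi.sub_apply, inner_sub_left]

theorem pairing_sub_right {b : ℝ → ℝ} (hb : IsWeight b) {L : Sph n × ℝ → V} (hL : LocL2 L)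
    {w w' : Sph n → V} (hw : MemLp w 2 (surf n)) (hw' : MemLp w' 2 (surf n)) :
    pairing b L (w - w') = pairing b L w - pairing b L w' := by
  obtain ⟨r, R, C, hr, h0, -⟩ := hb.exists_bounds
  rw [pairing_eq hr h0, pairing_eq hr h0, pairing_eq hr h0, ← integral_sub
    (MemLp.integrable_inner_real (hL r R hr) (memLp_weight_smul hb hw r R))
    (MemLp.integrable_inner_real (hL r R hr) (memLp_weight_smul hb hw' r R))]
  simp only [Pi.sub_apply, smul_sub, inner_sub_right]

theorem tendsto_pairing_left {b : ℝ → ℝ} (hb : IsWeight b) {L : ℕ → Sph n × ℝ → V}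
    {L' : Sph n × ℝ → V} (hL : ∀ k, LocL2 (L k)) (hL' : LocL2 L') (h : LocTendsto L L')
    {w : Sph n → V} (hw : MemLp w 2 (surf n)) :
    Tendsto (fun k => pairing b (L k) w) atTop (𝓝 (pairing b L' w)) := by
  obtain ⟨r, R, C, hr, h0, -⟩ := hb.exists_bounds
  have h1 := memLp_weight_smul hb hw r R
  rw [tendsto_iff_norm_sub_tendsto_zero]
  have h2 := (ENNReal.tendsto_toReal ENNReal.zero_ne_top).comp (h r R hr)
  refine squeeze_zero (fun _ => norm_nonneg _) (fun k => ?_) (by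
    simpa using h2.mul_const (eLpNorm (fun q : Sph n × ℝ => b q.2 • w q.1) 2
      (annMeas n r R)).toReal)
  rw [← pairing_sub_left hb (hL k) hL' hw, pairing_eq hr h0]
  exact MemLp.abs_integral_inner_real_le ((hL k r R hr).sub (hL' r R hr)) h1

theorem pairing_eq_integral {b : ℝ → ℝ} (hb : IsWeight b) {L : Sph n × ℝ → V} (hL : LocL2 L)
    {w : Sph n → V} (hw : MemLp w 2 (surf n)) :
    pairing b L w = ∫ t in Ioi 0, b t * ∫ θ, ⟪L (θ, t), w θ⟫_ℝ ∂surf n := by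
  obtain ⟨r, R, C, hr, h0, -⟩ := hb.exists_bounds
  rw [pairing_eq hr h0, annMeas, integral_prod_symm _
    (MemLp.integrable_inner_real (hL r R hr) (memLp_weight_smul hb hw r R))]
  simp only [real_inner_smul_right, integral_const_mul]
  have hsub : Icc r R ⊆ Ioi 0 := fun t ht => hr.trans_le ht.1
  symm
  refine setIntegral_eq_of_subset_of_forall_sdiff_eq_zero measurableSet_Ioi hsub fun t ht => ?_
  rw [h0 t ht.2, zero_mul]

/-- The pairing vanishes when it does so for each `t`. -/
theorem pairing_eq_zero {b : ℝ → ℝ} (hb : IsWeight b) {L : Sph n × ℝ → V} (hL : LocL2 L)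
    {w : Sph n → V} (hw : MemLp w 2 (surf n))
    (h : ∀ᵐ t ∂(volume.restrict (Ioi (0 : ℝ))), ∫ θ, ⟪L (θ, t), w θ⟫_ℝ ∂surf n = 0) :
    pairing b L w = 0 := by
  rw [pairing_eq_integral hb hL hw]
  refine integral_eq_zero_of_ae ?_
  filter_upwards [h] with t ht
  simp [ht]

theorem tendsto_pairing_right {b : ℝ → ℝ} (hb : IsWeight b) {L : Sph n × ℝ → V} (hL : LocL2 L)
    {w : ℕ → Sph n → V} {w' : Sph n → V} (hw : ∀ k, MemLp (w k) 2 (surf n))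
    (hw' : MemLp w' 2 (surf n))
    (h : Tendsto (fun k => eLpNorm (w k - w') 2 (surf n)) atTop (𝓝 0)) :
    Tendsto (fun k => pairing b L (w k)) atTop (𝓝 (pairing b L w')) := by
  obtain ⟨r, R, C, hr, h0, hC⟩ := hb.exists_bounds
  have hfst : ∀ v : Sph n → V, MemLp v 2 (surf n) →
      eLpNorm (fun q : Sph n × ℝ => b q.2 • v q.1) 2 (annMeas n r R) ≤
        ENNReal.ofReal C * ((volume.restrict (Icc r R)) univ ^ (1 / (2 : ℝ≥0∞)).toReal *
          eLpNorm v 2 (surf n)) := fun v hv => by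
    refine (eLpNorm_le_mul_eLpNorm_of_ae_le_mul (c := C) (g := fun q : Sph n × ℝ => v q.1)
      (ae_of_all _ fun q => ?_) 2).trans ?_
    · rw [norm_smul]
      exact mul_le_mul_of_nonneg_right (hC _) (norm_nonneg _)
    · gcongr
      have h1 := eLpNorm_map_measure (p := 2) (f := Prod.fst) (μ := annMeas n r R) (g := v)
        (by rw [annMeas, Measure.map_fst_prod]; exact hv.1.smul_measure _)
        measurable_fst.aemeasurable
      rw [annMeas, Measure.map_fst_prod, eLpNorm_smul_measure_of_ne_top (by simp), smul_eq_mul]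
        at h1
      exact h1.symm.le
  rw [tendsto_iff_norm_sub_tendsto_zero]
  have h2 : Tendsto (fun k => ENNReal.ofReal C * ((volume.restrict (Icc r R)) univ ^
      (1 / (2 : ℝ≥0∞)).toReal * eLpNorm (w k - w') 2 (surf n))) atTop (𝓝 0) := by
    have h3 := ENNReal.Tendsto.const_mul h (Or.inr (by simp :
      (volume.restrict (Icc r R)) univ ^ (1 / (2 : ℝ≥0∞)).toReal ≠ ∞))
    have h4 := ENNReal.Tendsto.const_mul h3 (Or.inr (ENNReal.ofReal_ne_top (r := C)))
    simpa using h4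
  have h5 := (ENNReal.tendsto_toReal ENNReal.zero_ne_top).comp h2
  have h6 := h5.const_mul (eLpNorm L 2 (annMeas n r R)).toReal
  rw [ENNReal.toReal_zero, mul_zero] at h6
  refine squeeze_zero (fun _ => norm_nonneg _) (fun k => ?_) h6
  rw [← pairing_sub_right hb hL (hw k) hw', pairing_eq hr h0]
  refine (MemLp.abs_integral_inner_real_le (hL r R hr)
    (memLp_weight_smul hb ((hw k).sub hw') r R)).trans ?_
  refine mul_le_mul_of_nonneg_left (ENNReal.toReal_mono ?_ (hfst _ ((hw k).sub hw')))
    ENNReal.toReal_nonneg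
  have := ((hw k).sub hw').2.ne
  finiteness

/-- A function on the half-cylinder whose pairings with a set of functions on the sphere vanish
has slices orthogonal to this set. -/
theorem ae_orthogonal_of_pairing [FiniteDimensional ℝ V] {L : Sph n × ℝ → V} (hL : LocL2 L)
    {K : ℝ → ℝ} (hK : ContinuousOn K (Ioi 0)) (hK0 : ∀ t, 0 < t → K t ≠ 0)
    (W : Set (Lp V 2 (surf n)))
    (h : ∀ a : ℝ → ℝ, ContDiff ℝ (⊤ : ℕ∞) a → IsWeight a → ∀ w ∈ W,
      pairing (fun t => a t * K t) L w = 0) :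
    ∀ᵐ t ∂(volume.restrict (Ioi (0 : ℝ))), ∃ hm : MemLp (fun θ => L (θ, t)) 2 (surf n),
      ∀ w ∈ W, ⟪hm.toLp _, w⟫_ℝ = 0 := by
  have hslice : ∀ᵐ t ∂(volume.restrict (Ioi (0 : ℝ))), MemLp (fun θ => L (θ, t)) 2 (surf n) := by
    have hU : Ioi (0 : ℝ) = ⋃ k : ℕ, Icc ((k + 1 : ℝ)⁻¹) (k + 1) := by
      ext t
      simp only [mem_Ioi, mem_iUnion, mem_Icc]
      constructor
      · intro ht
        obtain ⟨k, hk⟩ := exists_nat_ge (max t t⁻¹)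
        refine ⟨k, inv_le_of_inv_le₀ ht ?_, ?_⟩
        · linarith [le_max_right t t⁻¹]
        · linarith [le_max_left t t⁻¹]
      · rintro ⟨k, hk, -⟩
        exact lt_of_lt_of_le (by positivity) hk
    rw [hU, ae_restrict_iUnion_iff]
    intro k
    have h1 := hL ((k + 1 : ℝ)⁻¹) (k + 1) (by positivity)
    have h2 := (memLp_two_iff_integrable_sq_norm h1.1).1 h1
    filter_upwards [h1.1.prod_swap.prodMk_left, h2.prod_left_ae] with t h3 h4
    exact (memLp_two_iff_integrable_sq_norm h3).2 h4
  have : Fact ((2 : ℝ≥0∞) ≠ ∞) := ⟨by simp⟩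
  have : MeasurableSpace.CountablyGenerated (Sph n) := inferInstance
  have : IsSeparable (surf n) := inferInstance
  have : SecondCountableTopology (Lp V 2 (surf n)) := Lp.SecondCountableTopology
  -- The exceptional set of `t` depends on `w`; it suffices to treat countably many `w`, as `L²` of
  -- the sphere is separable.
  obtain ⟨D, hDc, hDd⟩ := TopologicalSpace.exists_countable_dense W
  have hae : ∀ᵐ t ∂(volume.restrict (Ioi (0 : ℝ))), ∀ w ∈ D,
      ∫ θ, ⟪L (θ, t), (w : Lp V 2 (surf n)) θ⟫_ℝ ∂surf n = 0 := by
    rw [ae_ball_iff hDc]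
    intro w hw
    have hc : LocallyIntegrableOn
        (fun t => K t * ∫ θ, ⟪L (θ, t), (w : Lp V 2 (surf n)) θ⟫_ℝ ∂surf n) (Ioi 0) := by
      refine LocallyIntegrableOn.continuousOn_mul ?_ hK isOpen_Ioi.isLocallyClosed
      intro t (ht : 0 < t)
      refine ⟨Icc (t / 2) (t + 1), mem_nhdsWithin_of_mem_nhds
        (Icc_mem_nhds (by linarith) (by linarith)), ?_⟩
      exact (MemLp.integrable_inner_real (hL (t / 2) (t + 1) (by linarith))
        ((Lp.memLp (w : Lp V 2 (surf n))).comp_fst _)).integral_prod_right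
    rw [ae_restrict_iff' measurableSet_Ioi]
    have := isOpen_Ioi.ae_eq_zero_of_integral_contDiff_smul_eq_zero hc fun a ha hac has => ?_
    · filter_upwards [this] with t h1 ht
      exact (mul_eq_zero.1 (h1 ht)).resolve_left (hK0 t ht)
    · have hw' : IsWeight a := ⟨ha.continuous, hac, has⟩
      have h1 := h a ha hw' w w.2
      rw [pairing_eq_integral (hw'.mul hK) hL (Lp.memLp _)] at h1
      rw [← h1]
      symm
      simp only [smul_eq_mul, ← mul_assoc]
      refine setIntegral_eq_integral_of_forall_compl_eq_zero fun t ht => ?_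
      rw [image_eq_zero_of_notMem_tsupport fun h' => ht (has h'), zero_mul, zero_mul]
  filter_upwards [hslice, hae] with t hm ht
  refine ⟨hm, fun w hw => ?_⟩
  have hcl : IsClosed {v : W | ⟪hm.toLp _, (v : Lp V 2 (surf n))⟫_ℝ = 0} :=
    isClosed_eq (by fun_prop) continuous_const
  have hall : D ⊆ {v : W | ⟪hm.toLp _, (v : Lp V 2 (surf n))⟫_ℝ = 0} := fun v hv => by
    change ⟪hm.toLp _, (v : Lp V 2 (surf n))⟫_ℝ = 0
    rw [← ht v hv, ← MemLp.inner_toLp_real hm (Lp.memLp _), Lp.toLp_coeFn]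
  have := hcl.closure_subset_iff.2 hall
  rw [hDd.closure_eq] at this
  exact this (mem_univ (⟨w, hw⟩ : W))

end Pairing

/-! ### Radial and tangential parts of covectors -/

section Horizontal

variable {n p : ℕ}

theorem pull_smul (c : ℝ) (T : E n →L[ℝ] E n) (α : Cov n p) :
    pull p (c • T) α = c ^ p • pull p T α := by
  ext v
  refine (α.toMultilinearMap.map_smul_univ (fun _ => c) fun k => T (v k)).trans ?_
  simp only [Finset.prod_const, Finset.card_univ, Fintype.card_fin]
  rfl

theorem contr_pull (T : E n →L[ℝ] E n) (v : E n) (α : Cov n (p + 1)) :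
    contr p v (pull (p + 1) T α) = pull p T (contr p (T v) α) := by
  ext w
  simp only [contr_apply, pull_apply, ContinuousAlternatingMap.curryLeft_apply_apply]
  congr 1
  funext k
  refine Fin.cases rfl (fun i => rfl) k

theorem contr_contr_comm (u v : E n) (α : Cov n (p + 2)) :
    contr p u (contr (p + 1) v α) = -contr p v (contr (p + 1) u α) := by
  ext w
  simp only [contr_apply, ContinuousAlternatingMap.curryLeft_apply_apply,
    ContinuousAlternatingMap.neg_apply]
  have h := α.toAlternatingMap.map_swap (Fin.cons u (Fin.cons v w) : Fin (p + 2) → E n)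
    (i := 0) (j := 1) (by simp)
  refine Eq.trans ?_ h
  change α _ = α _
  congr 1
  funext k
  refine Fin.cases ?_ (fun i => Fin.cases ?_ (fun j => ?_) i) k
  · rfl
  · rfl
  · have h0 : (j.succ.succ : Fin (p + 2)) ≠ 0 := Fin.succ_ne_zero _
    have h1 : (j.succ.succ : Fin (p + 2)) ≠ 1 := fun h =>
      Fin.succ_ne_zero j (Fin.succ_injective _ h)
    simp only [Function.comp_apply, Equiv.swap_apply_of_ne_of_ne h0 h1]
    rfl

theorem contr_contr_self (v : E n) (α : Cov n (p + 2)) :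
    contr p v (contr (p + 1) v α) = 0 := by
  have h := contr_contr_comm v v α
  ext w
  have := congrArg (fun β => β w) h
  simp only [ContinuousAlternatingMap.neg_apply] at this
  exact self_eq_neg.1 this

/-- A covector vanishing on a direction is determined by its restriction to the orthogonal
complement. -/
theorem pull_tangProj_of_vanish {x : E n} {α : Cov n p}
    (h : ∀ v : Fin p → E n, (∃ i, v i = x) → α v = 0) : pull p (tangProj x) α = α := by
  classical
  ext v
  rw [pull_apply]
  have key : ∀ s : Finset (Fin p), α (fun k => if k ∈ s then tangProj x (v k) else v k) = α v := by
    intro s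
    induction s using Finset.induction with
    | empty => simp
    | insert i s hi ih =>
      rw [← ih]
      set w : Fin p → E n := fun k => if k ∈ s then tangProj x (v k) else v k with hw
      have e1 : (fun k => if k ∈ insert i s then tangProj x (v k) else v k) =
          Function.update w i (v i - ((‖x‖ ^ 2)⁻¹ * ⟪x, v i⟫_ℝ) • x) := by
        funext k
        by_cases hk : k = i
        · subst hk; simp [tangProj_apply, radialProj_apply]
        · simp [hk, hw]
      have e2 : Function.update w i (v i) = w := by
        conv_rhs => rw [← Function.update_eq_self i w]
        simp [hw, hi]
      rw [e1, ContinuousAlternatingMap.map_update_sub, ContinuousAlternatingMap.map_update_smul,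
        h (Function.update w i x) ⟨i, by simp⟩, smul_zero, sub_zero, e2]
  simpa using key Finset.univ

theorem vanish_of_contr {x : E n} {α : Cov n (p + 1)} (h : contr p x α = 0)
    (v : Fin (p + 1) → E n) (hv : ∃ i, v i = x) : α v = 0 := by
  obtain ⟨i, hi⟩ := hv
  have h0 : ∀ w : Fin (p + 1) → E n, w 0 = x → α w = 0 := fun w hw => by
    have := congrArg (fun β => β (Fin.tail w)) h
    rw [contr_apply] at this
    simp only [ContinuousAlternatingMap.curryLeft_apply_apply] at this
    rw [← hw] at this
    have e : Matrix.vecCons (w 0) (Fin.tail w) = w := Fin.cons_self_tail w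
    rw [e] at this
    exact this
  by_cases hi0 : i = 0
  · exact h0 v (hi0 ▸ hi)
  · have h1 := α.toAlternatingMap.map_swap v (i := 0) (j := i) (Ne.symm hi0)
    have h2 : α (v ∘ Equiv.swap 0 i) = 0 := h0 _ (by simpa using hi)
    change α (v ∘ Equiv.swap 0 i) = -α v at h1
    rw [h2] at h1
    exact neg_eq_zero.1 h1.symm

theorem contr_of_vanish {x : E n} {α : Cov n (p + 1)}
    (h : ∀ v : Fin (p + 1) → E n, (∃ i, v i = x) → α v = 0) : contr p x α = 0 := by
  ext w
  exact h _ ⟨0, rfl⟩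

theorem contr_pull_tangProj {x : E n} (hx : x ≠ 0) (α : Cov n (p + 1)) :
    contr p x (pull (p + 1) (tangProj x) α) = 0 := by
  rw [contr_pull, tangProj_self hx, map_zero]
  simp

theorem pull_tangProj_of_contr {x : E n} {α : Cov n (p + 1)} (h : contr p x α = 0) :
    pull (p + 1) (tangProj x) α = α :=
  pull_tangProj_of_vanish (vanish_of_contr h)

theorem vanish_of_pull_tangProj {x : E n} (hx : x ≠ 0) {α : Cov n p}
    (h : pull p (tangProj x) α = α) (v : Fin p → E n) (hv : ∃ i, v i = x) : α v = 0 := by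
  obtain ⟨i, hi⟩ := hv
  rw [← h, pull_apply]
  exact α.map_coord_zero i (by rw [hi, tangProj_self hx])

/-- The restriction of a covector to the sphere through `x`, transported to the unit sphere by
the dilation. -/
def slot (p : ℕ) (x : E n) : Cov n p →L[ℝ] Cov n p := pull p (‖x‖ • tangProj x)

/-- The covector `ω₂` in the decomposition `ω = ω₁ + ω₂ ∧ dt`, before restriction to the sphere. -/
def radialPart (p : ℕ) (x : E n) : Cov n (p + 1) →L[ℝ] Cov n p :=
  (-1 : ℝ) ^ p • contr p (‖x‖⁻¹ • x)

theorem slot_eq (x : E n) (α : Cov n p) : slot p x α = ‖x‖ ^ p • pull p (tangProj x) α :=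
  pull_smul _ _ _

theorem pull_tangProj_tangProj {x : E n} (hx : x ≠ 0) (α : Cov n p) :
    pull p (tangProj x) (pull p (tangProj x) α) = pull p (tangProj x) α := by
  have : tangProj x ∘L tangProj x = tangProj x := by
    ext1 v
    exact tangProj_tangProj hx v
  rw [pull_pull, this]

theorem slot_pull_tangProj {x : E n} (hx : x ≠ 0) (α : Cov n p) :
    slot p x (pull p (tangProj x) α) = slot p x α := by
  rw [slot_eq, slot_eq, pull_tangProj_tangProj hx]

theorem contDiffOn_slot : ContDiffOn ℝ (⊤ : ℕ∞) (slot (n := n) p) {0}ᶜ :=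
  contDiffOn_pull ((contDiffOn_comp_norm (F := fun t => t) contDiffOn_id).smul contDiffOn_tangProj)

theorem contDiffOn_unit : ContDiffOn ℝ (⊤ : ℕ∞) (fun x : E n => ‖x‖⁻¹ • x) {0}ᶜ :=
  (contDiffOn_comp_norm (F := fun t => t⁻¹)
    (contDiffOn_id.inv fun _ ht => ne_of_gt ht)).smul contDiffOn_id

theorem contDiffOn_radialPart : ContDiffOn ℝ (⊤ : ℕ∞) (radialPart (n := n) p) {0}ᶜ := by
  refine contDiffOn_clm_apply.2 fun α => ?_
  have h : ContDiffOn ℝ (⊤ : ℕ∞) (fun x : E n => (contr p).flip α (‖x‖⁻¹ • x)) {0}ᶜ :=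
    ((contr p).flip α).contDiff.comp_contDiffOn contDiffOn_unit
  exact h.const_smul ((-1 : ℝ) ^ p)

/-- The covector `ρ ∧ β`, where `ρ = d|x|`. -/
def radialWedge (x : E n) (β : Cov n p) : Cov n (p + 1) :=
  ContinuousAlternatingMap.alternatizeUncurryFin ((innerSL ℝ (‖x‖⁻¹ • x)).smulRight β)

theorem slot_radialWedge {x : E n} (hx : x ≠ 0) (β : Cov n p) :
    slot (p + 1) x (radialWedge x β) = 0 := by
  rw [slot_eq]
  have : pull (p + 1) (tangProj x) (radialWedge x β) = 0 := by
    ext v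
    rw [pull_apply, radialWedge, ContinuousAlternatingMap.alternatizeUncurryFin_apply]
    refine Finset.sum_eq_zero fun i _ => ?_
    simp [inner_tangProj hx]
  rw [this, smul_zero]

theorem flatInner_radialWedge (x : E n) (α : Cov n (p + 1)) (β : Cov n p) :
    flatInner n (p + 1) α (radialWedge x β) = flatInner n p (contr p (‖x‖⁻¹ • x) α) β := by
  rw [flatInner_comm, radialWedge, flatInner_alternatize]
  have h : (‖x‖⁻¹ • x : E n) = ∑ j : Fin n, (‖x‖⁻¹ • x : E n) j • (stdVec j : E n) := by
    conv_lhs => rw [← (EuclideanSpace.basisFun (Fin n) ℝ).sum_repr (‖x‖⁻¹ • x : E n)]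
    rfl
  generalize (‖x‖⁻¹ • x : E n) = y at h ⊢
  conv_rhs => rw [h]
  simp only [map_sum, map_smul, sum_apply, smul_apply, smul_eq_mul]
  refine Finset.sum_congr rfl fun j _ => ?_
  rw [ContinuousLinearMap.smulRight_apply, innerSL_apply_apply, map_smul, smul_apply, smul_eq_mul,
    apply_coord_eq_inner, real_inner_comm, flatInner_comm, contr_apply]

variable {f g : ℝ → ℝ}

theorem coMetric_warped (hf0 : ∀ t, 0 < t → 0 < f t) (hg0 : ∀ t, 0 < t → 0 < g t) {x : E n}
    (hx : x ≠ 0) : coMetric (warpedMetric n f g) x =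
      radialField n (fun t => (f t)⁻¹) (fun t => t ^ 2 / g t) x := by
  have h0 := norm_pos_iff.2 hx
  have hf := hf0 _ h0
  have hg := hg0 _ h0
  have e1 : warpedMetric n f g x ∘L radialField n (fun t => (f t)⁻¹) (fun t => t ^ 2 / g t) x =
      ContinuousLinearMap.id ℝ (E n) := by
    rw [warpedMetric_eq, radialField_comp, ← radialField_one x]
    refine radialField_congr fun _ => ⟨?_, ?_⟩ <;> field_simp
  have e2 : radialField n (fun t => (f t)⁻¹) (fun t => t ^ 2 / g t) x ∘L warpedMetric n f g x =
      ContinuousLinearMap.id ℝ (E n) := by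
    rw [warpedMetric_eq, radialField_comp, ← radialField_one x]
    refine radialField_congr fun _ => ⟨?_, ?_⟩ <;> field_simp
  exact ContinuousLinearMap.inverse_eq e1 e2

theorem coMetric_warped_tangProj (hf0 : ∀ t, 0 < t → 0 < f t) (hg0 : ∀ t, 0 < t → 0 < g t)
    {x : E n} (hx : x ≠ 0) : coMetric (warpedMetric n f g) x ∘L tangProj x =
      (‖x‖ ^ 2 / g ‖x‖) • tangProj x := by
  rw [coMetric_warped hf0 hg0 hx]
  ext1 v
  rw [ContinuousLinearMap.comp_apply, radialField_apply _ _ hx, radialProj_tangProj hx,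
    tangProj_tangProj hx, smul_zero, zero_add, smul_apply]

theorem coMetric_warped_self (hf0 : ∀ t, 0 < t → 0 < f t) (hg0 : ∀ t, 0 < t → 0 < g t)
    {x : E n} (hx : x ≠ 0) : coMetric (warpedMetric n f g) x x = (f ‖x‖)⁻¹ • x := by
  rw [coMetric_warped hf0 hg0 hx, radialField_apply _ _ hx, radialProj_self hx, tangProj_self hx,
    smul_zero, add_zero]

/-- The scalar product with a covector that vanishes on the radial direction. -/
theorem formInner_warped_horizontal (hf0 : ∀ t, 0 < t → 0 < f t) (hg0 : ∀ t, 0 < t → 0 < g t)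
    {x : E n} (hx : x ≠ 0) (α : Cov n p) {β : Cov n p} (hβ : pull p (tangProj x) β = β) :
    formInner (warpedMetric n f g) x α β =
      ((g ‖x‖)⁻¹) ^ p * flatInner n p (slot p x α) (slot p x β) := by
  have h0 := norm_pos_iff.2 hx
  have hg := hg0 _ h0
  rw [formInner_eq, ← hβ, ← flatInner_pull_left (tangProj_symm x), pull_pull,
    coMetric_warped_tangProj hf0 hg0 hx, pull_smul, slot_pull_tangProj hx, slot_eq, slot_eq, hβ]
  simp only [map_smul, smul_apply, smul_eq_mul]
  rw [div_pow, inv_pow]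
  ring

/-- The scalar product with a covector of the form `ρ ∧ β`. -/
theorem formInner_warped_radialWedge (hf0 : ∀ t, 0 < t → 0 < f t) (hg0 : ∀ t, 0 < t → 0 < g t)
    {x : E n} (hx : x ≠ 0) (α : Cov n (p + 1)) {β : Cov n p}
    (hβ : pull p (tangProj x) β = β) :
    formInner (warpedMetric n f g) x α (radialWedge x β) = (-1) ^ p * ((f ‖x‖)⁻¹ *
      ((g ‖x‖)⁻¹) ^ p) * flatInner n p (slot p x (radialPart p x α)) (slot p x β) := by
  rw [formInner_eq, flatInner_radialWedge, contr_pull, map_smul,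
    coMetric_warped_self hf0 hg0 hx, smul_comm, (contr p).map_smul, smul_apply,
    (pull p _).map_smul, (flatInner n p).map_smul, smul_apply, ← formInner_eq,
    formInner_warped_horizontal hf0 hg0 hx _ hβ, radialPart, smul_apply, (slot p x).map_smul,
    (flatInner n p).map_smul, smul_apply, smul_eq_mul, smul_eq_mul]
  have : ((-1 : ℝ) ^ p) * (-1) ^ p = 1 := by rw [← mul_pow]; norm_num
  linear_combination (-(f ‖x‖)⁻¹ * ((g ‖x‖)⁻¹) ^ p *
    flatInner n p (slot p x (contr p (‖x‖⁻¹ • x) α)) (slot p x β)) * this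

theorem pow_mul_warpedVol {t : ℝ} (ht : 0 < t) :
    t ^ (n - 1) * warpedVol n f g t = √(f t * g t ^ (n - 1)) := by
  rw [warpedVol, ← Real.sqrt_sq (pow_pos ht (n - 1)).le, ← Real.sqrt_mul (by positivity)]
  congr 1
  rw [div_pow, ← pow_mul, ← pow_mul, mul_comm 2 (n - 1)]
  field_simp

end Horizontal

/-! ### Forms on the unit sphere -/

section SphereForms

variable {n p : ℕ}

theorem IsSphereForm.pull_tangProj {τ : Form n p} (h : IsSphereForm τ) {x : E n} (hx : x ≠ 0) :
    pull p (tangProj x) (τ x) = τ x :=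
  pull_tangProj_of_vanish (h.horizontal x hx)

/-- The smooth forms on the unit sphere, as a space of forms. -/
def sphereForms (n p : ℕ) : Submodule ℝ (Form n p) where
  carrier := {τ | IsSphereForm τ}
  add_mem' {σ τ} hσ hτ :=
    ⟨hσ.smooth.add hτ.smooth, fun x hx v hv => by
      simp [hσ.horizontal x hx v hv, hτ.horizontal x hx v hv], fun x hx c hc => by
      simp [hσ.invariant x hx c hc, hτ.invariant x hx c hc]⟩
  zero_mem' := ⟨contDiffOn_const, fun _ _ _ _ => rfl, fun _ _ _ _ => smul_zero _⟩
  smul_mem' a τ h :=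
    ⟨h.smooth.const_smul a, fun x hx v hv => by simp [h.horizontal x hx v hv],
      fun x hx c hc => by
        rw [Pi.smul_apply, Pi.smul_apply, smul_comm, h.invariant x hx c hc]⟩

theorem mem_sphereForms {τ : Form n p} : τ ∈ sphereForms n p ↔ IsSphereForm τ := Iff.rfl

/-- The restriction of a form to the points of the unit sphere, in coordinates. -/
def restr (τ : Form n p) : Sph n → CoordSpace n p := fun θ => coord n p (τ θ)

theorem cylMetric_unit {x : E n} (hx : ‖x‖ = 1) :
    cylMetric n x = ContinuousLinearMap.id ℝ (E n) := by
  have h0 : x ≠ 0 := by rw [← norm_pos_iff, hx]; norm_num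
  ext1 v
  simp [cylMetric, warpedMetric, h0, hx, tangProj_apply]

theorem sphereNormSq_eq (τ : Form n p) : sphereNormSq τ = eLpNorm (restr τ) 2 (surf n) ^ 2 := by
  have h : ∀ θ : Sph n, ENNReal.ofReal (formInner (cylMetric n) (θ : E n) (τ θ) (τ θ)) =
      ‖restr τ θ‖ₑ ^ (2 : ℝ) := fun θ => by
    rw [formInner_eq, coMetric, cylMetric_unit (norm_sph θ), ContinuousLinearMap.inverse_id,
      pull_id, flatInner_self, restr, ← ofReal_norm,
      ENNReal.ofReal_rpow_of_nonneg (norm_nonneg _) (by norm_num)]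
    norm_num
  rw [sphereNormSq]
  simp only [h]
  rw [eLpNorm_eq_lintegral_rpow_enorm_toReal (by norm_num) (by norm_num)]
  simp only [ENNReal.toReal_ofNat]
  rw [← ENNReal.rpow_natCast, ← ENNReal.rpow_mul]
  norm_num

theorem continuous_restr {τ : Form n p} (h : ContinuousOn τ {0}ᶜ) : Continuous (restr τ) :=
  (coord n p).continuous.comp (h.comp_continuous continuous_subtype_val fun θ => sph_ne_zero θ)

theorem memLp_sph_of_continuous {V : Type*} [NormedAddCommGroup V] {w : Sph n → V}
    (h : Continuous w) : MemLp w 2 (surf n) := by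
  obtain ⟨C, hC⟩ := isCompact_univ.exists_bound_of_continuousOn h.continuousOn
  exact MemLp.of_bound h.aestronglyMeasurable C
    (ae_of_all _ fun θ => hC θ (mem_univ _))

theorem memLp_restr {τ : Form n p} (h : ContinuousOn τ {0}ᶜ) : MemLp (restr τ) 2 (surf n) :=
  memLp_sph_of_continuous (continuous_restr h)

theorem IsSphereForm.memLp {τ : Form n p} (h : IsSphereForm τ) : MemLp (restr τ) 2 (surf n) :=
  memLp_restr h.smooth.continuousOn

theorem restr_sub (σ τ : Form n p) : restr (σ - τ) = restr σ - restr τ := by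
  funext θ; simp [restr]

/-- Smooth forms on the unit sphere as elements of `L²`. -/
def restrLp (n p : ℕ) : sphereForms n p →ₗ[ℝ] Lp (CoordSpace n p) 2 (surf n) where
  toFun τ := (IsSphereForm.memLp τ.2).toLp (restr τ)
  map_add' σ τ := by
    rw [← MemLp.toLp_add]
    congr 1
    funext θ; simp [restr]
  map_smul' c τ := by
    rw [RingHom.id_apply, ← MemLp.toLp_const_smul]
    congr 1
    funext θ; simp [restr]

/-- The closure in `L²` of a space of smooth forms on the sphere contains the square integrable
forms that are orthogonal to its orthogonal complement. -/
theorem inSphereClosure_of_orthogonal (K : Submodule ℝ (sphereForms n p)) {α : Form n p}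
    (hα : MemLp (restr α) 2 (surf n))
    (h : ∀ w ∈ (K.map (restrLp n p))ᗮ, ⟪hα.toLp (restr α), w⟫_ℝ = 0) :
    InSphereClosure {τ | ∃ hτ : τ ∈ sphereForms n p, (⟨τ, hτ⟩ : sphereForms n p) ∈ K} α := by
  intro ε hε
  have h1 : hα.toLp (restr α) ∈ (K.map (restrLp n p)).topologicalClosure := by
    rw [← Submodule.orthogonal_orthogonal_eq_closure, Submodule.mem_orthogonal]
    intro w hw
    rw [real_inner_comm]
    exact h w hw
  obtain ⟨δ, hδ, hδε⟩ : ∃ δ : ℝ≥0∞, 0 < δ ∧ δ ^ 2 < ε := by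
    obtain ⟨δ, hδ0, hδ⟩ := ENNReal.lt_iff_exists_nnreal_btwn.1 hε
    have hδ' : 0 < δ := by exact_mod_cast hδ0
    refine ⟨min δ 1, by simp [hδ'], lt_of_le_of_lt ?_ hδ⟩
    rw [sq]
    calc min (δ : ℝ≥0∞) 1 * min (δ : ℝ≥0∞) 1 ≤ δ * 1 :=
          mul_le_mul' (min_le_left _ _) (min_le_right _ _)
      _ = δ := mul_one _
  obtain ⟨y, ⟨τ, hτ, rfl⟩, hy⟩ := EMetric.mem_closure_iff.1 h1 δ hδ
  refine ⟨τ, ⟨τ.2, hτ⟩, ?_⟩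
  rw [sphereNormSq_eq, restr_sub]
  have h2 : edist (hα.toLp (restr α)) (restrLp n p τ) =
      eLpNorm (restr α - restr τ) 2 (surf n) := Lp.edist_toLp_toLp _ _ hα (IsSphereForm.memLp τ.2)
  rw [h2] at hy
  exact (pow_le_pow_left' hy.le 2).trans_lt hδε

/-- Orthogonality to a set of forms passes to its closure. -/
theorem integral_inner_eq_zero_of_inSphereClosure {S : Set (Form n p)} {α : Form n p}
    (hα : MemLp (restr α) 2 (surf n)) (hcl : InSphereClosure S α) {w : Sph n → CoordSpace n p}
    (hw : MemLp w 2 (surf n)) (hS : ∀ τ ∈ S, MemLp (restr τ) 2 (surf n))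
    (h : ∀ τ ∈ S, ∫ θ, ⟪restr τ θ, w θ⟫_ℝ ∂surf n = 0) :
    ∫ θ, ⟪restr α θ, w θ⟫_ℝ ∂surf n = 0 := by
  by_contra hne
  set c := |∫ θ, ⟪restr α θ, w θ⟫_ℝ ∂surf n| with hc
  have hc0 : 0 < c := abs_pos.2 hne
  set m := (eLpNorm w 2 (surf n)).toReal with hm
  have hm0 : 0 ≤ m := ENNReal.toReal_nonneg
  obtain ⟨τ, hτ, hτε⟩ := hcl (ENNReal.ofReal ((c / (m + 1)) ^ 2)) (by positivity)
  have h1 := MemLp.abs_integral_inner_real_le (hα.sub (hS τ hτ)) hw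
  have h2 : (eLpNorm (restr α - restr τ) 2 (surf n)).toReal < c / (m + 1) := by
    rw [sphereNormSq_eq, restr_sub, ENNReal.ofReal_pow (by positivity)] at hτε
    have h3 := lt_of_pow_lt_pow_left' 2 hτε
    exact (ENNReal.lt_ofReal_iff_toReal_lt (hα.sub (hS τ hτ)).2.ne).1 h3
  have h4 : ∫ θ, ⟪(restr α - restr τ) θ, w θ⟫_ℝ ∂surf n = ∫ θ, ⟪restr α θ, w θ⟫_ℝ ∂surf n := by
    simp only [Pi.sub_apply, inner_sub_left]
    rw [integral_sub (MemLp.integrable_inner_real hα hw)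
      (MemLp.integrable_inner_real (hS τ hτ) hw), h τ hτ, sub_zero]
  rw [h4, ← hc, ← hm] at h1
  have h5 : c ≤ c / (m + 1) * m := h1.trans (mul_le_mul_of_nonneg_right h2.le hm0)
  rw [div_mul_eq_mul_div, le_div_iff₀ (by positivity)] at h5
  nlinarith

/-- The pullback of a form under the map `x ↦ t x / |x|`. -/
def sphPull (t : ℝ) (ω : Form n p) : Form n p := fun x =>
  pull p ((t * ‖x‖⁻¹) • tangProj x) (ω ((t * ‖x‖⁻¹) • x))

theorem dilate_ne_zero {t : ℝ} (ht : 0 < t) {x : E n} (hx : x ≠ 0) : (t * ‖x‖⁻¹) • x ≠ 0 :=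
  smul_ne_zero (mul_pos ht (inv_pos.2 (norm_pos_iff.2 hx))).ne' hx

theorem contDiffOn_dilate (t : ℝ) :
    ContDiffOn ℝ (⊤ : ℕ∞) (fun x : E n => (t * ‖x‖⁻¹) • x) {0}ᶜ :=
  (contDiffOn_comp_norm (F := fun r => t * r⁻¹)
    (contDiffOn_const.mul (contDiffOn_id.inv fun _ ht => ne_of_gt ht))).smul contDiffOn_id

theorem fderiv_dilate (t : ℝ) {x : E n} (hx : x ≠ 0) :
    fderiv ℝ (fun x : E n => (t * ‖x‖⁻¹) • x) x = (t * ‖x‖⁻¹) • tangProj x := by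
  have h0 := norm_pos_iff.2 hx
  have h1 : HasDerivAt (fun r : ℝ => t * r⁻¹) (t * -(‖x‖ ^ 2)⁻¹) ‖x‖ :=
    (hasDerivAt_inv h0.ne').const_mul t
  have h2 := (hasFDerivAt_comp_norm hx h1).smul (hasFDerivAt_id x)
  refine h2.fderiv.trans ?_
  ext1 v
  simp only [add_apply, smul_apply, ContinuousLinearMap.smulRight_apply,
    ContinuousLinearMap.id_apply, tangProj_apply, radialProj_apply, smul_sub, smul_smul, id,
    innerSL_apply_apply, smul_eq_mul]
  rw [sub_eq_add_neg, ← neg_smul]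
  congr 2
  ring

theorem isSphereForm_sphPull {t : ℝ} (ht : 0 < t) {ω : Form n p}
    (hω : ContDiffOn ℝ (⊤ : ℕ∞) ω {0}ᶜ) : IsSphereForm (sphPull t ω) where
  smooth := by
    refine (contDiffOn_pull ?_).clm_apply (hω.comp (contDiffOn_dilate t) fun x hx =>
      dilate_ne_zero ht hx)
    exact (contDiffOn_comp_norm (F := fun r => t * r⁻¹)
      (contDiffOn_const.mul (contDiffOn_id.inv fun _ ht => ne_of_gt ht))).smul contDiffOn_tangProj
  horizontal x hx v hv := by
    obtain ⟨i, hi⟩ := hv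
    rw [sphPull, pull_apply]
    refine (ω _).map_coord_zero i ?_
    rw [hi, smul_apply, tangProj_self hx, smul_zero]
  invariant x hx c hc := by
    have e : (t * ‖c • x‖⁻¹) • c • x = (t * ‖x‖⁻¹) • x := by
      rw [smul_smul, norm_smul, Real.norm_of_nonneg hc.le]
      congr 1
      field_simp
    rw [sphPull, sphPull, e, tangProj_smul hc.ne', ← pull_smul, smul_smul, norm_smul,
      Real.norm_of_nonneg hc.le]
    congr 3
    field_simp

theorem extDeriv_sphPull {t : ℝ} (ht : 0 < t) {ω : Form n p}
    (hω : ContDiffOn ℝ (⊤ : ℕ∞) ω {0}ᶜ) {x : E n} (hx : x ≠ 0) :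
    extDeriv (sphPull t ω) x = sphPull t (extDeriv ω) x := by
  have hop : ({0}ᶜ : Set (E n)) ∈ 𝓝 x := isOpen_compl_singleton.mem_nhds hx
  have h1 : sphPull t ω =ᶠ[𝓝 x] fun y => (ω ((t * ‖y‖⁻¹) • y)).compContinuousLinearMap
      (fderiv ℝ (fun x : E n => (t * ‖x‖⁻¹) • x) y) := by
    filter_upwards [hop] with y hy
    rw [fderiv_dilate t hy]
    rfl
  rw [h1.extDeriv_eq, extDeriv_pullback (r := ((⊤ : ℕ∞) : WithTop ℕ∞)), fderiv_dilate t hx]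
  · rfl
  · exact (hω.contDiffAt (isOpen_compl_singleton.mem_nhds (dilate_ne_zero ht hx))).differentiableAt
      (by simp)
  · exact (contDiffOn_dilate t).contDiffAt hop
  · exact two_le_minSmoothness

theorem IsSphereForm.sphPull_one {τ : Form n p} (h : IsSphereForm τ) {x : E n} (hx : x ≠ 0) :
    sphPull 1 τ x = τ x := by
  have h0 := norm_pos_iff.2 hx
  rw [sphPull, pull_smul, one_mul]
  have h1 := h.pull_tangProj (smul_ne_zero (inv_ne_zero h0.ne') hx)
  rw [tangProj_smul (inv_ne_zero h0.ne')] at h1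
  rw [h1, h.invariant x hx _ (inv_pos.2 h0)]

theorem IsSphereForm.of_eqOn {σ τ : Form n p} (h : IsSphereForm σ) (he : EqOn τ σ {0}ᶜ) :
    IsSphereForm τ where
  smooth := h.smooth.congr he
  horizontal x hx v hv := by rw [he hx]; exact h.horizontal x hx v hv
  invariant x hx c hc := by
    rw [he hx, he (smul_ne_zero hc.ne' hx)]; exact h.invariant x hx c hc

theorem IsSphereForm.extDeriv {τ : Form n p} (h : IsSphereForm τ) :
    IsSphereForm (extDeriv τ) := by
  refine (isSphereForm_sphPull one_pos
    (contDiffOn_extDeriv isOpen_compl_singleton h.smooth)).of_eqOn fun x hx => ?_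
  rw [← extDeriv_sphPull one_pos h.smooth hx]
  have h1 : τ =ᶠ[𝓝 x] sphPull 1 τ := by
    filter_upwards [isOpen_compl_singleton.mem_nhds hx] with y hy
    exact (h.sphPull_one hy).symm
  exact h1.extDeriv_eq

/-- The restrictions of a form to the spheres, as a function on the cylinder. -/
def ang (ω : Form n p) : Sph n × ℝ → CoordSpace n p := fun q =>
  coord n p (slot p (polar q) (ω (polar q)))

theorem restr_sphPull {t : ℝ} (ht : 0 < t) (ω : Form n p) (θ : Sph n) :
    restr (sphPull t ω) θ = ang ω (θ, t) := by
  have hp : ‖polar (θ, t)‖ = t := norm_polar ht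
  rw [restr, sphPull, ang, slot, hp, polar, tangProj_smul ht.ne']
  simp

theorem restr_slice₁ {t : ℝ} (ht : 0 < t) (ω : Form n p) (θ : Sph n) :
    restr (slice₁ ω t) θ = ang ω (θ, t) := by
  have hp : ‖polar (θ, t)‖ = t := norm_polar ht
  rw [restr, ang, slot, hp, polar, tangProj_smul ht.ne']
  rfl

theorem restr_slice₂ {t : ℝ} (ht : 0 < t) (ω : Form n (p + 1)) (θ : Sph n) :
    restr (slice₂ ω t) θ = ang (fun x => radialPart p x (ω x)) (θ, t) := by
  have hp : ‖polar (θ, t)‖ = t := norm_polar ht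
  have h1 : ‖polar (θ, t)‖⁻¹ • polar (θ, t) = θ := by
    rw [hp, polar, smul_smul, inv_mul_cancel₀ ht.ne', one_smul]
  rw [restr, ang, radialPart, smul_apply, map_smul, h1, slot, hp, polar, tangProj_smul ht.ne']
  rfl

theorem IsSphereForm.ang_eq {τ : Form n p} (h : IsSphereForm τ) {q : Sph n × ℝ} (hq : 0 < q.2) :
    ang τ q = restr τ q.1 := by
  have h1 : tangProj (polar q) = tangProj (q.1 : E n) := tangProj_smul hq.ne' _
  rw [ang, slot_eq, h.pull_tangProj (polar_ne_zero hq), norm_polar hq, restr]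
  congr 1
  exact h.invariant _ (sph_ne_zero q.1) _ hq

theorem ang_extDeriv {t : ℝ} (ht : 0 < t) {ω : Form n p} (hω : ContDiffOn ℝ (⊤ : ℕ∞) ω {0}ᶜ)
    (θ : Sph n) : ang (extDeriv ω) (θ, t) = restr (extDeriv (sphPull t ω)) θ := by
  rw [← restr_sphPull ht, restr, restr, extDeriv_sphPull ht hω (sph_ne_zero θ)]

end SphereForms

/-! ### The codifferential of the unit sphere -/

section SphereCodiff

open MetricRoot (raised diverg)

variable {n p : ℕ}

theorem tangProj_comp_radialField (F K : ℝ → ℝ) {x : E n} (hx : x ≠ 0) :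
    tangProj x ∘L radialField n F K x = K ‖x‖ • tangProj x := by
  ext1 v
  rw [ContinuousLinearMap.comp_apply, radialField_apply _ _ hx, map_add, map_smul, map_smul,
    tangProj_radialProj hx, tangProj_tangProj hx, smul_zero, zero_add, smul_apply]

theorem pull_radialField (F K : ℝ → ℝ) {x : E n} (hx : x ≠ 0) {α : Cov n p}
    (hα : pull p (tangProj x) α = α) : pull p (radialField n F K x) α = K ‖x‖ ^ p • α := by
  conv_lhs => rw [← hα]
  rw [pull_pull, tangProj_comp_radialField F K hx, pull_smul, hα]

/-- The divergence of a form that vanishes on the radial direction does so, too. -/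
theorem pull_tangProj_diverg {F : Form n (p + 1)} (hF : ContDiffOn ℝ (⊤ : ℕ∞) F {0}ᶜ)
    (hor : ∀ y, y ≠ 0 → contr p y (F y) = 0) {x : E n} (hx : x ≠ 0) :
    pull p (tangProj x) (diverg F x) = diverg F x := by
  cases p with
  | zero => ext v; rw [pull_apply]; congr 1; exact Subsingleton.elim _ _
  | succ p =>
    refine pull_tangProj_of_contr ?_
    have hop : ({0}ᶜ : Set (E n)) ∈ 𝓝 x := isOpen_compl_singleton.mem_nhds hx
    have hd : HasFDerivAt F (fderiv ℝ F x) x :=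
      ((hF.contDiffAt hop).differentiableAt (by simp)).hasFDerivAt
    have h1 := (contr (p + 1)).hasFDerivAt_of_bilinear (hasFDerivAt_id x) hd
    have h2 : (fun y => contr (p + 1) (id y) (F y)) =ᶠ[𝓝 x] fun _ => 0 := by
      filter_upwards [hop] with y hy using hor y hy
    have h3 := h1.unique ((hasFDerivAt_const (0 : Cov n (p + 1)) x).congr_of_eventuallyEq h2)
    -- Differentiate the identity `ι_y F(y) = 0`.
    have h4 : ∀ v, contr (p + 1) x (fderiv ℝ F x v) = -contr (p + 1) v (F x) := fun v => by
      have := congrArg (fun L => L v) h3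
      simp only [add_apply, ContinuousLinearMap.precompR_apply, ContinuousLinearMap.precompL_apply,
        ContinuousLinearMap.id_apply, id, zero_apply] at this
      exact eq_neg_of_add_eq_zero_left this
    rw [diverg, map_sum]
    refine Finset.sum_eq_zero fun j _ => ?_
    rw [contr_contr_comm, h4, map_neg, neg_neg, contr_contr_self]

theorem one_pos' : ∀ t : ℝ, 0 < t → 0 < (1 : ℝ → ℝ) t := fun _ _ => one_pos

theorem contr_raised_cyl {ψ : Form n (p + 1)} {y : E n} (hy : y ≠ 0)
    (h : contr p y (ψ y) = 0) : contr p y (raised (cylMetric n) ψ y) = 0 := by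
  have e : coMetric (cylMetric n) y y = y := by
    have := coMetric_warped_self (n := n) one_pos' one_pos' hy
    rwa [Pi.one_apply, inv_one, one_smul] at this
  rw [raised, map_smul, contr_pull, e, h, map_zero, smul_zero]

theorem codiff_cyl_eq {ψ : Form n (p + 1)} (hψ : ContDiffOn ℝ (⊤ : ℕ∞) ψ {0}ᶜ)
    (hor : ∀ y, y ≠ 0 → contr p y (ψ y) = 0) {x : E n} (hx : x ≠ 0) :
    codiff (cylMetric n) ψ x = -((volDensity (cylMetric n) x)⁻¹ • ((1 / ‖x‖ ^ 2) ^ p •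
      diverg (raised (cylMetric n) ψ) x)) := by
  have e := pull_radialField 1 (fun t => (1 : ℝ → ℝ) t / t ^ 2) hx
    (pull_tangProj_diverg ((cylRoot n).smooth_raised hψ)
      (fun y hy => contr_raised_cyl hy (hor y hy)) hx)
  exact congrArg (fun β => -((volDensity (cylMetric n) x)⁻¹ • β)) e

theorem pull_tangProj_codiff_cyl {ψ : Form n (p + 1)} (hψ : ContDiffOn ℝ (⊤ : ℕ∞) ψ {0}ᶜ)
    (hor : ∀ y, y ≠ 0 → contr p y (ψ y) = 0) {x : E n} (hx : x ≠ 0) :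
    pull p (tangProj x) (codiff (cylMetric n) ψ x) = codiff (cylMetric n) ψ x := by
  rw [codiff_cyl_eq hψ hor hx, map_neg, map_smul, map_smul, pull_tangProj_diverg
    ((cylRoot n).smooth_raised hψ) (fun y hy => contr_raised_cyl hy (hor y hy)) hx]

theorem volDensity_cyl {x : E n} (hx : x ≠ 0) :
    volDensity (cylMetric n) x = (‖x‖ ^ (n - 1))⁻¹ := by
  have h0 := norm_pos_iff.2 hx
  have := pow_mul_warpedVol (n := n) (f := 1) (g := 1) h0
  rw [cylMetric, volDensity_warpedMetric one_pos' hx]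
  simp only [Pi.one_apply, one_pow, mul_one, Real.sqrt_one] at this
  exact eq_inv_of_mul_eq_one_right this

theorem IsSphereForm.contr_eq_zero {τ : Form n (p + 1)} (h : IsSphereForm τ) {x : E n}
    (hx : x ≠ 0) : contr p x (τ x) = 0 :=
  contr_of_vanish (h.horizontal x hx)

theorem IsSphereForm.raised_cyl {τ : Form n (p + 1)} (h : IsSphereForm τ) {y : E n}
    (hy : y ≠ 0) : raised (cylMetric n) τ y =
      (‖y‖ ^ (n - 1))⁻¹ • (‖y‖ ^ 2) ^ (p + 1) • τ y := by
  have := coMetric_warped (n := n) one_pos' one_pos' hy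
  rw [raised, volDensity_cyl hy, cylMetric, this, pull_radialField _ _ hy (h.pull_tangProj hy),
    Pi.one_apply, div_one]

/-- The codifferential of the product metric maps forms on the sphere to forms on the sphere. -/
theorem IsSphereForm.codiff_cyl {τ : Form n (p + 1)} (h : IsSphereForm τ) :
    IsSphereForm (codiff (cylMetric n) τ) where
  smooth := (cylRoot n).smooth_codiff h.smooth
  horizontal x hx := vanish_of_pull_tangProj hx
    (pull_tangProj_codiff_cyl h.smooth (fun _ => h.contr_eq_zero) hx)
  invariant x hx c hc := by
    set F := raised (cylMetric n) τ with hF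
    have hcx : c • x ≠ 0 := smul_ne_zero hc.ne' hx
    have h0 := norm_pos_iff.2 hx
    have hFs : ContDiffOn ℝ (⊤ : ℕ∞) F {0}ᶜ := (cylRoot n).smooth_raised h.smooth
    -- The raised form is homogeneous of degree `p + 1 - (n - 1)`; the divergence lowers the degree
    -- by one.
    have hhom : ∀ y : E n, y ≠ 0 → c ^ (n - 1) • F (c • y) = c ^ (p + 1) • F y := fun y hy => by
      have hy0 := norm_pos_iff.2 hy
      rw [hF, h.raised_cyl hy, h.raised_cyl (smul_ne_zero hc.ne' hy),
        ← h.invariant y hy c hc, norm_smul, Real.norm_of_nonneg hc.le]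
      simp only [smul_smul]
      congr 1
      field_simp
      ring
    have hd : ∀ y : E n, y ≠ 0 → HasFDerivAt F (fderiv ℝ F y) y := fun y hy =>
      ((hFs.contDiffAt (isOpen_compl_singleton.mem_nhds hy)).differentiableAt (by simp)).hasFDerivAt
    have hder : ∀ v, (c ^ (n - 1) * c) • fderiv ℝ F (c • x) v = c ^ (p + 1) • fderiv ℝ F x v := by
      intro v
      have e1 := ((hd _ hcx).comp x ((hasFDerivAt_id x).const_smul c)).const_smul (c ^ (n - 1))
      have e2 := ((hd x hx).const_smul (c ^ (p + 1))).congr_of_eventuallyEq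
        (f₁ := fun y => c ^ (n - 1) • F (c • y)) (by
          filter_upwards [isOpen_compl_singleton.mem_nhds hx] with y hy using hhom y hy)
      have e3 := congrArg (fun L => L v) (e1.unique e2)
      simpa [smul_smul] using e3
    have hdiv : (c ^ (n - 1) * c) • diverg F (c • x) = c ^ (p + 1) • diverg F x := by
      simp only [diverg, Finset.smul_sum, ← map_smul, hder]
    have hdiv' : c ^ (n - 1) • diverg F (c • x) = c ^ p • diverg F x := by
      have h1 : c • c ^ (n - 1) • diverg F (c • x) = c • c ^ p • diverg F x := by
        rw [smul_smul, smul_smul, mul_comm c, hdiv, pow_succ, mul_comm]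
      exact smul_right_injective _ hc.ne' h1
    have hdiv'' : diverg F (c • x) = (c ^ (n - 1))⁻¹ • c ^ p • diverg F x := by
      rw [← hdiv', smul_smul, inv_mul_cancel₀ (by positivity), one_smul]
    rw [codiff_cyl_eq h.smooth (fun _ => h.contr_eq_zero) hx,
      codiff_cyl_eq h.smooth (fun _ => h.contr_eq_zero) hcx, volDensity_cyl hx, volDensity_cyl hcx,
      ← hF, hdiv'', norm_smul, Real.norm_of_nonneg hc.le]
    simp only [smul_neg, smul_smul, inv_inv]
    congr 2
    simp only [one_div, mul_pow, inv_pow, mul_inv]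
    field_simp
    ring

end SphereCodiff

/-! ### Green's formula on the cylinder -/

section Green

variable {n p : ℕ}

theorem contDiff_radial {a : ℝ → ℝ} (ha : ContDiff ℝ (⊤ : ℕ∞) a) (hw : IsWeight a) :
    ContDiff ℝ (⊤ : ℕ∞) fun x : E n => a ‖x‖ := by
  obtain ⟨r, R, C, hr, h0, -⟩ := hw.exists_bounds
  refine contDiff_of_eventually_const (c := 0) (contDiffOn_comp_norm ha.contDiffOn) ?_
  filter_upwards [Metric.ball_mem_nhds (0 : E n) hr] with x hx
  exact h0 _ fun h => absurd h.1 (by simpa using hx)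

theorem tsupport_radial {a : ℝ → ℝ} (hw : IsWeight a) :
    tsupport (fun x : E n => a ‖x‖) ⊆ {0}ᶜ := by
  have h1 : tsupport (fun x : E n => a ‖x‖) ⊆ (fun x : E n => ‖x‖) ⁻¹' tsupport a :=
    tsupport_comp_subset_preimage a continuous_norm
  exact fun x hx => norm_pos_iff.1 (hw.support (h1 hx))

theorem hasCompactSupport_radial {a : ℝ → ℝ} (hw : IsWeight a) :
    HasCompactSupport fun x : E n => a ‖x‖ := by
  obtain ⟨r, R, C, hr, h0, -⟩ := hw.exists_bounds
  refine HasCompactSupport.of_support_subset_isCompact (isCompact_closedBall (0 : E n) R) ?_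
  intro x hx
  by_contra h
  exact hx (h0 _ fun h' => h (by simpa using h'.2))

/-- The product of a radial function with a form. -/
def radialMul (a : ℝ → ℝ) (ω : Form n p) : Form n p := fun x => a ‖x‖ • ω x

theorem contDiffOn_radialMul {a : ℝ → ℝ} (ha : ContDiff ℝ (⊤ : ℕ∞) a) {ω : Form n p}
    (hω : ContDiffOn ℝ (⊤ : ℕ∞) ω {0}ᶜ) : ContDiffOn ℝ (⊤ : ℕ∞) (radialMul a ω) {0}ᶜ :=
  (contDiffOn_comp_norm ha.contDiffOn).smul hω

theorem tsupport_radialMul {a : ℝ → ℝ} (hw : IsWeight a) (ω : Form n p) :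
    tsupport (radialMul a ω) ⊆ {0}ᶜ :=
  (tsupport_smul_subset_left (fun x : E n => a ‖x‖) ω).trans (tsupport_radial hw)

theorem isTestForm_radialMul {a : ℝ → ℝ} (ha : ContDiff ℝ (⊤ : ℕ∞) a) (hw : IsWeight a)
    {ω : Form n p} (hω : ContDiffOn ℝ (⊤ : ℕ∞) ω {0}ᶜ) : IsTestForm (radialMul a ω) :=
  ⟨contDiff_bilin (ContinuousLinearMap.lsmul ℝ ℝ) isOpen_compl_singleton (contDiff_radial ha hw)
    (tsupport_radial hw) hω, (hasCompactSupport_radial hw).smul_right⟩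

theorem extDeriv_radialMul {a : ℝ → ℝ} (ha : ContDiff ℝ (⊤ : ℕ∞) a) {ω : Form n p}
    (hω : ContDiffOn ℝ (⊤ : ℕ∞) ω {0}ᶜ) {x : E n} (hx : x ≠ 0) :
    extDeriv (radialMul a ω) x = a ‖x‖ • extDeriv ω x + deriv a ‖x‖ • radialWedge x (ω x) := by
  have h1 := hasFDerivAt_comp_norm hx (ha.differentiable (by simp) ‖x‖).hasDerivAt
  have h2 := h1.smul ((hω.contDiffAt (isOpen_compl_singleton.mem_nhds hx)).differentiableAt
    (by simp)).hasFDerivAt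
  have h4 : ((deriv a ‖x‖ * ‖x‖⁻¹) • innerSL ℝ x).smulRight (ω x) =
      deriv a ‖x‖ • (innerSL ℝ (‖x‖⁻¹ • x)).smulRight (ω x) := by
    ext1 v
    simp [smul_smul, mul_assoc]
  have h3 : fderiv ℝ (radialMul a ω) x = a ‖x‖ • fderiv ℝ ω x +
      deriv a ‖x‖ • (innerSL ℝ (‖x‖⁻¹ • x)).smulRight (ω x) := h2.fderiv.trans (by rw [h4])
  rw [extDeriv, h3, ContinuousAlternatingMap.alternatizeUncurryFin_add,
    ContinuousAlternatingMap.alternatizeUncurryFin_smul,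
    ContinuousAlternatingMap.alternatizeUncurryFin_smul, extDeriv, radialWedge]

theorem aestronglyMeasurable_of_continuousOn_compl {W : Type*} [NormedAddCommGroup W]
    [Nontrivial (E n)] {F : E n → W} (h : ContinuousOn F {0}ᶜ) : AEStronglyMeasurable F := by
  rw [← restrict_compl_singleton (μ := (volume : Measure (E n))) 0]
  exact h.aestronglyMeasurable (measurableSet_singleton _).compl

theorem MetricRoot.aestronglyMeasurable_formInner [Nontrivial (E n)] {G : MetricField n}
    (M : MetricRoot G {0}ᶜ) {ω η : Form n p} (hω : AEStronglyMeasurable ω)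
    (hη : AEStronglyMeasurable η) :
    AEStronglyMeasurable fun x => formInner G x (ω x) (η x) * volDensity G x := by
  refine AEStronglyMeasurable.mul ?_ (aestronglyMeasurable_of_continuousOn_compl
    M.smooth_vol.continuousOn)
  simp only [formInner]
  refine AEStronglyMeasurable.const_mul (Finset.aestronglyMeasurable_fun_sum _ fun I _ => ?_) _
  refine AEStronglyMeasurable.mul ?_ ((continuous_eval_const _).comp_aestronglyMeasurable hη)
  simp only [Cov.apply_eq_sum (ω _) fun k => coMetric G _ _]
  refine Finset.aestronglyMeasurable_fun_sum _ fun J _ => AEStronglyMeasurable.mul ?_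
    ((continuous_eval_const _).comp_aestronglyMeasurable hω)
  refine aestronglyMeasurable_of_continuousOn_compl (continuousOn_finsetProd _ fun k _ => ?_)
  exact (EuclideanSpace.proj (𝕜 := ℝ) (J k)).continuous.comp_continuousOn
    (M.smooth_coMetric.continuousOn.clm_apply continuousOn_const)

variable {f g : ℝ → ℝ}

/-- The scalar product with a form that vanishes on the radial direction, in polar coordinates. -/
theorem l2Inner_warped_horizontal [Nontrivial (E n)]
    (hf : ContDiffOn ℝ (⊤ : ℕ∞) f (Ioi 0)) (hg : ContDiffOn ℝ (⊤ : ℕ∞) g (Ioi 0))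
    (hf0 : ∀ t, 0 < t → 0 < f t) (hg0 : ∀ t, 0 < t → 0 < g t) {ω η : Form n p}
    (hω : AEStronglyMeasurable ω) (hη : AEStronglyMeasurable η)
    (hor : ∀ x, x ≠ 0 → pull p (tangProj x) (η x) = η x) :
    l2Inner (warpedMetric n f g) ω η =
      ∫ q, (√(f q.2 * g q.2 ^ (n - 1)) * ((g q.2)⁻¹) ^ p) * ⟪ang ω q, ang η q⟫_ℝ ∂cylMeas n := by
  rw [l2Inner, integral_polar _ ((rootCompl hf hg hf0 hg0).aestronglyMeasurable_formInner hω hη)]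
  refine integral_congr_ae ?_
  filter_upwards [ae_cylMeas_pos] with q hq
  have hx := polar_ne_zero hq
  rw [formInner_warped_horizontal hf0 hg0 hx _ (hor _ hx), volDensity_warpedMetric hg0 hx,
    norm_polar hq, ← pow_mul_warpedVol hq, flatInner_eq_inner]
  simp only [ang]
  ring

/-- The scalar product with a form `ρ ∧ η`, in polar coordinates. -/
theorem l2Inner_warped_radialWedge [Nontrivial (E n)]
    (hf : ContDiffOn ℝ (⊤ : ℕ∞) f (Ioi 0)) (hg : ContDiffOn ℝ (⊤ : ℕ∞) g (Ioi 0))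
    (hf0 : ∀ t, 0 < t → 0 < f t) (hg0 : ∀ t, 0 < t → 0 < g t) {ω : Form n (p + 1)}
    {η : Form n p} (hω : AEStronglyMeasurable ω)
    (hη : AEStronglyMeasurable fun x => radialWedge x (η x))
    (hor : ∀ x, x ≠ 0 → pull p (tangProj x) (η x) = η x) :
    l2Inner (warpedMetric n f g) ω (fun x => radialWedge x (η x)) =
      ∫ q, ((-1) ^ p * (√(f q.2 * g q.2 ^ (n - 1)) * (f q.2)⁻¹ * ((g q.2)⁻¹) ^ p)) *
        ⟪ang (fun x => radialPart p x (ω x)) q, ang η q⟫_ℝ ∂cylMeas n := by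
  rw [l2Inner, integral_polar _ ((rootCompl hf hg hf0 hg0).aestronglyMeasurable_formInner hω hη)]
  refine integral_congr_ae ?_
  filter_upwards [ae_cylMeas_pos] with q hq
  have hx := polar_ne_zero hq
  rw [formInner_warped_radialWedge hf0 hg0 hx _ (hor _ hx), volDensity_warpedMetric hg0 hx,
    norm_polar hq, ← pow_mul_warpedVol hq, flatInner_eq_inner]
  simp only [ang]
  ring

theorem ang_radialMul (a : ℝ → ℝ) (ω : Form n p) {q : Sph n × ℝ} (hq : 0 < q.2) :
    ang (radialMul a ω) q = a q.2 • ang ω q := by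
  rw [ang, radialMul, map_smul, map_smul, norm_polar hq, ang]

theorem ang_extDeriv_radialMul {a : ℝ → ℝ} (ha : ContDiff ℝ (⊤ : ℕ∞) a) {ω : Form n p}
    (hω : ContDiffOn ℝ (⊤ : ℕ∞) ω {0}ᶜ) {q : Sph n × ℝ} (hq : 0 < q.2) :
    ang (extDeriv (radialMul a ω)) q = a q.2 • ang (extDeriv ω) q := by
  rw [ang, extDeriv_radialMul ha hω (polar_ne_zero hq), map_add, map_smul, map_smul,
    slot_radialWedge (polar_ne_zero hq), smul_zero, add_zero, map_smul, norm_polar hq, ang]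

/-- On the cylinder, `d` and `δ` along the spheres are adjoint. -/
theorem green_cyl [Nontrivial (E n)] {a : ℝ → ℝ} (ha : ContDiff ℝ (⊤ : ℕ∞) a) (hw : IsWeight a)
    {φ : Form n p} {ψ : Form n (p + 1)} (hφ : ContDiffOn ℝ (⊤ : ℕ∞) φ {0}ᶜ)
    (hψ : ContDiffOn ℝ (⊤ : ℕ∞) ψ {0}ᶜ) (hor : ∀ y, y ≠ 0 → contr p y (ψ y) = 0) :
    ∫ q, a q.2 * ⟪ang (extDeriv φ) q, ang ψ q⟫_ℝ ∂cylMeas n =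
      ∫ q, a q.2 * ⟪ang φ q, ang (codiff (cylMetric n) ψ) q⟫_ℝ ∂cylMeas n := by
  have ht := isTestForm_radialMul ha hw hφ
  have h : l2Inner (warpedMetric n 1 1) (extDeriv (radialMul a φ)) ψ =
      l2Inner (warpedMetric n 1 1) (radialMul a φ) (codiff (cylMetric n) ψ) :=
    (cylRoot n).green ht (tsupport_radialMul hw φ) hψ
  -- As `ψ` is horizontal, the term `da ∧ φ` of `d(a φ)` is orthogonal to it.
  have hs : ContDiffOn ℝ (⊤ : ℕ∞) (1 : ℝ → ℝ) (Ioi 0) := contDiffOn_const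
  have hc := (cylRoot n).smooth_codiff hψ
  rw [l2Inner_warped_horizontal hs hs one_pos' one_pos'
      ht.extDeriv.1.continuous.aestronglyMeasurable
      (aestronglyMeasurable_of_continuousOn_compl hψ.continuousOn)
      (fun x hx => pull_tangProj_of_contr (hor x hx)),
    l2Inner_warped_horizontal hs hs one_pos' one_pos' ht.1.continuous.aestronglyMeasurable
      (aestronglyMeasurable_of_continuousOn_compl hc.continuousOn)
      (fun x hx => pull_tangProj_codiff_cyl hψ hor hx)] at h
  refine Eq.trans (integral_congr_ae ?_) (h.trans (integral_congr_ae ?_))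
  · filter_upwards [ae_cylMeas_pos] with q hq
    rw [ang_extDeriv_radialMul ha hφ hq, real_inner_smul_left]
    simp
  · filter_upwards [ae_cylMeas_pos] with q hq
    rw [ang_radialMul a φ hq, real_inner_smul_left]
    simp

end Green

/-! ### Restrictions of forms to spheres, tested against forms on the unit sphere -/

section Tested

variable {n p q : ℕ} {G : MetricField n}

theorem MetricRoot.contDiffOn_field (M : MetricRoot G univ) {B : E n → Cov n p →L[ℝ] Cov n q}
    (hB : ContDiffOn ℝ (⊤ : ℕ∞) B {0}ᶜ) : ContinuousOn (fun x =>
      (coord n q : Cov n q →L[ℝ] CoordSpace n q) ∘L B x ∘L M.unlift p x) {0}ᶜ := by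
  refine ContDiffOn.continuousOn (𝕜 := ℝ) (n := ((⊤ : ℕ∞) : WithTop ℕ∞))
    (contDiffOn_clm_apply.2 fun α => ?_)
  exact (coord n q).contDiff.comp_contDiffOn
    (hB.clm_apply (M.smooth_unlift.contDiffOn.clm_apply contDiffOn_const))

theorem MetricRoot.locL2_field [Nontrivial (E n)] (M : MetricRoot G univ)
    {B : E n → Cov n p →L[ℝ] Cov n q} (hB : ContDiffOn ℝ (⊤ : ℕ∞) B {0}ᶜ) {ω : Form n p}
    (hω : MemL2 G ω) : LocL2 fun s => coord n q (B (polar s) (ω (polar s))) := by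
  intro r R hr
  obtain ⟨C, hC, h⟩ := exists_eLpNorm_polar_le (M.contDiffOn_field hB) hr R
  have hu := M.memL2_iff.1 hω
  obtain ⟨h1, h2⟩ := h (M.up ω) hu.1
  simp only [ContinuousLinearMap.comp_apply, MetricRoot.up, M.unlift_lift] at h1 h2
  exact ⟨h1, h2.trans_lt (ENNReal.mul_lt_top hC.lt_top hu.2)⟩

theorem MetricRoot.locTendsto_field [Nontrivial (E n)] (M : MetricRoot G univ)
    {B : E n → Cov n p →L[ℝ] Cov n q} (hB : ContDiffOn ℝ (⊤ : ℕ∞) B {0}ᶜ) {φ : ℕ → Form n p}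
    {ω : Form n p} (hφ : ∀ k, MemL2 G (φ k)) (hω : MemL2 G ω)
    (h : Tendsto (fun k => normSq G (φ k - ω)) atTop (𝓝 0)) :
    LocTendsto (fun k s => coord n q (B (polar s) (φ k (polar s))))
      fun s => coord n q (B (polar s) (ω (polar s))) := by
  intro r R hr
  obtain ⟨C, hC, hb⟩ := exists_eLpNorm_polar_le (M.contDiffOn_field hB) hr R
  have hs : ∀ k, MemLp (M.up (φ k) - M.up ω) 2 volume := fun k =>
    (M.memL2_iff.1 (hφ k)).sub (M.memL2_iff.1 hω)
  have h1 := (M.tendsto_normSq_iff hφ hω).1 h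
  have h2 : Tendsto (fun k => eLpNorm (M.up (φ k) - M.up ω) 2 volume) atTop (𝓝 0) :=
    (ENNReal.tendsto_toReal_zero_iff fun k => (hs k).2.ne).1 h1
  have h3 := ENNReal.Tendsto.const_mul h2 (Or.inr hC)
  rw [mul_zero] at h3
  refine tendsto_of_tendsto_of_tendsto_of_le_of_le tendsto_const_nhds h3 (fun _ => zero_le)
    fun k => ?_
  have h4 := (hb _ (hs k).1).2
  rw [← M.up_sub] at h4
  simp only [ContinuousLinearMap.comp_apply, MetricRoot.up, M.unlift_lift] at h4
  rw [← MetricRoot.up_sub]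
  refine le_trans (le_of_eq ?_) h4
  congr 1
  funext s
  simp

/-- The restrictions to spheres of the radial part of a form. -/
def angRad (ω : Form n (p + 1)) : Sph n × ℝ → CoordSpace n p :=
  ang fun x => radialPart p x (ω x)

theorem contDiffOn_slot_radialPart :
    ContDiffOn ℝ (⊤ : ℕ∞) (fun x : E n => slot p x ∘L radialPart p x) {0}ᶜ :=
  contDiffOn_clm_apply.2 fun _ =>
    contDiffOn_slot.clm_apply (contDiffOn_radialPart.clm_apply contDiffOn_const)

theorem MetricRoot.locL2_ang [Nontrivial (E n)] (M : MetricRoot G univ) {ω : Form n p}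
    (hω : MemL2 G ω) : LocL2 (ang ω) := M.locL2_field contDiffOn_slot hω

theorem MetricRoot.locL2_angRad [Nontrivial (E n)] (M : MetricRoot G univ) {ω : Form n (p + 1)}
    (hω : MemL2 G ω) : LocL2 (angRad ω) := M.locL2_field contDiffOn_slot_radialPart hω

theorem MetricRoot.locTendsto_ang [Nontrivial (E n)] (M : MetricRoot G univ) {φ : ℕ → Form n p}
    {ω : Form n p} (hφ : ∀ k, MemL2 G (φ k)) (hω : MemL2 G ω)
    (h : Tendsto (fun k => normSq G (φ k - ω)) atTop (𝓝 0)) :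
    LocTendsto (fun k => ang (φ k)) (ang ω) := M.locTendsto_field contDiffOn_slot hφ hω h

theorem MetricRoot.locTendsto_angRad [Nontrivial (E n)] (M : MetricRoot G univ)
    {φ : ℕ → Form n (p + 1)} {ω : Form n (p + 1)} (hφ : ∀ k, MemL2 G (φ k)) (hω : MemL2 G ω)
    (h : Tendsto (fun k => normSq G (φ k - ω)) atTop (𝓝 0)) :
    LocTendsto (fun k => angRad (φ k)) (angRad ω) :=
  M.locTendsto_field contDiffOn_slot_radialPart hφ hω h

theorem continuousOn_ang {ω : Form n p} (h : ContinuousOn ω {0}ᶜ) :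
    ContinuousOn (ang ω) (univ ×ˢ Ioi 0) := by
  refine (coord n p).continuous.comp_continuousOn ?_
  exact (contDiffOn_slot.continuousOn.clm_apply h).comp continuous_polar.continuousOn
    fun q hq => polar_ne_zero hq.2

theorem locL2_ang_of_continuousOn {ω : Form n p} (h : ContinuousOn ω {0}ᶜ) : LocL2 (ang ω) := by
  intro r R hr
  have h1 : ContinuousOn (ang ω) (univ ×ˢ Icc r R) :=
    (continuousOn_ang h).mono fun q hq => ⟨hq.1, hr.trans_le hq.2.1⟩
  obtain ⟨C, hC⟩ := (isCompact_univ.prod isCompact_Icc).exists_bound_of_continuousOn h1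
  refine MemLp.of_bound ?_ C ?_
  · rw [annMeas_eq]
    exact h1.aestronglyMeasurable (MeasurableSet.univ.prod measurableSet_Icc)
  · filter_upwards [ae_annMeas_mem r R] with q hq using hC q ⟨mem_univ _, hq⟩

/-- The restrictions of a smooth form to spheres are orthogonal to whatever is orthogonal to all
smooth forms on the unit sphere. -/
theorem pairing_ang_eq_zero {ω : Form n p} (hω : ContDiffOn ℝ (⊤ : ℕ∞) ω {0}ᶜ) {b : ℝ → ℝ}
    (hb : IsWeight b) {w : Sph n → CoordSpace n p} (hw : MemLp w 2 (surf n))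
    (h : ∀ β : Form n p, IsSphereForm β → ∫ θ, ⟪restr β θ, w θ⟫_ℝ ∂surf n = 0) :
    pairing b (ang ω) w = 0 := by
  refine pairing_eq_zero hb (locL2_ang_of_continuousOn hω.continuousOn) hw ?_
  filter_upwards [ae_restrict_mem measurableSet_Ioi] with t ht
  simp only [← restr_sphPull ht]
  exact h _ (isSphereForm_sphPull ht hω)

/-- Integration by parts in the variable `t`. -/
theorem pairing_hasDerivAt {V : Type*} [NormedAddCommGroup V] [InnerProductSpace ℝ V]
    {L D : Sph n × ℝ → V} (hL : LocL2 L) (hD : LocL2 D)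
    (hder : ∀ θ t, 0 < t → HasDerivAt (fun s => L (θ, s)) (D (θ, t)) t)
    (hcont : ∀ θ, ContinuousOn (fun s => D (θ, s)) (Ioi 0)) {a : ℝ → ℝ}
    (ha : ContDiff ℝ (⊤ : ℕ∞) a) (hw : IsWeight a) (hw' : IsWeight (deriv a)) {w : Sph n → V}
    (hm : MemLp w 2 (surf n)) : pairing a D w = -pairing (deriv a) L w := by
  obtain ⟨r, R, C, hr, h0, -⟩ := hw.exists_bounds
  set r' := r / 2
  set R' := max r R + 1
  have hr' : 0 < r' := by positivity
  have hrr : r' < r := by simp only [r']; linarith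
  have hle : r' ≤ R' := by simp only [R']; linarith [le_max_left r R]
  have e0 : ∀ t, t ∉ Icc r' R' → a t = 0 := fun t ht => h0 t fun h => ht ⟨hrr.le.trans h.1,
    h.2.trans ((le_max_right r R).trans (by simp only [R']; linarith))⟩
  have e1 : ∀ t, t ∉ Icc r' R' → deriv a t = 0 := fun t ht => by
    have : a =ᶠ[𝓝 t] fun _ => 0 := by
      filter_upwards [isClosed_Icc.isOpen_compl.mem_nhds ht] with s hs using e0 s hs
    rw [this.deriv_eq, deriv_const]
  have er : a r' = 0 := h0 _ fun h => absurd h.1 (not_le.2 hrr)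
  have eR : a R' = 0 := h0 _ fun h => absurd h.2
    (not_le.2 ((le_max_right r R).trans_lt (by simp only [R']; linarith)))
  have i1 := MemLp.integrable_inner_real (hD r' R' hr') (memLp_weight_smul hw hm r' R')
  have i2 := MemLp.integrable_inner_real (hL r' R' hr') (memLp_weight_smul hw' hm r' R')
  rw [eq_neg_iff_add_eq_zero, pairing_eq hr' e0, pairing_eq hr' e1, ← integral_add i1 i2, annMeas,
    integral_prod (fun s : Sph n × ℝ => ⟪D s, a s.2 • w s.1⟫_ℝ + ⟪L s, deriv a s.2 • w s.1⟫_ℝ)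
      (i1.add i2)]
  refine integral_eq_zero_of_ae (ae_of_all _ fun θ => ?_)
  simp only [Pi.zero_apply]
  have hpos : ∀ t ∈ uIcc r' R', 0 < t := fun t ht => by
    rw [uIcc_of_le hle] at ht; exact hr'.trans_le ht.1
  rw [integral_Icc_eq_integral_Ioc, ← intervalIntegral.integral_of_le hle,
    intervalIntegral.integral_eq_sub_of_hasDerivAt (f := fun t => ⟪L (θ, t), a t • w θ⟫_ℝ)]
  · simp [er, eR]
  · intro t ht
    have h1 := (hder θ t (hpos t ht)).inner ℝ
      ((ha.differentiable (by simp) t).hasDerivAt.smul_const (w θ))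
    rw [add_comm]
    exact h1
  · refine ContinuousOn.intervalIntegrable ?_
    have hLc : ContinuousOn (fun s => L (θ, s)) (uIcc r' R') := fun t ht =>
      (hder θ t (hpos t ht)).continuousAt.continuousWithinAt
    have hDc := (hcont θ).mono hpos
    exact (hDc.inner (ha.continuous.continuousOn.smul continuousOn_const)).add
      (hLc.inner (hw'.continuous.continuousOn.smul continuousOn_const))

theorem IsWeight.deriv {a : ℝ → ℝ} (ha : ContDiff ℝ (⊤ : ℕ∞) a) (hw : IsWeight a) :
    IsWeight (deriv a) where
  continuous := ha.continuous_deriv (by simp)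
  compact := hw.compact.deriv
  support := (closure_mono support_deriv_subset).trans
    (by rw [isClosed_tsupport a |>.closure_eq]; exact hw.support)

/-- Contraction with the Euler vector field. -/
def eulerContr (φ : Form n (p + 1)) : Form n p := fun x => contr p x (φ x)

theorem contDiffOn_eulerContr {φ : Form n (p + 1)} {s : Set (E n)}
    (hφ : ContDiffOn ℝ (⊤ : ℕ∞) φ s) : ContDiffOn ℝ (⊤ : ℕ∞) (eulerContr φ) s :=
  (contr p).isBoundedBilinearMap.contDiff.comp_contDiffOn (contDiffOn_id.prodMk hφ)

/-- Cartan's formula for the Lie derivative along the Euler vector field. -/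
theorem contr_extDeriv {φ : Form n (p + 1)} (hφ : ContDiff ℝ (⊤ : ℕ∞) φ) (x : E n) :
    contr (p + 1) x (extDeriv φ x) =
      fderiv ℝ φ x x + (p + 1 : ℝ) • φ x - extDeriv (eulerContr φ) x := by
  have hd : HasFDerivAt φ (fderiv ℝ φ x) x := (hφ.differentiable (by simp) x).hasFDerivAt
  have h1 := (contr p).hasFDerivAt_of_bilinear (hasFDerivAt_id x) hd
  have h2 : extDeriv (eulerContr φ) x = ContinuousAlternatingMap.alternatizeUncurryFin
      ((contr p x) ∘L fderiv ℝ φ x) + (p + 1 : ℝ) • φ x := by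
    have e1 : fderiv ℝ (eulerContr φ) x = (contr p x) ∘L fderiv ℝ φ x + (contr p).flip (φ x) := by
      refine h1.fderiv.trans ?_
      ext1 v
      simp
    have e2 : (contr p).flip (φ x) = (φ x).curryLeft := rfl
    rw [extDeriv, e1, ContinuousAlternatingMap.alternatizeUncurryFin_add, e2,
      ContinuousAlternatingMap.alternatizeUncurryFin_curryLeft]
    congr 1
    rw [← Nat.cast_smul_eq_nsmul ℝ]
    push_cast
    rfl
  rw [h2, contr_apply, extDeriv, curryLeft_alternatize]
  rw [add_sub_add_right_eq_sub]
  rfl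

theorem hasDerivAt_ang {φ : Form n (p + 1)} (hφ : ContDiff ℝ (⊤ : ℕ∞) φ) (θ : Sph n) {t : ℝ}
    (ht : 0 < t) : HasDerivAt (fun s => ang φ (θ, s))
      (ang (fun x => ‖x‖⁻¹ • (fderiv ℝ φ x x + (p + 1 : ℝ) • φ x)) (θ, t)) t := by
  have e : ∀ s, 0 < s → ∀ α : Cov n (p + 1), slot (p + 1) (polar (θ, s)) α =
      s ^ (p + 1) • pull (p + 1) (tangProj (θ : E n)) α := fun s hs α => by
    have h1 : tangProj (polar (θ, s)) = tangProj (θ : E n) := tangProj_smul hs.ne' _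
    have h2 : ‖polar (θ, s)‖ = s := norm_polar hs
    rw [slot_eq, h1, h2]
  set Q : Cov n (p + 1) →L[ℝ] CoordSpace n (p + 1) :=
    (coord n (p + 1) : Cov n (p + 1) →L[ℝ] CoordSpace n (p + 1)) ∘L
      pull (p + 1) (tangProj (θ : E n)) with hQ
  have h1 : HasDerivAt (fun s : ℝ => s • (θ : E n)) (θ : E n) t := by
    simpa using (hasDerivAt_id t).smul_const (θ : E n)
  have h2 : HasDerivAt (fun s : ℝ => φ (s • (θ : E n))) (fderiv ℝ φ (t • (θ : E n)) θ) t :=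
    ((hφ.differentiable (by simp) _).hasFDerivAt).comp_hasDerivAt t h1
  have h3 : HasDerivAt (fun s : ℝ => Q (φ (s • (θ : E n))))
      (Q (fderiv ℝ φ (t • (θ : E n)) θ)) t := Q.hasFDerivAt.comp_hasDerivAt t h2
  have h4 := (hasDerivAt_pow (p + 1) t).smul h3
  refine (h4.congr_of_eventuallyEq ?_).congr_deriv ?_
  · filter_upwards [isOpen_Ioi.mem_nhds ht] with s hs
    rw [ang, e s hs, map_smul]
    rfl
  · have hn : ‖polar (θ, t)‖ = t := norm_polar ht
    rw [ang, e t ht, hn, polar]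
    simp only [map_smul, map_add, hQ, ContinuousLinearMap.comp_apply,
      ContinuousLinearEquiv.coe_coe, smul_add, smul_smul, Nat.add_sub_cancel]
    congr 2
    · field_simp
    · push_cast
      field_simp
      ring

/-- A weak form of Cartan's formula: up to closed forms on the unit sphere, the radial part of
`dφ` is the derivative in `t` of the restriction of `φ` to the spheres. -/
theorem pairing_angRad_extDeriv {φ : Form n (p + 1)} (hφ : ContDiff ℝ (⊤ : ℕ∞) φ) {a : ℝ → ℝ}
    (ha : ContDiff ℝ (⊤ : ℕ∞) a) (hw : IsWeight a) {w : Sph n → CoordSpace n (p + 1)}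
    (hm : MemLp w 2 (surf n))
    (h : ∀ β : Form n (p + 1), IsSphereForm β → IsSphereClosed β →
      ∫ θ, ⟪restr β θ, w θ⟫_ℝ ∂surf n = 0) :
    pairing a (angRad (extDeriv φ)) w = (-1) ^ p * pairing (deriv a) (ang φ) w := by
  have hF : ContDiffOn ℝ (⊤ : ℕ∞) (fun x => fderiv ℝ φ x x + (p + 1 : ℝ) • φ x) {0}ᶜ :=
    (((hφ.fderiv_right (m := ((⊤ : ℕ∞) : WithTop ℕ∞)) (by simp)).clm_apply contDiff_id).add
      (hφ.const_smul _)).contDiffOn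
  have hF' : ContDiffOn ℝ (⊤ : ℕ∞)
      (fun x => ‖x‖⁻¹ • (fderiv ℝ φ x x + (p + 1 : ℝ) • φ x)) {0}ᶜ :=
    (contDiffOn_comp_norm (F := fun t => t⁻¹)
      (contDiffOn_id.inv fun _ ht => ne_of_gt ht)).smul hF
  have hE := contDiffOn_eulerContr (hφ.contDiffOn (s := {0}ᶜ))
  have hE' : ContDiffOn ℝ (⊤ : ℕ∞) (fun x => ‖x‖⁻¹ • extDeriv (eulerContr φ) x) {0}ᶜ :=
    (contDiffOn_comp_norm (F := fun t => t⁻¹)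
      (contDiffOn_id.inv fun _ ht => ne_of_gt ht)).smul
      (contDiffOn_extDeriv isOpen_compl_singleton hE)
  have hparts := pairing_hasDerivAt (locL2_ang_of_continuousOn hφ.continuous.continuousOn)
    (locL2_ang_of_continuousOn hF'.continuousOn) (fun θ t ht => hasDerivAt_ang hφ θ ht)
    (fun θ => (continuousOn_ang hF'.continuousOn).comp (by fun_prop) fun s hs => ⟨mem_univ _, hs⟩)
    ha hw (hw.deriv ha) hm
  -- The other term of Cartan's formula restricts to exact forms on the spheres.
  have hzero : pairing a (ang fun x => ‖x‖⁻¹ • extDeriv (eulerContr φ) x) w = 0 := by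
    refine pairing_eq_zero hw (locL2_ang_of_continuousOn hE'.continuousOn) hm ?_
    filter_upwards [ae_restrict_mem measurableSet_Ioi] with t ht
    have hs : IsSphereForm (sphPull t (eulerContr φ)) := isSphereForm_sphPull ht hE
    have h1 : ∀ θ, ang (fun x => ‖x‖⁻¹ • extDeriv (eulerContr φ) x) (θ, t) =
        t⁻¹ • restr (extDeriv (sphPull t (eulerContr φ))) θ := fun θ => by
      have hn : ‖polar (θ, t)‖ = t := norm_polar ht
      rw [← ang_extDeriv ht hE, ang, map_smul, map_smul, hn, ang]
    simp only [h1, real_inner_smul_left, integral_const_mul]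
    rw [h _ hs.extDeriv fun x hx => ?_, mul_zero]
    exact extDeriv_extDeriv_apply (hs.smooth.contDiffAt (isOpen_compl_singleton.mem_nhds hx))
      two_le_minSmoothness
  have hsplit : angRad (extDeriv φ) = (-1 : ℝ) ^ (p + 1) •
      (ang (fun x => ‖x‖⁻¹ • (fderiv ℝ φ x x + (p + 1 : ℝ) • φ x)) -
        ang fun x => ‖x‖⁻¹ • extDeriv (eulerContr φ) x) := by
    funext s
    simp only [angRad, ang, radialPart, smul_apply, map_smul, contr_extDeriv hφ, Pi.smul_apply,
      Pi.sub_apply, map_sub, smul_sub]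
  have hsm : ∀ (c : ℝ) (L : Sph n × ℝ → CoordSpace n (p + 1)), pairing a (c • L) w =
      c * pairing a L w := fun c L => by
    simp only [pairing, Pi.smul_apply, real_inner_smul_left]
    exact integral_const_mul _ _
  rw [hsplit, hsm, pairing_sub_left hw (locL2_ang_of_continuousOn hF'.continuousOn)
    (locL2_ang_of_continuousOn hE'.continuousOn) hm, hzero, hparts, sub_zero, pow_succ]
  ring

end Tested

/-! ### Adjointness of `d` and `δ` on the unit sphere -/

section SphereGreen

variable {n p : ℕ}

section Functional

variable {V : Type*} [NormedAddCommGroup V] [InnerProductSpace ℝ V]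

theorem pairing_congr {b : ℝ → ℝ} (hb : IsWeight b) {L : Sph n × ℝ → V} (hL : LocL2 L)
    {w w' : Sph n → V} (hw : MemLp w 2 (surf n)) (h : w =ᵐ[surf n] w') :
    pairing b L w = pairing b L w' := by
  rw [pairing_eq_integral hb hL hw, pairing_eq_integral hb hL (hw.ae_eq h)]
  refine integral_congr_ae (ae_of_all _ fun t => ?_)
  beta_reduce
  congr 1
  refine integral_congr_ae ?_
  filter_upwards [h] with θ hθ
  rw [hθ]

/-- The pairing with a fixed function on the cylinder, as a functional on `L²` of the sphere. -/
def pairingCLM {b : ℝ → ℝ} (hb : IsWeight b) {L : Sph n × ℝ → V} (hL : LocL2 L) :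
    Lp V 2 (surf n) →L[ℝ] ℝ where
  toFun w := pairing b L w
  map_add' w w' := by
    rw [pairing_congr hb hL (Lp.memLp _) (Lp.coeFn_add w w')]
    have h1 := pairing_sub_right hb hL ((Lp.memLp w).add (Lp.memLp w')) (Lp.memLp w')
    rw [add_sub_cancel_right] at h1
    linarith
  map_smul' c w := by
    rw [pairing_congr hb hL (Lp.memLp _) (Lp.coeFn_smul c w)]
    simp only [pairing, Pi.smul_apply, smul_comm _ c, real_inner_smul_right, RingHom.id_apply,
      smul_eq_mul]
    exact integral_const_mul _ _
  cont := by
    refine SeqContinuous.continuous fun u w hu => ?_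
    refine tendsto_pairing_right hb hL (fun k => Lp.memLp _) (Lp.memLp w) ?_
    exact (Lp.tendsto_Lp_iff_tendsto_eLpNorm' u w).1 hu

theorem pairingCLM_apply {b : ℝ → ℝ} (hb : IsWeight b) {L : Sph n × ℝ → V} (hL : LocL2 L)
    (w : Lp V 2 (surf n)) : pairingCLM hb hL w = pairing b L w := rfl

theorem pairingCLM_toLp {b : ℝ → ℝ} (hb : IsWeight b) {L : Sph n × ℝ → V} (hL : LocL2 L)
    {w : Sph n → V} (hw : MemLp w 2 (surf n)) : pairingCLM hb hL (hw.toLp w) = pairing b L w :=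
  pairing_congr hb hL (Lp.memLp _) hw.coeFn_toLp

end Functional

/-- Orthogonality of a square integrable function to the smooth forms on the sphere. -/
def OrthSphere (w : Lp (CoordSpace n p) 2 (surf n)) : Prop :=
  ∀ β : Form n p, IsSphereForm β → ∫ θ, ⟪restr β θ, w θ⟫_ℝ ∂surf n = 0

/-- A functional on `L²` of the sphere vanishes if it does so on smooth forms and on their
orthogonal complement. -/
theorem clm_eq_zero_of_sphereForms (F : Lp (CoordSpace n p) 2 (surf n) →L[ℝ] ℝ)
    (h1 : ∀ β : Form n p, ∀ hβ : IsSphereForm β, F (hβ.memLp.toLp (restr β)) = 0)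
    (h2 : ∀ w, OrthSphere w → F w = 0) : F = 0 := by
  ext w
  set K := (LinearMap.range (restrLp n p)).topologicalClosure with hK
  have : CompleteSpace K := (Submodule.isClosed_topologicalClosure _).completeSpace_coe
  obtain ⟨y, hy, z, hz, rfl⟩ := K.exists_add_mem_mem_orthogonal w
  have hyF : F y = 0 := by
    have h3 : K ≤ LinearMap.ker F.toLinearMap := by
      refine Submodule.topologicalClosure_minimal _ ?_ F.isClosed_ker
      rintro _ ⟨β, rfl⟩
      exact h1 β β.2
    exact h3 hy
  have hzF : F z = 0 := by
    refine h2 z fun β hβ => ?_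
    have h4 := (Submodule.mem_orthogonal _ _).1 hz (restrLp n p ⟨β, hβ⟩)
      (Submodule.le_topologicalClosure _ ⟨⟨β, hβ⟩, rfl⟩)
    have h5 := MemLp.inner_toLp_real hβ.memLp (Lp.memLp z)
    rw [Lp.toLp_coeFn] at h5
    rw [← h5]
    exact h4
  rw [map_add, hyF, hzF, add_zero, zero_apply]

variable [Nontrivial (E n)]

/-- Moving `d` along the spheres from the form to the test form on the sphere. -/
theorem pairing_extDeriv {a : ℝ → ℝ} (ha : ContDiff ℝ (⊤ : ℕ∞) a) (hw : IsWeight a)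
    {φ : Form n p} (hφ : ContDiffOn ℝ (⊤ : ℕ∞) φ {0}ᶜ) {β : Form n (p + 1)}
    (hβ : IsSphereForm β) :
    pairing a (ang (extDeriv φ)) (restr β) = pairing a (ang φ) (restr (codiff (cylMetric n) β)) := by
  refine Eq.trans (integral_congr_ae ?_) ((green_cyl ha hw hφ hβ.smooth
    fun _ => hβ.contr_eq_zero).trans (integral_congr_ae ?_))
  · filter_upwards [ae_cylMeas_pos] with s hs
    rw [hβ.ang_eq hs, real_inner_smul_right]
  · filter_upwards [ae_cylMeas_pos] with s hs
    rw [hβ.codiff_cyl.ang_eq hs, real_inner_smul_right]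

/-- The component of a form along the spheres. -/
def tangPart (ω : Form n p) : Form n p := fun x => pull p (tangProj x) (ω x)

theorem contDiffOn_tangPart {ω : Form n p} (h : ContDiffOn ℝ (⊤ : ℕ∞) ω {0}ᶜ) :
    ContDiffOn ℝ (⊤ : ℕ∞) (tangPart ω) {0}ᶜ :=
  (contDiffOn_pull contDiffOn_tangProj).clm_apply h

theorem contDiffOn_codiff_tangPart {ω : Form n (p + 1)} (h : ContDiffOn ℝ (⊤ : ℕ∞) ω {0}ᶜ) :
    ContDiffOn ℝ (⊤ : ℕ∞) (codiff (cylMetric n) (tangPart ω)) {0}ᶜ :=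
  (cylRoot n).smooth_codiff (contDiffOn_tangPart h)

/-- Moving `d` from the test form on the sphere to `δ` along the spheres of the form. -/
theorem pairing_extDeriv_right {a : ℝ → ℝ} (ha : ContDiff ℝ (⊤ : ℕ∞) a) (hw : IsWeight a)
    {ψ : Form n (p + 1)} (hψ : ContDiffOn ℝ (⊤ : ℕ∞) ψ {0}ᶜ) {β : Form n p}
    (hβ : IsSphereForm β) : pairing a (ang ψ) (restr (extDeriv β)) =
      pairing a (ang (codiff (cylMetric n) (tangPart ψ))) (restr β) := by
  refine Eq.trans (integral_congr_ae ?_) ((green_cyl ha hw hβ.smooth (contDiffOn_tangPart hψ)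
    fun y hy => contr_pull_tangProj hy _).trans (integral_congr_ae ?_))
  · filter_upwards [ae_cylMeas_pos] with s hs
    rw [hβ.extDeriv.ang_eq hs, real_inner_smul_right, real_inner_comm]
    have : ang (tangPart ψ) s = ang ψ s := by
      rw [ang, tangPart, slot_pull_tangProj (polar_ne_zero hs), ang]
    rw [this]
  · filter_upwards [ae_cylMeas_pos] with s hs
    rw [hβ.ang_eq hs, real_inner_smul_right, real_inner_comm]

/-- Green's formula on the unit sphere. -/
theorem sphere_green {σ : Form n p} {β : Form n (p + 1)} (hσ : IsSphereForm σ)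
    (hβ : IsSphereForm β) : ∫ θ, ⟪restr (extDeriv σ) θ, restr β θ⟫_ℝ ∂surf n =
      ∫ θ, ⟪restr σ θ, restr (codiff (cylMetric n) β) θ⟫_ℝ ∂surf n := by
  -- Deduced from the formula on the cylinder: `τ` does not depend on `t`, so the weight factors out.
  have hslice : ∀ {k : ℕ} {τ : Form n k} (hτ : IsSphereForm τ) (w : Sph n → CoordSpace n k)
      (hw : MemLp w 2 (surf n)) (a : ℝ → ℝ), IsWeight a → pairing a (ang τ) w =
        (∫ t in Ioi 0, a t) * ∫ θ, ⟪restr τ θ, w θ⟫_ℝ ∂surf n := fun hτ w hw a ha => by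
    rw [pairing_eq_integral ha (locL2_ang_of_continuousOn hτ.smooth.continuousOn) hw,
      ← integral_mul_const]
    refine setIntegral_congr_fun measurableSet_Ioi fun t ht => ?_
    beta_reduce
    congr 1
    refine integral_congr_ae (ae_of_all _ fun θ => ?_)
    simp only [hτ.ang_eq (q := (θ, t)) ht]
  set c := ∫ θ, ⟪restr (extDeriv σ) θ, restr β θ⟫_ℝ ∂surf n
  set c' := ∫ θ, ⟪restr σ θ, restr (codiff (cylMetric n) β) θ⟫_ℝ ∂surf n
  have hc : LocallyIntegrableOn (fun _ : ℝ => c - c') (Ioi 0) :=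
    (locallyIntegrable_const _).locallyIntegrableOn _
  have h := isOpen_Ioi.ae_eq_zero_of_integral_contDiff_smul_eq_zero hc fun a ha hac has => by
    have hw : IsWeight a := ⟨ha.continuous, hac, has⟩
    have h1 := pairing_extDeriv ha hw hσ.smooth hβ
    rw [hslice hσ.extDeriv _ hβ.memLp a hw, hslice hσ _ hβ.codiff_cyl.memLp a hw] at h1
    have h2 : ∫ t, a t = ∫ t in Ioi 0, a t :=
      (setIntegral_eq_integral_of_forall_compl_eq_zero fun t ht =>
        image_eq_zero_of_notMem_tsupport fun h' => ht (has h')).symm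
    simp only [smul_eq_mul]
    rw [integral_mul_const, h2, mul_sub, h1, sub_self]
  have hpos : (volume.restrict (Ioi (0 : ℝ))) ≠ 0 := by simp
  have hne : (ae (volume.restrict (Ioi (0 : ℝ)))).NeBot := ae_neBot.2 hpos
  obtain ⟨t, ht⟩ := ((ae_restrict_iff' measurableSet_Ioi).2 h).exists
  exact sub_eq_zero.1 ht

/-- A form on the sphere that is orthogonal to the exact forms is coclosed. -/
theorem codiff_cyl_eq_zero_of_orthogonal {s : Form n (p + 1)} (hs : IsSphereForm s)
    (h : ∀ β : Form n p, IsSphereForm β →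
      ∫ θ, ⟪restr s θ, restr (extDeriv β) θ⟫_ℝ ∂surf n = 0) {x : E n} (hx : x ≠ 0) :
    codiff (cylMetric n) s x = 0 := by
  set β := codiff (cylMetric n) s with hβ
  have hβs : IsSphereForm β := hs.codiff_cyl
  have h1 := sphere_green hβs hs
  simp only [real_inner_comm (restr s _)] at h1
  rw [h β hβs] at h1
  have h2 : Continuous (restr β) := continuous_restr hβs.smooth.continuousOn
  have h3 : ∀ θ, restr β θ = 0 := by
    have h4 : (fun θ => ⟪restr β θ, restr β θ⟫_ℝ) =ᵐ[surf n] 0 :=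
      (integral_eq_zero_iff_of_nonneg (fun _ => real_inner_self_nonneg)
        (MemLp.integrable_inner_real hβs.memLp hβs.memLp)).1 h1.symm
    have h5 := (Continuous.ae_eq_iff_eq (surf n) (h2.inner h2) continuous_const).1 h4
    exact fun θ => inner_self_eq_zero.1 (congrFun h5 θ)
  have h0 := norm_pos_iff.2 hx
  have h6 : β (‖x‖⁻¹ • x) = 0 := by
    have := h3 ⟨‖x‖⁻¹ • x, by simp [norm_smul, h0.ne']⟩
    exact (coord n p).map_eq_zero_iff.1 this
  rw [← hβs.invariant x hx _ (inv_pos.2 h0), h6, smul_zero]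

theorem integral_inner_extDeriv_extDeriv {β : Form n p} (hβ : IsSphereForm β)
    (w : Sph n → CoordSpace n (p + 2)) :
    ∫ θ, ⟪w θ, restr (extDeriv (extDeriv β)) θ⟫_ℝ ∂surf n = 0 := by
  refine integral_eq_zero_of_ae (ae_of_all _ fun θ => ?_)
  have : extDeriv (extDeriv β) (θ : E n) = 0 := extDeriv_extDeriv_apply
    (hβ.smooth.contDiffAt (isOpen_compl_singleton.mem_nhds (sph_ne_zero θ))) two_le_minSmoothness
  simp [restr, this]

theorem integral_codiff_extDeriv {σ : Form n (p + 2)} {β : Form n p} (hσ : IsSphereForm σ)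
    (hβ : IsSphereForm β) :
    ∫ θ, ⟪restr (codiff (cylMetric n) σ) θ, restr (extDeriv β) θ⟫_ℝ ∂surf n = 0 := by
  have h := sphere_green hβ.extDeriv hσ
  simp only [real_inner_comm (restr σ _), integral_inner_extDeriv_extDeriv hβ] at h
  simp only [real_inner_comm (restr (extDeriv β) _)]
  exact h.symm

theorem IsSphereForm.isSphereCoclosed_codiff {σ : Form n (p + 1)} (hσ : IsSphereForm σ) :
    IsSphereCoclosed (codiff (cylMetric n) σ) := by
  cases p with
  | zero => trivial
  | succ p =>
    refine fun x hx => ?_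
    exact codiff_cyl_eq_zero_of_orthogonal hσ.codiff_cyl
      (fun β hβ => integral_codiff_extDeriv hσ hβ) hx

/-- Almost all restrictions to spheres of `δ` along the spheres of a form are coclosed. -/
theorem ae_isSphereCoclosed {ψ : Form n (p + 1)} (hψ : ContDiffOn ℝ (⊤ : ℕ∞) ψ {0}ᶜ) :
    ∀ᵐ t ∂(volume.restrict (Ioi (0 : ℝ))),
      IsSphereCoclosed (sphPull t (codiff (cylMetric n) (tangPart ψ))) := by
  cases p with
  | zero => exact ae_of_all _ fun _ => trivial
  | succ p =>
    have hκ := contDiffOn_codiff_tangPart hψ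
    have h := ae_orthogonal_of_pairing (locL2_ang_of_continuousOn hκ.continuousOn)
      (K := fun _ => 1) continuousOn_const (fun _ _ => one_ne_zero)
      {w | ∃ β : Form n p, ∃ hβ : IsSphereForm β, w = hβ.extDeriv.memLp.toLp _} ?_
    · filter_upwards [h, ae_restrict_mem measurableSet_Ioi] with t ⟨hm, ht⟩ ht0
      refine fun x hx => codiff_cyl_eq_zero_of_orthogonal (isSphereForm_sphPull ht0 hκ)
        (fun β hβ => ?_) hx
      have h1 := ht _ ⟨β, hβ, rfl⟩
      rw [MemLp.inner_toLp_real hm hβ.extDeriv.memLp] at h1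
      simpa only [restr_sphPull ht0] using h1
    · rintro a ha hw _ ⟨β, hβ, rfl⟩
      simp only [mul_one]
      rw [pairing_congr hw (locL2_ang_of_continuousOn hκ.continuousOn) (Lp.memLp _)
        hβ.extDeriv.memLp.coeFn_toLp, ← pairing_extDeriv_right ha hw hψ hβ.extDeriv]
      have hz := hβ.extDeriv.extDeriv
      refine pairing_eq_zero hw (locL2_ang_of_continuousOn hψ.continuousOn) hz.memLp
        (ae_of_all _ fun t => integral_inner_extDeriv_extDeriv hβ _)

end SphereGreen

/-! ### Testing against products of functions of `t` and forms on the sphere -/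

section TestForms

variable {n p : ℕ} {f g : ℝ → ℝ}

/-- The weight of the components along the spheres in the `L²` scalar product of `p`-forms. -/
def tangWeight (n p : ℕ) (f g : ℝ → ℝ) (t : ℝ) : ℝ := √(f t * g t ^ (n - 1)) * ((g t)⁻¹) ^ p

/-- The weight of the radial components in the `L²` scalar product of `p + 1`-forms. The sign
is that of `dt ∧ β = (-1)^p β ∧ dt`. -/
def radWeight (n p : ℕ) (f g : ℝ → ℝ) (t : ℝ) : ℝ :=
  (-1) ^ p * (√(f t * g t ^ (n - 1)) * (f t)⁻¹ * ((g t)⁻¹) ^ p)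

theorem contDiffOn_tangWeight (h : IsWarpingPair f g) :
    ContDiffOn ℝ (⊤ : ℕ∞) (tangWeight n p f g) (Ioi 0) :=
  ((h.smooth_f.mul (h.smooth_g.pow _)).sqrt fun t ht =>
    (mul_pos (h.pos_f t ht) (pow_pos (h.pos_g t ht) _)).ne').mul
      ((h.smooth_g.inv fun t ht => (h.pos_g t ht).ne').pow p)

theorem contDiffOn_radWeight (h : IsWarpingPair f g) :
    ContDiffOn ℝ (⊤ : ℕ∞) (radWeight n p f g) (Ioi 0) :=
  contDiffOn_const.mul ((((h.smooth_f.mul (h.smooth_g.pow _)).sqrt fun t ht =>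
    (mul_pos (h.pos_f t ht) (pow_pos (h.pos_g t ht) _)).ne').mul
      (h.smooth_f.inv fun t ht => (h.pos_f t ht).ne')).mul
        ((h.smooth_g.inv fun t ht => (h.pos_g t ht).ne').pow p))

theorem tangWeight_ne_zero (h : IsWarpingPair f g) (t : ℝ) (ht : 0 < t) :
    tangWeight n p f g t ≠ 0 := by
  have h1 := h.pos_f t ht
  have h2 := h.pos_g t ht
  unfold tangWeight
  positivity

theorem radWeight_ne_zero (h : IsWarpingPair f g) (t : ℝ) (ht : 0 < t) :
    radWeight n p f g t ≠ 0 := by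
  have h1 := h.pos_f t ht
  have h2 := h.pos_g t ht
  unfold radWeight
  refine mul_ne_zero (pow_ne_zero _ (by norm_num)) ?_
  positivity

theorem IsWeight.contDiff_mul {a K : ℝ → ℝ} (ha : ContDiff ℝ (⊤ : ℕ∞) a) (hw : IsWeight a)
    (hK : ContDiffOn ℝ (⊤ : ℕ∞) K (Ioi 0)) : ContDiff ℝ (⊤ : ℕ∞) fun t => a t * K t := by
  refine contDiff_iff_contDiffAt.2 fun t => ?_
  by_cases ht : t ∈ Ioi 0
  · exact ha.contDiffAt.mul (hK.contDiffAt (isOpen_Ioi.mem_nhds ht))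
  · have h0 := notMem_tsupport_iff_eventuallyEq.1 fun h => ht (hw.support h)
    refine (contDiffAt_const (c := (0 : ℝ))).congr_of_eventuallyEq ?_
    filter_upwards [h0] with s hs
    rw [hs, Pi.zero_apply, zero_mul]

theorem IsWeight.neg {a : ℝ → ℝ} (ha : IsWeight a) : IsWeight fun t => -a t := by
  have := ha.mul (K := fun _ => -1) continuousOn_const
  simpa only [mul_neg, mul_one] using this

/-- The form `dt ∧ β`. -/
def radialWedgeForm (β : Form n p) : Form n (p + 1) := fun x => radialWedge x (β x)

theorem radialWedge_smul (x : E n) (c : ℝ) (β : Cov n p) :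
    radialWedge x (c • β) = c • radialWedge x β := by
  have : (innerSL ℝ (‖x‖⁻¹ • x)).smulRight (c • β) =
      c • (innerSL ℝ (‖x‖⁻¹ • x)).smulRight β := by
    ext v w
    simp [mul_left_comm]
  rw [radialWedge, this, ContinuousAlternatingMap.alternatizeUncurryFin_smul, radialWedge]

theorem radialMul_radialWedgeForm (b : ℝ → ℝ) (β : Form n p) :
    radialMul b (radialWedgeForm β) = fun x => radialWedge x (radialMul b β x) := by
  ext1 x
  rw [radialMul, radialWedgeForm, radialMul, radialWedge_smul]

theorem contDiffOn_radialWedgeForm {β : Form n p} (hβ : ContDiffOn ℝ (⊤ : ℕ∞) β {0}ᶜ) :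
    ContDiffOn ℝ (⊤ : ℕ∞) (radialWedgeForm β) {0}ᶜ := by
  have h1 := contDiffOn_extDeriv isOpen_compl_singleton
    (contDiffOn_radialMul (a := id) contDiff_id hβ)
  have h2 : ContDiffOn ℝ (⊤ : ℕ∞) (fun x => ‖x‖ • extDeriv β x) {0}ᶜ :=
    contDiffOn_radialMul (a := id) contDiff_id (contDiffOn_extDeriv isOpen_compl_singleton hβ)
  refine (h1.sub h2).congr fun x hx => ?_
  rw [extDeriv_radialMul contDiff_id hβ hx]
  simp [radialWedgeForm]

theorem extDeriv_sub_apply {ω η : Form n p} {x : E n} (hω : DifferentiableAt ℝ ω x)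
    (hη : DifferentiableAt ℝ η x) : extDeriv (ω - η) x = extDeriv ω x - extDeriv η x := by
  rw [extDeriv, fderiv_sub hω hη]
  exact map_sub (ContinuousAlternatingMap.alternatizeUncurryFinCLM ℝ (E n) ℝ) _ _

/-- `d (b(t) dt ∧ β) = -b(t) dt ∧ dβ`. -/
theorem extDeriv_radialMul_radialWedgeForm {b : ℝ → ℝ} (hb : ContDiff ℝ (⊤ : ℕ∞) b) {β : Form n p}
    (hβ : ContDiffOn ℝ (⊤ : ℕ∞) β {0}ᶜ) {x : E n} (hx : x ≠ 0) :
    extDeriv (radialMul b (radialWedgeForm β)) x =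
      radialMul (fun t => -b t) (radialWedgeForm (extDeriv β)) x := by
  set B : ℝ → ℝ := fun t => ∫ s in (0 : ℝ)..t, b s with hB
  have hd : deriv B = b := funext fun t => hb.continuous.deriv_integral b 0 t
  have hBs : ContDiff ℝ (⊤ : ℕ∞) B := by
    refine contDiff_infty_iff_deriv.2 ⟨fun t => ?_, hd ▸ hb⟩
    exact (hb.continuous.integral_hasStrictDerivAt 0 t).hasDerivAt.differentiableAt
  have hdβ := contDiffOn_extDeriv isOpen_compl_singleton hβ
  have h1 := contDiffOn_radialMul hBs hβ
  have h2 := contDiffOn_radialMul hBs hdβ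
  have hn : ({0}ᶜ : Set (E n)) ∈ 𝓝 x := isOpen_compl_singleton.mem_nhds hx
  -- `b(t) dt ∧ β = d (B(t) β) - B(t) dβ` for a primitive `B` of `b`.
  have he : radialMul b (radialWedgeForm β) =ᶠ[𝓝 x]
      extDeriv (radialMul B β) - radialMul B (extDeriv β) := by
    filter_upwards [hn] with y hy
    rw [Pi.sub_apply, extDeriv_radialMul hBs hβ hy, hd]
    simp [radialMul, radialWedgeForm]
  rw [he.extDeriv_eq]
  have hs : extDeriv (extDeriv (radialMul B β) - radialMul B (extDeriv β)) x =
      extDeriv (extDeriv (radialMul B β)) x - extDeriv (radialMul B (extDeriv β)) x := by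
    have hA := (((contDiffOn_extDeriv isOpen_compl_singleton h1).contDiffAt hn).differentiableAt
      (by simp))
    have hC := ((h2.contDiffAt hn).differentiableAt (by simp))
    exact extDeriv_sub_apply hA hC
  rw [hs, extDeriv_extDeriv_apply (h1.contDiffAt hn) two_le_minSmoothness,
    extDeriv_radialMul hBs hdβ hx, extDeriv_extDeriv_apply (hβ.contDiffAt hn) two_le_minSmoothness,
    hd]
  simp only [radialMul, radialWedgeForm, smul_zero, zero_add, zero_sub]
  exact (neg_smul _ _).symm

variable [Nontrivial (E n)]

/-- Testing with `a(t) β` for a form `β` on the sphere sees only the spherical component. -/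
theorem l2Inner_radialMul (h : IsWarpingPair f g) {ω : Form n p} (hω : AEStronglyMeasurable ω)
    {a : ℝ → ℝ} (ha : ContDiff ℝ (⊤ : ℕ∞) a) {β : Form n p} (hβ : IsSphereForm β) :
    l2Inner (warpedMetric n f g) ω (radialMul a β) =
      pairing (fun t => a t * tangWeight n p f g t) (ang ω) (restr β) := by
  rw [l2Inner_warped_horizontal h.smooth_f h.smooth_g h.pos_f h.pos_g hω
    (aestronglyMeasurable_of_continuousOn_compl (contDiffOn_radialMul ha hβ.smooth).continuousOn)
    fun x hx => by rw [radialMul, map_smul, hβ.pull_tangProj hx]]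
  refine integral_congr_ae ?_
  filter_upwards [ae_cylMeas_pos] with q hq
  rw [ang_radialMul _ _ hq, hβ.ang_eq hq, real_inner_smul_right, real_inner_smul_right, tangWeight]
  ring

/-- Testing with `b(t) dt ∧ β` for a form `β` on the sphere sees only the radial component. -/
theorem l2Inner_radialWedgeForm (h : IsWarpingPair f g) {ω : Form n (p + 1)}
    (hω : AEStronglyMeasurable ω) {b : ℝ → ℝ} (hb : ContDiff ℝ (⊤ : ℕ∞) b) {β : Form n p}
    (hβ : IsSphereForm β) :
    l2Inner (warpedMetric n f g) ω (radialMul b (radialWedgeForm β)) =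
      pairing (fun t => b t * radWeight n p f g t) (angRad ω) (restr β) := by
  have hm := aestronglyMeasurable_of_continuousOn_compl
    (contDiffOn_radialMul hb (contDiffOn_radialWedgeForm hβ.smooth)).continuousOn
  rw [radialMul_radialWedgeForm] at hm ⊢
  rw [l2Inner_warped_radialWedge h.smooth_f h.smooth_g h.pos_f h.pos_g hω hm
    fun x hx => by rw [radialMul, map_smul, hβ.pull_tangProj hx]]
  refine integral_congr_ae ?_
  filter_upwards [ae_cylMeas_pos] with q hq
  rw [ang_radialMul _ _ hq, hβ.ang_eq hq, real_inner_smul_right, real_inner_smul_right, radWeight,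
    angRad]
  ring

theorem l2Inner_congr_right {G : MetricField n} (ω : Form n p) {η ψ : Form n p}
    (h : ∀ x, x ≠ 0 → η x = ψ x) : l2Inner G ω η = l2Inner G ω ψ := by
  refine integral_congr_ae ?_
  filter_upwards [Measure.ae_ne volume (0 : E n)] with x hx
  rw [h x hx]

end TestForms

/-! ### From tested identities to slices -/

section Slices

variable {n p : ℕ}

theorem LocL2.aestronglyMeasurable {V : Type*} [NormedAddCommGroup V]
    {L : Sph n × ℝ → V} (hL : LocL2 L) : AEStronglyMeasurable L (cylMeas n) := by
  have hU : (univ ×ˢ Ioi 0 : Set (Sph n × ℝ)) =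
      ⋃ k : ℕ, univ ×ˢ Icc (1 / ((k : ℝ) + 1)) k := by
    ext ⟨θ, t⟩
    simp only [mem_prod, mem_univ, mem_Ioi, true_and, mem_iUnion, mem_Icc]
    refine ⟨fun ht => ?_, fun ⟨k, hk, _⟩ => lt_of_lt_of_le (by positivity) hk⟩
    obtain ⟨k, hk⟩ := exists_nat_one_div_lt ht
    obtain ⟨l, hl⟩ := exists_nat_ge t
    refine ⟨max k l, ?_, hl.trans (by exact_mod_cast le_max_right k l)⟩
    refine le_trans ?_ hk.le
    have : (k : ℝ) ≤ (max k l : ℕ) := by exact_mod_cast le_max_left k l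
    gcongr
  rw [cylMeas_eq, hU, aestronglyMeasurable_iUnion_iff]
  intro k
  rw [← annMeas_eq]
  exact (hL _ _ (by positivity)).1

theorem LocL2.ae_memLp {V : Type*} [NormedAddCommGroup V] [InnerProductSpace ℝ V]
    [FiniteDimensional ℝ V] {L : Sph n × ℝ → V} (hL : LocL2 L) :
    ∀ᵐ t ∂(volume.restrict (Ioi (0 : ℝ))), MemLp (fun θ => L (θ, t)) 2 (surf n) := by
  filter_upwards [ae_orthogonal_of_pairing hL (K := fun _ => 1) continuousOn_const
    (fun _ _ => one_ne_zero) ∅ (fun _ _ _ _ h => h.elim)] with t ⟨h, _⟩ using h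

theorem ae_eq_zero_of_pairing {V : Type*} [NormedAddCommGroup V] [InnerProductSpace ℝ V]
    [FiniteDimensional ℝ V] {L : Sph n × ℝ → V} (hL : LocL2 L) {K : ℝ → ℝ}
    (hK : ContinuousOn K (Ioi 0)) (hK0 : ∀ t, 0 < t → K t ≠ 0)
    (h : ∀ a : ℝ → ℝ, ContDiff ℝ (⊤ : ℕ∞) a → IsWeight a → ∀ w : Lp V 2 (surf n),
      pairing (fun t => a t * K t) L w = 0) : L =ᵐ[cylMeas n] 0 := by
  have h1 := ae_orthogonal_of_pairing hL hK hK0 univ fun a ha hw w _ => h a ha hw w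
  have h2 : ∫⁻ q, ‖L q‖ₑ ∂cylMeas n = 0 := by
    rw [cylMeas, lintegral_prod_symm _ hL.aestronglyMeasurable.enorm]
    refine (lintegral_congr_ae ?_).trans lintegral_zero
    filter_upwards [h1] with t ⟨hm, ht⟩
    have h3 : hm.toLp _ = 0 := inner_self_eq_zero.1 (ht _ (mem_univ _))
    have h4 : (fun θ => L (θ, t)) =ᵐ[surf n] 0 := by
      have := hm.coeFn_toLp
      rw [h3] at this
      exact this.symm.trans (Lp.coeFn_zero _ _ _)
    refine (lintegral_congr_ae ?_).trans lintegral_zero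
    filter_upwards [h4] with θ hθ
    rw [hθ, Pi.zero_apply, enorm_zero]
  have h5 := (lintegral_eq_zero_iff' hL.aestronglyMeasurable.enorm).1 h2
  filter_upwards [h5] with q hq
  exact enorm_eq_zero.1 hq

/-- If the pairings with the functions orthogonal to a space of smooth forms vanish, the slices are
in the closure of that space. -/
theorem ae_inSphereClosure {L : Sph n × ℝ → CoordSpace n p} (hL : LocL2 L)
    {α : ℝ → Form n p} (hα : ∀ t, 0 < t → ∀ θ, restr (α t) θ = L (θ, t)) {K : ℝ → ℝ}
    (hK : ContinuousOn K (Ioi 0)) (hK0 : ∀ t, 0 < t → K t ≠ 0)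
    (S : Submodule ℝ (sphereForms n p))
    (h : ∀ a : ℝ → ℝ, ContDiff ℝ (⊤ : ℕ∞) a → IsWeight a → ∀ w : Lp (CoordSpace n p) 2 (surf n),
      (∀ τ ∈ S, ∫ θ, ⟪restr (τ : Form n p) θ, w θ⟫_ℝ ∂surf n = 0) →
        pairing (fun t => a t * K t) L w = 0) :
    ∀ᵐ t ∂(volume.restrict (Ioi (0 : ℝ))),
      InSphereClosure {τ | ∃ hτ : τ ∈ sphereForms n p, (⟨τ, hτ⟩ : sphereForms n p) ∈ S} (α t) := by
  have h1 := ae_orthogonal_of_pairing hL hK hK0 ((S.map (restrLp n p))ᗮ : Submodule ℝ _)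
    fun a ha hw w hwS => h a ha hw w fun τ hτ => by
      have h4 := (Submodule.mem_orthogonal _ _).1 hwS (restrLp n p τ)
        (Submodule.mem_map_of_mem hτ)
      have h5 := MemLp.inner_toLp_real (IsSphereForm.memLp τ.2) (Lp.memLp w)
      rw [Lp.toLp_coeFn] at h5
      rw [← h5]
      exact h4
  filter_upwards [h1, ae_restrict_mem measurableSet_Ioi] with t ⟨hm, ht⟩ ht0
  have he : restr (α t) = fun θ => L (θ, t) := funext (hα t ht0)
  have hm' : MemLp (restr (α t)) 2 (surf n) := he ▸ hm
  refine inSphereClosure_of_orthogonal S hm' fun w hw => ?_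
  have := ht w hw
  simpa only [he] using this

/-- The converse of `ae_inSphereClosure`. -/
theorem pairing_eq_zero_of_inSphereClosure {b : ℝ → ℝ} (hb : IsWeight b)
    {L : Sph n × ℝ → CoordSpace n p} (hL : LocL2 L) {α : ℝ → Form n p}
    (hα : ∀ t, 0 < t → ∀ θ, restr (α t) θ = L (θ, t)) {S : Set (Form n p)}
    (hS : ∀ τ ∈ S, IsSphereForm τ)
    (hcl : ∀ᵐ t ∂(volume.restrict (Ioi (0 : ℝ))), InSphereClosure S (α t))
    {w : Sph n → CoordSpace n p} (hw : MemLp w 2 (surf n))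
    (h : ∀ τ ∈ S, ∫ θ, ⟪restr τ θ, w θ⟫_ℝ ∂surf n = 0) : pairing b L w = 0 := by
  refine pairing_eq_zero hb hL hw ?_
  filter_upwards [hcl, hL.ae_memLp, ae_restrict_mem measurableSet_Ioi] with t h1 h2 ht
  have he : restr (α t) = fun θ => L (θ, t) := funext (hα t ht)
  have h3 := integral_inner_eq_zero_of_inSphereClosure (he ▸ h2) h1 hw
    (fun τ hτ => (hS τ hτ).memLp) h
  simpa only [he] using h3

/-- The closed forms on the sphere. -/
def closedForms (n p : ℕ) : Submodule ℝ (sphereForms n p) where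
  carrier := {τ | IsSphereClosed (τ : Form n p)}
  zero_mem' x hx := by
    have : extDeriv (0 : Form n p) x = 0 := by
      rw [← zero_smul ℝ (0 : Form n p), extDeriv_smul, zero_smul]
    exact this
  add_mem' {σ τ} hσ hτ x hx := by
    have hd : ∀ υ : sphereForms n p, DifferentiableAt ℝ (υ : Form n p) x := fun υ =>
      ((IsSphereForm.smooth υ.2).contDiffAt
        (isOpen_compl_singleton.mem_nhds hx)).differentiableAt (by simp)
    have := extDeriv_add (hd σ) (hd τ)
    rw [hσ x hx, hτ x hx, add_zero] at this
    exact this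
  smul_mem' c τ hτ x hx := by
    have := extDeriv_smul (x := x) c (τ : Form n p)
    rw [hτ x hx, smul_zero] at this
    exact this

theorem mem_closedForms (τ : sphereForms n p) :
    τ ∈ closedForms n p ↔ IsSphereClosed (τ : Form n p) := Iff.rfl

/-- The coclosed forms on the sphere, as the orthogonal complement of the exact ones. -/
def coclosedForms (n : ℕ) : (p : ℕ) → Submodule ℝ (sphereForms n p)
  | 0 => ⊤
  | p + 1 => Submodule.comap (restrLp n (p + 1))
      (Submodule.span ℝ {w | ∃ β : Form n p, ∃ hβ : IsSphereForm β,
        w = hβ.extDeriv.memLp.toLp (restr (extDeriv β))})ᗮ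

theorem mem_coclosedForms [Nontrivial (E n)] (τ : sphereForms n p) :
    τ ∈ coclosedForms n p ↔ IsSphereCoclosed (τ : Form n p) := by
  cases p with
  | zero => exact iff_of_true trivial trivial
  | succ p =>
    have hτ : IsSphereForm (τ : Form n (p + 1)) := τ.2
    have key : ∀ β : Form n p, ∀ hβ : IsSphereForm β,
        ⟪hβ.extDeriv.memLp.toLp (restr (extDeriv β)), restrLp n (p + 1) τ⟫_ℝ =
          ∫ θ, ⟪restr (τ : Form n (p + 1)) θ, restr (extDeriv β) θ⟫_ℝ ∂surf n := fun β hβ => by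
      rw [real_inner_comm]
      exact MemLp.inner_toLp_real hτ.memLp hβ.extDeriv.memLp
    rw [coclosedForms, Submodule.mem_comap, Submodule.mem_orthogonal]
    constructor
    · intro h x hx
      refine codiff_cyl_eq_zero_of_orthogonal hτ (fun β hβ => ?_) hx
      rw [← key β hβ]
      exact h _ (Submodule.subset_span ⟨β, hβ, rfl⟩)
    · intro h u hu
      induction hu using Submodule.span_induction with
      | zero => exact inner_zero_left _
      | add u v _ _ hu hv => rw [inner_add_left, hu, hv, add_zero]
      | smul c u _ hu => rw [real_inner_smul_left, hu, mul_zero]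
      | mem u hu =>
        obtain ⟨β, hβ, rfl⟩ := hu
        rw [key β hβ]
        have h1 := sphere_green hβ hτ
        simp only [real_inner_comm (restr (τ : Form n (p + 1)) _)] at h1
        simp only [real_inner_comm (restr (extDeriv β) _)] at h1 ⊢
        rw [h1]
        refine integral_eq_zero_of_ae (ae_of_all _ fun θ => ?_)
        have : codiff (cylMetric n) (τ : Form n (p + 1)) (θ : E n) = 0 := h _ (sph_ne_zero θ)
        simp [restr, this]

variable [Nontrivial (E n)]

theorem ae_eq_zero_of_coord {q : ℕ} {B : E n → Cov n q →L[ℝ] Cov n p} (hB : ContDiffOn ℝ (⊤ : ℕ∞) B {0}ᶜ)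
    {ω : Form n q} (hω : AEStronglyMeasurable ω)
    (h : (fun q => coord n p (B (polar q) (ω (polar q)))) =ᵐ[cylMeas n] 0) :
    ∀ᵐ x, B x (ω x) = 0 := by
  have h1 : AEStronglyMeasurable fun x => B x (ω x) :=
    isBoundedBilinearMap_apply.continuous.comp_aestronglyMeasurable
      ((aestronglyMeasurable_of_continuousOn_compl hB.continuousOn).prodMk hω)
  refine ae_eq_zero_of_polar h1 ?_
  filter_upwards [h] with q hq
  exact (coord n p).map_eq_zero_iff.1 hq

end Slices

/-! ### The derivatives of an eigenform of the third type -/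

section Conclusion

variable {n p : ℕ} [Nontrivial (E n)] {G : MetricField n}

/-- The exact forms on the sphere. -/
def exactForms (n p : ℕ) : Set (Form n (p + 1)) :=
  {τ | ∃ σ : Form n p, IsSphereForm σ ∧ τ = extDeriv σ}

/-- The coexact forms on the sphere. -/
def coexactForms (n p : ℕ) : Set (Form n p) :=
  {τ | ∃ σ : Form n (p + 1), IsSphereForm σ ∧ τ = codiff (cylMetric n) σ}

theorem isSphereForm_of_mem_exactForms : ∀ τ ∈ exactForms n p, IsSphereForm τ := by
  rintro _ ⟨σ, hσ, rfl⟩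
  exact hσ.extDeriv

theorem isSphereForm_of_mem_coexactForms : ∀ τ ∈ coexactForms n p, IsSphereForm τ := by
  rintro _ ⟨σ, hσ, rfl⟩
  exact hσ.codiff_cyl

theorem isSphereClosed_extDeriv {σ : Form n p} (hσ : IsSphereForm σ) :
    IsSphereClosed (extDeriv σ) := fun _ hx =>
  extDeriv_extDeriv_apply (hσ.smooth.contDiffAt (isOpen_compl_singleton.mem_nhds hx))
    two_le_minSmoothness

section ExtDeriv

variable {φ : ℕ → Form n (p + 1)} {Φ : Form n (p + 1)} {η : Form n (p + 2)}

/-- The radial component of `dΦ` is closed along the spheres if the spherical component of `Φ`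
is exact. It is the sum of `∂Φ₁/∂t` and an exact form. -/
theorem ae_slice₂_extDeriv (M : MetricRoot G univ) (hφ : ∀ k, IsTestForm (φ k))
    (hΦ : MemL2 G Φ) (hη : MemL2 G η) (h1 : Tendsto (fun k => normSq G (φ k - Φ)) atTop (𝓝 0))
    (h2 : Tendsto (fun k => normSq G (extDeriv (φ k) - η)) atTop (𝓝 0))
    (hcl : ∀ᵐ t ∂(volume.restrict (Ioi (0 : ℝ))),
      InSphereClosure (exactForms n p) (slice₁ Φ t)) :
    ∀ᵐ t ∂(volume.restrict (Ioi (0 : ℝ))),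
      InSphereClosure {τ | IsSphereForm τ ∧ IsSphereClosed τ} (slice₂ η t) := by
  have hmem : ∀ k, MemL2 G (φ k) := fun k => M.memL2 (hφ k)
  have hmem' : ∀ k, MemL2 G (extDeriv (φ k)) := fun k => M.memL2 (hφ k).extDeriv
  have h := ae_inSphereClosure (M.locL2_angRad hη) (α := slice₂ η)
    (fun t ht θ => restr_slice₂ ht η θ) (K := fun _ => 1) continuousOn_const
    (fun _ _ => one_ne_zero) (closedForms n (p + 1)) fun a ha hw w horth => by
      simp only [mul_one]
      have horth' : ∀ β : Form n (p + 1), IsSphereForm β → IsSphereClosed β →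
          ∫ θ, ⟪restr β θ, w θ⟫_ℝ ∂surf n = 0 := fun β hβ hβc => horth ⟨β, hβ⟩ hβc
      -- Up to sign, the pairing with `w` is that of `∂Φ₁/∂t`; after integration by parts it vanishes,
      -- as exact forms are closed.
      have l1 := tendsto_pairing_left hw (fun k => M.locL2_angRad (hmem' k)) (M.locL2_angRad hη)
        (M.locTendsto_angRad hmem' hη h2) (Lp.memLp w)
      have l2 := (tendsto_pairing_left (hw.deriv ha) (fun k => M.locL2_ang (hmem k))
        (M.locL2_ang hΦ) (M.locTendsto_ang hmem hΦ h1) (Lp.memLp w)).const_mul ((-1 : ℝ) ^ p)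
      have e := tendsto_nhds_unique l1 (l2.congr fun k =>
        (pairing_angRad_extDeriv (hφ k).1 ha hw (Lp.memLp w) horth').symm)
      rw [e, pairing_eq_zero_of_inSphereClosure (hw.deriv ha) (M.locL2_ang hΦ)
        (fun t ht θ => restr_slice₁ ht Φ θ) isSphereForm_of_mem_exactForms hcl (Lp.memLp w)
        fun τ ⟨σ, hσ, hτ⟩ => hτ ▸ horth' _ hσ.extDeriv (isSphereClosed_extDeriv hσ), mul_zero]
  simpa only [mem_closedForms, mem_sphereForms, exists_prop] using h

/-- The spherical component of `dΦ` vanishes if that of `Φ` is exact along the spheres. -/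
theorem ae_pull_tangProj_extDeriv (M : MetricRoot G univ) (hφ : ∀ k, IsTestForm (φ k))
    (hΦ : MemL2 G Φ) (hη : MemL2 G η) (h1 : Tendsto (fun k => normSq G (φ k - Φ)) atTop (𝓝 0))
    (h2 : Tendsto (fun k => normSq G (extDeriv (φ k) - η)) atTop (𝓝 0))
    (hcl : ∀ᵐ t ∂(volume.restrict (Ioi (0 : ℝ))),
      InSphereClosure (exactForms n p) (slice₁ Φ t)) :
    ∀ᵐ x, pull (p + 2) (tangProj x) (η x) = 0 := by
  have hmem : ∀ k, MemL2 G (φ k) := fun k => M.memL2 (hφ k)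
  have hmem' : ∀ k, MemL2 G (extDeriv (φ k)) := fun k => M.memL2 (hφ k).extDeriv
  have h0 : ang η =ᵐ[cylMeas n] 0 := ae_eq_zero_of_pairing (M.locL2_ang hη) (K := fun _ => 1)
    continuousOn_const (fun _ _ => one_ne_zero) fun a ha hw w => by
      simp only [mul_one]
      have lim : ∀ w : Sph n → CoordSpace n (p + 2), MemLp w 2 (surf n) →
          Tendsto (fun k => pairing a (ang (extDeriv (φ k))) w) atTop (𝓝 (pairing a (ang η) w)) :=
        fun w hm => tendsto_pairing_left hw (fun k => M.locL2_ang (hmem' k)) (M.locL2_ang hη)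
          (M.locTendsto_ang hmem' hη h2) hm
      have hF : pairingCLM hw (M.locL2_ang hη) = 0 := by
        refine clm_eq_zero_of_sphereForms _ (fun β hβ => ?_) fun w horth => ?_
        · rw [pairingCLM_toLp]
          -- Tested against `β`, the spherical component of `dΦ` is that of `Φ` tested against `δβ`, and
          -- exact forms are orthogonal to coexact ones.
          have l2 := tendsto_pairing_left hw (fun k => M.locL2_ang (hmem k))
            (M.locL2_ang hΦ) (M.locTendsto_ang hmem hΦ h1) hβ.codiff_cyl.memLp
          rw [tendsto_nhds_unique (lim _ hβ.memLp) (l2.congr fun k =>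
            (pairing_extDeriv ha hw (hφ k).1.contDiffOn hβ).symm)]
          refine pairing_eq_zero_of_inSphereClosure hw (M.locL2_ang hΦ)
            (fun t ht θ => restr_slice₁ ht Φ θ) isSphereForm_of_mem_exactForms hcl
            hβ.codiff_cyl.memLp ?_
          rintro _ ⟨σ, hσ, rfl⟩
          rw [← integral_codiff_extDeriv hβ hσ]
          simp only [real_inner_comm (restr (extDeriv σ) _)]
        · rw [pairingCLM_apply]
          refine tendsto_nhds_unique (lim _ (Lp.memLp w)) (tendsto_const_nhds.congr fun k => ?_)
          exact (pairing_ang_eq_zero (hφ k).extDeriv.1.contDiffOn hw (Lp.memLp w) horth).symm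
      exact congrArg (fun F => F w) hF
  filter_upwards [ae_eq_zero_of_coord contDiffOn_slot hη.1 h0,
    Measure.ae_ne volume (0 : E n)] with x hx hx0
  rw [slot_eq] at hx
  exact (smul_eq_zero.1 hx).resolve_left (pow_ne_zero _ (norm_ne_zero_iff.2 hx0))

end ExtDeriv

section Codiff

variable {f g : ℝ → ℝ}

/-- The interior product with `x` is horizontal, so it vanishes when its spherical component
does. -/
theorem vanish_of_slot_radialPart {x : E n} (hx : x ≠ 0) {α : Cov n (p + 1)}
    (h : slot p x (radialPart p x α) = 0) (v : Fin (p + 1) → E n) (hv : ∃ i, v i = x) :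
    α v = 0 := by
  refine vanish_of_contr ?_ v hv
  have h1 : pull p (tangProj x) (contr p x α) = contr p x α :=
    pull_tangProj_of_vanish fun u ⟨i, hi⟩ => by
      rw [contr_apply]
      exact α.map_eq_zero_of_eq _ (i := 0) (j := i.succ) (by simp [hi]) (Fin.succ_ne_zero i).symm
  have h0 := norm_ne_zero_iff.2 hx
  have h2 : radialPart p x α = ((-1 : ℝ) ^ p * ‖x‖⁻¹) • contr p x α := by
    rw [radialPart, smul_apply, mul_smul, map_smul, smul_apply]
  rw [slot_eq, h2, map_smul, h1, smul_smul] at h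
  exact (smul_eq_zero.1 h).resolve_left
    (mul_ne_zero (pow_ne_zero _ h0) (mul_ne_zero (pow_ne_zero _ (by norm_num)) (inv_ne_zero h0)))

/-- The radial component of `δΦ` vanishes if that of `Φ` is coexact along the spheres. -/
theorem ae_vanish_codiff (hfg : IsWarpingPair f g) {φ : ℕ → Form n (p + 2)} {Φ : Form n (p + 2)}
    {ζ : Form n (p + 1)} (hφ : ∀ k, IsTestForm (φ k)) (hΦ : MemL2 (warpedMetric n f g) Φ)
    (hζ : MemL2 (warpedMetric n f g) ζ)
    (h2 : Tendsto (fun k => normSq (warpedMetric n f g)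
      (codiff (warpedMetric n f g) (φ k) - ζ)) atTop (𝓝 0))
    (hδ : HasCodiff (warpedMetric n f g) Φ ζ)
    (hcl : ∀ᵐ t ∂(volume.restrict (Ioi (0 : ℝ))),
      InSphereClosure (coexactForms n (p + 1)) (slice₂ Φ t)) :
    ∀ᵐ x, ∀ v : Fin (p + 1) → E n, (∃ i, v i = x) → ζ x v = 0 := by
  have M := hfg.root n
  have hmem' : ∀ k, MemL2 (warpedMetric n f g) (codiff (warpedMetric n f g) (φ k)) :=
    fun k => M.memL2 (M.isTestForm_codiff (hφ k))
  have hK := contDiffOn_radWeight (n := n) (p := p) hfg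
  have h0 : angRad ζ =ᵐ[cylMeas n] 0 := ae_eq_zero_of_pairing (M.locL2_angRad hζ)
    hK.continuousOn (radWeight_ne_zero hfg) fun b hb hw w => by
      have hwK := hw.mul hK.continuousOn
      have hF : pairingCLM hwK (M.locL2_angRad hζ) = 0 := by
        refine clm_eq_zero_of_sphereForms _ (fun β hβ => ?_) fun w horth => ?_
        · have ht := isTestForm_radialMul hb hw (contDiffOn_radialWedgeForm hβ.smooth)
          -- `⟨δΦ, b dt ∧ β⟩ = -⟨Φ, b dt ∧ dβ⟩`, and coexact forms are orthogonal to exact ones.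
          rw [pairingCLM_toLp, ← l2Inner_radialWedgeForm hfg hζ.1 hb hβ, hδ _ ht,
            l2Inner_congr_right Φ fun x hx => extDeriv_radialMul_radialWedgeForm hb hβ.smooth hx,
            l2Inner_radialWedgeForm hfg hΦ.1 hb.neg hβ.extDeriv]
          refine pairing_eq_zero_of_inSphereClosure
            (hw.neg.mul (contDiffOn_radWeight hfg).continuousOn) (M.locL2_angRad hΦ)
            (fun t ht θ => restr_slice₂ ht Φ θ) isSphereForm_of_mem_coexactForms hcl
            hβ.extDeriv.memLp ?_
          rintro _ ⟨σ, hσ, rfl⟩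
          exact integral_codiff_extDeriv hσ hβ
        · rw [pairingCLM_apply]
          refine tendsto_nhds_unique (tendsto_pairing_left hwK
            (fun k => M.locL2_angRad (hmem' k)) (M.locL2_angRad hζ)
            (M.locTendsto_angRad hmem' hζ h2) (Lp.memLp w)) (tendsto_const_nhds.congr fun k => ?_)
          refine (pairing_ang_eq_zero ?_ hwK (Lp.memLp w) horth).symm
          exact contDiffOn_radialPart.clm_apply (M.isTestForm_codiff (hφ k)).1.contDiffOn
      exact congrArg (fun F => F w) hF
  filter_upwards [ae_eq_zero_of_coord contDiffOn_slot_radialPart hζ.1 h0,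
    Measure.ae_ne volume (0 : E n)] with x hx hx0
  exact vanish_of_slot_radialPart hx0 hx

/-- The spherical component of `δφ`, tested against functions on the sphere: up to weights, it
is the sum of `δ` along the spheres of the spherical component of `φ` and of the `t`-derivative of
the radial component. -/
theorem pairing_codiff (hfg : IsWarpingPair f g) {φ : Form n (p + 1)} (hφ : IsTestForm φ)
    {a : ℝ → ℝ} (ha : ContDiff ℝ (⊤ : ℕ∞) a) (hw : IsWeight a)
    (w : Lp (CoordSpace n p) 2 (surf n)) :
    pairing (fun t => a t * tangWeight n p f g t) (ang (codiff (warpedMetric n f g) φ)) w =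
      pairing (fun t => a t * tangWeight n (p + 1) f g t)
        (ang (codiff (cylMetric n) (tangPart φ))) w +
      pairing (fun t => deriv a t * radWeight n p f g t) (angRad φ) w := by
  have M := hfg.root n
  have hK := contDiffOn_tangWeight (n := n) (p := p) hfg
  have hK1 := contDiffOn_tangWeight (n := n) (p := p + 1) hfg
  have hK' := contDiffOn_radWeight (n := n) (p := p) hfg
  have ha' : ContDiff ℝ (⊤ : ℕ∞) (deriv a) := (contDiff_infty_iff_deriv.1 ha).2
  have w0 := hw.mul hK.continuousOn
  have w1 := hw.mul hK1.continuousOn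
  have w2 := (hw.deriv ha).mul hK'.continuousOn
  have hδ := M.isTestForm_codiff hφ
  have hκ := contDiffOn_codiff_tangPart (n := n) hφ.1.contDiffOn
  have L0 := M.locL2_ang (M.memL2 hδ)
  have L1 := locL2_ang_of_continuousOn hκ.continuousOn
  have L2 := M.locL2_angRad (M.memL2 hφ)
  have hF : pairingCLM w0 L0 - (pairingCLM w1 L1 + pairingCLM w2 L2) = 0 := by
    refine clm_eq_zero_of_sphereForms _ (fun β hβ => ?_) fun w horth => ?_
    · simp only [sub_apply, add_apply, pairingCLM_toLp]
      have t0 := isTestForm_radialMul ha hw hβ.smooth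
      have t1 := isTestForm_radialMul ha hw hβ.extDeriv.smooth
      have t2 := isTestForm_radialMul ha' (hw.deriv ha) (contDiffOn_radialWedgeForm hβ.smooth)
      -- Move `δ` to the test form: `d(a β) = a dβ + a' dt ∧ β`.
      rw [← l2Inner_radialMul hfg (M.memL2 hδ).1 ha hβ, M.l2Inner_comm, ← M.green_univ t0 hφ,
        M.l2Inner_comm, l2Inner_congr_right φ (ψ := radialMul a (extDeriv β) +
          radialMul (deriv a) (radialWedgeForm β)) fun x hx => extDeriv_radialMul ha hβ.smooth hx,
        M.l2Inner_add_right (M.memL2 t1) (M.memL2 t2) (M.memL2 hφ),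
        l2Inner_radialMul hfg (M.memL2 hφ).1 ha hβ.extDeriv,
        l2Inner_radialWedgeForm hfg (M.memL2 hφ).1 ha' hβ,
        pairing_extDeriv_right (hw.contDiff_mul ha hK1) w1 hφ.1.contDiffOn hβ, sub_self]
    · simp only [sub_apply, add_apply, pairingCLM_apply]
      rw [pairing_ang_eq_zero hδ.1.contDiffOn w0 (Lp.memLp w) horth,
        pairing_ang_eq_zero hκ w1 (Lp.memLp w) horth, angRad, pairing_ang_eq_zero
          (contDiffOn_radialPart.clm_apply hφ.1.contDiffOn) w2 (Lp.memLp w) horth]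
      simp
  exact sub_eq_zero.1 (congrArg (fun F => F w) hF)

/-- The spherical component of `δΦ` is coclosed along the spheres if the radial component of `Φ`
is coexact. -/
theorem ae_slice₁_codiff (hfg : IsWarpingPair f g) {φ : ℕ → Form n (p + 1)} {Φ : Form n (p + 1)}
    {ζ : Form n p} (hφ : ∀ k, IsTestForm (φ k)) (hΦ : MemL2 (warpedMetric n f g) Φ)
    (hζ : MemL2 (warpedMetric n f g) ζ)
    (h1 : Tendsto (fun k => normSq (warpedMetric n f g) (φ k - Φ)) atTop (𝓝 0))
    (h2 : Tendsto (fun k => normSq (warpedMetric n f g)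
      (codiff (warpedMetric n f g) (φ k) - ζ)) atTop (𝓝 0))
    (hcl : ∀ᵐ t ∂(volume.restrict (Ioi (0 : ℝ))),
      InSphereClosure (coexactForms n p) (slice₂ Φ t)) :
    ∀ᵐ t ∂(volume.restrict (Ioi (0 : ℝ))),
      InSphereClosure {τ | IsSphereForm τ ∧ IsSphereCoclosed τ} (slice₁ ζ t) := by
  have M := hfg.root n
  have hmem : ∀ k, MemL2 (warpedMetric n f g) (φ k) := fun k => M.memL2 (hφ k)
  have hmem' : ∀ k, MemL2 (warpedMetric n f g) (codiff (warpedMetric n f g) (φ k)) :=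
    fun k => M.memL2 (M.isTestForm_codiff (hφ k))
  have hK := contDiffOn_tangWeight (n := n) (p := p) hfg
  have hK1 := contDiffOn_tangWeight (n := n) (p := p + 1) hfg
  have hK' := contDiffOn_radWeight (n := n) (p := p) hfg
  have h := ae_inSphereClosure (M.locL2_ang hζ) (α := slice₁ ζ)
    (fun t ht θ => restr_slice₁ ht ζ θ) hK.continuousOn (tangWeight_ne_zero hfg)
    (coclosedForms n p) fun a ha hw w horth => by
      have horth' : ∀ β : Form n p, IsSphereForm β → IsSphereCoclosed β →
          ∫ θ, ⟪restr β θ, w θ⟫_ℝ ∂surf n = 0 :=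
        fun β hβ hβc => horth ⟨β, hβ⟩ ((mem_coclosedForms _).2 hβc)
      have w2 := (hw.deriv ha).mul hK'.continuousOn
      have l1 := tendsto_pairing_left (hw.mul hK.continuousOn) (fun k => M.locL2_ang (hmem' k))
        (M.locL2_ang hζ) (M.locTendsto_ang hmem' hζ h2) (Lp.memLp w)
      have l2 := tendsto_pairing_left w2 (fun k => M.locL2_angRad (hmem k))
        (M.locL2_angRad hΦ) (M.locTendsto_angRad hmem hΦ h1) (Lp.memLp w)
      -- In `pairing_codiff`, the term with `δ` along the spheres drops out, being coclosed. The
      -- other one passes to the limit, where it vanishes since coexact forms are coclosed.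
      rw [tendsto_nhds_unique l1 (l2.congr fun k => ?_)]
      · exact pairing_eq_zero_of_inSphereClosure w2 (M.locL2_angRad hΦ)
          (fun t ht θ => restr_slice₂ ht Φ θ) isSphereForm_of_mem_coexactForms hcl (Lp.memLp w)
          fun τ ⟨σ, hσ, hτ⟩ => hτ ▸ horth' _ hσ.codiff_cyl hσ.isSphereCoclosed_codiff
      · rw [pairing_codiff hfg (hφ k) ha hw w]
        have hκ := contDiffOn_codiff_tangPart (n := n) (hφ k).1.contDiffOn
        have L1 := locL2_ang_of_continuousOn hκ.continuousOn
        have : pairing (fun t => a t * tangWeight n (p + 1) f g t)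
            (ang (codiff (cylMetric n) (tangPart (φ k)))) w = 0 := by
          refine pairing_eq_zero (hw.mul hK1.continuousOn) L1 (Lp.memLp w) ?_
          filter_upwards [ae_isSphereCoclosed (hφ k).1.contDiffOn,
            ae_restrict_mem measurableSet_Ioi] with t ht ht0
          have := horth' _ (isSphereForm_sphPull ht0 hκ) ht
          simpa only [restr_sphPull ht0] using this
        rw [this, zero_add]
  simpa only [mem_coclosedForms, mem_sphereForms, exists_prop] using h

end Codiff

end Conclusion

end HodgeWarped

end

/-- On `ℝⁿ` with a complete rotationally symmetric metric, let `Φ` be an eigenform of degree `p + 1`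
of the restriction of the Laplace-Beltrami operator to `𝓛₃`, with eigenvalue `μ > 0`. Then `dΦ` and
`δΦ` are square integrable; if `dΦ ≠ 0`, it is an eigenform of the restriction to `𝓛₂`, and if
`δΦ ≠ 0`, it is an eigenform of the restriction to `𝓛₁`, both with the same eigenvalue. -/
theorem proposition6p3 (n p : ℕ) (hn : 2 ≤ n) (f g : ℝ → ℝ)
    (hfg : HodgeWarped.IsWarpingPair f g) (μ : ℝ) (hμ : 0 < μ)
    (Φ : HodgeWarped.Form n (p + 1))
    (hΦ : HodgeWarped.IsEigenform (HodgeWarped.warpedMetric n f g) μ Φ)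
    (hΦ3 : HodgeWarped.InL3 Φ) :
    (∃ η : HodgeWarped.Form n (p + 2),
      HodgeWarped.MemL2 (HodgeWarped.warpedMetric n f g) η ∧
      HodgeWarped.HasExtDeriv (HodgeWarped.warpedMetric n f g) Φ η ∧
      (¬ η =ᵐ[MeasureTheory.volume] 0 →
        HodgeWarped.IsEigenform (HodgeWarped.warpedMetric n f g) μ η ∧ HodgeWarped.InL2 η)) ∧
    (∃ ζ : HodgeWarped.Form n p,
      HodgeWarped.MemL2 (HodgeWarped.warpedMetric n f g) ζ ∧
      HodgeWarped.HasCodiff (HodgeWarped.warpedMetric n f g) Φ ζ ∧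
      (¬ ζ =ᵐ[MeasureTheory.volume] 0 →
        HodgeWarped.IsEigenform (HodgeWarped.warpedMetric n f g) μ ζ ∧ HodgeWarped.InL1 ζ)) := by
  have : Nontrivial (HodgeWarped.E n) := by
    have : NeZero n := ⟨by omega⟩
    infer_instance
  obtain ⟨φ, hφ, h1, ⟨η, hη, l3, hd, gη⟩, ζ, hζ, l4, hδ, gζ⟩ :=
    (hfg.root n).exists_derivatives hfg.hasCutoffs hΦ.2
  have mΦ := hΦ.2.1
  have hex := hΦ3.mono fun _ h => h.1
  have hco := hΦ3.mono fun _ h => h.2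
  refine ⟨⟨η, hη, hd, fun hne => ⟨⟨hne, gη⟩, ?_, ?_⟩⟩, ζ, hζ, hδ, fun hne => ⟨⟨hne, gζ⟩, ?_, ?_⟩⟩
  · exact HodgeWarped.ae_pull_tangProj_extDeriv (hfg.root n) hφ mΦ hη h1 l3 hex
  · exact HodgeWarped.ae_slice₂_extDeriv (hfg.root n) hφ mΦ hη h1 l3 hex
  · cases p with
    | zero => exact MeasureTheory.ae_of_all _ fun x v ⟨i, _⟩ => i.elim0
    | succ p => exact HodgeWarped.ae_vanish_codiff hfg hφ mΦ hζ l4 hδ hco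
  · exact HodgeWarped.ae_slice₁_codiff hfg hφ mΦ hζ h1 l4 hco
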